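/- **Conventions.** Bicategories are small (with objects, 1-cells and 2-cells in fixed universes, the same for all bicategories below). For 2-cells, $\beta\cdot\alpha$ is vertical and $\beta\circ\alpha$ horizontal composition; the constraints of a bicategory are the invertible 2-cells $a_{h,g,f}:(h\circ g)\circ f\Rightarrow h\circ(g\circ f)$, $l_f:1\circ f\Rightarrow f$, $r_f:f\circ 1\Rightarrow f$. A *lax functor* $F:\mathcal A\to\mathcal B$ has constraints $\widehat F_{g,f}:Fg\circ Ff\Rightarrow F(g\circ f)$, $\widehat F_a:1_{Fa}\Rightarrow F1_a$; a *homomorphism* is a lax functor with invertible constraints. In the category of bicategories and lax functors the composite of $F$ and $G$ has constraints $G\widehat F\cdot\widehat G$. In the equations below, canonical isomorphisms (associativity and unit constraints of the fibre bicategories, constraints of the homomorphisms $f^*$) and identity cells are not written, so each is an equation between pastings. **Lax bidiagrams.** Let $\mathcal B$ be a bicategory. A *lax bidiagram of bicategories* $\mathcal F:\mathcal B^{\rm op}\to\mathbf{Bicat}$ (contravariant on 1-cells, covariant on 2-cells) consists of - (D1) a bicategory $\mathcal F_a$ for each object $a$; (D2) a homomorphism $f^*:\mathcal F_b\to\mathcal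 F_a$ for each 1-cell $f:a\to b$; (D3) a pseudo transformation $\alpha^*:f^*\Rightarrow g^*$ for each 2-cell $\alpha:f\Rightarrow g$; - (D4) pseudo transformations $\chi_{g,f}:f^*g^*\Rightarrow(g\circ f)^*$ for $a\xrightarrow{f}b\xrightarrow{g}c$; (D5) pseudo transformations $\chi_a:1_{\mathcal F_a}\Rightarrow 1_a^*$; - (D6) invertible modifications $\xi_{\beta,\alpha}:\beta^*\circ\alpha^*\Rrightarrow(\beta\cdot\alpha)^*$ for vertically composable 2-cells; (D7) invertible modifications $\xi_f:1_{f^*}\Rrightarrow(1_f)^*$; - (D8) for $\alpha:f\Rightarrow h:a\to b$ and $\beta:g\Rightarrow k:b\to c$, an invertible modification $\chi_{\beta,\alpha}:(\beta\circ\alpha)^*\circ\chi_{g,f}\Rrightarrow\chi_{k,h}\circ(\alpha^*k^*\circ f^*\beta^*)$; - (D9) for $a\xrightarrow{f}b\xrightarrow{g}c\xrightarrow{h}d$, an invertible modification $\omega_{h,g,f}:a_{h,g,f}^{\,*}\circ(\chi_{h\circ g,f}\circ f^*\chi_{h,g})\Rrightarrow\chi_{h,g\circ f}\circ\chi_{g,f}h^*$;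 - (D10) for $f:a\to b$, invertible modifications $\gamma_f:l_f^*\circ(\chi_{1_b,f}\circ f^*\chi_b)\Rrightarrow 1_{f^*}$ and $\delta_f:r_f^*\circ(\chi_{f,1_a}\circ\chi_af^*)\Rrightarrow 1_{f^*}$. Here $a_{h,g,f}$ denotes the constraint $(h\circ g)\circ f\Rightarrow h\circ(g\circ f)$. Write $\xi$ also for the composites of cells (D6), (D7) and their inverses attached to commutative diagrams of 2-cells of $\mathcal B$, and write $\chi_{\beta,f}:(\beta\circ 1_f)^*\circ\chi_{g,f}\Rrightarrow\chi_{k,f}\circ f^*\beta^*$ and $\chi_{g,\alpha}:(1_g\circ\alpha)^*\circ\chi_{g,f}\Rrightarrow\chi_{g,h}\circ\alpha^*g^*$ for $\chi_{\beta,1_f}$ and $\chi_{1_g,\alpha}$ followed by the inverses of $\xi_f$ and $\xi_g$. The axioms are: - (C1) $\xi_{\zeta,\beta\cdot\alpha}\cdot(\zeta^*\circ\xi_{\beta,\alpha})=\xi_{\zeta\cdot\beta,\alpha}\cdot(\xi_{\zeta,\beta}\circ\alpha^*)$; (C2) $\xi_{\alpha,1_f}\cdot(\alpha^*\circ\xi_f)$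 and $\xi_{1_g,\alpha}\cdot(\xi_g\circ\alpha^*)$ are the canonical isomorphisms, for $\alpha:f\Rightarrow g$. - (C3) For $f\overset{\alpha}\Rightarrow f'\overset{\alpha'}\Rightarrow f''$ and $g\overset{\beta}\Rightarrow g'\overset{\beta'}\Rightarrow g''$: pasting $\chi_{\beta,\alpha}$ and $\chi_{\beta',\alpha'}$, interchanging $\alpha^*$ and $f^*\beta'^*$ by the naturality isomorphism of $\alpha^*$, and applying $f^*\xi_{\beta',\beta}$ and $\xi_{\alpha',\alpha}$ gives $\chi_{\beta'\cdot\beta,\,\alpha'\cdot\alpha}$ preceded by $\xi:(\beta'\circ\alpha')^*\circ(\beta\circ\alpha)^*\Rrightarrow((\beta'\cdot\beta)\circ(\alpha'\cdot\alpha))^*$. (C4) $\chi_{1_g,1_f}$ preceded by $\xi:1\Rrightarrow(1_g\circ 1_f)^*$ equals the pasting of $\xi_f$ and $f^*\xi_g$. - (C5) For $\alpha:f\Rightarrow f'$, $\beta:g\Rightarrow g'$, $\zeta:h\Rightarrow h'$: from $(\,(\zeta\circ(\beta\circ\alpha))\,)^*\circ a_{h,g,f}^{\,*}\circ\chi_{h\circ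 g,f}\circ f^*\chi_{h,g}$ to $\chi_{h',g'\circ f'}\circ\chi_{g',f'}h'^*\circ\alpha^*g'^*h'^*\circ f^*\beta^*h'^*\circ f^*g^*\zeta^*$, the pasting of $\xi$ (for naturality of $a$), $\chi_{\zeta\circ\beta,\alpha}$, $f^*\chi_{\zeta,\beta}$, the naturality isomorphism of $\alpha^*$ at $\chi_{h',g'}$, and $\omega_{h',g',f'}$ equals the pasting of $\omega_{h,g,f}$, $\chi_{\zeta,\beta\circ\alpha}$, the inverse naturality isomorphism of $\chi_{g,f}$ at $\zeta^*$, and $\chi_{\beta,\alpha}$. - (C6) For $a\xrightarrow fb\xrightarrow gc\xrightarrow hd\xrightarrow ke$: on the transformation $(1_k\circ a_{h,g,f})^*\circ a_{k,h\circ g,f}^{\,*}\circ(a_{k,h,g}\circ1_f)^*\circ\chi\circ f^*\chi\circ f^*g^*\chi_{k,h}$, the pasting of $\xi$ (for the pentagon), $\omega_{k\circ h,g,f}$, the naturality isomorphism of $\chi_{g,f}$ at $\chi_{k,h}$ and $\omega_{k,h,g\circ f}$ equals the pasting of $\chi_{a_{k,h,g},f}$, $f^*\omega_{k,h,g}$,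 $\omega_{k,h\circ g,f}$, $\chi_{k,a_{h,g,f}}$ and $\omega_{h,g,f}k^*$. - (C7) For $\alpha:f\Rightarrow g:a\to b$: the pasting of $\xi$ (for naturality of $r$) and $\delta_f$ equals the pasting of $\chi_{\alpha,1_a}$, the inverse naturality isomorphism of $\chi_a$ at $\alpha^*$, and $\delta_g$; and the pasting of $\xi$ (for naturality of $l$) and $\gamma_f$ equals the pasting of $\chi_{1_b,\alpha}$, the naturality isomorphism of $\alpha^*$ at $\chi_b$, and $\gamma_g$. - (C8) For $a\xrightarrow fb\xrightarrow gc$: the pasting of $\xi$ (for the triangle $(1_g\circ l_f)\cdot a_{g,1_b,f}=r_g\circ 1_f$), $\omega_{g,1_b,f}$, $\chi_{g,l_f}$ and $\gamma_fg^*$ equals the pasting of $\chi_{r_g,f}$ and $f^*\delta_g$. **Grothendieck construction.** $\int_{\mathcal B}\mathcal F$ has objects $(x,a)$ with $a\in\mathcal B$, $x\in\mathcal F_a$; 1-cells $(u,f):(x,a)\to(y,b)$ with $f:a\to b$ and $u:x\to f^*y$; 2-cells $(\phi,\alpha):(u,f)\Rightarrow(v,g)$ with $\alpha:f\Rightarrow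 g$ and $\phi:\alpha^*y\circ u\Rightarrow v$. - Vertical composition: $(\psi,\beta)\cdot(\phi,\alpha)=(\psi\cdot(\beta^*y\circ\phi)\cdot(\xi_{\beta,\alpha}^{-1}y\circ u),\ \beta\cdot\alpha)$. Identities: $(\xi_f^{-1}y\circ u,\,1_f)$ (followed by $1\circ u\cong u$). - Horizontal composition: $(u',f')\circ(u,f)=(\chi_{f',f}z\circ(f^*u'\circ u),\,f'\circ f)$ for $u':y\to f'^*z$; the horizontal composite of $(\phi,\alpha):(u,f)\Rightarrow(v,g)$ and $(\phi',\alpha'):(u',f')\Rightarrow(v',g')$ lies over $\alpha'\circ\alpha$ and is the pasting of $\chi_{\alpha',\alpha}z$, $f^*\phi'$, the naturality isomorphism $\alpha^*(g'^*z)\circ f^*v'\cong g^*v'\circ\alpha^*y$, and $\phi$. Identity 1-cells: $(\chi_ax,1_a)$. - Constraints: over $a_{h,g,f}$, the pasting of $\omega_{h,g,f}$ and the naturality isomorphism of $\chi_{g,f}$ at the third 1-cell; over $l_f$, the cell given by $\gamma_f$; over $r_f$, the pasting of the inverse naturality isomorphism of $\chi_a$ at $u$ and $\delta_f$. The projection is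 $P:\int_{\mathcal B}\mathcal F\to\mathcal B$, $(x,a)\mapsto a$, $(u,f)\mapsto f$, $(\phi,\alpha)\mapsto\alpha$, with identity constraints. **Change of base.** For a lax functor $F:\mathcal A\to\mathcal B$, $\mathcal FF$ consists of the bicategories $\mathcal F_{Fa}$, homomorphisms $(Ff)^*$, transformations $(F\alpha)^*$, $\chi^{\mathcal FF}_{g,f}=\widehat F_{g,f}^{\,*}\circ\chi_{Fg,Ff}$, $\chi^{\mathcal FF}_a=\widehat F_a^{\,*}\circ\chi_{Fa}$, with $\xi^{\mathcal FF}$ given by $\xi_{F\beta,F\alpha}$ and $\xi_{Ff}$, with $\chi^{\mathcal FF}_{\beta,\alpha}$ the pasting of $\xi$ (for naturality of $\widehat F$) and $\chi_{F\beta,F\alpha}$, with $\omega^{\mathcal FF}_{h,g,f}$ the pasting of $\chi_{\widehat F_{h,g},Ff}^{-1}$, $\xi$ (for the associativity axiom of $F$), $\omega_{Fh,Fg,Ff}$ and $\chi_{Fh,\widehat F_{g,f}}$, and with $\gamma^{\mathcal FF}_f$ (resp. $\delta^{\mathcal FF}_f$) the pasting of $\chi_{\widehat F_b,Ff}^{-1}$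 (resp. $\chi_{Ff,\widehat F_a}^{-1}$), $\xi$ (for the unit axiom of $F$) and $\gamma_{Ff}$ (resp. $\delta_{Ff}$). Define $\bar F:\int_{\mathcal A}\mathcal FF\to\int_{\mathcal B}\mathcal F$ by $(x,a)\mapsto(x,Fa)$, $(u,f)\mapsto(u,Ff)$, $(\phi,\alpha)\mapsto(\phi,F\alpha)$, with constraints $(a,\widehat F_{g,f})$ (first component an associativity isomorphism $\widehat F_{g,f}^{\,*}z\circ(\chi z\circ w)\cong(\widehat F_{g,f}^{\,*}z\circ\chi z)\circ w$) and $(1,\widehat F_a)$. **Lemma.** Let $\mathcal F$ be a lax bidiagram of bicategories over $\mathcal B$ and $F:\mathcal A\to\mathcal B$ a lax functor. Then $\mathcal FF$ is a lax bidiagram over $\mathcal A$, $\int_{\mathcal A}\mathcal FF$ and $\int_{\mathcal B}\mathcal F$ are bicategories, $\bar F$ is a lax functor, and the square $$\begin{array}{ccc}\int_{\mathcal A}\mathcal FF&\xrightarrow{\ \bar F\ }&\int_{\mathcal B}\mathcal F\\ {\scriptstyle P}\downarrow&&\downarrow{\scriptstyle P}\\ \mathcal A&\xrightarrow{\ F\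 }&\mathcal B\end{array}$$ is a pullback in the category of bicategories and lax functors. -/

import Mathlib

open CategoryTheory Bicategory

universe w v u w₁ v₁ u₁ w₂ v₂ u₂

namespace LaxBidiag

section Modifications

variable {C : Type u} [Bicategory.{w, v} C] {D : Type u₁} [Bicategory.{w₁, v₁} D]
  {E : Type u₂} [Bicategory.{w₂, v₂} E]

/-- The part of a pseudo transformation that enters the definition of a modification: its
components `app x`, and its invertible naturality 2-cells `F u ≫ app y ≅ app x ≫ G u`.
(Since the 2-cells and constraints of `F` and `G` play no role here, composition of
homomorphisms is strictly associative at this level.) -/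
structure TransData (F G : C ⥤q D) where
  /-- the component at an object -/
  app (x : C) : F.obj x ⟶ G.obj x
  /-- the naturality 2-cell at a 1-cell -/
  nat {x y : C} (u : x ⟶ y) : F.map u ≫ app y ≅ app x ≫ G.map u

/-- The components and naturality 2-cells of a pseudo transformation. -/
@[reducible]
def TransData.of {F G : C ⥤ᵖ D} (t : Pseudofunctor.StrongTrans F G) :
    TransData F.toPrefunctor G.toPrefunctor where
  app x := t.app x
  nat u := t.naturality u

/-- The identity transformation. -/
@[reducible]
def TransData.id (F : C ⥤q D) : TransData F F where
  app x := 𝟙 (F.obj x)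
  nat u := ρ_ (F.map u) ≪≫ (λ_ (F.map u)).symm

/-- Vertical composition of transformations, `F ⇒ G ⇒ H`. -/
@[reducible]
def TransData.comp {F G H : C ⥤q D} (s : TransData F G) (t : TransData G H) : TransData F H where
  app x := s.app x ≫ t.app x
  nat {x y} u := (α_ (F.map u) (s.app y) (t.app y)).symm ≪≫
    whiskerRightIso (s.nat u) (t.app y) ≪≫ α_ (s.app x) (G.map u) (t.app y) ≪≫
    whiskerLeftIso (s.app x) (t.nat u) ≪≫ (α_ (s.app x) (t.app x) (H.map u)).symm

/-- The transformation `t K : F K ⇒ G K` obtained from `t : F ⇒ G` by restriction along `K`. -/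
@[reducible]
def TransData.precomp {F G : C ⥤q D} (t : TransData F G) (K : E ⥤q C) :
    TransData (K ⋙q F) (K ⋙q G) where
  app x := t.app (K.obj x)
  nat u := t.nat (K.map u)

/-- The transformation `H t : H F ⇒ H G` obtained from `t : F ⇒ G` by applying the
homomorphism `H`. -/
@[reducible]
def TransData.postcomp {F G : C ⥤q D} (t : TransData F G) (H : D ⥤ᵖ E) :
    TransData (F ⋙q H.toPrefunctor) (G ⋙q H.toPrefunctor) where
  app x := H.map (t.app x)
  nat {x y} u := (H.mapComp (F.map u) (t.app y)).symm ≪≫ H.map₂Iso (t.nat u) ≪≫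
    H.mapComp (t.app x) (G.map u)

/-- A family of invertible 2-cells `m x : s x ≅ t x` is an invertible modification `s ⇛ t`. -/
def IsModification {F G : C ⥤q D} (s t : TransData F G) (m : ∀ x, s.app x ≅ t.app x) : Prop :=
  ∀ ⦃x y : C⦄ (u : x ⟶ y),
    F.map u ◁ (m y).hom ≫ (t.nat u).hom = (s.nat u).hom ≫ (m x).hom ▷ G.map u

end Modifications

/-- Horizontal composition of 2-cells in a bicategory. -/
abbrev hc {B : Type u} [Bicategory.{w, v} B] {a b c : B} {f h : a ⟶ b} {g k : b ⟶ c}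
    (α : f ⟶ h) (β : g ⟶ k) : f ≫ g ⟶ h ≫ k :=
  α ▷ g ≫ h ◁ β

/-- The bicategories, homomorphisms and pseudo transformations of a lax bidiagram of bicategories
over `B` (contravariant on 1-cells, covariant on 2-cells). Composites in the diagrammatic
order `f ≫ g` stand for `g ∘ f`. -/
structure Core (B : Type u) [Bicategory.{w, v} B] where
  /-- the bicategory over an object -/
  fib : B → Type u₁
  /-- the bicategory structure over an object -/
  [bicat : ∀ b, Bicategory.{w₁, v₁} (fib b)]
  /-- the homomorphism `f^*` of a 1-cell -/
  pull {a b : B} (f : a ⟶ b) : fib b ⥤ᵖ fib a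
  /-- the pseudo transformation `α^* : f^* ⇒ g^*` of a 2-cell -/
  pull₂ {a b : B} {f g : a ⟶ b} (α : f ⟶ g) : Pseudofunctor.StrongTrans (pull f) (pull g)
  /-- the pseudo transformation `χ : f^* g^* ⇒ (g ∘ f)^*` -/
  chi {a b c : B} (f : a ⟶ b) (g : b ⟶ c) :
    Pseudofunctor.StrongTrans ((pull g).comp (pull f)) (pull (f ≫ g))
  /-- the pseudo transformation `χ : 1 ⇒ 1_b^*` -/
  chiId (b : B) : Pseudofunctor.StrongTrans (Pseudofunctor.id (fib b)) (pull (𝟙 b))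

attribute [instance] Core.bicat

namespace Core

variable {B : Type u} [Bicategory.{w, v} B] (𝓕 : Core.{w, v, u, w₁, v₁, u₁} B)

/-- `f^* x`. -/
abbrev ob {a b : B} (f : a ⟶ b) (x : 𝓕.fib b) : 𝓕.fib a := (𝓕.pull f).obj x

/-- `f^* u`. -/
abbrev mp {a b : B} (f : a ⟶ b) {x y : 𝓕.fib b} (p : x ⟶ y) : 𝓕.ob f x ⟶ 𝓕.ob f y :=
  (𝓕.pull f).map p

/-- `f^* φ`. -/
abbrev mp₂ {a b : B} (f : a ⟶ b) {x y : 𝓕.fib b} {p q : x ⟶ y} (φ : p ⟶ q) :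
    𝓕.mp f p ⟶ 𝓕.mp f q :=
  (𝓕.pull f).map₂ φ

/-- The constraint `f^* (v ∘ u) ≅ f^* v ∘ f^* u`. -/
abbrev mpComp {a b : B} (f : a ⟶ b) {x y z : 𝓕.fib b} (p : x ⟶ y) (q : y ⟶ z) :
    𝓕.mp f (p ≫ q) ≅ 𝓕.mp f p ≫ 𝓕.mp f q :=
  (𝓕.pull f).mapComp p q

/-- The constraint `f^* 1_x ≅ 1_{f^* x}`. -/
abbrev mpId {a b : B} (f : a ⟶ b) (x : 𝓕.fib b) : 𝓕.mp f (𝟙 x) ≅ 𝟙 (𝓕.ob f x) :=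
  (𝓕.pull f).mapId x

/-- The component `α^* x : f^* x ⟶ g^* x`. -/
abbrev st {a b : B} {f g : a ⟶ b} (α : f ⟶ g) (x : 𝓕.fib b) : 𝓕.ob f x ⟶ 𝓕.ob g x :=
  (𝓕.pull₂ α).app x

/-- The naturality 2-cell of `α^*` at a 1-cell. -/
abbrev stNat {a b : B} {f g : a ⟶ b} (α : f ⟶ g) {x y : 𝓕.fib b} (p : x ⟶ y) :
    𝓕.mp f p ≫ 𝓕.st α y ≅ 𝓕.st α x ≫ 𝓕.mp g p :=
  (𝓕.pull₂ α).naturality p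

/-- The component `χ x : f^* g^* x ⟶ (g ∘ f)^* x`. -/
abbrev ch {a b c : B} (f : a ⟶ b) (g : b ⟶ c) (x : 𝓕.fib c) :
    𝓕.ob f (𝓕.ob g x) ⟶ 𝓕.ob (f ≫ g) x :=
  (𝓕.chi f g).app x

/-- The naturality 2-cell of `χ : f^* g^* ⇒ (g ∘ f)^*` at a 1-cell. -/
abbrev chNat {a b c : B} (f : a ⟶ b) (g : b ⟶ c) {x y : 𝓕.fib c} (p : x ⟶ y) :
    𝓕.mp f (𝓕.mp g p) ≫ 𝓕.ch f g y ≅ 𝓕.ch f g x ≫ 𝓕.mp (f ≫ g) p :=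
  (𝓕.chi f g).naturality p

/-- The component `χ x : x ⟶ 1_b^* x`. -/
abbrev cu (b : B) (x : 𝓕.fib b) : x ⟶ 𝓕.ob (𝟙 b) x := (𝓕.chiId b).app x

/-- The naturality 2-cell of `χ : 1 ⇒ 1_b^*` at a 1-cell. -/
abbrev cuNat (b : B) {x y : 𝓕.fib b} (p : x ⟶ y) :
    p ≫ 𝓕.cu b y ≅ 𝓕.cu b x ≫ 𝓕.mp (𝟙 b) p :=
  (𝓕.chiId b).naturality p

end Core

/-- All the data of a lax bidiagram of bicategories: to `Core` are added the components, at the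
objects of the bicategories of the bidiagram, of the invertible modifications `ξ`, `χ`, `ω`, `γ`
and `δ`. -/
structure Data (B : Type u) [Bicategory.{w, v} B] extends Core.{w, v, u, w₁, v₁, u₁} B where
  /-- `ξ : β^* ∘ α^* ⇛ (β · α)^*` -/
  xi {a b : B} {f g h : a ⟶ b} (α : f ⟶ g) (β : g ⟶ h) (x : fib b) :
    toCore.st α x ≫ toCore.st β x ≅ toCore.st (α ≫ β) x
  /-- `ξ : 1_{f^*} ⇛ 1_f^*` -/
  xiId {a b : B} (f : a ⟶ b) (x : fib b) : 𝟙 (toCore.ob f x) ≅ toCore.st (𝟙 f) x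
  /-- `χ : (β ∘ α)^* ∘ χ ⇛ χ ∘ (α^* β^*)` -/
  chi₂ {a b c : B} {f h : a ⟶ b} {g k : b ⟶ c} (α : f ⟶ h) (β : g ⟶ k) (x : fib c) :
    toCore.ch f g x ≫ toCore.st (hc α β) x ≅
      (toCore.mp f (toCore.st β x) ≫ toCore.st α (toCore.ob k x)) ≫ toCore.ch h k x
  /-- `ω : a^* ∘ (χ ∘ f^* χ) ⇛ χ ∘ χ h^*` -/
  omega {a b c d : B} (f : a ⟶ b) (g : b ⟶ c) (h : c ⟶ d) (x : fib d) :
    (toCore.mp f (toCore.ch g h x) ≫ toCore.ch f (g ≫ h) x) ≫ toCore.st (α_ f g h).inv x ≅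
      toCore.ch f g (toCore.ob h x) ≫ toCore.ch (f ≫ g) h x
  /-- `γ : l^* ∘ (χ ∘ f^* χ) ⇛ 1_{f^*}` -/
  gamma {a b : B} (f : a ⟶ b) (x : fib b) :
    (toCore.mp f (toCore.cu b x) ≫ toCore.ch f (𝟙 b) x) ≫ toCore.st (ρ_ f).hom x ≅
      𝟙 (toCore.ob f x)
  /-- `δ : r^* ∘ (χ ∘ χ f^*) ⇛ 1_{f^*}` -/
  delta {a b : B} (f : a ⟶ b) (x : fib b) :
    (toCore.cu a (toCore.ob f x) ≫ toCore.ch (𝟙 a) f x) ≫ toCore.st (λ_ f).hom x ≅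
      𝟙 (toCore.ob f x)

namespace Data

variable {B : Type u} [Bicategory.{w, v} B] (𝓕 : Data.{w, v, u, w₁, v₁, u₁} B)

/-! ### Derived 2-cells: the canonical composites of the cells `ξ` along commutative diagrams of
2-cells of `B`, and the cells `χ` for whiskered 2-cells. -/

/-- `β^* ∘ α^* ≅ θ^*` when `β · α = θ`. -/
def xi₂ {a b : B} {f g h : a ⟶ b} (α : f ⟶ g) (β : g ⟶ h) {θ : f ⟶ h} (e : α ≫ β = θ)
    (x : 𝓕.fib b) : 𝓕.st α x ≫ 𝓕.st β x ≅ 𝓕.st θ x :=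
  𝓕.xi α β x ≪≫ eqToIso (congrArg (fun τ => 𝓕.st τ x) e)

/-- `γ^* ∘ (β^* ∘ α^*) ≅ θ^*` when `γ · β · α = θ`. -/
def xi₃ {a b : B} {f g h k : a ⟶ b} (α : f ⟶ g) (β : g ⟶ h) (γ : h ⟶ k) {θ : f ⟶ k}
    (e : α ≫ β ≫ γ = θ) (x : 𝓕.fib b) : 𝓕.st α x ≫ 𝓕.st β x ≫ 𝓕.st γ x ≅ 𝓕.st θ x :=
  whiskerLeftIso (𝓕.st α x) (𝓕.xi β γ x) ≪≫ 𝓕.xi₂ α (β ≫ γ) e x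

/-- `1_{f^*} ≅ θ^*` when `θ = 1_f`. -/
def xi₀ {a b : B} {f : a ⟶ b} {θ : f ⟶ f} (e : 𝟙 f = θ) (x : 𝓕.fib b) :
    𝟙 (𝓕.ob f x) ≅ 𝓕.st θ x :=
  𝓕.xiId f x ≪≫ eqToIso (congrArg (fun τ => 𝓕.st τ x) e)

/-- `θ^* ≅ τ^*` when `θ = τ`. -/
def stEq {a b : B} {f g : a ⟶ b} {θ τ : f ⟶ g} (e : θ = τ) (x : 𝓕.fib b) :
    𝓕.st θ x ≅ 𝓕.st τ x :=
  eqToIso (congrArg (fun σ => 𝓕.st σ x) e)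

/-- `χ : (β ∘ 1_f)^* ∘ χ ⇛ χ ∘ f^* β^*`. -/
def chiL {a b c : B} (f : a ⟶ b) {g k : b ⟶ c} (β : g ⟶ k) (x : 𝓕.fib c) :
    𝓕.ch f g x ≫ 𝓕.st (f ◁ β) x ≅ 𝓕.mp f (𝓕.st β x) ≫ 𝓕.ch f k x :=
  whiskerLeftIso (𝓕.ch f g x) (𝓕.stEq (τ := hc (𝟙 f) β) (by simp [hc]) x) ≪≫ 𝓕.chi₂ (𝟙 f) β x ≪≫
    whiskerRightIso (whiskerLeftIso (𝓕.mp f (𝓕.st β x)) (𝓕.xiId f (𝓕.ob k x)).symm ≪≫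
      ρ_ (𝓕.mp f (𝓕.st β x))) (𝓕.ch f k x)

/-- `χ : (1_g ∘ α)^* ∘ χ ⇛ χ ∘ α^* g^*`. -/
def chiR {a b c : B} {f h : a ⟶ b} (α : f ⟶ h) (g : b ⟶ c) (x : 𝓕.fib c) :
    𝓕.ch f g x ≫ 𝓕.st (α ▷ g) x ≅ 𝓕.st α (𝓕.ob g x) ≫ 𝓕.ch h g x :=
  whiskerLeftIso (𝓕.ch f g x) (𝓕.stEq (τ := hc α (𝟙 g)) (by simp [hc]) x) ≪≫ 𝓕.chi₂ α (𝟙 g) x ≪≫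
    whiskerRightIso (whiskerRightIso ((𝓕.pull f).map₂Iso (𝓕.xiId g x).symm ≪≫
      𝓕.mpId f (𝓕.ob g x)) (𝓕.st α (𝓕.ob g x)) ≪≫ λ_ (𝓕.st α (𝓕.ob g x))) (𝓕.ch h g x)

end Data

open Data in
/-- The axioms of a lax bidiagram of bicategories: the families `ξ`, `χ`, `ω`, `γ`, `δ` are
modifications, and the coherence equations between (pastings of) modifications hold. -/
structure IsLaxBidiagram {B : Type u} [Bicategory.{w, v} B]
    (𝓕 : Data.{w, v, u, w₁, v₁, u₁} B) : Prop where
  /-- `ξ` is a modification -/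
  xi_mod {a b : B} {f g h : a ⟶ b} (α : f ⟶ g) (β : g ⟶ h) :
    IsModification ((TransData.of (𝓕.pull₂ α)).comp (TransData.of (𝓕.pull₂ β)))
      (TransData.of (𝓕.pull₂ (α ≫ β))) (𝓕.xi α β)
  /-- `ξ` (unit) is a modification -/
  xiId_mod {a b : B} (f : a ⟶ b) :
    IsModification (TransData.id (𝓕.pull f).toPrefunctor) (TransData.of (𝓕.pull₂ (𝟙 f)))
      (𝓕.xiId f)
  /-- `χ` is a modification -/
  chi₂_mod {a b c : B} {f h : a ⟶ b} {g k : b ⟶ c} (α : f ⟶ h) (β : g ⟶ k) :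
    IsModification
      ((TransData.of (𝓕.chi f g)).comp (TransData.of (𝓕.pull₂ (hc α β))))
      ((((TransData.of (𝓕.pull₂ β)).postcomp (𝓕.pull f)).comp
        ((TransData.of (𝓕.pull₂ α)).precomp (𝓕.pull k).toPrefunctor)).comp
        (TransData.of (𝓕.chi h k)))
      (𝓕.chi₂ α β)
  /-- `ω` is a modification -/
  omega_mod {a b c d : B} (f : a ⟶ b) (g : b ⟶ c) (h : c ⟶ d) :
    IsModification
      ((((TransData.of (𝓕.chi g h)).postcomp (𝓕.pull f)).comp
        (TransData.of (𝓕.chi f (g ≫ h)))).comp (TransData.of (𝓕.pull₂ (α_ f g h).inv)))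
      (((TransData.of (𝓕.chi f g)).precomp (𝓕.pull h).toPrefunctor).comp
        (TransData.of (𝓕.chi (f ≫ g) h)))
      (𝓕.omega f g h)
  /-- `γ` is a modification -/
  gamma_mod {a b : B} (f : a ⟶ b) :
    IsModification
      ((((TransData.of (𝓕.chiId b)).postcomp (𝓕.pull f)).comp
        (TransData.of (𝓕.chi f (𝟙 b)))).comp (TransData.of (𝓕.pull₂ (ρ_ f).hom)))
      (TransData.id (𝓕.pull f).toPrefunctor)
      (𝓕.gamma f)
  /-- `δ` is a modification -/
  delta_mod {a b : B} (f : a ⟶ b) :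
    IsModification
      ((((TransData.of (𝓕.chiId a)).precomp (𝓕.pull f).toPrefunctor).comp
        (TransData.of (𝓕.chi (𝟙 a) f))).comp (TransData.of (𝓕.pull₂ (λ_ f).hom)))
      (TransData.id (𝓕.pull f).toPrefunctor)
      (𝓕.delta f)
  /-- associativity of `ξ` -/
  xi_assoc {a b : B} {f g h k : a ⟶ b} (α : f ⟶ g) (β : g ⟶ h) (ζ : h ⟶ k) (x : 𝓕.fib b) :
    (𝓕.xi α β x).hom ▷ 𝓕.st ζ x ≫ (𝓕.xi₂ (α ≫ β) ζ (Category.assoc α β ζ) x).hom =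
      (α_ (𝓕.st α x) (𝓕.st β x) (𝓕.st ζ x)).hom ≫ 𝓕.st α x ◁ (𝓕.xi β ζ x).hom ≫
        (𝓕.xi α (β ≫ ζ) x).hom
  /-- unity of `ξ`, before -/
  xi_id_left {a b : B} {f g : a ⟶ b} (α : f ⟶ g) (x : 𝓕.fib b) :
    (𝓕.xiId f x).hom ▷ 𝓕.st α x ≫ (𝓕.xi₂ (𝟙 f) α (Category.id_comp α) x).hom =
      (λ_ (𝓕.st α x)).hom
  /-- unity of `ξ`, after -/
  xi_id_right {a b : B} {f g : a ⟶ b} (α : f ⟶ g) (x : 𝓕.fib b) :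
    𝓕.st α x ◁ (𝓕.xiId g x).hom ≫ (𝓕.xi₂ α (𝟙 g) (Category.comp_id α) x).hom =
      (ρ_ (𝓕.st α x)).hom
  /-- `χ` is compatible with vertical composition of 2-cells -/
  chi₂_comp {a b c : B} {f f' f'' : a ⟶ b} {g g' g'' : b ⟶ c} (α : f ⟶ f') (α' : f' ⟶ f'')
      (β : g ⟶ g') (β' : g' ⟶ g'') (x : 𝓕.fib c) :
    𝟙 ((𝓕.ch f g x ≫ 𝓕.st (hc α β) x) ≫ 𝓕.st (hc α' β') x) ≫
      (𝓕.chi₂ α β x).hom ▷ 𝓕.st (hc α' β') x ⊗≫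
      (𝓕.mp f (𝓕.st β x) ≫ 𝓕.st α (𝓕.ob g' x)) ◁ (𝓕.chi₂ α' β' x).hom ⊗≫
      𝓕.mp f (𝓕.st β x) ◁ (𝓕.stNat α (𝓕.st β' x)).inv ▷
        (𝓕.st α' (𝓕.ob g'' x) ≫ 𝓕.ch f'' g'' x) ⊗≫
      ((𝓕.mpComp f (𝓕.st β x) (𝓕.st β' x)).inv ≫ 𝓕.mp₂ f (𝓕.xi β β' x).hom) ▷
        (𝓕.st α (𝓕.ob g'' x) ≫ 𝓕.st α' (𝓕.ob g'' x) ≫ 𝓕.ch f'' g'' x) ⊗≫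
      𝓕.mp f (𝓕.st (β ≫ β') x) ◁ (𝓕.xi α α' (𝓕.ob g'' x)).hom ▷ 𝓕.ch f'' g'' x ⊗≫
      𝟙 ((𝓕.mp f (𝓕.st (β ≫ β') x) ≫ 𝓕.st (α ≫ α') (𝓕.ob g'' x)) ≫ 𝓕.ch f'' g'' x) =
    𝟙 ((𝓕.ch f g x ≫ 𝓕.st (hc α β) x) ≫ 𝓕.st (hc α' β') x) ⊗≫
      𝓕.ch f g x ◁ (𝓕.xi₂ (hc α β) (hc α' β') (θ := hc (α ≫ α') (β ≫ β'))
        (by simp [hc, whisker_exchange_assoc]) x).hom ≫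
      (𝓕.chi₂ (α ≫ α') (β ≫ β') x).hom
  /-- `χ` is compatible with identity 2-cells -/
  chi₂_id {a b c : B} (f : a ⟶ b) (g : b ⟶ c) (x : 𝓕.fib c) :
    𝟙 (𝓕.ch f g x) ⊗≫
      𝓕.ch f g x ◁ (𝓕.xi₀ (θ := hc (𝟙 f) (𝟙 g)) (by simp [hc]) x).hom ≫
      (𝓕.chi₂ (𝟙 f) (𝟙 g) x).hom =
    𝟙 (𝓕.ch f g x) ⊗≫
      ((𝓕.mpId f (𝓕.ob g x)).inv ≫ 𝓕.mp₂ f (𝓕.xiId g x).hom) ▷ 𝓕.ch f g x ⊗≫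
      𝓕.mp f (𝓕.st (𝟙 g) x) ◁ (𝓕.xiId f (𝓕.ob g x)).hom ▷ 𝓕.ch f g x ⊗≫
      𝟙 ((𝓕.mp f (𝓕.st (𝟙 g) x) ≫ 𝓕.st (𝟙 f) (𝓕.ob g x)) ≫ 𝓕.ch f g x)
  /-- compatibility of `ω` with 2-cells -/
  omega_nat {a b c d : B} {f f' : a ⟶ b} {g g' : b ⟶ c} {h h' : c ⟶ d} (α : f ⟶ f')
      (β : g ⟶ g') (ζ : h ⟶ h') (x : 𝓕.fib d) :
    𝟙 (𝓕.mp f (𝓕.ch g h x) ≫ 𝓕.ch f (g ≫ h) x ≫ 𝓕.st (α_ f g h).inv x ≫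
        𝓕.st (hc (hc α β) ζ) x) ⊗≫
      (𝓕.mp f (𝓕.ch g h x) ≫ 𝓕.ch f (g ≫ h) x) ◁
        (𝓕.xi₂ (α_ f g h).inv (hc (hc α β) ζ) rfl x ≪≫
          (𝓕.xi₂ (hc α (hc β ζ)) (α_ f' g' h').inv (by simp [hc]) x).symm).hom ⊗≫
      𝓕.mp f (𝓕.ch g h x) ◁ (𝓕.chi₂ α (hc β ζ) x).hom ▷ 𝓕.st (α_ f' g' h').inv x ⊗≫
      ((𝓕.mpComp f (𝓕.ch g h x) (𝓕.st (hc β ζ) x)).inv ≫ 𝓕.mp₂ f (𝓕.chi₂ β ζ x).hom ≫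
        (𝓕.mpComp f (𝓕.mp g (𝓕.st ζ x) ≫ 𝓕.st β (𝓕.ob h' x)) (𝓕.ch g' h' x)).hom) ▷
        (𝓕.st α (𝓕.ob (g' ≫ h') x) ≫ 𝓕.ch f' (g' ≫ h') x ≫ 𝓕.st (α_ f' g' h').inv x) ⊗≫
      𝓕.mp f (𝓕.mp g (𝓕.st ζ x) ≫ 𝓕.st β (𝓕.ob h' x)) ◁ (𝓕.stNat α (𝓕.ch g' h' x)).hom ▷
        (𝓕.ch f' (g' ≫ h') x ≫ 𝓕.st (α_ f' g' h').inv x) ⊗≫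
      (𝓕.mp f (𝓕.mp g (𝓕.st ζ x) ≫ 𝓕.st β (𝓕.ob h' x)) ≫
        𝓕.st α (𝓕.ob g' (𝓕.ob h' x))) ◁ (𝓕.omega f' g' h' x).hom ⊗≫
      (𝓕.mpComp f (𝓕.mp g (𝓕.st ζ x)) (𝓕.st β (𝓕.ob h' x))).hom ▷
        (𝓕.st α (𝓕.ob g' (𝓕.ob h' x)) ≫ 𝓕.ch f' g' (𝓕.ob h' x) ≫ 𝓕.ch (f' ≫ g') h' x) ⊗≫
      𝟙 (𝓕.mp f (𝓕.mp g (𝓕.st ζ x)) ≫ 𝓕.mp f (𝓕.st β (𝓕.ob h' x)) ≫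
        𝓕.st α (𝓕.ob g' (𝓕.ob h' x)) ≫ 𝓕.ch f' g' (𝓕.ob h' x) ≫ 𝓕.ch (f' ≫ g') h' x) =
    𝟙 (𝓕.mp f (𝓕.ch g h x) ≫ 𝓕.ch f (g ≫ h) x ≫ 𝓕.st (α_ f g h).inv x ≫
        𝓕.st (hc (hc α β) ζ) x) ⊗≫
      (𝓕.omega f g h x).hom ▷ 𝓕.st (hc (hc α β) ζ) x ⊗≫
      𝓕.ch f g (𝓕.ob h x) ◁ (𝓕.chi₂ (hc α β) ζ x).hom ⊗≫
      (𝓕.chNat f g (𝓕.st ζ x)).inv ▷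
        (𝓕.st (hc α β) (𝓕.ob h' x) ≫ 𝓕.ch (f' ≫ g') h' x) ⊗≫
      𝓕.mp f (𝓕.mp g (𝓕.st ζ x)) ◁ (𝓕.chi₂ α β (𝓕.ob h' x)).hom ▷ 𝓕.ch (f' ≫ g') h' x ⊗≫
      𝟙 (𝓕.mp f (𝓕.mp g (𝓕.st ζ x)) ≫ 𝓕.mp f (𝓕.st β (𝓕.ob h' x)) ≫
        𝓕.st α (𝓕.ob g' (𝓕.ob h' x)) ≫ 𝓕.ch f' g' (𝓕.ob h' x) ≫ 𝓕.ch (f' ≫ g') h' x)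
  /-- the pentagon-type equation for `ω` -/
  omega_pentagon {a b c d e : B} (f : a ⟶ b) (g : b ⟶ c) (h : c ⟶ d) (k : d ⟶ e)
      (x : 𝓕.fib e) :
    𝟙 (𝓕.mp f (𝓕.mp g (𝓕.ch h k x)) ≫ 𝓕.mp f (𝓕.ch g (h ≫ k) x) ≫
        𝓕.ch f (g ≫ h ≫ k) x ≫ 𝓕.st (f ◁ (α_ g h k).inv) x ≫
        𝓕.st (α_ f (g ≫ h) k).inv x ≫ 𝓕.st ((α_ f g h).inv ▷ k) x) ≫
      𝓕.mp f (𝓕.mp g (𝓕.ch h k x)) ◁ 𝓕.mp f (𝓕.ch g (h ≫ k) x) ◁ 𝓕.ch f (g ≫ h ≫ k) x ◁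
        (𝓕.xi₃ (f ◁ (α_ g h k).inv) (α_ f (g ≫ h) k).inv ((α_ f g h).inv ▷ k)
            (by simp) x ≪≫
          (𝓕.xi₂ (α_ f g (h ≫ k)).inv (α_ (f ≫ g) h k).inv rfl x).symm).hom ⊗≫
      𝓕.mp f (𝓕.mp g (𝓕.ch h k x)) ◁ (𝓕.omega f g (h ≫ k) x).hom ▷
        𝓕.st (α_ (f ≫ g) h k).inv x ⊗≫
      (𝓕.chNat f g (𝓕.ch h k x)).hom ▷
        (𝓕.ch (f ≫ g) (h ≫ k) x ≫ 𝓕.st (α_ (f ≫ g) h k).inv x) ⊗≫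
      𝓕.ch f g (𝓕.ob h (𝓕.ob k x)) ◁ (𝓕.omega (f ≫ g) h k x).hom =
    𝟙 (𝓕.mp f (𝓕.mp g (𝓕.ch h k x)) ≫ 𝓕.mp f (𝓕.ch g (h ≫ k) x) ≫
        𝓕.ch f (g ≫ h ≫ k) x ≫ 𝓕.st (f ◁ (α_ g h k).inv) x ≫
        𝓕.st (α_ f (g ≫ h) k).inv x ≫ 𝓕.st ((α_ f g h).inv ▷ k) x) ⊗≫
      (𝓕.mp f (𝓕.mp g (𝓕.ch h k x)) ≫ 𝓕.mp f (𝓕.ch g (h ≫ k) x)) ◁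
        (𝓕.chiL f (α_ g h k).inv x).hom ▷
        (𝓕.st (α_ f (g ≫ h) k).inv x ≫ 𝓕.st ((α_ f g h).inv ▷ k) x) ⊗≫
      ((𝓕.mpComp f (𝓕.mp g (𝓕.ch h k x)) (𝓕.ch g (h ≫ k) x)).inv ▷
          𝓕.mp f (𝓕.st (α_ g h k).inv x) ≫
        (𝓕.mpComp f (𝓕.mp g (𝓕.ch h k x) ≫ 𝓕.ch g (h ≫ k) x) (𝓕.st (α_ g h k).inv x)).inv ≫
        𝓕.mp₂ f (𝓕.omega g h k x).hom ≫
        (𝓕.mpComp f (𝓕.ch g h (𝓕.ob k x)) (𝓕.ch (g ≫ h) k x)).hom) ▷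
        (𝓕.ch f ((g ≫ h) ≫ k) x ≫ 𝓕.st (α_ f (g ≫ h) k).inv x ≫
          𝓕.st ((α_ f g h).inv ▷ k) x) ⊗≫
      𝓕.mp f (𝓕.ch g h (𝓕.ob k x)) ◁ (𝓕.omega f (g ≫ h) k x).hom ▷
        𝓕.st ((α_ f g h).inv ▷ k) x ⊗≫
      (𝓕.mp f (𝓕.ch g h (𝓕.ob k x)) ≫ 𝓕.ch f (g ≫ h) (𝓕.ob k x)) ◁
        (𝓕.chiR (α_ f g h).inv k x).hom ⊗≫
      (𝓕.omega f g h (𝓕.ob k x)).hom ▷ 𝓕.ch ((f ≫ g) ≫ h) k x ⊗≫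
      𝟙 (𝓕.ch f g (𝓕.ob h (𝓕.ob k x)) ≫ 𝓕.ch (f ≫ g) h (𝓕.ob k x) ≫
        𝓕.ch ((f ≫ g) ≫ h) k x)
  /-- compatibility of `δ` with 2-cells -/
  delta_nat {a b : B} {f g : a ⟶ b} (α : f ⟶ g) (x : 𝓕.fib b) :
    𝟙 (𝓕.cu a (𝓕.ob f x) ≫ 𝓕.ch (𝟙 a) f x ≫ 𝓕.st (𝟙 a ◁ α) x ≫ 𝓕.st (λ_ g).hom x) ≫
      𝓕.cu a (𝓕.ob f x) ◁ 𝓕.ch (𝟙 a) f x ◁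
        (𝓕.xi₂ (𝟙 a ◁ α) (λ_ g).hom rfl x ≪≫
          (𝓕.xi₂ (λ_ f).hom α (leftUnitor_naturality α).symm x).symm).hom ⊗≫
      (𝓕.delta f x).hom ▷ 𝓕.st α x ⊗≫
      𝟙 (𝓕.st α x) =
    𝟙 (𝓕.cu a (𝓕.ob f x) ≫ 𝓕.ch (𝟙 a) f x ≫ 𝓕.st (𝟙 a ◁ α) x ≫ 𝓕.st (λ_ g).hom x) ⊗≫
      𝓕.cu a (𝓕.ob f x) ◁ (𝓕.chiL (𝟙 a) α x).hom ▷ 𝓕.st (λ_ g).hom x ⊗≫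
      (𝓕.cuNat a (𝓕.st α x)).inv ▷ (𝓕.ch (𝟙 a) g x ≫ 𝓕.st (λ_ g).hom x) ⊗≫
      𝓕.st α x ◁ (𝓕.delta g x).hom ⊗≫
      𝟙 (𝓕.st α x)
  /-- compatibility of `γ` with 2-cells -/
  gamma_nat {a b : B} {f g : a ⟶ b} (α : f ⟶ g) (x : 𝓕.fib b) :
    𝟙 (𝓕.mp f (𝓕.cu b x) ≫ 𝓕.ch f (𝟙 b) x ≫ 𝓕.st (α ▷ 𝟙 b) x ≫ 𝓕.st (ρ_ g).hom x) ≫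
      𝓕.mp f (𝓕.cu b x) ◁ 𝓕.ch f (𝟙 b) x ◁
        (𝓕.xi₂ (α ▷ 𝟙 b) (ρ_ g).hom rfl x ≪≫
          (𝓕.xi₂ (ρ_ f).hom α (rightUnitor_naturality α).symm x).symm).hom ⊗≫
      (𝓕.gamma f x).hom ▷ 𝓕.st α x ⊗≫
      𝟙 (𝓕.st α x) =
    𝟙 (𝓕.mp f (𝓕.cu b x) ≫ 𝓕.ch f (𝟙 b) x ≫ 𝓕.st (α ▷ 𝟙 b) x ≫ 𝓕.st (ρ_ g).hom x) ⊗≫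
      𝓕.mp f (𝓕.cu b x) ◁ (𝓕.chiR α (𝟙 b) x).hom ▷ 𝓕.st (ρ_ g).hom x ⊗≫
      (𝓕.stNat α (𝓕.cu b x)).hom ▷ (𝓕.ch g (𝟙 b) x ≫ 𝓕.st (ρ_ g).hom x) ⊗≫
      𝓕.st α x ◁ (𝓕.gamma g x).hom ⊗≫
      𝟙 (𝓕.st α x)
  /-- the triangle-type equation for `ω`, `γ` and `δ` -/
  omega_triangle {a b c : B} (f : a ⟶ b) (g : b ⟶ c) (x : 𝓕.fib c) :
    𝟙 (𝓕.mp f (𝓕.cu b (𝓕.ob g x)) ≫ 𝓕.mp f (𝓕.ch (𝟙 b) g x) ≫ 𝓕.ch f (𝟙 b ≫ g) x ≫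
        𝓕.st (f ◁ (λ_ g).hom) x) ≫
      𝓕.mp f (𝓕.cu b (𝓕.ob g x)) ◁ 𝓕.mp f (𝓕.ch (𝟙 b) g x) ◁ 𝓕.ch f (𝟙 b ≫ g) x ◁
        (𝓕.xi₂ (α_ f (𝟙 b) g).inv ((ρ_ f).hom ▷ g) (by simp) x).inv ⊗≫
      𝓕.mp f (𝓕.cu b (𝓕.ob g x)) ◁ (𝓕.omega f (𝟙 b) g x).hom ▷ 𝓕.st ((ρ_ f).hom ▷ g) x ⊗≫
      (𝓕.mp f (𝓕.cu b (𝓕.ob g x)) ≫ 𝓕.ch f (𝟙 b) (𝓕.ob g x)) ◁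
        (𝓕.chiR (ρ_ f).hom g x).hom ⊗≫
      (𝓕.gamma f (𝓕.ob g x)).hom ▷ 𝓕.ch f g x ⊗≫
      𝟙 (𝓕.ch f g x) =
    𝟙 (𝓕.mp f (𝓕.cu b (𝓕.ob g x)) ≫ 𝓕.mp f (𝓕.ch (𝟙 b) g x) ≫ 𝓕.ch f (𝟙 b ≫ g) x ≫
        𝓕.st (f ◁ (λ_ g).hom) x) ⊗≫
      (𝓕.mp f (𝓕.cu b (𝓕.ob g x)) ≫ 𝓕.mp f (𝓕.ch (𝟙 b) g x)) ◁
        (𝓕.chiL f (λ_ g).hom x).hom ⊗≫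
      ((𝓕.mpComp f (𝓕.cu b (𝓕.ob g x)) (𝓕.ch (𝟙 b) g x)).inv ▷ 𝓕.mp f (𝓕.st (λ_ g).hom x) ≫
        (𝓕.mpComp f (𝓕.cu b (𝓕.ob g x) ≫ 𝓕.ch (𝟙 b) g x) (𝓕.st (λ_ g).hom x)).inv ≫
        𝓕.mp₂ f (𝓕.delta g x).hom ≫ (𝓕.mpId f (𝓕.ob g x)).hom) ▷ 𝓕.ch f g x ⊗≫
      𝟙 (𝓕.ch f g x)

/-- A lax bidiagram of bicategories `𝓕 : Bᵒᵖ → Bicat`. -/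
structure LaxBidiagram (B : Type u) [Bicategory.{w, v} B] extends
    Data.{w, v, u, w₁, v₁, u₁} B where
  /-- the axioms -/
  isLax : IsLaxBidiagram toData

section HBicategory

/-- A bicategory presented by a horizontal composition of 2-cells that is a functor of two
variables (Mathlib's `Bicategory` is presented by whiskerings). -/
structure HBicategory (O : Type u) (Hom : O → O → Type v) [∀ X Y, Category.{w} (Hom X Y)] where
  /-- identity 1-cells -/
  one (X : O) : Hom X X
  /-- composition of 1-cells -/
  comp {X Y Z : O} : Hom X Y → Hom Y Z → Hom X Z
  /-- horizontal composition of 2-cells -/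
  hcomp {X Y Z : O} {p q : Hom X Y} {p' q' : Hom Y Z} :
    (p ⟶ q) → (p' ⟶ q') → (comp p p' ⟶ comp q q')
  /-- associativity constraint -/
  asso {X Y Z T : O} (p : Hom X Y) (q : Hom Y Z) (r : Hom Z T) :
    comp p (comp q r) ≅ comp (comp p q) r
  /-- unit constraint -/
  unitL {X Y : O} (p : Hom X Y) : comp p (one Y) ≅ p
  /-- unit constraint -/
  unitR {X Y : O} (p : Hom X Y) : comp (one X) p ≅ p
  hcomp_id {X Y Z : O} (p : Hom X Y) (q : Hom Y Z) : hcomp (𝟙 p) (𝟙 q) = 𝟙 (comp p q)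
  hcomp_comp {X Y Z : O} {p q r : Hom X Y} {p' q' r' : Hom Y Z} (s₁ : p ⟶ q) (s₂ : q ⟶ r)
    (t₁ : p' ⟶ q') (t₂ : q' ⟶ r') : hcomp (s₁ ≫ s₂) (t₁ ≫ t₂) = hcomp s₁ t₁ ≫ hcomp s₂ t₂
  asso_nat {X Y Z T : O} {p p' : Hom X Y} {q q' : Hom Y Z} {r r' : Hom Z T}
    (s : p ⟶ p') (s' : q ⟶ q') (s'' : r ⟶ r') :
    hcomp s (hcomp s' s'') ≫ (asso p' q' r').hom = (asso p q r).hom ≫ hcomp (hcomp s s') s''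
  unitL_nat {X Y : O} {p q : Hom X Y} (s : p ⟶ q) :
    hcomp s (𝟙 (one Y)) ≫ (unitL q).hom = (unitL p).hom ≫ s
  unitR_nat {X Y : O} {p q : Hom X Y} (s : p ⟶ q) :
    hcomp (𝟙 (one X)) s ≫ (unitR q).hom = (unitR p).hom ≫ s
  pentagon {X Y Z T U : O} (p : Hom X Y) (q : Hom Y Z) (r : Hom Z T) (t : Hom T U) :
    hcomp (𝟙 p) (asso q r t).hom ≫ (asso p (comp q r) t).hom ≫ hcomp (asso p q r).hom (𝟙 t) =
      (asso p q (comp r t)).hom ≫ (asso (comp p q) r t).hom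
  triangle {X Y Z : O} (p : Hom X Y) (q : Hom Y Z) :
    (asso p (one Y) q).hom ≫ hcomp (unitL p).hom (𝟙 q) = hcomp (𝟙 p) (unitR q).hom

/-- Horizontal composition of invertible 2-cells. -/
def HBicategory.hcompIso {O : Type u} {Hom : O → O → Type v} [∀ X Y, Category.{w} (Hom X Y)]
    (S : HBicategory O Hom) {X Y Z : O} {p q : Hom X Y} {p' q' : Hom Y Z} (s : p ≅ q)
    (t : p' ≅ q') : S.comp p p' ≅ S.comp q q' where
  hom := S.hcomp s.hom t.hom
  inv := S.hcomp s.inv t.inv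
  hom_inv_id := by simp [← S.hcomp_comp, S.hcomp_id]
  inv_hom_id := by simp [← S.hcomp_comp, S.hcomp_id]

/-- The Mathlib bicategory of an `HBicategory`. -/
@[reducible]
def HBicategory.toBicategory {O : Type u} {Hom : O → O → Type v}
    [∀ X Y, Category.{w} (Hom X Y)] (S : HBicategory O Hom) : Bicategory.{w, v} O where
  Hom := Hom
  id := S.one
  comp := S.comp
  homCategory X Y := inferInstance
  whiskerLeft {X Y _} (p : Hom X Y) _ _ s := S.hcomp (𝟙 p) s
  whiskerRight {_ Y Z _ _} s (q : Hom Y Z) := S.hcomp s (𝟙 q)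
  associator p q r := (S.asso p q r).symm
  leftUnitor := S.unitR
  rightUnitor := S.unitL
  whiskerLeft_id := S.hcomp_id
  whiskerLeft_comp {_ _ _} (p : Hom _ _) {_ _ _} s t := by
    rw [← S.hcomp_comp, Category.id_comp]
  id_whiskerLeft {_ _ p q} s := by
    rw [← Category.assoc, Iso.eq_comp_inv]
    exact S.unitR_nat s
  comp_whiskerLeft {_ _ _ _} p q {r r'} s := by
    have := S.asso_nat (𝟙 p) (𝟙 q) s
    rw [S.hcomp_id] at this
    simp [this]
  id_whiskerRight := S.hcomp_id
  comp_whiskerRight {_ _ _ _ _ _} s t (q : Hom _ _) := by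
    rw [← S.hcomp_comp, Category.id_comp]
  whiskerRight_id s := by
    rw [← Category.assoc, Iso.eq_comp_inv]
    exact S.unitL_nat s
  whiskerRight_comp {_ _ _ _ _ _} s q r := by
    have := S.asso_nat s (𝟙 q) (𝟙 r)
    rw [S.hcomp_id] at this
    simp [← reassoc_of% this]
  whisker_assoc {_ _ _ _} p _ _ s r := by
    simp [S.asso_nat]
  whisker_exchange {_ _ _ _ _ _ _} s t := by
    simp [← S.hcomp_comp]
  pentagon {_ _ _ _ _} p q r t := by
    have : S.hcompIso (Iso.refl p) (S.asso q r t) ≪≫ S.asso p (S.comp q r) t ≪≫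
        S.hcompIso (S.asso p q r) (Iso.refl t) =
        S.asso p q (S.comp r t) ≪≫ S.asso (S.comp p q) r t := by
      ext
      exact S.pentagon p q r t
    simpa [HBicategory.hcompIso] using congrArg Iso.inv this
  triangle {_ _ _} p q := by
    simp [← S.triangle]

end HBicategory

/-! ### The cells over `B` of the Grothendieck construction -/

namespace Data

variable {B : Type u} [Bicategory.{w, v} B] (𝓕 : Data.{w, v, u, w₁, v₁, u₁} B)

/-- The composite `χ z ∘ (f^* u' ∘ u)` of `u : x ⟶ f^* y` and `u' : y ⟶ f'^* z`. -/
def compFib {a b c : B} (f : a ⟶ b) (f' : b ⟶ c) {x : 𝓕.fib a} {y : 𝓕.fib b} {z : 𝓕.fib c}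
    (p : x ⟶ 𝓕.ob f y) (p' : y ⟶ 𝓕.ob f' z) : x ⟶ 𝓕.ob (f ≫ f') z :=
  (p ≫ 𝓕.mp f p') ≫ 𝓕.ch f f' z

/-- The vertical composite `(β · α)^* y ∘ u ⟶ w` of `φ : α^* y ∘ u ⟶ v` and
`ψ : β^* y ∘ v ⟶ w`. -/
def vcompFib {a b : B} {f g h : a ⟶ b} (α : f ⟶ g) (β : g ⟶ h) {x : 𝓕.fib a} {y : 𝓕.fib b}
    {p : x ⟶ 𝓕.ob f y} {q : x ⟶ 𝓕.ob g y} {r : x ⟶ 𝓕.ob h y}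
    (φ : p ≫ 𝓕.st α y ⟶ q) (ψ : q ≫ 𝓕.st β y ⟶ r) : p ≫ 𝓕.st (α ≫ β) y ⟶ r :=
  p ◁ (𝓕.xi α β y).inv ⊗≫ φ ▷ 𝓕.st β y ≫ ψ

/-- The 2-cell `1_f^* y ∘ u ⟶ u`. -/
def idFib {a b : B} (f : a ⟶ b) {x : 𝓕.fib a} {y : 𝓕.fib b} (p : x ⟶ 𝓕.ob f y) :
    p ≫ 𝓕.st (𝟙 f) y ⟶ p :=
  p ◁ (𝓕.xiId f y).inv ≫ (ρ_ p).hom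

/-- The horizontal composite of `φ : α^* y ∘ u ⟶ v` and `φ' : α'^* z ∘ u' ⟶ v'`. -/
def hcompFib {a b c : B} {f g : a ⟶ b} {f' g' : b ⟶ c} (α : f ⟶ g) (α' : f' ⟶ g')
    {x : 𝓕.fib a} {y : 𝓕.fib b} {z : 𝓕.fib c} {p : x ⟶ 𝓕.ob f y} {q : x ⟶ 𝓕.ob g y}
    {p' : y ⟶ 𝓕.ob f' z} {q' : y ⟶ 𝓕.ob g' z}
    (φ : p ≫ 𝓕.st α y ⟶ q) (φ' : p' ≫ 𝓕.st α' z ⟶ q') :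
    𝓕.compFib f f' p p' ≫ 𝓕.st (hc α α') z ⟶ 𝓕.compFib g g' q q' :=
  𝟙 (((p ≫ 𝓕.mp f p') ≫ 𝓕.ch f f' z) ≫ 𝓕.st (hc α α') z) ⊗≫
    (p ≫ 𝓕.mp f p') ◁ (𝓕.chi₂ α α' z).hom ⊗≫
    p ◁ ((𝓕.mpComp f p' (𝓕.st α' z)).inv ≫ 𝓕.mp₂ f φ') ▷
      (𝓕.st α (𝓕.ob g' z) ≫ 𝓕.ch g g' z) ⊗≫
    p ◁ (𝓕.stNat α q').hom ▷ 𝓕.ch g g' z ⊗≫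
    φ ▷ (𝓕.mp g q' ≫ 𝓕.ch g g' z) ⊗≫
    𝟙 ((q ≫ 𝓕.mp g q') ≫ 𝓕.ch g g' z)

/-- The 2-cell over the associativity constraint of `B`. -/
def assocFib {a b c d : B} (f : a ⟶ b) (g : b ⟶ c) (h : c ⟶ d) {x : 𝓕.fib a} {y : 𝓕.fib b}
    {z : 𝓕.fib c} {t : 𝓕.fib d} (p : x ⟶ 𝓕.ob f y) (q : y ⟶ 𝓕.ob g z) (r : z ⟶ 𝓕.ob h t) :
    𝓕.compFib f (g ≫ h) p (𝓕.compFib g h q r) ≫ 𝓕.st (α_ f g h).inv t ⟶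
      𝓕.compFib (f ≫ g) h (𝓕.compFib f g p q) r :=
  𝟙 (((p ≫ 𝓕.mp f ((q ≫ 𝓕.mp g r) ≫ 𝓕.ch g h t)) ≫ 𝓕.ch f (g ≫ h) t) ≫
      𝓕.st (α_ f g h).inv t) ⊗≫
    p ◁ ((𝓕.mpComp f (q ≫ 𝓕.mp g r) (𝓕.ch g h t)).hom ≫
      (𝓕.mpComp f q (𝓕.mp g r)).hom ▷ 𝓕.mp f (𝓕.ch g h t)) ▷
      (𝓕.ch f (g ≫ h) t ≫ 𝓕.st (α_ f g h).inv t) ⊗≫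
    (p ≫ 𝓕.mp f q ≫ 𝓕.mp f (𝓕.mp g r)) ◁ (𝓕.omega f g h t).hom ⊗≫
    (p ≫ 𝓕.mp f q) ◁ (𝓕.chNat f g r).hom ▷ 𝓕.ch (f ≫ g) h t ⊗≫
    𝟙 ((((p ≫ 𝓕.mp f q) ≫ 𝓕.ch f g z) ≫ 𝓕.mp (f ≫ g) r) ≫ 𝓕.ch (f ≫ g) h t)

/-- The 2-cell over the unit constraint `1_b ∘ f ⟶ f` of `B`. -/
def unitLFib {a b : B} (f : a ⟶ b) {x : 𝓕.fib a} {y : 𝓕.fib b} (p : x ⟶ 𝓕.ob f y) :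
    𝓕.compFib f (𝟙 b) p (𝓕.cu b y) ≫ 𝓕.st (ρ_ f).hom y ⟶ p :=
  𝟙 (((p ≫ 𝓕.mp f (𝓕.cu b y)) ≫ 𝓕.ch f (𝟙 b) y) ≫ 𝓕.st (ρ_ f).hom y) ⊗≫
    p ◁ (𝓕.gamma f y).hom ⊗≫ 𝟙 p

/-- The 2-cell over the unit constraint `f ∘ 1_a ⟶ f` of `B`. -/
def unitRFib {a b : B} (f : a ⟶ b) {x : 𝓕.fib a} {y : 𝓕.fib b} (p : x ⟶ 𝓕.ob f y) :
    𝓕.compFib (𝟙 a) f (𝓕.cu a x) p ≫ 𝓕.st (λ_ f).hom y ⟶ p :=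
  𝟙 (((𝓕.cu a x ≫ 𝓕.mp (𝟙 a) p) ≫ 𝓕.ch (𝟙 a) f y) ≫ 𝓕.st (λ_ f).hom y) ⊗≫
    (𝓕.cuNat a p).inv ▷ (𝓕.ch (𝟙 a) f y ≫ 𝓕.st (λ_ f).hom y) ⊗≫
    p ◁ (𝓕.delta f y).hom ⊗≫ 𝟙 p

end Data

section Grothendieck

variable {B : Type u} [Bicategory.{w, v} B] (𝓕 : Data.{w, v, u, w₁, v₁, u₁} B)

/-- The objects `(x, a)` of the Grothendieck construction. -/
structure Obj where
  /-- the object `a` of `B` -/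
  base : B
  /-- the object `x` over `a` -/
  fib : 𝓕.fib base

namespace Obj

variable {𝓕}

/-- The 1-cells `(u, f) : (x, a) ⟶ (y, b)` of the Grothendieck construction. -/
structure Hom₁ (X Y : Obj 𝓕) where
  /-- the 1-cell `f : a ⟶ b` -/
  base : X.base ⟶ Y.base
  /-- the 1-cell `u : x ⟶ f^* y` -/
  fib : X.fib ⟶ 𝓕.ob base Y.fib

/-- The 2-cells `(φ, α) : (u, f) ⟶ (v, g)` of the Grothendieck construction. -/
@[ext]
structure Hom₂ {X Y : Obj 𝓕} (p q : Hom₁ X Y) where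
  /-- the 2-cell `α : f ⟶ g` -/
  base : p.base ⟶ q.base
  /-- the 2-cell `φ : α^* y ∘ u ⟶ v` -/
  fib : p.fib ≫ 𝓕.st base Y.fib ⟶ q.fib

/-- The identity 2-cell. -/
@[simps]
def id₂ {X Y : Obj 𝓕} (p : Hom₁ X Y) : Hom₂ p p where
  base := 𝟙 p.base
  fib := 𝓕.idFib p.base p.fib

/-- Vertical composition of 2-cells. -/
@[simps]
def comp₂ {X Y : Obj 𝓕} {p q r : Hom₁ X Y} (s : Hom₂ p q) (t : Hom₂ q r) : Hom₂ p r where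
  base := s.base ≫ t.base
  fib := 𝓕.vcompFib s.base t.base s.fib t.fib

/-- The identity 1-cell. -/
@[simps]
def id₁ (X : Obj 𝓕) : Hom₁ X X where
  base := 𝟙 X.base
  fib := 𝓕.cu X.base X.fib

/-- Horizontal composition of 1-cells. -/
@[simps]
def comp₁ {X Y Z : Obj 𝓕} (p : Hom₁ X Y) (q : Hom₁ Y Z) : Hom₁ X Z where
  base := p.base ≫ q.base
  fib := 𝓕.compFib p.base q.base p.fib q.fib

/-- Horizontal composition of 2-cells. -/
@[simps]
def hcomp₂ {X Y Z : Obj 𝓕} {p q : Hom₁ X Y} {p' q' : Hom₁ Y Z} (s : Hom₂ p q)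
    (s' : Hom₂ p' q') : Hom₂ (comp₁ p p') (comp₁ q q') where
  base := hc s.base s'.base
  fib := 𝓕.hcompFib s.base s'.base s.fib s'.fib

/-- The associativity constraint `(h ∘ g) ∘ f ⟶ h ∘ (g ∘ f)`. -/
@[simps]
def assoc₂ {X Y Z T : Obj 𝓕} (p : Hom₁ X Y) (q : Hom₁ Y Z) (r : Hom₁ Z T) :
    Hom₂ (comp₁ p (comp₁ q r)) (comp₁ (comp₁ p q) r) where
  base := (α_ p.base q.base r.base).inv
  fib := 𝓕.assocFib p.base q.base r.base p.fib q.fib r.fib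

/-- The unit constraint `1 ∘ f ⟶ f`. -/
@[simps]
def unitL₂ {X Y : Obj 𝓕} (p : Hom₁ X Y) : Hom₂ (comp₁ p (id₁ Y)) p where
  base := (ρ_ p.base).hom
  fib := 𝓕.unitLFib p.base p.fib

/-- The unit constraint `f ∘ 1 ⟶ f`. -/
@[simps]
def unitR₂ {X Y : Obj 𝓕} (p : Hom₁ X Y) : Hom₂ (comp₁ (id₁ X) p) p where
  base := (λ_ p.base).hom
  fib := 𝓕.unitRFib p.base p.fib

end Obj

open Obj in
/-- The axioms of a bicategory for the compositions and constraints of the Grothendieck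
construction: the hom-categories are categories, horizontal composition is a functor, the
constraints are invertible and natural, and the pentagon and triangle equations hold. -/
class IsBicategory : Prop where
  /-- vertical composition is left unital -/
  id_comp {X Y : Obj 𝓕} {p q : Hom₁ X Y} (s : Hom₂ p q) : comp₂ (id₂ p) s = s
  /-- vertical composition is right unital -/
  comp_id {X Y : Obj 𝓕} {p q : Hom₁ X Y} (s : Hom₂ p q) : comp₂ s (id₂ q) = s
  /-- vertical composition is associative -/
  assoc {X Y : Obj 𝓕} {p q r t : Hom₁ X Y} (s₁ : Hom₂ p q) (s₂ : Hom₂ q r) (s₃ : Hom₂ r t) :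
    comp₂ (comp₂ s₁ s₂) s₃ = comp₂ s₁ (comp₂ s₂ s₃)
  /-- horizontal composition preserves identities -/
  hcomp_id {X Y Z : Obj 𝓕} (p : Hom₁ X Y) (q : Hom₁ Y Z) :
    hcomp₂ (id₂ p) (id₂ q) = id₂ (comp₁ p q)
  /-- horizontal composition preserves vertical composition -/
  hcomp_comp {X Y Z : Obj 𝓕} {p q r : Hom₁ X Y} {p' q' r' : Hom₁ Y Z} (s₁ : Hom₂ p q)
    (s₂ : Hom₂ q r) (t₁ : Hom₂ p' q') (t₂ : Hom₂ q' r') :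
    hcomp₂ (comp₂ s₁ s₂) (comp₂ t₁ t₂) = comp₂ (hcomp₂ s₁ t₁) (hcomp₂ s₂ t₂)
  /-- the associativity constraint is invertible -/
  assoc_iso {X Y Z T : Obj 𝓕} (p : Hom₁ X Y) (q : Hom₁ Y Z) (r : Hom₁ Z T) :
    ∃ i : Hom₂ (comp₁ (comp₁ p q) r) (comp₁ p (comp₁ q r)),
      comp₂ (assoc₂ p q r) i = id₂ _ ∧ comp₂ i (assoc₂ p q r) = id₂ _
  /-- the constraint `1 ∘ f ⟶ f` is invertible -/
  unitL_iso {X Y : Obj 𝓕} (p : Hom₁ X Y) :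
    ∃ i : Hom₂ p (comp₁ p (id₁ Y)), comp₂ (unitL₂ p) i = id₂ _ ∧ comp₂ i (unitL₂ p) = id₂ _
  /-- the constraint `f ∘ 1 ⟶ f` is invertible -/
  unitR_iso {X Y : Obj 𝓕} (p : Hom₁ X Y) :
    ∃ i : Hom₂ p (comp₁ (id₁ X) p), comp₂ (unitR₂ p) i = id₂ _ ∧ comp₂ i (unitR₂ p) = id₂ _
  /-- the associativity constraint is natural -/
  assoc_nat {X Y Z T : Obj 𝓕} {p p' : Hom₁ X Y} {q q' : Hom₁ Y Z} {r r' : Hom₁ Z T}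
    (s : Hom₂ p p') (s' : Hom₂ q q') (s'' : Hom₂ r r') :
    comp₂ (hcomp₂ s (hcomp₂ s' s'')) (assoc₂ p' q' r') =
      comp₂ (assoc₂ p q r) (hcomp₂ (hcomp₂ s s') s'')
  /-- the constraint `1 ∘ f ⟶ f` is natural -/
  unitL_nat {X Y : Obj 𝓕} {p q : Hom₁ X Y} (s : Hom₂ p q) :
    comp₂ (hcomp₂ s (id₂ (id₁ Y))) (unitL₂ q) = comp₂ (unitL₂ p) s
  /-- the constraint `f ∘ 1 ⟶ f` is natural -/
  unitR_nat {X Y : Obj 𝓕} {p q : Hom₁ X Y} (s : Hom₂ p q) :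
    comp₂ (hcomp₂ (id₂ (id₁ X)) s) (unitR₂ q) = comp₂ (unitR₂ p) s
  /-- the pentagon equation -/
  pentagon {X Y Z T U : Obj 𝓕} (p : Hom₁ X Y) (q : Hom₁ Y Z) (r : Hom₁ Z T) (t : Hom₁ T U) :
    comp₂ (hcomp₂ (id₂ p) (assoc₂ q r t))
        (comp₂ (assoc₂ p (comp₁ q r) t) (hcomp₂ (assoc₂ p q r) (id₂ t))) =
      comp₂ (assoc₂ p q (comp₁ r t)) (assoc₂ (comp₁ p q) r t)
  /-- the triangle equation -/
  triangle {X Y Z : Obj 𝓕} (p : Hom₁ X Y) (q : Hom₁ Y Z) :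
    comp₂ (assoc₂ p (id₁ Y) q) (hcomp₂ (unitL₂ p) (id₂ q)) = hcomp₂ (id₂ p) (unitR₂ q)

variable {𝓕}

namespace Obj

/-- The hom-categories of the Grothendieck construction. -/
instance homCategory [h : IsBicategory 𝓕] (X Y : Obj 𝓕) : Category (Hom₁ X Y) where
  Hom p q := Hom₂ p q
  id p := id₂ p
  comp s t := comp₂ s t
  id_comp := h.id_comp
  comp_id := h.comp_id
  assoc := h.assoc

/-- The associativity constraint as an isomorphism. -/
noncomputable def assocIso [h : IsBicategory 𝓕] {X Y Z T : Obj 𝓕} (p : Hom₁ X Y) (q : Hom₁ Y Z)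
    (r : Hom₁ Z T) : comp₁ p (comp₁ q r) ≅ comp₁ (comp₁ p q) r where
  hom := assoc₂ p q r
  inv := (h.assoc_iso p q r).choose
  hom_inv_id := (h.assoc_iso p q r).choose_spec.1
  inv_hom_id := (h.assoc_iso p q r).choose_spec.2

/-- The constraint `1 ∘ f ⟶ f` as an isomorphism. -/
noncomputable def unitLIso [h : IsBicategory 𝓕] {X Y : Obj 𝓕} (p : Hom₁ X Y) :
    comp₁ p (id₁ Y) ≅ p where
  hom := unitL₂ p
  inv := (h.unitL_iso p).choose
  hom_inv_id := (h.unitL_iso p).choose_spec.1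
  inv_hom_id := (h.unitL_iso p).choose_spec.2

/-- The constraint `f ∘ 1 ⟶ f` as an isomorphism. -/
noncomputable def unitRIso [h : IsBicategory 𝓕] {X Y : Obj 𝓕} (p : Hom₁ X Y) :
    comp₁ (id₁ X) p ≅ p where
  hom := unitR₂ p
  inv := (h.unitR_iso p).choose
  hom_inv_id := (h.unitR_iso p).choose_spec.1
  inv_hom_id := (h.unitR_iso p).choose_spec.2

/-- The Grothendieck construction, with its functorial horizontal composition. -/
noncomputable def hbicategory (𝓕 : Data.{w, v, u, w₁, v₁, u₁} B) [h : IsBicategory 𝓕] :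
    HBicategory (Obj 𝓕) Hom₁ where
  one := id₁
  comp := comp₁
  hcomp s t := hcomp₂ s t
  asso := assocIso
  unitL := unitLIso
  unitR := unitRIso
  hcomp_id := h.hcomp_id
  hcomp_comp := h.hcomp_comp
  asso_nat := h.assoc_nat
  unitL_nat := h.unitL_nat
  unitR_nat := h.unitR_nat
  pentagon := h.pentagon
  triangle := h.triangle

/-- The Grothendieck construction `∫ 𝓕` as a bicategory. -/
noncomputable instance bicategory [IsBicategory 𝓕] : Bicategory (Obj 𝓕) :=
  (hbicategory 𝓕).toBicategory

end Obj

theorem Obj.assocIso_inv_base [h : IsBicategory 𝓕] {X Y Z T : Obj 𝓕} (p : Obj.Hom₁ X Y)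
    (q : Obj.Hom₁ Y Z) (r : Obj.Hom₁ Z T) :
    Obj.Hom₂.base (Obj.assocIso p q r).inv = (α_ p.base q.base r.base).hom := by
  have e : (α_ p.base q.base r.base).inv ≫ Obj.Hom₂.base (Obj.assocIso p q r).inv =
      𝟙 (p.base ≫ q.base ≫ r.base) :=
    congrArg Obj.Hom₂.base (h.assoc_iso p q r).choose_spec.1
  exact ((Iso.inv_comp_eq _).1 e).trans (Category.comp_id _)

theorem Obj.unitLIso_inv_base [h : IsBicategory 𝓕] {X Y : Obj 𝓕} (p : Obj.Hom₁ X Y) :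
    Obj.Hom₂.base (Obj.unitLIso p).inv = (ρ_ p.base).inv := by
  have e : (ρ_ p.base).hom ≫ Obj.Hom₂.base (Obj.unitLIso p).inv = 𝟙 (p.base ≫ 𝟙 Y.base) :=
    congrArg Obj.Hom₂.base (h.unitL_iso p).choose_spec.1
  exact ((Iso.eq_inv_comp _).2 e).trans (Category.comp_id _)

theorem Obj.unitRIso_inv_base [h : IsBicategory 𝓕] {X Y : Obj 𝓕} (p : Obj.Hom₁ X Y) :
    Obj.Hom₂.base (Obj.unitRIso p).inv = (λ_ p.base).inv := by
  have e : (λ_ p.base).hom ≫ Obj.Hom₂.base (Obj.unitRIso p).inv = 𝟙 (𝟙 X.base ≫ p.base) :=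
    congrArg Obj.Hom₂.base (h.unitR_iso p).choose_spec.1
  exact ((Iso.eq_inv_comp _).2 e).trans (Category.comp_id _)

variable (𝓕) in
/-- The projection 2-functor `P : ∫ 𝓕 ⟶ B`. -/
def proj [IsBicategory 𝓕] : Obj 𝓕 ⥤ᴸ B where
  obj X := X.base
  map {_ _} (p : Obj.Hom₁ _ _) := p.base
  map₂ {_ _ _ _} (s : Obj.Hom₂ _ _) := s.base
  map₂_id _ := rfl
  map₂_comp _ _ := rfl
  mapId X := 𝟙 (𝟙 X.base)
  mapComp {_ _ _} (p : Obj.Hom₁ _ _) (q : Obj.Hom₁ _ _) := 𝟙 (p.base ≫ q.base)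
  mapComp_naturality_left {_ _ _ p p'} (s : Obj.Hom₂ p p') (q : Obj.Hom₁ _ _) := by
    change 𝟙 _ ≫ hc s.base (𝟙 q.base) = s.base ▷ q.base ≫ 𝟙 (p'.base ≫ q.base)
    simp [hc]
  mapComp_naturality_right {_ _ _} (p : Obj.Hom₁ _ _) {q q'} (s : Obj.Hom₂ q q') := by
    change 𝟙 _ ≫ hc (𝟙 p.base) s.base = p.base ◁ s.base ≫ 𝟙 (p.base ≫ q'.base)
    simp [hc]
  map₂_associator {_ _ _ _} (p : Obj.Hom₁ _ _) (q : Obj.Hom₁ _ _) (r : Obj.Hom₁ _ _) := by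
    change 𝟙 (p.base ≫ q.base) ▷ r.base ≫ 𝟙 ((p.base ≫ q.base) ≫ r.base) ≫
      Obj.Hom₂.base (Obj.assocIso p q r).inv = (α_ p.base q.base r.base).hom ≫
        p.base ◁ 𝟙 (q.base ≫ r.base) ≫ 𝟙 (p.base ≫ q.base ≫ r.base)
    rw [Obj.assocIso_inv_base]
    simp only [Bicategory.id_whiskerRight, Bicategory.whiskerLeft_id, Category.comp_id]
    exact (Category.id_comp _).trans (Category.id_comp _)
  map₂_leftUnitor {X _} (p : Obj.Hom₁ _ _) := by
    change Obj.Hom₂.base (Obj.unitRIso p).inv = (λ_ p.base).inv ≫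
      𝟙 (𝟙 X.base) ▷ p.base ≫ 𝟙 (𝟙 X.base ≫ p.base)
    rw [Obj.unitRIso_inv_base]
    simp only [Bicategory.id_whiskerRight, Category.comp_id]
    rfl
  map₂_rightUnitor {_ Y} (p : Obj.Hom₁ _ _) := by
    change Obj.Hom₂.base (Obj.unitLIso p).inv = (ρ_ p.base).inv ≫
      p.base ◁ 𝟙 (𝟙 Y.base) ≫ 𝟙 (p.base ≫ 𝟙 Y.base)
    rw [Obj.unitLIso_inv_base]
    simp only [Bicategory.whiskerLeft_id, Category.comp_id]
    rfl

end Grothendieck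

section BaseChange

variable {A : Type u₂} [Bicategory.{w₂, v₂} A] {B : Type u} [Bicategory.{w, v} B]

/-- The component of `ω` for the composite of `𝓕` with `F`. -/
def Data.compOmega (𝓕 : Data.{w, v, u, w₁, v₁, u₁} B) (F : A ⥤ᴸ B) {a b c d : A} (f : a ⟶ b)
    (g : b ⟶ c) (h : c ⟶ d) (x : 𝓕.fib (F.obj d)) :
    (𝓕.mp (F.map f) (𝓕.ch (F.map g) (F.map h) x ≫ 𝓕.st (F.mapComp g h) x) ≫
        𝓕.ch (F.map f) (F.map (g ≫ h)) x ≫ 𝓕.st (F.mapComp f (g ≫ h)) x) ≫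
        𝓕.st (F.map₂ (α_ f g h).inv) x ≅
      (𝓕.ch (F.map f) (F.map g) (𝓕.ob (F.map h) x) ≫
        𝓕.st (F.mapComp f g) (𝓕.ob (F.map h) x)) ≫
        𝓕.ch (F.map (f ≫ g)) (F.map h) x ≫ 𝓕.st (F.mapComp (f ≫ g) h) x :=
  whiskerRightIso (whiskerRightIso
      (𝓕.mpComp (F.map f) (𝓕.ch (F.map g) (F.map h) x) (𝓕.st (F.mapComp g h) x)) _) _ ≪⊗≫
    whiskerLeftIso (𝓕.mp (F.map f) (𝓕.ch (F.map g) (F.map h) x))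
      (whiskerRightIso (𝓕.chiL (F.map f) (F.mapComp g h) x).symm
        (𝓕.st (F.mapComp f (g ≫ h)) x ≫ 𝓕.st (F.map₂ (α_ f g h).inv) x)) ≪⊗≫
    whiskerLeftIso
      (𝓕.mp (F.map f) (𝓕.ch (F.map g) (F.map h) x) ≫ 𝓕.ch (F.map f) (F.map g ≫ F.map h) x)
      (𝓕.xi₃ (F.map f ◁ F.mapComp g h) (F.mapComp f (g ≫ h)) (F.map₂ (α_ f g h).inv) rfl x ≪≫
        (𝓕.xi₃ (α_ (F.map f) (F.map g) (F.map h)).inv (F.mapComp f g ▷ F.map h)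
          (F.mapComp (f ≫ g) h) (by simp [LaxFunctor.mapComp_assoc_left]) x).symm) ≪⊗≫
    whiskerRightIso (𝓕.omega (F.map f) (F.map g) (F.map h) x)
      (𝓕.st (F.mapComp f g ▷ F.map h) x ≫ 𝓕.st (F.mapComp (f ≫ g) h) x) ≪⊗≫
    whiskerLeftIso (𝓕.ch (F.map f) (F.map g) (𝓕.ob (F.map h) x))
      (whiskerRightIso (𝓕.chiR (F.mapComp f g) (F.map h) x) (𝓕.st (F.mapComp (f ≫ g) h) x)) ≪⊗≫
    Iso.refl ((𝓕.ch (F.map f) (F.map g) (𝓕.ob (F.map h) x) ≫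
        𝓕.st (F.mapComp f g) (𝓕.ob (F.map h) x)) ≫
        𝓕.ch (F.map (f ≫ g)) (F.map h) x ≫ 𝓕.st (F.mapComp (f ≫ g) h) x)

/-- The component of `γ` for the composite of `𝓕` with `F`. -/
def Data.compGamma (𝓕 : Data.{w, v, u, w₁, v₁, u₁} B) (F : A ⥤ᴸ B) {a b : A} (f : a ⟶ b)
    (x : 𝓕.fib (F.obj b)) :
    (𝓕.mp (F.map f) (𝓕.cu (F.obj b) x ≫ 𝓕.st (F.mapId b) x) ≫
        𝓕.ch (F.map f) (F.map (𝟙 b)) x ≫ 𝓕.st (F.mapComp f (𝟙 b)) x) ≫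
        𝓕.st (F.map₂ (ρ_ f).hom) x ≅ 𝟙 (𝓕.ob (F.map f) x) :=
  whiskerRightIso (whiskerRightIso
      (𝓕.mpComp (F.map f) (𝓕.cu (F.obj b) x) (𝓕.st (F.mapId b) x)) _) _ ≪⊗≫
    whiskerLeftIso (𝓕.mp (F.map f) (𝓕.cu (F.obj b) x))
      (whiskerRightIso (𝓕.chiL (F.map f) (F.mapId b) x).symm
        (𝓕.st (F.mapComp f (𝟙 b)) x ≫ 𝓕.st (F.map₂ (ρ_ f).hom) x)) ≪⊗≫
    whiskerLeftIso (𝓕.mp (F.map f) (𝓕.cu (F.obj b) x) ≫ 𝓕.ch (F.map f) (𝟙 (F.obj b)) x)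
      (𝓕.xi₃ (F.map f ◁ F.mapId b) (F.mapComp f (𝟙 b)) (F.map₂ (ρ_ f).hom)
        (F.map₂_rightUnitor_hom f).symm x) ≪⊗≫
    𝓕.gamma (F.map f) x

/-- The component of `δ` for the composite of `𝓕` with `F`. -/
def Data.compDelta (𝓕 : Data.{w, v, u, w₁, v₁, u₁} B) (F : A ⥤ᴸ B) {a b : A} (f : a ⟶ b)
    (x : 𝓕.fib (F.obj b)) :
    ((𝓕.cu (F.obj a) (𝓕.ob (F.map f) x) ≫ 𝓕.st (F.mapId a) (𝓕.ob (F.map f) x)) ≫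
        𝓕.ch (F.map (𝟙 a)) (F.map f) x ≫ 𝓕.st (F.mapComp (𝟙 a) f) x) ≫
        𝓕.st (F.map₂ (λ_ f).hom) x ≅ 𝟙 (𝓕.ob (F.map f) x) :=
  Iso.refl (((𝓕.cu (F.obj a) (𝓕.ob (F.map f) x) ≫ 𝓕.st (F.mapId a) (𝓕.ob (F.map f) x)) ≫
        𝓕.ch (F.map (𝟙 a)) (F.map f) x ≫ 𝓕.st (F.mapComp (𝟙 a) f) x) ≫
        𝓕.st (F.map₂ (λ_ f).hom) x) ≪⊗≫
    whiskerLeftIso (𝓕.cu (F.obj a) (𝓕.ob (F.map f) x))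
      (whiskerRightIso (𝓕.chiR (F.mapId a) (F.map f) x).symm
        (𝓕.st (F.mapComp (𝟙 a) f) x ≫ 𝓕.st (F.map₂ (λ_ f).hom) x)) ≪⊗≫
    whiskerLeftIso (𝓕.cu (F.obj a) (𝓕.ob (F.map f) x) ≫ 𝓕.ch (𝟙 (F.obj a)) (F.map f) x)
      (𝓕.xi₃ (F.mapId a ▷ F.map f) (F.mapComp (𝟙 a) f) (F.map₂ (λ_ f).hom)
        (F.map₂_leftUnitor_hom f).symm x) ≪⊗≫
    𝓕.delta (F.map f) x

/-- The data of the lax bidiagram `𝓕 F` obtained by composing `𝓕` with a lax functor `F`. -/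
def Data.comp (𝓕 : Data.{w, v, u, w₁, v₁, u₁} B) (F : A ⥤ᴸ B) :
    Data.{w₂, v₂, u₂, w₁, v₁, u₁} A where
  fib a := 𝓕.fib (F.obj a)
  pull f := 𝓕.pull (F.map f)
  pull₂ α := 𝓕.pull₂ (F.map₂ α)
  chi f g := (𝓕.chi (F.map f) (F.map g)).vcomp (𝓕.pull₂ (F.mapComp f g))
  chiId a := (𝓕.chiId (F.obj a)).vcomp (𝓕.pull₂ (F.mapId a))
  xi α β x := 𝓕.xi₂ (F.map₂ α) (F.map₂ β) (F.map₂_comp α β).symm x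
  xiId f x := 𝓕.xi₀ (F.map₂_id f).symm x
  chi₂ {_ _ _ f h g k} α β x :=
    α_ (𝓕.ch (F.map f) (F.map g) x) (𝓕.st (F.mapComp f g) x) (𝓕.st (F.map₂ (hc α β)) x) ≪≫
      whiskerLeftIso (𝓕.ch (F.map f) (F.map g) x)
        (𝓕.xi₂ (F.mapComp f g) (F.map₂ (hc α β)) rfl x ≪≫
          (𝓕.xi₂ (hc (F.map₂ α) (F.map₂ β)) (F.mapComp h k) (by simp [hc]) x).symm) ≪≫
      (α_ (𝓕.ch (F.map f) (F.map g) x) (𝓕.st (hc (F.map₂ α) (F.map₂ β)) x)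
        (𝓕.st (F.mapComp h k) x)).symm ≪≫
      whiskerRightIso (𝓕.chi₂ (F.map₂ α) (F.map₂ β) x) (𝓕.st (F.mapComp h k) x) ≪≫
      α_ (𝓕.mp (F.map f) (𝓕.st (F.map₂ β) x) ≫ 𝓕.st (F.map₂ α) (𝓕.ob (F.map k) x))
        (𝓕.ch (F.map h) (F.map k) x) (𝓕.st (F.mapComp h k) x)
  omega f g h x := 𝓕.compOmega F f g h x
  gamma f x := 𝓕.compGamma F f x
  delta f x := 𝓕.compDelta F f x

/-- The data (without the axioms) of a lax functor. -/
@[ext]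
structure LaxData (A : Type u₂) [Bicategory.{w₂, v₂} A] (B : Type u) [Bicategory.{w, v} B]
    extends PrelaxFunctorStruct A B where
  /-- the unit constraint -/
  mapId (a : A) : 𝟙 (obj a) ⟶ map (𝟙 a)
  /-- the composition constraint -/
  mapComp {a b c : A} (f : a ⟶ b) (g : b ⟶ c) : map f ≫ map g ⟶ map (f ≫ g)

/-- The underlying data of a lax functor. -/
def LaxData.of (F : A ⥤ᴸ B) : LaxData A B where
  toPrelaxFunctorStruct := F.toPrelaxFunctorStruct
  mapId := F.mapId
  mapComp := F.mapComp

/-- The 2-cell over the constraint `F v ∘ F u ⟶ F (v ∘ u)`: an associativity constraint. -/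
def Data.baseChangeComp (𝓕 : Data.{w, v, u, w₁, v₁, u₁} B) (F : A ⥤ᴸ B) {a b c : A} (f : a ⟶ b)
    (g : b ⟶ c) {x : 𝓕.fib (F.obj a)} {y : 𝓕.fib (F.obj b)} {z : 𝓕.fib (F.obj c)}
    (p : x ⟶ 𝓕.ob (F.map f) y) (q : y ⟶ 𝓕.ob (F.map g) z) :
    𝓕.compFib (F.map f) (F.map g) p q ≫ 𝓕.st (F.mapComp f g) z ⟶ (𝓕.comp F).compFib f g p q :=
  (α_ (p ≫ 𝓕.mp (F.map f) q) (𝓕.ch (F.map f) (F.map g) z) (𝓕.st (F.mapComp f g) z)).hom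

/-- The 2-cell over the constraint `1 ⟶ F 1`: an identity. -/
def Data.baseChangeId (𝓕 : Data.{w, v, u, w₁, v₁, u₁} B) (F : A ⥤ᴸ B) (a : A)
    (x : 𝓕.fib (F.obj a)) :
    𝓕.cu (F.obj a) x ≫ 𝓕.st (F.mapId a) x ⟶ (𝓕.comp F).cu a x :=
  𝟙 (𝓕.cu (F.obj a) x ≫ 𝓕.st (F.mapId a) x)

/-- The data of the lax functor `∫ 𝓕 F ⟶ ∫ 𝓕` induced by `F`. -/
noncomputable def baseChange (𝓕 : Data.{w, v, u, w₁, v₁, u₁} B) (F : A ⥤ᴸ B) [IsBicategory (𝓕.comp F)]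
    [IsBicategory 𝓕] : LaxData (Obj (𝓕.comp F)) (Obj 𝓕) where
  obj X := { base := F.obj X.base, fib := X.fib }
  map {_ _} (p : Obj.Hom₁ _ _) := { base := F.map p.base, fib := p.fib }
  map₂ {_ _ _ _} (s : Obj.Hom₂ _ _) := { base := F.map₂ s.base, fib := s.fib }
  mapId X :=
    { base := F.mapId X.base, fib := 𝓕.baseChangeId F X.base X.fib }
  mapComp {_ _ _} (p : Obj.Hom₁ _ _) (q : Obj.Hom₁ _ _) :=
    { base := F.mapComp p.base q.base
      fib := 𝓕.baseChangeComp F p.base q.base p.fib q.fib }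

end BaseChange

/-- Bicategories (with homs and 2-homs in fixed universes). -/
structure LaxBicat : Type (max (u + 1) (v + 1) (w + 1)) where
  /-- the bundled bicategory -/
  of ::
  /-- the objects -/
  carrier : Type u
  /-- the structure -/
  [str : Bicategory.{w, v} carrier]

namespace LaxBicat

attribute [instance] LaxBicat.str

theorem lax_ext {A : Type u₂} [Bicategory.{w₂, v₂} A] {B : Type u} [Bicategory.{w, v} B]
    {F G : A ⥤ᴸ B} (h : F.toPrelaxFunctor = G.toPrelaxFunctor) (h₁ : F.mapId ≍ G.mapId)
    (h₂ : @LaxFunctor.mapComp _ _ _ _ F ≍ @LaxFunctor.mapComp _ _ _ _ G) : F = G := by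
  obtain ⟨F, _, _⟩ := F
  obtain ⟨G, _, _⟩ := G
  obtain rfl : F = G := h
  obtain rfl := eq_of_heq h₁
  obtain rfl := eq_of_heq h₂
  rfl

/-- The category of bicategories and lax functors. -/
instance : Category LaxBicat.{w, v, u} where
  Hom A B := A.carrier ⥤ᴸ B.carrier
  id A := LaxFunctor.id A.carrier
  comp F G := F.comp G
  id_comp F := by
    refine lax_ext rfl (heq_of_eq ?_) (heq_of_eq ?_)
    · funext a
      change F.mapId a ≫ F.map₂ (𝟙 (𝟙 a)) = F.mapId a
      simp
    · funext a b c f g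
      change F.mapComp f g ≫ F.map₂ (𝟙 (f ≫ g)) = F.mapComp f g
      simp
  comp_id F := by
    refine lax_ext rfl (heq_of_eq ?_) (heq_of_eq ?_)
    · funext a
      exact Category.id_comp (F.mapId a)
    · funext a b c f g
      exact Category.id_comp (F.mapComp f g)
  assoc F G H := by
    refine lax_ext rfl (heq_of_eq ?_) (heq_of_eq ?_)
    · funext a
      change H.mapId _ ≫ H.map₂ (G.mapId (F.obj a) ≫ G.map₂ (F.mapId a)) =
        (H.mapId _ ≫ H.map₂ (G.mapId (F.obj a))) ≫ H.map₂ (G.map₂ (F.mapId a))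
      simp
    · funext a b c f g
      change H.mapComp _ _ ≫ H.map₂ (G.mapComp (F.map f) (F.map g) ≫ G.map₂ (F.mapComp f g)) =
        (H.mapComp _ _ ≫ H.map₂ (G.mapComp (F.map f) (F.map g))) ≫ H.map₂ (G.map₂ (F.mapComp f g))
      simp

/-- A lax functor as a morphism of the category of bicategories and lax functors. -/
abbrev ofLax {A B : Type u} [Bicategory.{w, v} A] [Bicategory.{w, v} B] (F : A ⥤ᴸ B) :
    LaxBicat.of A ⟶ LaxBicat.of B := F

end LaxBicat

end LaxBidiag

set_option linter.unusedSimpArgs false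
set_option linter.unnecessarySeqFocus false
set_option linter.unusedSectionVars false

namespace LaxBidiag

/-! A 2-cell `(φ, α)` of `∫ 𝓕` consists of a 2-cell `α` of the base and a 2-cell `φ` of a fibre, and
`F̄` changes only the base component. Up to constraints, a cell of `∫ 𝓕F` is therefore a cell of `A`
together with a cell of `∫ 𝓕` over its image. The work lies in the constraints and in the axioms of
`𝓕F`.

Whiskered axioms. A structure cell of `𝓕`, whiskered with a 1-cell `s` into its source, is a 2-cell
of `∫ 𝓕` over the corresponding 2-cell of the base. By (C1) and (C2), the 1-cells of `∫ 𝓕` between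
two given objects form a category `Tot`; its composition absorbs the cells `ξ`, and (C3)–(C8) become
plain equations in it (`TotAxioms`). Whiskering with `s` gives one direction (`totAxioms`), and `s =
1` gives the other (`TotAxioms.isLaxBidiagram`).

Bicategory axioms. Each axiom for horizontal composition or for the constraints of `∫ 𝓕` is one of
these equations at a suitable `s`, combined with the modification axioms and naturality
(`IsLaxBidiagram.isBicategory`). Conversely, a 1-cell `s : y ⟶ f^* g^* x` is, up to `f^* 1 ≅ 1`, the
part without `χ` of the composite of `(s, f)` and `(1, g)`. Hence if (C1) and (C2) hold and the
structure cells are modifications, the bicategory axioms of `∫ 𝓕` give back (C3)–(C8)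
(`IsBicategory.totAxioms`).

Change of base. For `𝓕F`, the axioms on `ξ` and on modifications are checked directly (`hasXi_comp`,
`HasModifications.comp`). The definitions of its other structure cells say that `F̄`, with its
constraints, respects horizontal composition and the constraints (`pushComp_comp_push`,
`pushComp_comp_assoc₂`, `pushId_comp_unitL₂`, `pushId_comp_unitR₂`). The constraints of `F̄` have
invertible fibre components, hence can be cancelled on the left from an equation between 2-cells
with equal bases. So an equation in `∫ 𝓕F` holds as soon as it holds in `A` and its image, preceded
by such constraints, holds in `∫ 𝓕` (`eq_of_pmap`). In this way the bicategory axioms pass from `∫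
𝓕` to `∫ 𝓕F` (`IsBicategory.comp`), and the converse above makes `𝓕F` a lax bidiagram.

Pullback. Let `H : C ⥤ᴸ ∫ 𝓕` and `K : C ⥤ᴸ A` have the same image in `B`. On objects, 1-cells and
2-cells the lift takes its base from `K` and its fibre components from `H`. A constraint of a
composite `F̄ L` is a constraint of `F̄` followed by the image of one of `L`, and pasting with an
invertible cell is bijective (`vcompFib_bijective`); so the constraints of the lift exist and are
unique. Its axioms hold by the same reflection principle (`IsLax.of_baseChange`). -/

/-- To compare two 2-cells it suffices to present them as the results of whiskering equal
2-cells, up to coherence. -/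
theorem act_congr {D : Type u} [Bicategory.{w, v} D] {x y z : D} {P Q : x ⟶ z} {L R : P ⟶ Q}
    (h : L = R) (s : y ⟶ x) {P' Q' : y ⟶ z} [BicategoricalCoherence P' (s ≫ P)]
    [BicategoricalCoherence (s ≫ Q) Q'] {l r : P' ⟶ Q'} (hl : l = 𝟙 P' ⊗≫ s ◁ L ⊗≫ 𝟙 Q')
    (hr : r = 𝟙 P' ⊗≫ s ◁ R ⊗≫ 𝟙 Q') : l = r := by
  rw [hl, hr, h]

/-- To compare two 2-cells it suffices to present them as equal 2-cells, up to coherence. -/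
theorem coh_congr {D : Type u} [Bicategory.{w, v} D] {x z : D} {P Q P' Q' : x ⟶ z}
    {L R : P ⟶ Q} (h : L = R) [BicategoricalCoherence P' P]
    [BicategoricalCoherence Q Q'] {l r : P' ⟶ Q'} (hl : l = 𝟙 P' ⊗≫ L ⊗≫ 𝟙 Q')
    (hr : r = 𝟙 P' ⊗≫ R ⊗≫ 𝟙 Q') : l = r := by
  rw [hl, hr, h]

/-! ### Left-bracketed, whiskered forms of the structure cells. -/

namespace Data

variable {B : Type u} [Bicategory.{w, v} B] (𝓕 : Data.{w, v, u, w₁, v₁, u₁} B)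

/-! ### The structure cells acting on a 1-cell -/

section Act

variable {a b c d : B}

/-- The action of `ξ` on a 1-cell. -/
def xiAt {f g h : a ⟶ b} (α : f ⟶ g) (β : g ⟶ h) {y : 𝓕.fib a} {x : 𝓕.fib b}
    (s : y ⟶ 𝓕.ob f x) : (s ≫ 𝓕.st α x) ≫ 𝓕.st β x ≅ s ≫ 𝓕.st (α ≫ β) x :=
  α_ _ _ _ ≪≫ whiskerLeftIso s (𝓕.xi α β x)

/-- The action of the unit constraint `ξ` on a 1-cell. -/
def xiIdAt (f : a ⟶ b) {y : 𝓕.fib a} {x : 𝓕.fib b} (s : y ⟶ 𝓕.ob f x) :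
    s ≅ s ≫ 𝓕.st (𝟙 f) x :=
  (ρ_ s).symm ≪≫ whiskerLeftIso s (𝓕.xiId f x)

/-- The action of the naturality 2-cell of `α^*` on a 1-cell. -/
def stNatAt {f g : a ⟶ b} (α : f ⟶ g) {y : 𝓕.fib a} {x x' : 𝓕.fib b} (p : x ⟶ x')
    (s : y ⟶ 𝓕.ob f x) :
    (s ≫ 𝓕.mp f p) ≫ 𝓕.st α x' ≅ (s ≫ 𝓕.st α x) ≫ 𝓕.mp g p :=
  α_ _ _ _ ≪≫ whiskerLeftIso s (𝓕.stNat α p) ≪≫ (α_ _ _ _).symm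

/-- The action of the naturality 2-cell of `χ` on a 1-cell. -/
def chNatAt (f : a ⟶ b) (g : b ⟶ c) {y : 𝓕.fib a} {x x' : 𝓕.fib c} (p : x ⟶ x')
    (s : y ⟶ 𝓕.ob f (𝓕.ob g x)) :
    (s ≫ 𝓕.mp f (𝓕.mp g p)) ≫ 𝓕.ch f g x' ≅ (s ≫ 𝓕.ch f g x) ≫ 𝓕.mp (f ≫ g) p :=
  α_ _ _ _ ≪≫ whiskerLeftIso s (𝓕.chNat f g p) ≪≫ (α_ _ _ _).symm

/-- The action of the naturality 2-cell of the unit `χ` on a 1-cell. -/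
def cuNatAt {y x x' : 𝓕.fib a} (p : x ⟶ x') (s : y ⟶ x) :
    (s ≫ p) ≫ 𝓕.cu a x' ≅ (s ≫ 𝓕.cu a x) ≫ 𝓕.mp (𝟙 a) p :=
  α_ _ _ _ ≪≫ whiskerLeftIso s (𝓕.cuNat a p) ≪≫ (α_ _ _ _).symm

/-- The action of `χ_{β,α}` on a 1-cell. -/
def chiAt {f h : a ⟶ b} {g k : b ⟶ c} (α : f ⟶ h) (β : g ⟶ k) {y : 𝓕.fib a} {x : 𝓕.fib c}
    (s : y ⟶ 𝓕.ob f (𝓕.ob g x)) :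
    (s ≫ 𝓕.ch f g x) ≫ 𝓕.st (hc α β) x ≅
      ((s ≫ 𝓕.mp f (𝓕.st β x)) ≫ 𝓕.st α (𝓕.ob k x)) ≫ 𝓕.ch h k x :=
  α_ _ _ _ ≪≫ whiskerLeftIso s (𝓕.chi₂ α β x) ≪≫ (α_ _ _ _).symm ≪≫
    whiskerRightIso (α_ _ _ _).symm _

/-- The action of `χ_{β,f}` on a 1-cell. -/
def chiLAt (f : a ⟶ b) {g k : b ⟶ c} (β : g ⟶ k) {y : 𝓕.fib a} {x : 𝓕.fib c}
    (s : y ⟶ 𝓕.ob f (𝓕.ob g x)) :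
    (s ≫ 𝓕.ch f g x) ≫ 𝓕.st (f ◁ β) x ≅ (s ≫ 𝓕.mp f (𝓕.st β x)) ≫ 𝓕.ch f k x :=
  α_ _ _ _ ≪≫ whiskerLeftIso s (𝓕.chiL f β x) ≪≫ (α_ _ _ _).symm

/-- The action of `χ_{g,α}` on a 1-cell. -/
def chiRAt {f h : a ⟶ b} (α : f ⟶ h) (g : b ⟶ c) {y : 𝓕.fib a} {x : 𝓕.fib c}
    (s : y ⟶ 𝓕.ob f (𝓕.ob g x)) :
    (s ≫ 𝓕.ch f g x) ≫ 𝓕.st (α ▷ g) x ≅ (s ≫ 𝓕.st α (𝓕.ob g x)) ≫ 𝓕.ch h g x :=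
  α_ _ _ _ ≪≫ whiskerLeftIso s (𝓕.chiR α g x) ≪≫ (α_ _ _ _).symm

/-- The action of `ω` on a 1-cell. -/
def omegaAt (f : a ⟶ b) (g : b ⟶ c) (h : c ⟶ d) {y : 𝓕.fib a} {x : 𝓕.fib d}
    (s : y ⟶ 𝓕.ob f (𝓕.ob g (𝓕.ob h x))) :
    ((s ≫ 𝓕.mp f (𝓕.ch g h x)) ≫ 𝓕.ch f (g ≫ h) x) ≫ 𝓕.st (α_ f g h).inv x ≅
      (s ≫ 𝓕.ch f g (𝓕.ob h x)) ≫ 𝓕.ch (f ≫ g) h x :=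
  whiskerRightIso (α_ _ _ _) _ ≪≫ α_ _ _ _ ≪≫ whiskerLeftIso s (𝓕.omega f g h x) ≪≫
    (α_ _ _ _).symm

/-- The action of `γ` on a 1-cell. -/
def gammaAt (f : a ⟶ b) {y : 𝓕.fib a} {x : 𝓕.fib b} (s : y ⟶ 𝓕.ob f x) :
    ((s ≫ 𝓕.mp f (𝓕.cu b x)) ≫ 𝓕.ch f (𝟙 b) x) ≫ 𝓕.st (ρ_ f).hom x ≅ s :=
  whiskerRightIso (α_ _ _ _) _ ≪≫ α_ _ _ _ ≪≫ whiskerLeftIso s (𝓕.gamma f x) ≪≫ ρ_ s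

/-- The action of `δ` on a 1-cell. -/
def deltaAt (f : a ⟶ b) {y : 𝓕.fib a} {x : 𝓕.fib b} (s : y ⟶ 𝓕.ob f x) :
    ((s ≫ 𝓕.cu a (𝓕.ob f x)) ≫ 𝓕.ch (𝟙 a) f x) ≫ 𝓕.st (λ_ f).hom x ≅ s :=
  whiskerRightIso (α_ _ _ _) _ ≪≫ α_ _ _ _ ≪≫ whiskerLeftIso s (𝓕.delta f x) ≪≫ ρ_ s

/-- The constraint of the homomorphism `f^*` acting on a 1-cell. -/
def mpCompAt (f : a ⟶ b) {y : 𝓕.fib a} {x x' x'' : 𝓕.fib b} (p : x ⟶ x') (q : x' ⟶ x'')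
    (s : y ⟶ 𝓕.ob f x) : s ≫ 𝓕.mp f (p ≫ q) ≅ (s ≫ 𝓕.mp f p) ≫ 𝓕.mp f q :=
  whiskerLeftIso s (𝓕.mpComp f p q) ≪≫ (α_ _ _ _).symm

/-- The unit constraint of the homomorphism `f^*` acting on a 1-cell. -/
def mpIdAt (f : a ⟶ b) {y : 𝓕.fib a} {x : 𝓕.fib b}
    (s : y ⟶ 𝓕.ob f x) : s ≫ 𝓕.mp f (𝟙 x) ≅ s :=
  whiskerLeftIso s (𝓕.mpId f x) ≪≫ ρ_ s

variable {𝓕}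

section Naturality

variable {y : 𝓕.fib a}

/-- The interchange law: a 2-cell `σ` acts on the whiskering 1-cell, the structure cell on what
follows it. The same reason gives all the lemmas of this section. With 1-cells kept left-bracketed,
no associators appear in these rules. -/
theorem xiAt_nat {f g h : a ⟶ b} (α : f ⟶ g) (β : g ⟶ h) {x : 𝓕.fib b}
    {s s' : y ⟶ 𝓕.ob f x} (σ : s ⟶ s') :
    σ ▷ 𝓕.st α x ▷ 𝓕.st β x ≫ (𝓕.xiAt α β s').hom = (𝓕.xiAt α β s).hom ≫ σ ▷ 𝓕.st (α ≫ β) x := by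
  refine coh_congr (whisker_exchange σ (𝓕.xi α β x).hom).symm ?_ ?_ <;>
    simp only [xiAt, Iso.trans_hom, whiskerLeftIso_hom, whiskerRightIso_hom, Iso.symm_hom] <;>
    bicategory

theorem xiIdAt_nat (f : a ⟶ b) {x : 𝓕.fib b} {s s' : y ⟶ 𝓕.ob f x} (σ : s ⟶ s') :
    σ ≫ (𝓕.xiIdAt f s').hom = (𝓕.xiIdAt f s).hom ≫ σ ▷ 𝓕.st (𝟙 f) x := by
  simp [xiIdAt, whisker_exchange]

theorem stNatAt_nat {f g : a ⟶ b} (α : f ⟶ g) {x x' : 𝓕.fib b} (p : x ⟶ x')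
    {s s' : y ⟶ 𝓕.ob f x} (σ : s ⟶ s') :
    σ ▷ 𝓕.mp f p ▷ 𝓕.st α x' ≫ (𝓕.stNatAt α p s').hom =
      (𝓕.stNatAt α p s).hom ≫ σ ▷ 𝓕.st α x ▷ 𝓕.mp g p := by
  refine coh_congr (whisker_exchange σ (𝓕.stNat α p).hom).symm ?_ ?_ <;>
    simp only [stNatAt, Iso.trans_hom, whiskerLeftIso_hom, whiskerRightIso_hom, Iso.symm_hom] <;>
    bicategory

theorem chNatAt_nat (f : a ⟶ b) (g : b ⟶ c) {x x' : 𝓕.fib c} (p : x ⟶ x')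
    {s s' : y ⟶ 𝓕.ob f (𝓕.ob g x)} (σ : s ⟶ s') :
    σ ▷ 𝓕.mp f (𝓕.mp g p) ▷ 𝓕.ch f g x' ≫ (𝓕.chNatAt f g p s').hom =
      (𝓕.chNatAt f g p s).hom ≫ σ ▷ 𝓕.ch f g x ▷ 𝓕.mp (f ≫ g) p := by
  refine coh_congr (whisker_exchange σ (𝓕.chNat f g p).hom).symm ?_ ?_ <;>
    simp only [chNatAt, Iso.trans_hom, whiskerLeftIso_hom, whiskerRightIso_hom, Iso.symm_hom] <;>
    bicategory

theorem chiAt_nat {f h : a ⟶ b} {g k : b ⟶ c} (α : f ⟶ h) (β : g ⟶ k) {x : 𝓕.fib c}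
    {s s' : y ⟶ 𝓕.ob f (𝓕.ob g x)} (σ : s ⟶ s') :
    σ ▷ 𝓕.ch f g x ▷ 𝓕.st (hc α β) x ≫ (𝓕.chiAt α β s').hom = (𝓕.chiAt α β s).hom ≫
      σ ▷ 𝓕.mp f (𝓕.st β x) ▷ 𝓕.st α (𝓕.ob k x) ▷ 𝓕.ch h k x := by
  refine coh_congr (whisker_exchange σ (𝓕.chi₂ α β x).hom).symm ?_ ?_ <;>
    simp only [chiAt, Iso.trans_hom, whiskerLeftIso_hom, whiskerRightIso_hom, Iso.symm_hom] <;>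
    bicategory

theorem chiLAt_nat (f : a ⟶ b) {g k : b ⟶ c} (β : g ⟶ k) {x : 𝓕.fib c}
    {s s' : y ⟶ 𝓕.ob f (𝓕.ob g x)} (σ : s ⟶ s') :
    σ ▷ 𝓕.ch f g x ▷ 𝓕.st (f ◁ β) x ≫ (𝓕.chiLAt f β s').hom = (𝓕.chiLAt f β s).hom ≫
      σ ▷ 𝓕.mp f (𝓕.st β x) ▷ 𝓕.ch f k x := by
  refine coh_congr (whisker_exchange σ (𝓕.chiL f β x).hom).symm ?_ ?_ <;>
    simp only [chiLAt, Iso.trans_hom, whiskerLeftIso_hom, whiskerRightIso_hom, Iso.symm_hom] <;>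
    bicategory

theorem chiRAt_nat {f h : a ⟶ b} (α : f ⟶ h) (g : b ⟶ c) {x : 𝓕.fib c}
    {s s' : y ⟶ 𝓕.ob f (𝓕.ob g x)} (σ : s ⟶ s') :
    σ ▷ 𝓕.ch f g x ▷ 𝓕.st (α ▷ g) x ≫ (𝓕.chiRAt α g s').hom = (𝓕.chiRAt α g s).hom ≫
      σ ▷ 𝓕.st α (𝓕.ob g x) ▷ 𝓕.ch h g x := by
  refine coh_congr (whisker_exchange σ (𝓕.chiR α g x).hom).symm ?_ ?_ <;>
    simp only [chiRAt, Iso.trans_hom, whiskerLeftIso_hom, whiskerRightIso_hom, Iso.symm_hom] <;>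
    bicategory

theorem omegaAt_nat (f : a ⟶ b) (g : b ⟶ c) (h : c ⟶ d) {x : 𝓕.fib d}
    {s s' : y ⟶ 𝓕.ob f (𝓕.ob g (𝓕.ob h x))} (σ : s ⟶ s') :
    σ ▷ 𝓕.mp f (𝓕.ch g h x) ▷ 𝓕.ch f (g ≫ h) x ▷ 𝓕.st (α_ f g h).inv x ≫
        (𝓕.omegaAt f g h s').hom =
      (𝓕.omegaAt f g h s).hom ≫ σ ▷ 𝓕.ch f g (𝓕.ob h x) ▷ 𝓕.ch (f ≫ g) h x := by
  refine coh_congr (whisker_exchange σ (𝓕.omega f g h x).hom).symm ?_ ?_ <;>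
    simp only [omegaAt, Iso.trans_hom, whiskerLeftIso_hom, whiskerRightIso_hom, Iso.symm_hom] <;>
    bicategory

theorem gammaAt_nat (f : a ⟶ b) {x : 𝓕.fib b} {s s' : y ⟶ 𝓕.ob f x} (σ : s ⟶ s') :
    σ ▷ 𝓕.mp f (𝓕.cu b x) ▷ 𝓕.ch f (𝟙 b) x ▷ 𝓕.st (ρ_ f).hom x ≫ (𝓕.gammaAt f s').hom =
      (𝓕.gammaAt f s).hom ≫ σ := by
  refine coh_congr (whisker_exchange σ (𝓕.gamma f x).hom).symm ?_ ?_ <;>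
    simp only [gammaAt, Iso.trans_hom, whiskerLeftIso_hom, whiskerRightIso_hom, Iso.symm_hom] <;>
    bicategory

theorem deltaAt_nat (f : a ⟶ b) {x : 𝓕.fib b} {s s' : y ⟶ 𝓕.ob f x} (σ : s ⟶ s') :
    σ ▷ 𝓕.cu a (𝓕.ob f x) ▷ 𝓕.ch (𝟙 a) f x ▷ 𝓕.st (λ_ f).hom x ≫ (𝓕.deltaAt f s').hom =
      (𝓕.deltaAt f s).hom ≫ σ := by
  refine coh_congr (whisker_exchange σ (𝓕.delta f x).hom).symm ?_ ?_ <;>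
    simp only [deltaAt, Iso.trans_hom, whiskerLeftIso_hom, whiskerRightIso_hom, Iso.symm_hom] <;>
    bicategory

theorem mpCompAt_nat (f : a ⟶ b) {x x' x'' : 𝓕.fib b} (p : x ⟶ x') (q : x' ⟶ x'')
    {s s' : y ⟶ 𝓕.ob f x} (σ : s ⟶ s') :
    σ ▷ 𝓕.mp f (p ≫ q) ≫ (𝓕.mpCompAt f p q s').hom =
      (𝓕.mpCompAt f p q s).hom ≫ σ ▷ 𝓕.mp f p ▷ 𝓕.mp f q := by
  refine coh_congr (whisker_exchange σ (𝓕.mpComp f p q).hom).symm ?_ ?_ <;>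
    simp only [mpCompAt, Iso.trans_hom, whiskerLeftIso_hom, whiskerRightIso_hom, Iso.symm_hom] <;>
    bicategory

theorem mpIdAt_nat (f : a ⟶ b) {x : 𝓕.fib b} {s s' : y ⟶ 𝓕.ob f x} (σ : s ⟶ s') :
    σ ▷ 𝓕.mp f (𝟙 x) ≫ (𝓕.mpIdAt f s').hom = (𝓕.mpIdAt f s).hom ≫ σ := by
  refine coh_congr (whisker_exchange σ (𝓕.mpId f x).hom).symm ?_ ?_ <;>
    simp only [mpIdAt, Iso.trans_hom, whiskerLeftIso_hom, whiskerRightIso_hom, Iso.symm_hom] <;>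
    bicategory

end Naturality

end Act

end Data

end LaxBidiag

/-! ### The hom-categories of the Grothendieck construction and their opcartesian 2-cells. -/

namespace LaxBidiag

open Data

/-- The coherence axioms of a lax bidiagram that concern the cells `ξ` only. -/
class HasXi {B : Type u} [Bicategory.{w, v} B] (𝓕 : Data.{w, v, u, w₁, v₁, u₁} B) : Prop where
  xi_assoc {a b : B} {f g h k : a ⟶ b} (α : f ⟶ g) (β : g ⟶ h) (ζ : h ⟶ k) (x : 𝓕.fib b) :
    (𝓕.xi α β x).hom ▷ 𝓕.st ζ x ≫ (𝓕.xi₂ (α ≫ β) ζ (Category.assoc α β ζ) x).hom =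
      (α_ (𝓕.st α x) (𝓕.st β x) (𝓕.st ζ x)).hom ≫ 𝓕.st α x ◁ (𝓕.xi β ζ x).hom ≫
        (𝓕.xi α (β ≫ ζ) x).hom
  xi_id_left {a b : B} {f g : a ⟶ b} (α : f ⟶ g) (x : 𝓕.fib b) :
    (𝓕.xiId f x).hom ▷ 𝓕.st α x ≫ (𝓕.xi₂ (𝟙 f) α (Category.id_comp α) x).hom =
      (λ_ (𝓕.st α x)).hom
  xi_id_right {a b : B} {f g : a ⟶ b} (α : f ⟶ g) (x : 𝓕.fib b) :
    𝓕.st α x ◁ (𝓕.xiId g x).hom ≫ (𝓕.xi₂ α (𝟙 g) (Category.comp_id α) x).hom =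
      (ρ_ (𝓕.st α x)).hom

theorem IsLaxBidiagram.hasXi {B : Type u} [Bicategory.{w, v} B]
    {𝓕 : Data.{w, v, u, w₁, v₁, u₁} B} (H : IsLaxBidiagram 𝓕) : HasXi 𝓕 :=
  ⟨H.xi_assoc, H.xi_id_left, H.xi_id_right⟩

namespace Data

variable {B : Type u} [Bicategory.{w, v} B] (𝓕 : Data.{w, v, u, w₁, v₁, u₁} B)

/-! ### The total categories -/

/-- The 1-cells from `y` to `x` of the Grothendieck construction. -/
structure Tot {a b : B} (y : 𝓕.fib a) (x : 𝓕.fib b) where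
  /-- the 1-cell of `B` -/
  base : a ⟶ b
  /-- the 1-cell over `base` -/
  fib : y ⟶ 𝓕.ob base x

/-- A 1-cell of the Grothendieck construction. -/
abbrev tob {a b : B} (f : a ⟶ b) {y : 𝓕.fib a} {x : 𝓕.fib b} (s : y ⟶ 𝓕.ob f x) : 𝓕.Tot y x :=
  ⟨f, s⟩

variable {𝓕}

/-- The 2-cells of the Grothendieck construction. -/
@[ext]
structure Tot.Hom {a b : B} {y : 𝓕.fib a} {x : 𝓕.fib b} (s t : 𝓕.Tot y x) where
  /-- the 2-cell of `B` -/
  base : s.base ⟶ t.base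
  /-- the 2-cell over `base` -/
  fib : s.fib ≫ 𝓕.st base x ⟶ t.fib

section Xi

variable {a b : B} {y : 𝓕.fib a} {x : 𝓕.fib b}

@[simp]
theorem stEq_refl {f g : a ⟶ b} {θ : f ⟶ g} : 𝓕.stEq (rfl : θ = θ) x = Iso.refl _ := rfl

theorem xi₂_eq {f g h : a ⟶ b} (α : f ⟶ g) (β : g ⟶ h) {θ : f ⟶ h} (e : α ≫ β = θ) :
    𝓕.xi₂ α β e x = 𝓕.xi α β x ≪≫ 𝓕.stEq e x := rfl

theorem xi₀_eq {f : a ⟶ b} {θ : f ⟶ f} (e : 𝟙 f = θ) :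
    𝓕.xi₀ e x = 𝓕.xiId f x ≪≫ 𝓕.stEq e x := rfl

variable [HasXi 𝓕]

theorem xiAt_assoc {f g h k : a ⟶ b} (α : f ⟶ g) (β : g ⟶ h) (ζ : h ⟶ k) (s : y ⟶ 𝓕.ob f x) :
    (𝓕.xiAt α β s).hom ▷ 𝓕.st ζ x ≫ (𝓕.xiAt (α ≫ β) ζ s).hom ≫
      s ◁ (𝓕.stEq (Category.assoc α β ζ) x).hom =
      (𝓕.xiAt β ζ (s ≫ 𝓕.st α x)).hom ≫ (𝓕.xiAt α (β ≫ ζ) s).hom := by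
  refine act_congr (HasXi.xi_assoc α β ζ x) s ?_ ?_ <;>
    (try simp only [xiAt, xi₂_eq, Iso.trans_hom, whiskerLeftIso_hom]) <;> bicategory

theorem xiAt_id_left {f g : a ⟶ b} (α : f ⟶ g) (s : y ⟶ 𝓕.ob f x) :
    (𝓕.xiIdAt f s).hom ▷ 𝓕.st α x ≫ (𝓕.xiAt (𝟙 f) α s).hom ≫
      s ◁ (𝓕.stEq (Category.id_comp α) x).hom = 𝟙 _ := by
  refine act_congr (HasXi.xi_id_left α x) s ?_ ?_ <;>
    (try simp only [xiAt, xiIdAt, xi₂_eq, Iso.trans_hom, whiskerLeftIso_hom, Iso.symm_hom]) <;> bicategory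

theorem xiAt_id_right {f g : a ⟶ b} (α : f ⟶ g) (s : y ⟶ 𝓕.ob f x) :
    (𝓕.xiIdAt g (s ≫ 𝓕.st α x)).hom ≫ (𝓕.xiAt α (𝟙 g) s).hom ≫
      s ◁ (𝓕.stEq (Category.comp_id α) x).hom = 𝟙 _ := by
  refine act_congr (HasXi.xi_id_right α x) s ?_ ?_ <;>
    (try simp only [xiAt, xiIdAt, xi₂_eq, Iso.trans_hom, whiskerLeftIso_hom, Iso.symm_hom]) <;> bicategory

theorem xiAt_inv_id_left {f g : a ⟶ b} (α : f ⟶ g) (s : y ⟶ 𝓕.ob f x) :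
    (𝓕.xiAt (𝟙 f) α s).inv ≫ (𝓕.xiIdAt f s).inv ▷ 𝓕.st α x =
      s ◁ (𝓕.stEq (Category.id_comp α) x).hom := by
  rw [Iso.inv_comp_eq, ← cancel_epi ((𝓕.xiIdAt f s).hom ▷ 𝓕.st α x), xiAt_id_left]
  simp

theorem xiAt_inv_id_right {f g : a ⟶ b} (α : f ⟶ g) (s : y ⟶ 𝓕.ob f x) :
    (𝓕.xiAt α (𝟙 g) s).inv ≫ (𝓕.xiIdAt g (s ≫ 𝓕.st α x)).inv =
      s ◁ (𝓕.stEq (Category.comp_id α) x).hom := by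
  rw [Iso.inv_comp_eq, ← cancel_epi (𝓕.xiIdAt g (s ≫ 𝓕.st α x)).hom, xiAt_id_right]
  simp

theorem xiAt_inv_assoc {f g h k : a ⟶ b} (α : f ⟶ g) (β : g ⟶ h) (ζ : h ⟶ k)
    (s : y ⟶ 𝓕.ob f x) :
    (𝓕.xiAt (α ≫ β) ζ s).inv ≫ (𝓕.xiAt α β s).inv ▷ 𝓕.st ζ x =
      s ◁ (𝓕.stEq (Category.assoc α β ζ) x).hom ≫ (𝓕.xiAt α (β ≫ ζ) s).inv ≫
        (𝓕.xiAt β ζ (s ≫ 𝓕.st α x)).inv := by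
  rw [Iso.inv_comp_eq, ← cancel_epi ((𝓕.xiAt α β s).hom ▷ 𝓕.st ζ x), reassoc_of% xiAt_assoc]
  simp

end Xi

section Xi'

variable {a b : B} {y : 𝓕.fib a} {x : 𝓕.fib b}

theorem xiAt_inv_nat {f g h : a ⟶ b} (α : f ⟶ g) (β : g ⟶ h) {s s' : y ⟶ 𝓕.ob f x} (σ : s ⟶ s') :
    (𝓕.xiAt α β s).inv ≫ σ ▷ 𝓕.st α x ▷ 𝓕.st β x = σ ▷ 𝓕.st (α ≫ β) x ≫ (𝓕.xiAt α β s').inv := by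
  rw [Iso.inv_comp_eq, ← Category.assoc, ← xiAt_nat]
  simp

theorem xiIdAt_inv_nat (f : a ⟶ b) {s s' : y ⟶ 𝓕.ob f x} (σ : s ⟶ s') :
    σ ▷ 𝓕.st (𝟙 f) x ≫ (𝓕.xiIdAt f s').inv = (𝓕.xiIdAt f s).inv ≫ σ := by
  rw [Iso.eq_inv_comp, ← Category.assoc, ← xiIdAt_nat]
  simp

/-- The cells `ξ` enter a composite of 2-cells of the Grothendieck construction through their
inverses, together with a transport along an equation of the base. Here they are gathered at the
start of one side, where the axioms of a lax bidiagram have them. -/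
theorem stEq_hom_comp_iff {f g : a ⟶ b} {θ τ : f ⟶ g} (e : θ = τ) {s : y ⟶ 𝓕.ob f x}
    {P Q R : y ⟶ 𝓕.ob g x} (i : P ≅ s ≫ 𝓕.st θ x) (j : Q ≅ s ≫ 𝓕.st τ x) (m : P ⟶ R)
    (n : Q ⟶ R) : i.inv ≫ m = s ◁ (𝓕.stEq e x).hom ≫ j.inv ≫ n ↔
      j.hom ≫ s ◁ (𝓕.stEq e x).inv ≫ i.inv ≫ m = n := by
  subst e
  simp [Iso.eq_inv_comp]

end Xi'

namespace Tot

variable {a b : B} {y : 𝓕.fib a} {x : 𝓕.fib b}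

/-- The bases of two equal 2-cells are often only provably equal. Comparing the fibre components
through `stEq` replaces heterogeneous equality by an invertible 2-cell. -/
theorem Hom.ext_stEq {s t : 𝓕.Tot y x} {m n : Hom s t} (e : m.base = n.base)
    (h : m.fib = s.fib ◁ (𝓕.stEq e x).hom ≫ n.fib) : m = n := by
  obtain ⟨α, φ⟩ := m
  obtain ⟨β, ψ⟩ := n
  obtain rfl : α = β := e
  obtain rfl : φ = ψ := by simpa using h
  rfl

theorem Hom.fib_eq {s t : 𝓕.Tot y x} {m n : Hom s t} (h : m = n) :
    m.fib = s.fib ◁ (𝓕.stEq (congrArg Hom.base h) x).hom ≫ n.fib := by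
  subst h
  simp

/-- The category of 1-cells and 2-cells from `y` to `x` of the Grothendieck construction. -/
instance category [HasXi 𝓕] : Category (𝓕.Tot y x) where
  Hom := Hom
  id s := ⟨𝟙 s.base, (𝓕.xiIdAt s.base s.fib).inv⟩
  comp {s t r} m n := ⟨m.base ≫ n.base,
    (𝓕.xiAt m.base n.base s.fib).inv ≫ m.fib ▷ 𝓕.st n.base x ≫ n.fib⟩
  id_comp {s t} m := by
    refine Hom.ext_stEq (Category.id_comp _) ?_
    dsimp only
    rw [reassoc_of% xiAt_inv_id_left]
  comp_id {s t} m := by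
    refine Hom.ext_stEq (Category.comp_id _) ?_
    dsimp only
    rw [xiIdAt_inv_nat, reassoc_of% xiAt_inv_id_right]
  assoc {s t r q} m n k := by
    refine Hom.ext_stEq (Category.assoc _ _ _) ?_
    dsimp only
    simp only [comp_whiskerRight, Category.assoc]
    rw [reassoc_of% xiAt_inv_assoc, reassoc_of% xiAt_inv_nat]

section Cells

variable [HasXi 𝓕]

variable {f g h : a ⟶ b} {s s' s'' : y ⟶ 𝓕.ob f x} {t t' : y ⟶ 𝓕.ob g x} {r : y ⟶ 𝓕.ob h x}

/-- The 2-cell of the Grothendieck construction with given components. -/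
def cell (α : f ⟶ g) (φ : s ≫ 𝓕.st α x ⟶ t) : 𝓕.tob f s ⟶ 𝓕.tob g t :=
  Hom.mk α φ

/-- The 2-cell of the Grothendieck construction over an identity that is given by a 2-cell of
a fibre. -/
def ver (φ : s ⟶ s') : 𝓕.tob f s ⟶ 𝓕.tob f s' :=
  cell (𝟙 f) ((𝓕.xiIdAt f s).inv ≫ φ)

theorem cell_surj (m : 𝓕.tob f s ⟶ 𝓕.tob g t) : m = cell (Hom.base m) (Hom.fib m) := rfl

@[simp] theorem cell_base (α : f ⟶ g) (φ : s ≫ 𝓕.st α x ⟶ t) : Hom.base (cell α φ) = α := rfl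
@[simp] theorem cell_fib (α : f ⟶ g) (φ : s ≫ 𝓕.st α x ⟶ t) : Hom.fib (cell α φ) = φ := rfl
@[simp] theorem comp_base {p q r : 𝓕.Tot y x} (m : p ⟶ q) (n : q ⟶ r) :
    Hom.base (m ≫ n) = Hom.base m ≫ Hom.base n := rfl
@[simp] theorem id_base (p : 𝓕.Tot y x) : Hom.base (𝟙 p) = 𝟙 p.base := rfl
@[simp] theorem ver_base (φ : s ⟶ s') : Hom.base (ver φ) = 𝟙 f := rfl

theorem cell_comp (α : f ⟶ g) (β : g ⟶ h) (φ : s ≫ 𝓕.st α x ⟶ t) (ψ : t ≫ 𝓕.st β x ⟶ r) :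
    cell α φ ≫ cell β ψ = cell (α ≫ β) ((𝓕.xiAt α β s).inv ≫ φ ▷ 𝓕.st β x ≫ ψ) := rfl

theorem cell_eq_cell {α α' : f ⟶ g} (e : α = α') {φ : s ≫ 𝓕.st α x ⟶ t}
    {φ' : s ≫ 𝓕.st α' x ⟶ t} (h : φ = s ◁ (𝓕.stEq e x).hom ≫ φ') : cell α φ = cell α' φ' :=
  Hom.ext_stEq e h

theorem cell_eq_cell_iff {α α' : f ⟶ g} (e : α = α') {φ : s ≫ 𝓕.st α x ⟶ t}
    {φ' : s ≫ 𝓕.st α' x ⟶ t} :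
    cell α φ = cell α' φ' ↔ φ = s ◁ (𝓕.stEq e x).hom ≫ φ' :=
  ⟨fun h => Hom.fib_eq h, cell_eq_cell e⟩

theorem cell_injective {α : f ⟶ g} {φ φ' : s ≫ 𝓕.st α x ⟶ t} (h : cell α φ = cell α φ') :
    φ = φ' := by
  simpa using Hom.fib_eq h

-- By (C2), the `ξ` of a composite with an identity cancels the unit `ξ` in `ver`. So following by a
-- cell of a fibre is ordinary composition in that fibre.
@[simp]
theorem cell_comp_ver (α : f ⟶ g) (φ : s ≫ 𝓕.st α x ⟶ t) (ψ : t ⟶ t') :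
    cell α φ ≫ ver ψ = cell α (φ ≫ ψ) := by
  rw [ver, cell_comp]
  refine cell_eq_cell (Category.comp_id _) ?_
  rw [reassoc_of% xiIdAt_inv_nat, reassoc_of% xiAt_inv_id_right]

@[simp]
theorem cell_comp_ver_assoc (α : f ⟶ g) (φ : s ≫ 𝓕.st α x ⟶ t) (ψ : t ⟶ t') {q : 𝓕.Tot y x}
    (m : 𝓕.tob g t' ⟶ q) : cell α φ ≫ ver ψ ≫ m = cell α (φ ≫ ψ) ≫ m := by
  rw [← cell_comp_ver, Category.assoc]

@[simp]
theorem ver_comp_cell (ψ : s ⟶ s') (α : f ⟶ g) (φ : s' ≫ 𝓕.st α x ⟶ t) :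
    ver ψ ≫ cell α φ = cell α (ψ ▷ 𝓕.st α x ≫ φ) := by
  rw [ver, cell_comp]
  refine cell_eq_cell (Category.id_comp _) ?_
  simp only [comp_whiskerRight, Category.assoc]
  rw [reassoc_of% xiAt_inv_id_left]

@[simp]
theorem ver_comp_cell_assoc (ψ : s ⟶ s') (α : f ⟶ g) (φ : s' ≫ 𝓕.st α x ⟶ t) {q : 𝓕.Tot y x}
    (m : 𝓕.tob g t ⟶ q) : ver ψ ≫ cell α φ ≫ m = cell α (ψ ▷ 𝓕.st α x ≫ φ) ≫ m := by
  rw [← ver_comp_cell, Category.assoc]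

@[simp]
theorem ver_comp_ver (φ : s ⟶ s') (ψ : s' ⟶ s'') : ver φ ≫ ver ψ = ver (φ ≫ ψ) := by
  rw [ver, cell_comp_ver, Category.assoc]
  rfl

@[simp]
theorem ver_comp_ver_assoc (φ : s ⟶ s') (ψ : s' ⟶ s'') {q : 𝓕.Tot y x} (m : 𝓕.tob f s'' ⟶ q) :
    ver φ ≫ ver ψ ≫ m = ver (φ ≫ ψ) ≫ m := by
  rw [← ver_comp_ver, Category.assoc]

@[simp]
theorem ver_id : ver (𝟙 s) = 𝟙 (𝓕.tob f s) := by
  rw [ver, Category.comp_id]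
  rfl

/-- The opcartesian factorisation: the chosen lift of `α` at `s`, then a 2-cell of the fibre.
Naturality need only be checked on the two factors. -/
theorem cell_eq_lam_comp (α : f ⟶ g) (φ : s ≫ 𝓕.st α x ⟶ t) :
    cell α φ = cell α (𝟙 (s ≫ 𝓕.st α x)) ≫ ver φ := by
  simp

/-- Invertible 2-cells over the 2-cells of `B` are opcartesian. -/
theorem cell_cancel {α : f ⟶ g} {φ : s ≫ 𝓕.st α x ⟶ t} [IsIso φ] {q : 𝓕.Tot y x}
    {m n : 𝓕.tob g t ⟶ q} (e : Hom.base m = Hom.base n) (h : cell α φ ≫ m = cell α φ ≫ n) :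
    m = n := by
  obtain ⟨β, ψ⟩ := m
  obtain ⟨γ, θ⟩ := n
  obtain rfl : β = γ := e
  obtain rfl : ψ = θ := by
    have := cell_injective (α := α ≫ β) (φ := (𝓕.xiAt α β s).inv ≫ φ ▷ 𝓕.st β x ≫ ψ)
      (φ' := (𝓕.xiAt α β s).inv ≫ φ ▷ 𝓕.st β x ≫ θ) h
    rwa [cancel_epi, cancel_epi] at this
  rfl

/-- A right inverse is written down over `inv α`. That it is also a left inverse follows by
cancelling the opcartesian `cell α φ`. -/
theorem isIso_cell {α : f ⟶ g} {φ : s ≫ 𝓕.st α x ⟶ t} [IsIso α] [IsIso φ] : IsIso (cell α φ) := by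
  let m : 𝓕.tob g t ⟶ 𝓕.tob f s := cell (inv α) (inv φ ▷ 𝓕.st (inv α) x ≫
    (𝓕.xiAt α (inv α) s).hom ≫ s ◁ (𝓕.stEq (IsIso.hom_inv_id α) x).hom ≫ (𝓕.xiIdAt f s).inv)
  have h₁ : cell α φ ≫ m = 𝟙 _ := by
    rw [cell_comp, ← ver_id, ver]
    refine cell_eq_cell (IsIso.hom_inv_id α) ?_
    rw [← comp_whiskerRight_assoc]
    simp
  exact ⟨m, h₁, cell_cancel (α := α) (φ := φ) (by simp [m]) (by
    rw [reassoc_of% h₁, Category.comp_id])⟩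

instance isIso_ver (φ : s ⟶ s') [IsIso φ] : IsIso (ver φ) :=
  ⟨ver (inv φ), by simp, by simp⟩

theorem cell_comp₃ {k : a ⟶ b} {q : y ⟶ 𝓕.ob k x} (α : f ⟶ g) (β : g ⟶ h) (γ : h ⟶ k)
    (φ : s ≫ 𝓕.st α x ⟶ t) (ψ : t ≫ 𝓕.st β x ⟶ r) (θ : r ≫ 𝓕.st γ x ⟶ q) :
    cell α φ ≫ cell β ψ ≫ cell γ θ = cell (α ≫ β ≫ γ) ((𝓕.xiAt α (β ≫ γ) s).inv ≫
      (𝓕.xiAt β γ (s ≫ 𝓕.st α x)).inv ≫ φ ▷ 𝓕.st β x ▷ 𝓕.st γ x ≫ ψ ▷ 𝓕.st γ x ≫ θ) := by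
  rw [cell_comp, cell_comp, reassoc_of% xiAt_inv_nat]

end Cells

attribute [irreducible] cell

end Tot

end Data

end LaxBidiag

/-! ### The coherence axioms as equations between 2-cells of the Grothendieck construction. -/

namespace LaxBidiag

namespace Data

variable {B : Type u} [Bicategory.{w, v} B] (𝓕 : Data.{w, v, u, w₁, v₁, u₁} B)

/-! ### The images of the structure cells under the homomorphisms `f^*` -/

section MpAct

variable {a b c d e : B}

/-- The action of `f^* ξ` on a 1-cell. -/
def mpXiAt (f : a ⟶ b) {g h k : b ⟶ c} (β : g ⟶ h) (β' : h ⟶ k) {y : 𝓕.fib a} {x : 𝓕.fib c}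
    (s : y ⟶ 𝓕.ob f (𝓕.ob g x)) :
    (s ≫ 𝓕.mp f (𝓕.st β x)) ≫ 𝓕.mp f (𝓕.st β' x) ≅ s ≫ 𝓕.mp f (𝓕.st (β ≫ β') x) :=
  (𝓕.mpCompAt f (𝓕.st β x) (𝓕.st β' x) s).symm ≪≫
    whiskerLeftIso s ((𝓕.pull f).map₂Iso (𝓕.xi β β' x))

/-- The action of `f^*` of the unit constraint `ξ` on a 1-cell. -/
def mpXiIdAt (f : a ⟶ b) (g : b ⟶ c) {y : 𝓕.fib a} {x : 𝓕.fib c}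
    (s : y ⟶ 𝓕.ob f (𝓕.ob g x)) : s ≅ s ≫ 𝓕.mp f (𝓕.st (𝟙 g) x) :=
  (𝓕.mpIdAt f s).symm ≪≫ whiskerLeftIso s ((𝓕.pull f).map₂Iso (𝓕.xiId g x))

/-- The action of `f^* χ_{ζ,β}` on a 1-cell. -/
def mpChiAt (f : a ⟶ b) {g g' : b ⟶ c} {h h' : c ⟶ d} (β : g ⟶ g') (ζ : h ⟶ h') {y : 𝓕.fib a}
    {x : 𝓕.fib d} (s : y ⟶ 𝓕.ob f (𝓕.ob g (𝓕.ob h x))) :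
    (s ≫ 𝓕.mp f (𝓕.ch g h x)) ≫ 𝓕.mp f (𝓕.st (hc β ζ) x) ≅
      ((s ≫ 𝓕.mp f (𝓕.mp g (𝓕.st ζ x))) ≫ 𝓕.mp f (𝓕.st β (𝓕.ob h' x))) ≫
        𝓕.mp f (𝓕.ch g' h' x) :=
  (𝓕.mpCompAt f (𝓕.ch g h x) (𝓕.st (hc β ζ) x) s).symm ≪≫
    whiskerLeftIso s ((𝓕.pull f).map₂Iso (𝓕.chi₂ β ζ x)) ≪≫
    𝓕.mpCompAt f (𝓕.mp g (𝓕.st ζ x) ≫ 𝓕.st β (𝓕.ob h' x)) (𝓕.ch g' h' x) s ≪≫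
    whiskerRightIso (𝓕.mpCompAt f (𝓕.mp g (𝓕.st ζ x)) (𝓕.st β (𝓕.ob h' x)) s) _

/-- The action of `f^* ω` on a 1-cell. -/
def mpOmegaAt (f : a ⟶ b) (g : b ⟶ c) (h : c ⟶ d) (k : d ⟶ e) {y : 𝓕.fib a}
    {x : 𝓕.fib e} (s : y ⟶ 𝓕.ob f (𝓕.ob g (𝓕.ob h (𝓕.ob k x)))) :
    ((s ≫ 𝓕.mp f (𝓕.mp g (𝓕.ch h k x))) ≫ 𝓕.mp f (𝓕.ch g (h ≫ k) x)) ≫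
        𝓕.mp f (𝓕.st (α_ g h k).inv x) ≅
      (s ≫ 𝓕.mp f (𝓕.ch g h (𝓕.ob k x))) ≫ 𝓕.mp f (𝓕.ch (g ≫ h) k x) :=
  whiskerRightIso (𝓕.mpCompAt f (𝓕.mp g (𝓕.ch h k x)) (𝓕.ch g (h ≫ k) x) s).symm _ ≪≫
    (𝓕.mpCompAt f (𝓕.mp g (𝓕.ch h k x) ≫ 𝓕.ch g (h ≫ k) x) (𝓕.st (α_ g h k).inv x) s).symm ≪≫
    whiskerLeftIso s ((𝓕.pull f).map₂Iso (𝓕.omega g h k x)) ≪≫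
    𝓕.mpCompAt f (𝓕.ch g h (𝓕.ob k x)) (𝓕.ch (g ≫ h) k x) s

/-- The action of `f^* δ` on a 1-cell. -/
def mpDeltaAt (f : a ⟶ b) (g : b ⟶ c) {y : 𝓕.fib a} {x : 𝓕.fib c}
    (s : y ⟶ 𝓕.ob f (𝓕.ob g x)) :
    ((s ≫ 𝓕.mp f (𝓕.cu b (𝓕.ob g x))) ≫ 𝓕.mp f (𝓕.ch (𝟙 b) g x)) ≫ 𝓕.mp f (𝓕.st (λ_ g).hom x) ≅
      s :=
  whiskerRightIso (𝓕.mpCompAt f (𝓕.cu b (𝓕.ob g x)) (𝓕.ch (𝟙 b) g x) s).symm _ ≪≫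
    (𝓕.mpCompAt f (𝓕.cu b (𝓕.ob g x) ≫ 𝓕.ch (𝟙 b) g x) (𝓕.st (λ_ g).hom x) s).symm ≪≫
    whiskerLeftIso s ((𝓕.pull f).map₂Iso (𝓕.delta g x)) ≪≫ 𝓕.mpIdAt f s

end MpAct

variable {𝓕}

namespace Tot

variable [HasXi 𝓕] {a b c d e : B} {y : 𝓕.fib a}

/-! ### The structure cells as 2-cells of the Grothendieck construction -/

/-- The 2-cell `χ_{β,α}` over `β ∘ α`. -/
def chiC {f h : a ⟶ b} {g k : b ⟶ c} (α : f ⟶ h) (β : g ⟶ k) {x : 𝓕.fib c}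
    (s : y ⟶ 𝓕.ob f (𝓕.ob g x)) :
    𝓕.tob (f ≫ g) (s ≫ 𝓕.ch f g x) ⟶
      𝓕.tob (h ≫ k) (((s ≫ 𝓕.mp f (𝓕.st β x)) ≫ 𝓕.st α (𝓕.ob k x)) ≫ 𝓕.ch h k x) :=
  cell (hc α β) (𝓕.chiAt α β s).hom

/-- The 2-cell `χ_{β,f}` over `β ∘ f`. -/
def chiLC (f : a ⟶ b) {g k : b ⟶ c} (β : g ⟶ k) {x : 𝓕.fib c} (s : y ⟶ 𝓕.ob f (𝓕.ob g x)) :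
    𝓕.tob (f ≫ g) (s ≫ 𝓕.ch f g x) ⟶
      𝓕.tob (f ≫ k) ((s ≫ 𝓕.mp f (𝓕.st β x)) ≫ 𝓕.ch f k x) :=
  cell (f ◁ β) (𝓕.chiLAt f β s).hom

/-- The 2-cell `χ_{g,α}` over `g ∘ α`. -/
def chiRC {f h : a ⟶ b} (α : f ⟶ h) (g : b ⟶ c) {x : 𝓕.fib c} (s : y ⟶ 𝓕.ob f (𝓕.ob g x)) :
    𝓕.tob (f ≫ g) (s ≫ 𝓕.ch f g x) ⟶
      𝓕.tob (h ≫ g) ((s ≫ 𝓕.st α (𝓕.ob g x)) ≫ 𝓕.ch h g x) :=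
  cell (α ▷ g) (𝓕.chiRAt α g s).hom

/-- The 2-cell `ω` over the associativity constraint. -/
def omegaC (f : a ⟶ b) (g : b ⟶ c) (h : c ⟶ d) {x : 𝓕.fib d}
    (s : y ⟶ 𝓕.ob f (𝓕.ob g (𝓕.ob h x))) :
    𝓕.tob (f ≫ g ≫ h) ((s ≫ 𝓕.mp f (𝓕.ch g h x)) ≫ 𝓕.ch f (g ≫ h) x) ⟶
      𝓕.tob ((f ≫ g) ≫ h) ((s ≫ 𝓕.ch f g (𝓕.ob h x)) ≫ 𝓕.ch (f ≫ g) h x) :=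
  cell (α_ f g h).inv (𝓕.omegaAt f g h s).hom

/-- The 2-cell `γ` over the unit constraint. -/
def gammaC (f : a ⟶ b) {x : 𝓕.fib b} (s : y ⟶ 𝓕.ob f x) :
    𝓕.tob (f ≫ 𝟙 b) ((s ≫ 𝓕.mp f (𝓕.cu b x)) ≫ 𝓕.ch f (𝟙 b) x) ⟶ 𝓕.tob f s :=
  cell (ρ_ f).hom (𝓕.gammaAt f s).hom

/-- The 2-cell `δ` over the unit constraint. -/
def deltaC (f : a ⟶ b) {x : 𝓕.fib b} (s : y ⟶ 𝓕.ob f x) :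
    𝓕.tob (𝟙 a ≫ f) ((s ≫ 𝓕.cu a (𝓕.ob f x)) ≫ 𝓕.ch (𝟙 a) f x) ⟶ 𝓕.tob f s :=
  cell (λ_ f).hom (𝓕.deltaAt f s).hom

end Tot

open Tot

/-- The axioms of a lax bidiagram other than those on `ξ` and on modifications, as equations
between 2-cells of the Grothendieck construction. -/
structure TotAxioms (𝓕 : Data.{w, v, u, w₁, v₁, u₁} B) [HasXi 𝓕] : Prop where
  /-- `χ` is compatible with vertical composition of 2-cells -/
  chi₂_comp {a b c : B} {f f' f'' : a ⟶ b} {g g' g'' : b ⟶ c} (α : f ⟶ f') (α' : f' ⟶ f'')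
      (β : g ⟶ g') (β' : g' ⟶ g'') {y : 𝓕.fib a} {x : 𝓕.fib c} (s : y ⟶ 𝓕.ob f (𝓕.ob g x)) :
    chiC α β s ≫ chiC α' β' _ ≫
        ver ((𝓕.stNatAt α (𝓕.st β' x) (s ≫ 𝓕.mp f (𝓕.st β x))).inv ▷ 𝓕.st α' _ ▷ 𝓕.ch f'' g'' x) ≫
        ver ((𝓕.mpXiAt f β β' s).hom ▷ 𝓕.st α _ ▷ 𝓕.st α' _ ▷ 𝓕.ch f'' g'' x) ≫
        ver ((𝓕.xiAt α α' _).hom ▷ 𝓕.ch f'' g'' x) =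
      chiC (α ≫ α') (β ≫ β') s
  /-- `χ` is compatible with identity 2-cells -/
  chi₂_id {a b c : B} (f : a ⟶ b) (g : b ⟶ c) {y : 𝓕.fib a} {x : 𝓕.fib c}
      (s : y ⟶ 𝓕.ob f (𝓕.ob g x)) :
    chiC (𝟙 f) (𝟙 g) s ≫ ver ((𝓕.xiIdAt f _).inv ▷ 𝓕.ch f g x) ≫
        ver ((𝓕.mpXiIdAt f g s).inv ▷ 𝓕.ch f g x) =
      𝟙 (𝓕.tob (f ≫ g) (s ≫ 𝓕.ch f g x))
  /-- compatibility of `ω` with 2-cells -/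
  omega_nat {a b c d : B} {f f' : a ⟶ b} {g g' : b ⟶ c} {h h' : c ⟶ d} (α : f ⟶ f')
      (β : g ⟶ g') (ζ : h ⟶ h') {y : 𝓕.fib a} {x : 𝓕.fib d}
      (s : y ⟶ 𝓕.ob f (𝓕.ob g (𝓕.ob h x))) :
    chiC α (hc β ζ) (s ≫ 𝓕.mp f (𝓕.ch g h x)) ≫
        ver ((𝓕.mpChiAt f β ζ s).hom ▷ 𝓕.st α _ ▷ 𝓕.ch f' (g' ≫ h') x) ≫
        ver ((𝓕.stNatAt α (𝓕.ch g' h' x) _).hom ▷ 𝓕.ch f' (g' ≫ h') x) ≫ omegaC f' g' h' _ =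
      omegaC f g h s ≫ chiC (hc α β) ζ (s ≫ 𝓕.ch f g _) ≫
        ver ((𝓕.chNatAt f g (𝓕.st ζ x) s).inv ▷ 𝓕.st (hc α β) _ ▷ 𝓕.ch (f' ≫ g') h' x) ≫
        ver ((𝓕.chiAt α β (s ≫ 𝓕.mp f (𝓕.mp g (𝓕.st ζ x)))).hom ▷ 𝓕.ch (f' ≫ g') h' x)
  /-- the pentagon-type equation for `ω` -/
  omega_pentagon {a b c d e : B} (f : a ⟶ b) (g : b ⟶ c) (h : c ⟶ d) (k : d ⟶ e)
      {y : 𝓕.fib a} {x : 𝓕.fib e} (s : y ⟶ 𝓕.ob f (𝓕.ob g (𝓕.ob h (𝓕.ob k x)))) :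
    omegaC f g (h ≫ k) (s ≫ 𝓕.mp f (𝓕.mp g (𝓕.ch h k x))) ≫
        ver ((𝓕.chNatAt f g (𝓕.ch h k x) s).hom ▷ 𝓕.ch (f ≫ g) (h ≫ k) x) ≫
        omegaC (f ≫ g) h k (s ≫ 𝓕.ch f g _) =
      chiLC f (α_ g h k).inv
          ((s ≫ 𝓕.mp f (𝓕.mp g (𝓕.ch h k x))) ≫ 𝓕.mp f (𝓕.ch g (h ≫ k) x)) ≫
        ver ((𝓕.mpOmegaAt f g h k s).hom ▷ 𝓕.ch f ((g ≫ h) ≫ k) x) ≫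
        omegaC f (g ≫ h) k (s ≫ 𝓕.mp f (𝓕.ch g h (𝓕.ob k x))) ≫
        chiRC (α_ f g h).inv k _ ≫ ver ((𝓕.omegaAt f g h s).hom ▷ 𝓕.ch ((f ≫ g) ≫ h) k x)
  /-- compatibility of `δ` with 2-cells -/
  delta_nat {a b : B} {f g : a ⟶ b} (α : f ⟶ g) {y : 𝓕.fib a} {x : 𝓕.fib b}
      (s : y ⟶ 𝓕.ob f x) :
    deltaC f s ≫ cell α (𝟙 (s ≫ 𝓕.st α x)) =
      chiLC (𝟙 a) α (s ≫ 𝓕.cu a _) ≫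
        ver ((𝓕.cuNatAt (𝓕.st α x) s).inv ▷ 𝓕.ch (𝟙 a) g x) ≫ deltaC g (s ≫ 𝓕.st α x)
  /-- compatibility of `γ` with 2-cells -/
  gamma_nat {a b : B} {f g : a ⟶ b} (α : f ⟶ g) {y : 𝓕.fib a} {x : 𝓕.fib b}
      (s : y ⟶ 𝓕.ob f x) :
    gammaC f s ≫ cell α (𝟙 (s ≫ 𝓕.st α x)) =
      chiRC α (𝟙 b) (s ≫ 𝓕.mp f (𝓕.cu b x)) ≫
        ver ((𝓕.stNatAt α (𝓕.cu b x) s).hom ▷ 𝓕.ch g (𝟙 b) x) ≫ gammaC g (s ≫ 𝓕.st α x)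
  /-- the triangle-type equation -/
  omega_triangle {a b c : B} (f : a ⟶ b) (g : b ⟶ c) {y : 𝓕.fib a} {x : 𝓕.fib c}
      (s : y ⟶ 𝓕.ob f (𝓕.ob g x)) :
    omegaC f (𝟙 b) g (s ≫ 𝓕.mp f (𝓕.cu b (𝓕.ob g x))) ≫ chiRC (ρ_ f).hom g _ ≫
        ver ((𝓕.gammaAt f s).hom ▷ 𝓕.ch f g x) =
      chiLC f (λ_ g).hom
          ((s ≫ 𝓕.mp f (𝓕.cu b (𝓕.ob g x))) ≫ 𝓕.mp f (𝓕.ch (𝟙 b) g x)) ≫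
        ver ((𝓕.mpDeltaAt f g s).hom ▷ 𝓕.ch f g x)

theorem xi₃_eq {a b : B} {f g h k : a ⟶ b} (α : f ⟶ g) (β : g ⟶ h) (γ : h ⟶ k) {θ : f ⟶ k}
    (e : α ≫ β ≫ γ = θ) (x : 𝓕.fib b) : 𝓕.xi₃ α β γ e x =
      whiskerLeftIso (𝓕.st α x) (𝓕.xi β γ x) ≪≫ 𝓕.xi α (β ≫ γ) x ≪≫ 𝓕.stEq e x := rfl

end Data

end LaxBidiag

/-! ### Passage between the axioms and their whiskered forms. -/

namespace LaxBidiag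

namespace Data

open Tot

variable {B : Type u} [Bicategory.{w, v} B] {𝓕 : Data.{w, v, u, w₁, v₁, u₁} B}

theorem stEq_hom_eq_iff {a b : B} {y : 𝓕.fib a} {x : 𝓕.fib b} {f g : a ⟶ b} {θ τ : f ⟶ g}
    (e : θ = τ) {s : y ⟶ 𝓕.ob f x} {R : y ⟶ 𝓕.ob g x} (m : s ≫ 𝓕.st θ x ⟶ R)
    (n : s ≫ 𝓕.st τ x ⟶ R) :
    m = s ◁ (𝓕.stEq e x).hom ≫ n ↔ s ◁ (𝓕.stEq e x).inv ≫ m = n := by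
  subst e
  simp

theorem stEq_hom_comp_comp_iff {a b : B} {y : 𝓕.fib a} {x : 𝓕.fib b} {f g : a ⟶ b}
    {θ τ : f ⟶ g} (e : θ = τ) {s : y ⟶ 𝓕.ob f x}
    {P Q Q' R : y ⟶ 𝓕.ob g x} (i : P ≅ s ≫ 𝓕.st θ x) (j : Q ≅ s ≫ 𝓕.st τ x) (k : Q' ≅ Q)
    (m : P ⟶ R) (n : Q' ⟶ R) : i.inv ≫ m = s ◁ (𝓕.stEq e x).hom ≫ j.inv ≫ k.inv ≫ n ↔
      k.hom ≫ j.hom ≫ s ◁ (𝓕.stEq e x).inv ≫ i.inv ≫ m = n := by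
  subst e
  simp [Iso.eq_inv_comp]

/-- Both equations say that `m`, up to transport, is the pasting of the two unit cells `ξ`: once
with these on the right-hand side, as in (C4), once with their inverses composed with `m`, as in
`TotAxioms`. -/
theorem chi₂_id_iff {a b c : B} {f : a ⟶ b} {g : b ⟶ c} {y : 𝓕.fib a} {x : 𝓕.fib c}
    {s : y ⟶ 𝓕.ob f (𝓕.ob g x)} {θ : f ≫ g ⟶ f ≫ g} (e : θ = 𝟙 (f ≫ g))
    (m : (s ≫ 𝓕.ch f g x) ≫ 𝓕.st θ x ⟶
      ((s ≫ 𝓕.mp f (𝓕.st (𝟙 g) x)) ≫ 𝓕.st (𝟙 f) (𝓕.ob g x)) ≫ 𝓕.ch f g x) :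
    (𝓕.xiIdAt (f ≫ g) (s ≫ 𝓕.ch f g x)).hom ≫ (s ≫ 𝓕.ch f g x) ◁ (𝓕.stEq e x).inv ≫ m =
        (𝓕.mpXiIdAt f g s).hom ▷ 𝓕.ch f g x ≫ (𝓕.xiIdAt f _).hom ▷ 𝓕.ch f g x ↔
      m ≫ (𝓕.xiIdAt f _).inv ▷ 𝓕.ch f g x ≫ (𝓕.mpXiIdAt f g s).inv ▷ 𝓕.ch f g x =
        (s ≫ 𝓕.ch f g x) ◁ (𝓕.stEq e x).hom ≫ (𝓕.xiIdAt _ _).inv ≫ 𝟙 _ := by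
  subst e
  rw [← Iso.eq_inv_comp, stEq_refl, Iso.refl_inv, Iso.refl_hom, Bicategory.whiskerLeft_id,
    Category.id_comp, Category.id_comp, Category.comp_id, ← comp_whiskerRight,
    ← comp_whiskerRight, ← Iso.trans_hom, ← Iso.trans_inv, ← whiskerRightIso_hom,
    ← whiskerRightIso_inv, Iso.comp_inv_eq]

/-- The first part of the action of `f^* χ_{ζ,β}` on a 1-cell. -/
def mpChiAt' {a b c d : B} (f : a ⟶ b) {g g' : b ⟶ c} {h h' : c ⟶ d} (β : g ⟶ g') (ζ : h ⟶ h')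
    {y : 𝓕.fib a} {x : 𝓕.fib d} (s : y ⟶ 𝓕.ob f (𝓕.ob g (𝓕.ob h x))) :
    (s ≫ 𝓕.mp f (𝓕.ch g h x)) ≫ 𝓕.mp f (𝓕.st (hc β ζ) x) ≅
      (s ≫ 𝓕.mp f (𝓕.mp g (𝓕.st ζ x) ≫ 𝓕.st β (𝓕.ob h' x))) ≫ 𝓕.mp f (𝓕.ch g' h' x) :=
  (𝓕.mpCompAt f (𝓕.ch g h x) (𝓕.st (hc β ζ) x) s).symm ≪≫
    whiskerLeftIso s ((𝓕.pull f).map₂Iso (𝓕.chi₂ β ζ x)) ≪≫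
    𝓕.mpCompAt f (𝓕.mp g (𝓕.st ζ x) ≫ 𝓕.st β (𝓕.ob h' x)) (𝓕.ch g' h' x) s

/-- `mpChiAt` splits `f^*` of the composite of `g^*ζ^*` and `β^*` at once, whereas the axiom
`omega_nat` splits it only at the end. The constraint of `f^*` acts on the whiskering 1-cell, so it
slides past the naturality cell of `α^*` and past `ω`. -/
theorem mpChiAt_stNatAt_omegaC [HasXi 𝓕] {a b c d : B} {f f' : a ⟶ b} {g g' : b ⟶ c}
    {h h' : c ⟶ d} (α : f ⟶ f') (β : g ⟶ g') (ζ : h ⟶ h') {y : 𝓕.fib a} {x : 𝓕.fib d}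
    (s : y ⟶ 𝓕.ob f (𝓕.ob g (𝓕.ob h x))) :
    ver ((𝓕.mpChiAt f β ζ s).hom ▷ 𝓕.st α _ ▷ 𝓕.ch f' (g' ≫ h') x) ≫
        ver ((𝓕.stNatAt α (𝓕.ch g' h' x) _).hom ▷ 𝓕.ch f' (g' ≫ h') x) ≫ omegaC f' g' h' _ =
      ver ((mpChiAt' f β ζ s).hom ▷ 𝓕.st α _ ▷ 𝓕.ch f' (g' ≫ h') x) ≫
        ver ((𝓕.stNatAt α (𝓕.ch g' h' x) _).hom ▷ 𝓕.ch f' (g' ≫ h') x) ≫ omegaC f' g' h' _ ≫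
        ver ((𝓕.mpCompAt f (𝓕.mp g (𝓕.st ζ x)) (𝓕.st β (𝓕.ob h' x)) s).hom ▷ 𝓕.st α _ ▷
          𝓕.ch f' g' _ ▷ 𝓕.ch (f' ≫ g') h' x) := by
  have e : 𝓕.mpChiAt f β ζ s = mpChiAt' f β ζ s ≪≫ whiskerRightIso
      (𝓕.mpCompAt f (𝓕.mp g (𝓕.st ζ x)) (𝓕.st β (𝓕.ob h' x)) s) _ := by
    simp [mpChiAt, mpChiAt']
  rw [e]
  simp only [omegaC, cell_comp_ver, ← omegaAt_nat, Iso.trans_hom, whiskerRightIso_hom,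
    comp_whiskerRight, ← ver_comp_ver, Category.assoc]
  simp only [← ver_comp_cell]
  simp only [ver_comp_ver_assoc, ← comp_whiskerRight, Category.assoc, stNatAt_nat]

/-- Each equation is the corresponding axiom whiskered with `s`. Beyond coherence, the bases have to
be matched and the cells `ξ` brought to the side where the axiom has them. -/
theorem totAxioms [HasXi 𝓕] (H : IsLaxBidiagram 𝓕) : TotAxioms 𝓕 where
  chi₂_comp α α' β β' _ _ s := by
    simp only [chiC, cell_comp_ver, cell_comp_ver_assoc, ver_comp_ver, ver_comp_ver_assoc, cell_comp]
    refine cell_eq_cell (by simp [hc, whisker_exchange_assoc]) ?_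
    rw [Iso.inv_comp_eq]
    refine act_congr (H.chi₂_comp α α' β β' _) s ?_ ?_ <;>
    (try simp only [chiAt, chiLAt, chiRAt, omegaAt, gammaAt, deltaAt, stNatAt, chNatAt, cuNatAt,
      mpXiAt, mpXiIdAt, mpChiAt, mpChiAt', mpOmegaAt, mpDeltaAt, mpCompAt, mpIdAt, xiAt, xiIdAt, xi₂_eq,
      xi₃_eq, xi₀_eq, stEq_refl, Iso.trans_refl,
      Functor.mapIso_hom, Functor.mapIso_inv, PrelaxFunctor.mapFunctor_map,
      Iso.trans_hom, Iso.trans_inv, Iso.symm_hom, Iso.symm_inv, whiskerLeftIso_hom,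
      whiskerLeftIso_inv, whiskerRightIso_hom, whiskerRightIso_inv]) <;>
    bicategory
  chi₂_id f g _ _ s := by
    simp only [chiC, cell_comp_ver, cell_comp_ver_assoc, ver_comp_ver, ver_comp_ver_assoc]
    rw [← ver_id, ver]
    refine cell_eq_cell (by simp [hc]) ?_
    rw [← chi₂_id_iff]
    refine act_congr (H.chi₂_id f g _) s ?_ ?_ <;>
    (try simp only [chiAt, chiLAt, chiRAt, omegaAt, gammaAt, deltaAt, stNatAt, chNatAt, cuNatAt,
      mpXiAt, mpXiIdAt, mpChiAt, mpChiAt', mpOmegaAt, mpDeltaAt, mpCompAt, mpIdAt, xiAt, xiIdAt, xi₂_eq,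
      xi₃_eq, xi₀_eq, stEq_refl, Iso.trans_refl,
      Functor.mapIso_hom, Functor.mapIso_inv, PrelaxFunctor.mapFunctor_map,
      Iso.trans_hom, Iso.trans_inv, Iso.symm_hom, Iso.symm_inv, whiskerLeftIso_hom,
      whiskerLeftIso_inv, whiskerRightIso_hom, whiskerRightIso_inv]) <;>
    bicategory
  omega_nat α β ζ _ _ s := by
    rw [mpChiAt_stNatAt_omegaC]
    simp only [chiC, omegaC, cell_comp_ver, cell_comp_ver_assoc, ver_comp_ver, ver_comp_ver_assoc, cell_comp]
    refine cell_eq_cell (by simp [hc]) ?_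
    rw [stEq_hom_comp_iff]
    refine act_congr (H.omega_nat α β ζ _) s ?_ ?_ <;>
    (try simp only [chiAt, chiLAt, chiRAt, omegaAt, gammaAt, deltaAt, stNatAt, chNatAt, cuNatAt,
      mpXiAt, mpXiIdAt, mpChiAt, mpChiAt', mpOmegaAt, mpDeltaAt, mpCompAt, mpIdAt, xiAt, xiIdAt, xi₂_eq,
      xi₃_eq, xi₀_eq, stEq_refl, Iso.trans_refl,
      Functor.mapIso_hom, Functor.mapIso_inv, PrelaxFunctor.mapFunctor_map,
      Iso.trans_hom, Iso.trans_inv, Iso.symm_hom, Iso.symm_inv, whiskerLeftIso_hom,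
      whiskerLeftIso_inv, whiskerRightIso_hom, whiskerRightIso_inv]) <;>
    bicategory
  omega_pentagon f g h k _ _ s := by
    simp only [chiLC, chiRC, omegaC, cell_comp_ver, cell_comp_ver_assoc, ver_comp_ver, ver_comp_ver_assoc]
    rw [cell_comp, cell_comp₃]
    refine cell_eq_cell (by simp) ?_
    rw [stEq_hom_comp_comp_iff]
    refine act_congr (H.omega_pentagon f g h k _) s ?_ ?_ <;>
    (try simp only [chiAt, chiLAt, chiRAt, omegaAt, gammaAt, deltaAt, stNatAt, chNatAt, cuNatAt,
      mpXiAt, mpXiIdAt, mpChiAt, mpChiAt', mpOmegaAt, mpDeltaAt, mpCompAt, mpIdAt, xiAt, xiIdAt, xi₂_eq,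
      xi₃_eq, xi₀_eq, stEq_refl, Iso.trans_refl,
      Functor.mapIso_hom, Functor.mapIso_inv, PrelaxFunctor.mapFunctor_map,
      Iso.trans_hom, Iso.trans_inv, Iso.symm_hom, Iso.symm_inv, whiskerLeftIso_hom,
      whiskerLeftIso_inv, whiskerRightIso_hom, whiskerRightIso_inv]) <;>
    bicategory
  delta_nat α _ _ s := by
    simp only [chiLC, deltaC, cell_comp_ver, cell_comp_ver_assoc, ver_comp_ver, ver_comp_ver_assoc, cell_comp]
    refine cell_eq_cell (by simp) ?_
    rw [stEq_hom_comp_iff]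
    refine act_congr (H.delta_nat α _) s ?_ ?_ <;>
    (try simp only [chiAt, chiLAt, chiRAt, omegaAt, gammaAt, deltaAt, stNatAt, chNatAt, cuNatAt,
      mpXiAt, mpXiIdAt, mpChiAt, mpChiAt', mpOmegaAt, mpDeltaAt, mpCompAt, mpIdAt, xiAt, xiIdAt, xi₂_eq,
      xi₃_eq, xi₀_eq, stEq_refl, Iso.trans_refl,
      Functor.mapIso_hom, Functor.mapIso_inv, PrelaxFunctor.mapFunctor_map,
      Iso.trans_hom, Iso.trans_inv, Iso.symm_hom, Iso.symm_inv, whiskerLeftIso_hom,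
      whiskerLeftIso_inv, whiskerRightIso_hom, whiskerRightIso_inv]) <;>
    bicategory
  gamma_nat α _ _ s := by
    simp only [chiRC, gammaC, cell_comp_ver, cell_comp_ver_assoc, ver_comp_ver, ver_comp_ver_assoc, cell_comp]
    refine cell_eq_cell (by simp) ?_
    rw [stEq_hom_comp_iff]
    refine act_congr (H.gamma_nat α _) s ?_ ?_ <;>
    (try simp only [chiAt, chiLAt, chiRAt, omegaAt, gammaAt, deltaAt, stNatAt, chNatAt, cuNatAt,
      mpXiAt, mpXiIdAt, mpChiAt, mpChiAt', mpOmegaAt, mpDeltaAt, mpCompAt, mpIdAt, xiAt, xiIdAt, xi₂_eq,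
      xi₃_eq, xi₀_eq, stEq_refl, Iso.trans_refl,
      Functor.mapIso_hom, Functor.mapIso_inv, PrelaxFunctor.mapFunctor_map,
      Iso.trans_hom, Iso.trans_inv, Iso.symm_hom, Iso.symm_inv, whiskerLeftIso_hom,
      whiskerLeftIso_inv, whiskerRightIso_hom, whiskerRightIso_inv]) <;>
    bicategory
  omega_triangle f g _ _ s := by
    simp only [chiLC, chiRC, omegaC, cell_comp_ver, cell_comp_ver_assoc, ver_comp_ver, ver_comp_ver_assoc, cell_comp]
    refine cell_eq_cell (by simp) ?_
    rw [stEq_hom_eq_iff]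
    refine act_congr (H.omega_triangle f g _) s ?_ ?_ <;>
    (try simp only [chiAt, chiLAt, chiRAt, omegaAt, gammaAt, deltaAt, stNatAt, chNatAt, cuNatAt,
      mpXiAt, mpXiIdAt, mpChiAt, mpChiAt', mpOmegaAt, mpDeltaAt, mpCompAt, mpIdAt, xiAt, xiIdAt, xi₂_eq,
      xi₃_eq, xi₀_eq, stEq_refl, Iso.trans_refl,
      Functor.mapIso_hom, Functor.mapIso_inv, PrelaxFunctor.mapFunctor_map,
      Iso.trans_hom, Iso.trans_inv, Iso.symm_hom, Iso.symm_inv, whiskerLeftIso_hom,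
      whiskerLeftIso_inv, whiskerRightIso_hom, whiskerRightIso_inv]) <;>
    bicategory

/-- The structure cells of a lax bidiagram are modifications. -/
structure _root_.LaxBidiag.HasModifications (𝓕 : Data.{w, v, u, w₁, v₁, u₁} B) : Prop where
  /-- `ξ` is a modification -/
  xi_mod {a b : B} {f g h : a ⟶ b} (α : f ⟶ g) (β : g ⟶ h) :
      IsModification ((TransData.of (𝓕.pull₂ α)).comp (TransData.of (𝓕.pull₂ β)))
        (TransData.of (𝓕.pull₂ (α ≫ β))) (𝓕.xi α β)
  /-- `ξ` is a modification -/
  xiId_mod {a b : B} (f : a ⟶ b) :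
      IsModification (TransData.id (𝓕.pull f).toPrefunctor) (TransData.of (𝓕.pull₂ (𝟙 f)))
        (𝓕.xiId f)
  /-- `χ` is a modification -/
  chi₂_mod {a b c : B} {f h : a ⟶ b} {g k : b ⟶ c} (α : f ⟶ h) (β : g ⟶ k) :
      IsModification
        ((TransData.of (𝓕.chi f g)).comp (TransData.of (𝓕.pull₂ (hc α β))))
        ((((TransData.of (𝓕.pull₂ β)).postcomp (𝓕.pull f)).comp
          ((TransData.of (𝓕.pull₂ α)).precomp (𝓕.pull k).toPrefunctor)).comp
          (TransData.of (𝓕.chi h k)))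
        (𝓕.chi₂ α β)
  /-- `ω` is a modification -/
  omega_mod {a b c d : B} (f : a ⟶ b) (g : b ⟶ c) (h : c ⟶ d) :
      IsModification
        ((((TransData.of (𝓕.chi g h)).postcomp (𝓕.pull f)).comp
          (TransData.of (𝓕.chi f (g ≫ h)))).comp (TransData.of (𝓕.pull₂ (α_ f g h).inv)))
        (((TransData.of (𝓕.chi f g)).precomp (𝓕.pull h).toPrefunctor).comp
          (TransData.of (𝓕.chi (f ≫ g) h)))
        (𝓕.omega f g h)
  /-- `γ` is a modification -/
  gamma_mod {a b : B} (f : a ⟶ b) :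
      IsModification
        ((((TransData.of (𝓕.chiId b)).postcomp (𝓕.pull f)).comp
          (TransData.of (𝓕.chi f (𝟙 b)))).comp (TransData.of (𝓕.pull₂ (ρ_ f).hom)))
        (TransData.id (𝓕.pull f).toPrefunctor)
        (𝓕.gamma f)
  /-- `δ` is a modification -/
  delta_mod {a b : B} (f : a ⟶ b) :
      IsModification
        ((((TransData.of (𝓕.chiId a)).precomp (𝓕.pull f).toPrefunctor).comp
          (TransData.of (𝓕.chi (𝟙 a) f))).comp (TransData.of (𝓕.pull₂ (λ_ f).hom)))
        (TransData.id (𝓕.pull f).toPrefunctor)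
        (𝓕.delta f)

theorem _root_.LaxBidiag.IsLaxBidiagram.hasModifications (H : IsLaxBidiagram 𝓕) : HasModifications 𝓕 :=
  ⟨H.xi_mod, H.xiId_mod, H.chi₂_mod, H.omega_mod, H.gamma_mod, H.delta_mod⟩

/-- At `s = 1` the whiskering is only a unit constraint, so each equation in `Tot` unwinds to the
original axiom up to coherence. -/
theorem TotAxioms.isLaxBidiagram [HasXi 𝓕] (T : TotAxioms 𝓕) (M : HasModifications 𝓕) :
    IsLaxBidiagram 𝓕 where
  xi_mod := M.xi_mod
  xiId_mod := M.xiId_mod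
  chi₂_mod := M.chi₂_mod
  omega_mod := M.omega_mod
  gamma_mod := M.gamma_mod
  delta_mod := M.delta_mod
  xi_assoc := HasXi.xi_assoc
  xi_id_left := HasXi.xi_id_left
  xi_id_right := HasXi.xi_id_right
  chi₂_comp α α' β β' x := by
    have h := T.chi₂_comp α α' β β' (𝟙 (𝓕.ob _ (𝓕.ob _ x)))
    simp only [chiC, cell_comp_ver, cell_comp_ver_assoc, ver_comp_ver, ver_comp_ver_assoc, cell_comp] at h
    rw [cell_eq_cell_iff (by simp [hc, whisker_exchange_assoc]), Iso.inv_comp_eq] at h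
    refine coh_congr h ?_ ?_ <;>
    (try simp only [chiAt, chiLAt, chiRAt, omegaAt, gammaAt, deltaAt, stNatAt, chNatAt, cuNatAt,
      mpXiAt, mpXiIdAt, mpChiAt, mpChiAt', mpOmegaAt, mpDeltaAt, mpCompAt, mpIdAt, xiAt, xiIdAt, xi₂_eq,
      xi₃_eq, xi₀_eq, stEq_refl, Iso.trans_refl,
      Functor.mapIso_hom, Functor.mapIso_inv, PrelaxFunctor.mapFunctor_map,
      Iso.trans_hom, Iso.trans_inv, Iso.symm_hom, Iso.symm_inv, whiskerLeftIso_hom,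
      whiskerLeftIso_inv, whiskerRightIso_hom, whiskerRightIso_inv]) <;>
    bicategory
  chi₂_id f g x := by
    have h := T.chi₂_id f g (𝟙 (𝓕.ob f (𝓕.ob g x)))
    simp only [chiC, cell_comp_ver, cell_comp_ver_assoc, ver_comp_ver, ver_comp_ver_assoc] at h
    rw [← ver_id, ver, cell_eq_cell_iff (by simp [hc]), ← chi₂_id_iff] at h
    refine coh_congr h ?_ ?_ <;>
    (try simp only [chiAt, chiLAt, chiRAt, omegaAt, gammaAt, deltaAt, stNatAt, chNatAt, cuNatAt,
      mpXiAt, mpXiIdAt, mpChiAt, mpChiAt', mpOmegaAt, mpDeltaAt, mpCompAt, mpIdAt, xiAt, xiIdAt, xi₂_eq,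
      xi₃_eq, xi₀_eq, stEq_refl, Iso.trans_refl,
      Functor.mapIso_hom, Functor.mapIso_inv, PrelaxFunctor.mapFunctor_map,
      Iso.trans_hom, Iso.trans_inv, Iso.symm_hom, Iso.symm_inv, whiskerLeftIso_hom,
      whiskerLeftIso_inv, whiskerRightIso_hom, whiskerRightIso_inv]) <;>
    bicategory
  omega_nat α β ζ x := by
    have h := T.omega_nat α β ζ (𝟙 (𝓕.ob _ (𝓕.ob _ (𝓕.ob _ x))))
    rw [mpChiAt_stNatAt_omegaC] at h
    simp only [chiC, omegaC, cell_comp_ver, cell_comp_ver_assoc, ver_comp_ver, ver_comp_ver_assoc, cell_comp] at h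
    rw [cell_eq_cell_iff (by simp [hc]), stEq_hom_comp_iff] at h
    refine coh_congr h ?_ ?_ <;>
    (try simp only [chiAt, chiLAt, chiRAt, omegaAt, gammaAt, deltaAt, stNatAt, chNatAt, cuNatAt,
      mpXiAt, mpXiIdAt, mpChiAt, mpChiAt', mpOmegaAt, mpDeltaAt, mpCompAt, mpIdAt, xiAt, xiIdAt, xi₂_eq,
      xi₃_eq, xi₀_eq, stEq_refl, Iso.trans_refl,
      Functor.mapIso_hom, Functor.mapIso_inv, PrelaxFunctor.mapFunctor_map,
      Iso.trans_hom, Iso.trans_inv, Iso.symm_hom, Iso.symm_inv, whiskerLeftIso_hom,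
      whiskerLeftIso_inv, whiskerRightIso_hom, whiskerRightIso_inv]) <;>
    bicategory
  omega_pentagon f g h k x := by
    have h := T.omega_pentagon f g h k (𝟙 (𝓕.ob f (𝓕.ob g (𝓕.ob h (𝓕.ob k x)))))
    simp only [chiLC, chiRC, omegaC, cell_comp_ver, cell_comp_ver_assoc, ver_comp_ver, ver_comp_ver_assoc] at h
    rw [cell_comp, cell_comp₃, cell_eq_cell_iff (by simp), stEq_hom_comp_comp_iff] at h
    refine coh_congr h ?_ ?_ <;>
    (try simp only [chiAt, chiLAt, chiRAt, omegaAt, gammaAt, deltaAt, stNatAt, chNatAt, cuNatAt,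
      mpXiAt, mpXiIdAt, mpChiAt, mpChiAt', mpOmegaAt, mpDeltaAt, mpCompAt, mpIdAt, xiAt, xiIdAt, xi₂_eq,
      xi₃_eq, xi₀_eq, stEq_refl, Iso.trans_refl,
      Functor.mapIso_hom, Functor.mapIso_inv, PrelaxFunctor.mapFunctor_map,
      Iso.trans_hom, Iso.trans_inv, Iso.symm_hom, Iso.symm_inv, whiskerLeftIso_hom,
      whiskerLeftIso_inv, whiskerRightIso_hom, whiskerRightIso_inv]) <;>
    bicategory
  delta_nat α x := by
    have h := T.delta_nat α (𝟙 (𝓕.ob _ x))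
    simp only [chiLC, deltaC, cell_comp_ver, cell_comp_ver_assoc, ver_comp_ver, ver_comp_ver_assoc, cell_comp] at h
    rw [cell_eq_cell_iff (by simp), stEq_hom_comp_iff] at h
    refine coh_congr h ?_ ?_ <;>
    (try simp only [chiAt, chiLAt, chiRAt, omegaAt, gammaAt, deltaAt, stNatAt, chNatAt, cuNatAt,
      mpXiAt, mpXiIdAt, mpChiAt, mpChiAt', mpOmegaAt, mpDeltaAt, mpCompAt, mpIdAt, xiAt, xiIdAt, xi₂_eq,
      xi₃_eq, xi₀_eq, stEq_refl, Iso.trans_refl,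
      Functor.mapIso_hom, Functor.mapIso_inv, PrelaxFunctor.mapFunctor_map,
      Iso.trans_hom, Iso.trans_inv, Iso.symm_hom, Iso.symm_inv, whiskerLeftIso_hom,
      whiskerLeftIso_inv, whiskerRightIso_hom, whiskerRightIso_inv]) <;>
    bicategory
  gamma_nat α x := by
    have h := T.gamma_nat α (𝟙 (𝓕.ob _ x))
    simp only [chiRC, gammaC, cell_comp_ver, cell_comp_ver_assoc, ver_comp_ver, ver_comp_ver_assoc, cell_comp] at h
    rw [cell_eq_cell_iff (by simp), stEq_hom_comp_iff] at h
    refine coh_congr h ?_ ?_ <;>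
    (try simp only [chiAt, chiLAt, chiRAt, omegaAt, gammaAt, deltaAt, stNatAt, chNatAt, cuNatAt,
      mpXiAt, mpXiIdAt, mpChiAt, mpChiAt', mpOmegaAt, mpDeltaAt, mpCompAt, mpIdAt, xiAt, xiIdAt, xi₂_eq,
      xi₃_eq, xi₀_eq, stEq_refl, Iso.trans_refl,
      Functor.mapIso_hom, Functor.mapIso_inv, PrelaxFunctor.mapFunctor_map,
      Iso.trans_hom, Iso.trans_inv, Iso.symm_hom, Iso.symm_inv, whiskerLeftIso_hom,
      whiskerLeftIso_inv, whiskerRightIso_hom, whiskerRightIso_inv]) <;>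
    bicategory
  omega_triangle f g x := by
    have h := T.omega_triangle f g (𝟙 (𝓕.ob f (𝓕.ob g x)))
    simp only [chiLC, chiRC, omegaC, cell_comp_ver, cell_comp_ver_assoc, ver_comp_ver, ver_comp_ver_assoc, cell_comp] at h
    rw [cell_eq_cell_iff (by simp), stEq_hom_eq_iff] at h
    refine coh_congr h ?_ ?_ <;>
    (try simp only [chiAt, chiLAt, chiRAt, omegaAt, gammaAt, deltaAt, stNatAt, chNatAt, cuNatAt,
      mpXiAt, mpXiIdAt, mpChiAt, mpChiAt', mpOmegaAt, mpDeltaAt, mpCompAt, mpIdAt, xiAt, xiIdAt, xi₂_eq,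
      xi₃_eq, xi₀_eq, stEq_refl, Iso.trans_refl,
      Functor.mapIso_hom, Functor.mapIso_inv, PrelaxFunctor.mapFunctor_map,
      Iso.trans_hom, Iso.trans_inv, Iso.symm_hom, Iso.symm_inv, whiskerLeftIso_hom,
      whiskerLeftIso_inv, whiskerRightIso_hom, whiskerRightIso_inv]) <;>
    bicategory

end Data

end LaxBidiag

/-! ### Whiskered forms of the axioms for homomorphisms, transformations and modifications. -/

namespace LaxBidiag

namespace Data

variable {B : Type u} [Bicategory.{w, v} B] {𝓕 : Data.{w, v, u, w₁, v₁, u₁} B}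

/-! ### Compatibilities of the actions with 1-cells and 2-cells of the fibres -/

variable {a b c d : B}

section Transformations

variable {y : 𝓕.fib a}

theorem stNatAt_map₂ {f g : a ⟶ b} (α : f ⟶ g) {x x' : 𝓕.fib b} {p q : x ⟶ x'} (η : p ⟶ q)
    (s : y ⟶ 𝓕.ob f x) :
    (s ◁ 𝓕.mp₂ f η) ▷ 𝓕.st α x' ≫ (𝓕.stNatAt α q s).hom =
      (𝓕.stNatAt α p s).hom ≫ (s ≫ 𝓕.st α x) ◁ 𝓕.mp₂ g η := by
  refine act_congr ((𝓕.pull₂ α).naturality_naturality η) s ?_ ?_ <;>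
  (try simp only [stNatAt, Iso.trans_hom, whiskerLeftIso_hom, Iso.symm_hom]) <;> bicategory

theorem stNatAt_comp {f g : a ⟶ b} (α : f ⟶ g) {x x' x'' : 𝓕.fib b} (p : x ⟶ x') (q : x' ⟶ x'')
    (s : y ⟶ 𝓕.ob f x) :
    (𝓕.mpCompAt f p q s).hom ▷ 𝓕.st α x'' ≫ (𝓕.stNatAt α q (s ≫ 𝓕.mp f p)).hom ≫
        (𝓕.stNatAt α p s).hom ▷ 𝓕.mp g q =
      (𝓕.stNatAt α (p ≫ q) s).hom ≫ (𝓕.mpCompAt g p q (s ≫ 𝓕.st α x)).hom := by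
  refine act_congr ((𝓕.pull₂ α).naturality_comp p q).symm s ?_ ?_ <;>
  (try simp only [stNatAt, mpCompAt, Iso.trans_hom, whiskerLeftIso_hom, Iso.symm_hom]) <;> bicategory

theorem chNatAt_map₂ (f : a ⟶ b) (g : b ⟶ c) {x x' : 𝓕.fib c} {p q : x ⟶ x'} (η : p ⟶ q)
    (s : y ⟶ 𝓕.ob f (𝓕.ob g x)) :
    (s ◁ 𝓕.mp₂ f (𝓕.mp₂ g η)) ▷ 𝓕.ch f g x' ≫ (𝓕.chNatAt f g q s).hom =
      (𝓕.chNatAt f g p s).hom ≫ (s ≫ 𝓕.ch f g x) ◁ 𝓕.mp₂ (f ≫ g) η := by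
  have h : 𝓕.mp₂ f (𝓕.mp₂ g η) ▷ 𝓕.ch f g x' ≫ (𝓕.chNat f g q).hom =
      (𝓕.chNat f g p).hom ≫ 𝓕.ch f g x ◁ 𝓕.mp₂ (f ≫ g) η := (𝓕.chi f g).naturality_naturality η
  refine act_congr h s ?_ ?_ <;>
  (try simp only [chNatAt, Iso.trans_hom, whiskerLeftIso_hom, Iso.symm_hom]) <;> bicategory

/-- The constraint of the homomorphism `f^* g^*` acting on a 1-cell. -/
def mpMpCompAt (f : a ⟶ b) (g : b ⟶ c) {x x' x'' : 𝓕.fib c} (p : x ⟶ x') (q : x' ⟶ x'')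
    (s : y ⟶ 𝓕.ob f (𝓕.ob g x)) :
    s ≫ 𝓕.mp f (𝓕.mp g (p ≫ q)) ≅ (s ≫ 𝓕.mp f (𝓕.mp g p)) ≫ 𝓕.mp f (𝓕.mp g q) :=
  whiskerLeftIso s ((𝓕.pull f).map₂Iso (𝓕.mpComp g p q)) ≪≫
    𝓕.mpCompAt f (𝓕.mp g p) (𝓕.mp g q) s

theorem chNatAt_comp (f : a ⟶ b) (g : b ⟶ c) {x x' x'' : 𝓕.fib c} (p : x ⟶ x') (q : x' ⟶ x'')
    (s : y ⟶ 𝓕.ob f (𝓕.ob g x)) :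
    (mpMpCompAt f g p q s).hom ▷ 𝓕.ch f g x'' ≫
        (𝓕.chNatAt f g q (s ≫ 𝓕.mp f (𝓕.mp g p))).hom ≫
        (𝓕.chNatAt f g p s).hom ▷ 𝓕.mp (f ≫ g) q =
      (𝓕.chNatAt f g (p ≫ q) s).hom ≫ (𝓕.mpCompAt (f ≫ g) p q (s ≫ 𝓕.ch f g x)).hom := by
  have h : (𝓕.chNat f g (p ≫ q)).hom ≫ 𝓕.ch f g x ◁ (𝓕.mpComp (f ≫ g) p q).hom =
      (𝓕.mp₂ f (𝓕.mpComp g p q).hom ≫ (𝓕.mpComp f (𝓕.mp g p) (𝓕.mp g q)).hom) ▷ 𝓕.ch f g x'' ≫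
        (α_ _ _ _).hom ≫ 𝓕.mp f (𝓕.mp g p) ◁ (𝓕.chNat f g q).hom ≫ (α_ _ _ _).inv ≫
        (𝓕.chNat f g p).hom ▷ 𝓕.mp (f ≫ g) q ≫ (α_ _ _ _).hom :=
    (𝓕.chi f g).naturality_comp p q
  refine act_congr h.symm s ?_ ?_ <;>
  (try simp only [chNatAt, mpCompAt, mpMpCompAt, Iso.trans_hom, whiskerLeftIso_hom, Iso.symm_hom,
    Pseudofunctor.comp_mapComp,
    Functor.mapIso_hom, PrelaxFunctor.mapFunctor_map, Functor.mapIso_inv]) <;> bicategory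

theorem mpCompAt_map₂_left (f : a ⟶ b) {x x' x'' : 𝓕.fib b} {p p' : x ⟶ x'} (η : p ⟶ p')
    (q : x' ⟶ x'') (s : y ⟶ 𝓕.ob f x) :
    s ◁ 𝓕.mp₂ f (η ▷ q) ≫ (𝓕.mpCompAt f p' q s).hom =
      (𝓕.mpCompAt f p q s).hom ≫ (s ◁ 𝓕.mp₂ f η) ▷ 𝓕.mp f q := by
  simp [mpCompAt, Pseudofunctor.map₂_whisker_right]

theorem mpCompAt_map₂_right (f : a ⟶ b) {x x' x'' : 𝓕.fib b} (p : x ⟶ x')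
    {q q' : x' ⟶ x''} (η : q ⟶ q') (s : y ⟶ 𝓕.ob f x) :
    s ◁ 𝓕.mp₂ f (p ◁ η) ≫ (𝓕.mpCompAt f p q' s).hom =
      (𝓕.mpCompAt f p q s).hom ≫ (s ≫ 𝓕.mp f p) ◁ 𝓕.mp₂ f η := by
  simp [mpCompAt, Pseudofunctor.map₂_whisker_left]

theorem mpCompAt_assoc (f : a ⟶ b) {x x' x'' x''' : 𝓕.fib b} (p : x ⟶ x')
    (q : x' ⟶ x'') (r : x'' ⟶ x''') (s : y ⟶ 𝓕.ob f x) :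
    (𝓕.mpCompAt f (p ≫ q) r s).hom ≫ (𝓕.mpCompAt f p q s).hom ▷ 𝓕.mp f r =
      s ◁ 𝓕.mp₂ f (α_ p q r).hom ≫ (𝓕.mpCompAt f p (q ≫ r) s).hom ≫
        (𝓕.mpCompAt f q r (s ≫ 𝓕.mp f p)).hom := by
  simp [mpCompAt, Pseudofunctor.map₂_associator]

theorem mpCompAt_id_right (f : a ⟶ b) {x x' : 𝓕.fib b} (p : x ⟶ x') (s : y ⟶ 𝓕.ob f x) :
    (𝓕.mpCompAt f p (𝟙 x') s).hom ≫ (𝓕.mpIdAt f (s ≫ 𝓕.mp f p)).hom =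
      s ◁ 𝓕.mp₂ f (ρ_ p).hom := by
  simp [mpCompAt, mpIdAt, Pseudofunctor.map₂_right_unitor]

end Transformations

section Mods

variable {y : 𝓕.fib a}

/-- The action of the image under `f^*` of the naturality 2-cell of `β^*` on a 1-cell. -/
def mpStNatAt (f : a ⟶ b) {g k : b ⟶ c} (β : g ⟶ k) {x x' : 𝓕.fib c} (p : x ⟶ x')
    (s : y ⟶ 𝓕.ob f (𝓕.ob g x)) :
    (s ≫ 𝓕.mp f (𝓕.mp g p)) ≫ 𝓕.mp f (𝓕.st β x') ≅
      (s ≫ 𝓕.mp f (𝓕.st β x)) ≫ 𝓕.mp f (𝓕.mp k p) :=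
  (𝓕.mpCompAt f (𝓕.mp g p) (𝓕.st β x') s).symm ≪≫
    whiskerLeftIso s ((𝓕.pull f).map₂Iso (𝓕.stNat β p)) ≪≫
    𝓕.mpCompAt f (𝓕.st β x) (𝓕.mp k p) s

/-- The action of the image under `f^*` of the naturality 2-cell of `χ` on a 1-cell. -/
def mpChNatAt (f : a ⟶ b) (g : b ⟶ c) (h : c ⟶ d) {x x' : 𝓕.fib d} (p : x ⟶ x')
    (s : y ⟶ 𝓕.ob f (𝓕.ob g (𝓕.ob h x))) :
    (s ≫ 𝓕.mp f (𝓕.mp g (𝓕.mp h p))) ≫ 𝓕.mp f (𝓕.ch g h x') ≅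
      (s ≫ 𝓕.mp f (𝓕.ch g h x)) ≫ 𝓕.mp f (𝓕.mp (g ≫ h) p) :=
  (𝓕.mpCompAt f (𝓕.mp g (𝓕.mp h p)) (𝓕.ch g h x') s).symm ≪≫
    whiskerLeftIso s ((𝓕.pull f).map₂Iso (𝓕.chNat g h p)) ≪≫
    𝓕.mpCompAt f (𝓕.ch g h x) (𝓕.mp (g ≫ h) p) s

/-- The action of the image under `f^*` of the naturality 2-cell of the unit `χ` on a 1-cell. -/
def mpCuNatAt (f : a ⟶ b) {x x' : 𝓕.fib b} (p : x ⟶ x') (s : y ⟶ 𝓕.ob f x) :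
    (s ≫ 𝓕.mp f p) ≫ 𝓕.mp f (𝓕.cu b x') ≅
      (s ≫ 𝓕.mp f (𝓕.cu b x)) ≫ 𝓕.mp f (𝓕.mp (𝟙 b) p) :=
  (𝓕.mpCompAt f p (𝓕.cu b x') s).symm ≪≫
    whiskerLeftIso s ((𝓕.pull f).map₂Iso (𝓕.cuNat b p)) ≪≫
    𝓕.mpCompAt f (𝓕.cu b x) (𝓕.mp (𝟙 b) p) s

end Mods

end Data

namespace HasModifications

open Data

variable {B : Type u} [Bicategory.{w, v} B] {𝓕 : Data.{w, v, u, w₁, v₁, u₁} B}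
  {a b c d : B} {y : 𝓕.fib a}


/-- This and the next four lemmas are the modification axioms of `ξ`, its unit, `χ`, `ω` and `γ`,
whiskered with `s`. They let a structure cell pass a 1-cell `p` of a fibre. The axiom for `δ` is
never needed in this form. -/
theorem xiAt_stNatAt (H : HasModifications 𝓕) {f g h : a ⟶ b} (α : f ⟶ g) (β : g ⟶ h)
    {x x' : 𝓕.fib b} (p : x ⟶ x') (s : y ⟶ 𝓕.ob f x) :
    (𝓕.xiAt α β (s ≫ 𝓕.mp f p)).hom ≫ (𝓕.stNatAt (α ≫ β) p s).hom =
      (𝓕.stNatAt α p s).hom ▷ 𝓕.st β x' ≫ (𝓕.stNatAt β p (s ≫ 𝓕.st α x)).hom ≫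
        (𝓕.xiAt α β s).hom ▷ 𝓕.mp h p := by
  refine act_congr (H.xi_mod α β p) s ?_ ?_ <;>
  (try simp only [xiAt, xiIdAt, chiAt, omegaAt, gammaAt, deltaAt, stNatAt, chNatAt, cuNatAt,
    mpStNatAt, mpChNatAt, mpCuNatAt, mpCompAt, mpIdAt, Iso.trans_hom, Iso.trans_inv,
    whiskerLeftIso_hom, whiskerLeftIso_inv, Iso.symm_hom, Iso.symm_inv, whiskerRightIso_hom,
    whiskerRightIso_inv, Functor.mapIso_hom, Functor.mapIso_inv, PrelaxFunctor.mapFunctor_map]) <;>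
  bicategory

theorem xiIdAt_stNatAt (H : HasModifications 𝓕) (f : a ⟶ b) {x x' : 𝓕.fib b} (p : x ⟶ x')
    (s : y ⟶ 𝓕.ob f x) :
    (𝓕.xiIdAt f (s ≫ 𝓕.mp f p)).hom ≫ (𝓕.stNatAt (𝟙 f) p s).hom =
      (𝓕.xiIdAt f s).hom ▷ 𝓕.mp f p := by
  refine act_congr (H.xiId_mod f p) s ?_ ?_ <;>
  (try simp only [xiAt, xiIdAt, chiAt, omegaAt, gammaAt, deltaAt, stNatAt, chNatAt, cuNatAt,
    mpStNatAt, mpChNatAt, mpCuNatAt, mpCompAt, mpIdAt, Iso.trans_hom, Iso.trans_inv,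
    whiskerLeftIso_hom, whiskerLeftIso_inv, Iso.symm_hom, Iso.symm_inv, whiskerRightIso_hom,
    whiskerRightIso_inv, Functor.mapIso_hom, Functor.mapIso_inv, PrelaxFunctor.mapFunctor_map]) <;>
  bicategory

theorem chiAt_chNatAt (H : HasModifications 𝓕) {f h : a ⟶ b} {g k : b ⟶ c} (α : f ⟶ h) (β : g ⟶ k)
    {x x' : 𝓕.fib c} (p : x ⟶ x') (s : y ⟶ 𝓕.ob f (𝓕.ob g x)) :
    (𝓕.chiAt α β (s ≫ 𝓕.mp f (𝓕.mp g p))).hom ≫ (mpStNatAt f β p s).hom ▷ 𝓕.st α _ ▷ 𝓕.ch h k x' ≫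
        (𝓕.stNatAt α (𝓕.mp k p) (s ≫ 𝓕.mp f (𝓕.st β x))).hom ▷ 𝓕.ch h k x' ≫
        (𝓕.chNatAt h k p ((s ≫ 𝓕.mp f (𝓕.st β x)) ≫ 𝓕.st α _)).hom =
      (𝓕.chNatAt f g p s).hom ▷ 𝓕.st (hc α β) x' ≫
        (𝓕.stNatAt (hc α β) p (s ≫ 𝓕.ch f g x)).hom ≫
        (𝓕.chiAt α β s).hom ▷ 𝓕.mp (h ≫ k) p := by
  -- The modification axiom with the naturality cells of the composite transformations written out,
  -- so that coherence can be applied to it.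
  have e : 𝓕.mp f (𝓕.mp g p) ◁ (𝓕.chi₂ α β x').hom ≫ (α_ _ _ _).inv ≫
      ((α_ _ _ _).inv ≫ ((𝓕.mpComp f (𝓕.mp g p) (𝓕.st β x')).inv ≫ 𝓕.mp₂ f (𝓕.stNat β p).hom ≫
        (𝓕.mpComp f (𝓕.st β x) (𝓕.mp k p)).hom) ▷ 𝓕.st α _ ≫ (α_ _ _ _).hom ≫
        𝓕.mp f (𝓕.st β x) ◁ (𝓕.stNat α (𝓕.mp k p)).hom ≫ (α_ _ _ _).inv) ▷ 𝓕.ch h k x' ≫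
      (α_ _ _ _).hom ≫ (𝓕.mp f (𝓕.st β x) ≫ 𝓕.st α _) ◁ (𝓕.chNat h k p).hom ≫ (α_ _ _ _).inv =
      ((α_ _ _ _).inv ≫ (𝓕.chNat f g p).hom ▷ 𝓕.st (hc α β) x' ≫ (α_ _ _ _).hom ≫
        𝓕.ch f g x ◁ (𝓕.stNat (hc α β) p).hom ≫ (α_ _ _ _).inv) ≫
        (𝓕.chi₂ α β x).hom ▷ 𝓕.mp (h ≫ k) p := H.chi₂_mod α β p
  refine act_congr e s ?_ ?_ <;>
  (try simp only [xiAt, xiIdAt, chiAt, omegaAt, gammaAt, deltaAt, stNatAt, chNatAt, cuNatAt,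
    mpStNatAt, mpChNatAt, mpCuNatAt, mpCompAt, mpIdAt, Iso.trans_hom, Iso.trans_inv,
    whiskerLeftIso_hom, whiskerLeftIso_inv, Iso.symm_hom, Iso.symm_inv, whiskerRightIso_hom,
    whiskerRightIso_inv, Functor.mapIso_hom, Functor.mapIso_inv, PrelaxFunctor.mapFunctor_map]) <;>
  bicategory

theorem omegaAt_chNatAt (H : HasModifications 𝓕) (f : a ⟶ b) (g : b ⟶ c) (h : c ⟶ d)
    {x x' : 𝓕.fib d} (p : x ⟶ x') (s : y ⟶ 𝓕.ob f (𝓕.ob g (𝓕.ob h x))) :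
    (𝓕.omegaAt f g h (s ≫ 𝓕.mp f (𝓕.mp g (𝓕.mp h p)))).hom ≫
        (𝓕.chNatAt f g (𝓕.mp h p) s).hom ▷ 𝓕.ch (f ≫ g) h x' ≫
        (𝓕.chNatAt (f ≫ g) h p (s ≫ 𝓕.ch f g _)).hom =
      (mpChNatAt f g h p s).hom ▷ 𝓕.ch f (g ≫ h) x' ▷ 𝓕.st (α_ f g h).inv x' ≫
        (𝓕.chNatAt f (g ≫ h) p (s ≫ 𝓕.mp f (𝓕.ch g h x))).hom ▷ 𝓕.st (α_ f g h).inv x' ≫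
        (𝓕.stNatAt (α_ f g h).inv p ((s ≫ 𝓕.mp f (𝓕.ch g h x)) ≫ 𝓕.ch f (g ≫ h) x)).hom ≫
        (𝓕.omegaAt f g h s).hom ▷ 𝓕.mp ((f ≫ g) ≫ h) p := by
  have e : 𝓕.mp f (𝓕.mp g (𝓕.mp h p)) ◁ (𝓕.omega f g h x').hom ≫ (α_ _ _ _).inv ≫
      (𝓕.chNat f g (𝓕.mp h p)).hom ▷ 𝓕.ch (f ≫ g) h x' ≫ (α_ _ _ _).hom ≫
        𝓕.ch f g (𝓕.ob h x) ◁ (𝓕.chNat (f ≫ g) h p).hom ≫ (α_ _ _ _).inv =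
      ((α_ _ _ _).inv ≫ ((α_ _ _ _).inv ≫ ((𝓕.mpComp f (𝓕.mp g (𝓕.mp h p)) (𝓕.ch g h x')).inv ≫
        𝓕.mp₂ f (𝓕.chNat g h p).hom ≫ (𝓕.mpComp f (𝓕.ch g h x) (𝓕.mp (g ≫ h) p)).hom) ▷
          𝓕.ch f (g ≫ h) x' ≫ (α_ _ _ _).hom ≫ 𝓕.mp f (𝓕.ch g h x) ◁ (𝓕.chNat f (g ≫ h) p).hom ≫
        (α_ _ _ _).inv) ▷ 𝓕.st (α_ f g h).inv x' ≫ (α_ _ _ _).hom ≫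
        (𝓕.mp f (𝓕.ch g h x) ≫ 𝓕.ch f (g ≫ h) x) ◁ (𝓕.stNat (α_ f g h).inv p).hom ≫
        (α_ _ _ _).inv) ≫ (𝓕.omega f g h x).hom ▷ 𝓕.mp ((f ≫ g) ≫ h) p := H.omega_mod f g h p
  refine act_congr e s ?_ ?_ <;>
  (try simp only [xiAt, xiIdAt, chiAt, omegaAt, gammaAt, deltaAt, stNatAt, chNatAt, cuNatAt,
    mpStNatAt, mpChNatAt, mpCuNatAt, mpCompAt, mpIdAt, Iso.trans_hom, Iso.trans_inv,
    whiskerLeftIso_hom, whiskerLeftIso_inv, Iso.symm_hom, Iso.symm_inv, whiskerRightIso_hom,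
    whiskerRightIso_inv, Functor.mapIso_hom, Functor.mapIso_inv, PrelaxFunctor.mapFunctor_map]) <;>
  bicategory

theorem gammaAt_stNatAt (H : HasModifications 𝓕) (f : a ⟶ b) {x x' : 𝓕.fib b} (p : x ⟶ x')
    (s : y ⟶ 𝓕.ob f x) :
    (mpCuNatAt f p s).hom ▷ 𝓕.ch f (𝟙 b) x' ▷ 𝓕.st (ρ_ f).hom x' ≫
        (𝓕.chNatAt f (𝟙 b) p (s ≫ 𝓕.mp f (𝓕.cu b x))).hom ▷ 𝓕.st (ρ_ f).hom x' ≫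
        (𝓕.stNatAt (ρ_ f).hom p ((s ≫ 𝓕.mp f (𝓕.cu b x)) ≫ 𝓕.ch f (𝟙 b) x)).hom ≫
        (𝓕.gammaAt f s).hom ▷ 𝓕.mp f p =
      (𝓕.gammaAt f (s ≫ 𝓕.mp f p)).hom := by
  have e : 𝓕.mp f p ◁ (𝓕.gamma f x').hom ≫ (ρ_ (𝓕.mp f p)).hom ≫ (λ_ (𝓕.mp f p)).inv =
      ((α_ _ _ _).inv ≫ ((α_ _ _ _).inv ≫ ((𝓕.mpComp f p (𝓕.cu b x')).inv ≫
        𝓕.mp₂ f (𝓕.cuNat b p).hom ≫ (𝓕.mpComp f (𝓕.cu b x) (𝓕.mp (𝟙 b) p)).hom) ▷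
          𝓕.ch f (𝟙 b) x' ≫ (α_ _ _ _).hom ≫ 𝓕.mp f (𝓕.cu b x) ◁ (𝓕.chNat f (𝟙 b) p).hom ≫
        (α_ _ _ _).inv) ▷ 𝓕.st (ρ_ f).hom x' ≫ (α_ _ _ _).hom ≫
        (𝓕.mp f (𝓕.cu b x) ≫ 𝓕.ch f (𝟙 b) x) ◁ (𝓕.stNat (ρ_ f).hom p).hom ≫
        (α_ _ _ _).inv) ≫ (𝓕.gamma f x).hom ▷ 𝓕.mp f p := H.gamma_mod f p
  refine act_congr e.symm s ?_ ?_ <;>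
  (try simp only [xiAt, xiIdAt, chiAt, omegaAt, gammaAt, deltaAt, stNatAt, chNatAt, cuNatAt,
    mpStNatAt, mpChNatAt, mpCuNatAt, mpCompAt, mpIdAt, Iso.trans_hom, Iso.trans_inv,
    whiskerLeftIso_hom, whiskerLeftIso_inv, Iso.symm_hom, Iso.symm_inv, whiskerRightIso_hom,
    whiskerRightIso_inv, Functor.mapIso_hom, Functor.mapIso_inv, PrelaxFunctor.mapFunctor_map]) <;>
  bicategory

end HasModifications

end LaxBidiag

/-! ### Functoriality of horizontal composition. -/

namespace LaxBidiag

theorem whiskerRight_comp_congr {D : Type u} [Bicategory.{w, v} D] {x z z' : D} {P Q Q' R : x ⟶ z}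
    {f : P ⟶ Q} {g : Q ⟶ R} {f' : P ⟶ Q'} {g' : Q' ⟶ R} (h : f ≫ g = f' ≫ g') (m : z ⟶ z') :
    f ▷ m ≫ g ▷ m = f' ▷ m ≫ g' ▷ m := by
  rw [← comp_whiskerRight, h, comp_whiskerRight]

namespace Data

variable {B : Type u} [Bicategory.{w, v} B] {𝓕 : Data.{w, v, u, w₁, v₁, u₁} B}

variable {a b c d : B}

/-! ### Horizontal composition -/

section Act

variable {y : 𝓕.fib a} {x x' x'' x₃ x₄ : 𝓕.fib b}

/-- The action on a 1-cell of the image under `f^*` of a 2-cell with target a composite. -/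
def actAt (f : a ⟶ b) (p : y ⟶ 𝓕.ob f x) {q : x ⟶ x'} {m : x' ⟶ x''} {r : x ⟶ x''}
    (φ : q ≫ m ⟶ r) : (p ≫ 𝓕.mp f q) ≫ 𝓕.mp f m ⟶ p ≫ 𝓕.mp f r :=
  (𝓕.mpCompAt f q m p).inv ≫ p ◁ 𝓕.mp₂ f φ

theorem actAt_nat (f : a ⟶ b) {p p' : y ⟶ 𝓕.ob f x} (σ : p ⟶ p') {q : x ⟶ x'} {m : x' ⟶ x''}
    {r : x ⟶ x''} (φ : q ≫ m ⟶ r) :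
    σ ▷ 𝓕.mp f q ▷ 𝓕.mp f m ≫ actAt f p' φ = actAt f p φ ≫ σ ▷ 𝓕.mp f r := by
  rw [actAt, actAt, ← cancel_epi (𝓕.mpCompAt f q m p).hom, ← reassoc_of% mpCompAt_nat]
  simp [whisker_exchange]

theorem mpCompAt_hom_actAt (f : a ⟶ b) (p : y ⟶ 𝓕.ob f x) {q : x ⟶ x'} {m : x' ⟶ x''}
    {r : x ⟶ x''} (φ : q ≫ m ⟶ r) :
    (𝓕.mpCompAt f q m p).hom ≫ actAt f p φ = p ◁ 𝓕.mp₂ f φ := by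
  simp [actAt]

theorem actAt_comp (f : a ⟶ b) (p : y ⟶ 𝓕.ob f x) {q : x ⟶ x'} {m : x' ⟶ x''} {r r' : x ⟶ x''}
    (φ : q ≫ m ⟶ r) (ψ : r ⟶ r') :
    actAt f p (φ ≫ ψ) = actAt f p φ ≫ p ◁ 𝓕.mp₂ f ψ := by
  simp [actAt]

theorem map₂_actAt (f : a ⟶ b) (p : y ⟶ 𝓕.ob f x) {q q' : x ⟶ x'} {m : x' ⟶ x''} {r : x ⟶ x''}
    (η : q ⟶ q') (φ : q' ≫ m ⟶ r) :
    (p ◁ 𝓕.mp₂ f η) ▷ 𝓕.mp f m ≫ actAt f p φ = actAt f p (η ▷ m ≫ φ) := by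
  rw [actAt, actAt, ← cancel_epi (𝓕.mpCompAt f q m p).hom, ← reassoc_of% mpCompAt_map₂_left]
  simp

/-- Naturality of `α^*` in the 2-cell `φ`, together with its compatibility with composition of
1-cells, since the source of `φ` is a composite. -/
theorem stNatAt_actAt {f g : a ⟶ b} (α : f ⟶ g) (p : y ⟶ 𝓕.ob f x) {q : x ⟶ x'} {m : x' ⟶ x''}
    {r : x ⟶ x''} (φ : q ≫ m ⟶ r) :
    (𝓕.stNatAt α m (p ≫ 𝓕.mp f q)).hom ≫ (𝓕.stNatAt α q p).hom ▷ 𝓕.mp g m ≫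
        actAt g (p ≫ 𝓕.st α x) φ =
      actAt f p φ ▷ 𝓕.st α x'' ≫ (𝓕.stNatAt α r p).hom := by
  rw [actAt, actAt, ← cancel_epi ((𝓕.mpCompAt f q m p).hom ▷ 𝓕.st α x''), reassoc_of% stNatAt_comp]
  rw [Iso.hom_inv_id_assoc, ← comp_whiskerRight_assoc, Iso.hom_inv_id_assoc, stNatAt_map₂]

/-- Associativity of the constraints of the homomorphism `f^*`, together with `f^*` being a functor
on 2-cells. -/
theorem actAt_actAt (f : a ⟶ b) (p : y ⟶ 𝓕.ob f x) {q : x ⟶ x'} {m : x' ⟶ x''} {n : x'' ⟶ x₃}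
    {r : x ⟶ x''} {t : x ⟶ x₃} (φ : q ≫ m ⟶ r) (ψ : r ≫ n ⟶ t) :
    actAt f p φ ▷ 𝓕.mp f n ≫ actAt f p ψ = (𝓕.mpCompAt f m n (p ≫ 𝓕.mp f q)).inv ≫
      actAt f p ((α_ q m n).inv ≫ φ ▷ n ≫ ψ) := by
  rw [Iso.eq_inv_comp, ← cancel_epi (p ◁ 𝓕.mp₂ f (α_ q m n).hom ≫ (𝓕.mpCompAt f q (m ≫ n) p).hom)]
  rw [Category.assoc, Category.assoc, mpCompAt_hom_actAt, ← reassoc_of% mpCompAt_assoc]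
  rw [actAt, comp_whiskerRight_assoc]
  simp only [← comp_whiskerRight_assoc, Category.assoc, Iso.hom_inv_id_assoc]
  rw [map₂_actAt, mpCompAt_hom_actAt,
    ← Bicategory.whiskerLeft_comp, ← PrelaxFunctor.map₂_comp]
  simp

theorem whiskerLeft_map₂_actAt (f : a ⟶ b) (p : y ⟶ 𝓕.ob f x) {q : x ⟶ x'} {m m' : x' ⟶ x''}
    {r : x ⟶ x''} (η : m ⟶ m') (φ : q ≫ m' ⟶ r) :
    (p ≫ 𝓕.mp f q) ◁ 𝓕.mp₂ f η ≫ actAt f p φ = actAt f p (q ◁ η ≫ φ) := by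
  rw [actAt, actAt, ← cancel_epi (𝓕.mpCompAt f q m p).hom, ← reassoc_of% mpCompAt_map₂_right]
  simp

/-- How `f^*` acts on a vertical composite of the Grothendieck construction: `f^*ξ` appears, as in
(C3). -/
theorem actAt_xiAt (f : a ⟶ b) {g h k : b ⟶ c} (β : g ⟶ h) (β' : h ⟶ k) {x : 𝓕.fib b}
    {z : 𝓕.fib c} (p : y ⟶ 𝓕.ob f x) {q : x ⟶ 𝓕.ob g z} {r : x ⟶ 𝓕.ob h z} {t : x ⟶ 𝓕.ob k z}
    (φ : q ≫ 𝓕.st β z ⟶ r) (ψ : r ≫ 𝓕.st β' z ⟶ t) :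
    actAt f p φ ▷ 𝓕.mp f (𝓕.st β' z) ≫ actAt f p ψ =
      (𝓕.mpXiAt f β β' (p ≫ 𝓕.mp f q)).hom ≫
        actAt f p ((𝓕.xiAt β β' q).inv ≫ φ ▷ 𝓕.st β' z ≫ ψ) := by
  rw [actAt_actAt, mpXiAt, Iso.trans_hom, Category.assoc, Iso.symm_hom, whiskerLeftIso_hom,
    Functor.mapIso_hom, PrelaxFunctor.mapFunctor_map, whiskerLeft_map₂_actAt]
  simp [xiAt]

theorem actAt_xiIdAt (f : a ⟶ b) (g : b ⟶ c) {x : 𝓕.fib b}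
    {z : 𝓕.fib c} (p : y ⟶ 𝓕.ob f x) (q : x ⟶ 𝓕.ob g z) :
    actAt f p (𝓕.xiIdAt g q).inv = (𝓕.mpXiIdAt f g (p ≫ 𝓕.mp f q)).inv := by
  rw [← cancel_epi (𝓕.mpXiIdAt f g (p ≫ 𝓕.mp f q)).hom, Iso.hom_inv_id, mpXiIdAt, Iso.trans_hom,
    Category.assoc, Iso.symm_hom, whiskerLeftIso_hom, Functor.mapIso_hom,
    PrelaxFunctor.mapFunctor_map, whiskerLeft_map₂_actAt, Iso.inv_comp_eq, Category.comp_id,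
    ← cancel_epi (𝓕.mpCompAt f q (𝟙 _) p).hom, mpCompAt_id_right, mpCompAt_hom_actAt]
  simp [xiIdAt]

end Act

section HFib

variable {y : 𝓕.fib a} {x : 𝓕.fib b} {z : 𝓕.fib c}

/-- The vertical composite of two cells over `B`. -/
abbrev vFib {f g h : a ⟶ b} (α : f ⟶ g) (β : g ⟶ h) {p : y ⟶ 𝓕.ob f x} {q : y ⟶ 𝓕.ob g x}
    {r : y ⟶ 𝓕.ob h x} (φ : p ≫ 𝓕.st α x ⟶ q) (ψ : q ≫ 𝓕.st β x ⟶ r) :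
    p ≫ 𝓕.st (α ≫ β) x ⟶ r :=
  (𝓕.xiAt α β p).inv ≫ φ ▷ 𝓕.st β x ≫ ψ

/-- The part of the horizontal composite of two cells that does not involve `χ`. -/
def hFib {f g : a ⟶ b} {f' g' : b ⟶ c} (α : f ⟶ g) (α' : f' ⟶ g')
    {p : y ⟶ 𝓕.ob f x} {q : y ⟶ 𝓕.ob g x} {p' : x ⟶ 𝓕.ob f' z} {q' : x ⟶ 𝓕.ob g' z}
    (φ : p ≫ 𝓕.st α x ⟶ q) (φ' : p' ≫ 𝓕.st α' z ⟶ q') :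
    ((p ≫ 𝓕.mp f p') ≫ 𝓕.mp f (𝓕.st α' z)) ≫ 𝓕.st α (𝓕.ob g' z) ⟶ q ≫ 𝓕.mp g q' :=
  actAt f p φ' ▷ 𝓕.st α _ ≫ (𝓕.stNatAt α q' p).hom ≫ φ ▷ 𝓕.mp g q'

/-- The interchange law with `χ` left out. The image of `ψ'` moves left past `φ` by interchange,
then past the naturality cell of `α^*`. The images of `φ'` and `ψ'` then merge by `actAt_xiAt`, and
the naturality cells of `α^*` and `β^*` merge because `ξ` is a modification. The three cells left
over are those that (C3) adds to the pasting of the two `χ`. -/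
theorem hFib_comp (M : HasModifications 𝓕) {f g h : a ⟶ b} {f' g' h' : b ⟶ c} (α : f ⟶ g)
    (β : g ⟶ h) (α' : f' ⟶ g') (β' : g' ⟶ h')
    {p : y ⟶ 𝓕.ob f x} {q : y ⟶ 𝓕.ob g x} {r : y ⟶ 𝓕.ob h x}
    {p' : x ⟶ 𝓕.ob f' z} {q' : x ⟶ 𝓕.ob g' z} {r' : x ⟶ 𝓕.ob h' z}
    (φ : p ≫ 𝓕.st α x ⟶ q) (φ' : p' ≫ 𝓕.st α' z ⟶ q') (ψ : q ≫ 𝓕.st β x ⟶ r)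
    (ψ' : q' ≫ 𝓕.st β' z ⟶ r') :
    (hFib α α' φ φ' ▷ 𝓕.mp g (𝓕.st β' z)) ▷ 𝓕.st β _ ≫ hFib β β' ψ ψ' =
      (𝓕.stNatAt α (𝓕.st β' z) _).inv ▷ 𝓕.st β _ ≫ (𝓕.mpXiAt f α' β' _).hom ▷ 𝓕.st α _ ▷ 𝓕.st β _ ≫
        (𝓕.xiAt α β _).hom ≫ hFib (α ≫ β) (α' ≫ β') (vFib α β φ ψ) (vFib α' β' φ' ψ') := by
  have e₁ := actAt_nat g φ ψ'
  have e₂ := stNatAt_nat β r' φ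
  have e₃ := stNatAt_actAt α p ψ'
  rw [← Iso.eq_inv_comp] at e₃
  have e₄ : actAt f p φ' ▷ 𝓕.st α _ ▷ 𝓕.mp g (𝓕.st β' z) ≫ (𝓕.stNatAt α (𝓕.st β' z) _).inv =
      (𝓕.stNatAt α (𝓕.st β' z) _).inv ≫ actAt f p φ' ▷ 𝓕.mp f (𝓕.st β' z) ▷ 𝓕.st α _ := by
    rw [Iso.comp_inv_eq, Category.assoc, stNatAt_nat, Iso.inv_hom_id_assoc]
  have e₅ := actAt_xiAt f α' β' p φ' ψ'
  have e₆ := M.xiAt_stNatAt α β r' p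
  have e₃' := congrArg (· ▷ 𝓕.st β _) e₃
  have e₅' := congrArg (· ▷ 𝓕.st α _ ▷ 𝓕.st β _) e₅
  simp only [comp_whiskerRight] at e₃' e₅'
  simp only [hFib, comp_whiskerRight, Category.assoc]
  rw [reassoc_of% whiskerRight_comp_congr e₁, reassoc_of% e₂, reassoc_of% e₃',
    reassoc_of% whiskerRight_comp_congr e₄, reassoc_of% e₅', ← reassoc_of% xiAt_nat, reassoc_of% e₆,
    hom_inv_whiskerRight_assoc]

end HFib


namespace Tot

section HC

variable {y : 𝓕.fib a} {x : 𝓕.fib b} {z : 𝓕.fib c} [HasXi 𝓕]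

theorem ver_comp_chiC {f h : a ⟶ b} {g k : b ⟶ c} (α : f ⟶ h) (β : g ⟶ k)
    {s s' : y ⟶ 𝓕.ob f (𝓕.ob g z)} (σ : s ⟶ s') :
    ver (σ ▷ 𝓕.ch f g z) ≫ chiC α β s' =
      chiC α β s ≫ ver (σ ▷ 𝓕.mp f (𝓕.st β z) ▷ 𝓕.st α _ ▷ 𝓕.ch h k z) := by
  rw [chiC, chiC, ver_comp_cell, cell_comp_ver, chiAt_nat]

theorem ver_comp_chiLC (f : a ⟶ b) {g k : b ⟶ c} (β : g ⟶ k)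
    {s s' : y ⟶ 𝓕.ob f (𝓕.ob g z)} (σ : s ⟶ s') :
    ver (σ ▷ 𝓕.ch f g z) ≫ chiLC f β s' =
      chiLC f β s ≫ ver (σ ▷ 𝓕.mp f (𝓕.st β z) ▷ 𝓕.ch f k z) := by
  rw [chiLC, chiLC, ver_comp_cell, cell_comp_ver, chiLAt_nat]

theorem ver_comp_chiRC {f h : a ⟶ b} (α : f ⟶ h) (g : b ⟶ c)
    {s s' : y ⟶ 𝓕.ob f (𝓕.ob g z)} (σ : s ⟶ s') :
    ver (σ ▷ 𝓕.ch f g z) ≫ chiRC α g s' = chiRC α g s ≫ ver (σ ▷ 𝓕.st α _ ▷ 𝓕.ch h g z) := by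
  rw [chiRC, chiRC, ver_comp_cell, cell_comp_ver, chiRAt_nat]

theorem ver_comp_omegaC (f : a ⟶ b) (g : b ⟶ c) (h : c ⟶ d) {x : 𝓕.fib d}
    {s s' : y ⟶ 𝓕.ob f (𝓕.ob g (𝓕.ob h x))} (σ : s ⟶ s') :
    ver (σ ▷ 𝓕.mp f (𝓕.ch g h x) ▷ 𝓕.ch f (g ≫ h) x) ≫ omegaC f g h s' =
      omegaC f g h s ≫ ver (σ ▷ 𝓕.ch f g _ ▷ 𝓕.ch (f ≫ g) h x) := by
  rw [omegaC, omegaC, ver_comp_cell, cell_comp_ver, omegaAt_nat]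

theorem ver_comp_gammaC (f : a ⟶ b) {s s' : y ⟶ 𝓕.ob f x} (σ : s ⟶ s') :
    ver (σ ▷ 𝓕.mp f (𝓕.cu b x) ▷ 𝓕.ch f (𝟙 b) x) ≫ gammaC f s' = gammaC f s ≫ ver σ := by
  rw [gammaC, gammaC, ver_comp_cell, cell_comp_ver, gammaAt_nat]

theorem ver_comp_deltaC (f : a ⟶ b) {s s' : y ⟶ 𝓕.ob f x} (σ : s ⟶ s') :
    ver (σ ▷ 𝓕.cu a _ ▷ 𝓕.ch (𝟙 a) f x) ≫ deltaC f s' = deltaC f s ≫ ver σ := by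
  rw [deltaC, deltaC, ver_comp_cell, cell_comp_ver, deltaAt_nat]

/-- The horizontal composite of two cells over `B`. -/
def hC {f g : a ⟶ b} {f' g' : b ⟶ c} (α : f ⟶ g) (α' : f' ⟶ g')
    {p : y ⟶ 𝓕.ob f x} {q : y ⟶ 𝓕.ob g x} {p' : x ⟶ 𝓕.ob f' z} {q' : x ⟶ 𝓕.ob g' z}
    (φ : p ≫ 𝓕.st α x ⟶ q) (φ' : p' ≫ 𝓕.st α' z ⟶ q') :
    𝓕.tob (f ≫ f') ((p ≫ 𝓕.mp f p') ≫ 𝓕.ch f f' z) ⟶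
      𝓕.tob (g ≫ g') ((q ≫ 𝓕.mp g q') ≫ 𝓕.ch g g' z) :=
  chiC α α' (p ≫ 𝓕.mp f p') ≫ ver (hFib α α' φ φ' ▷ 𝓕.ch g g' z)

/-- The associativity constraint as a 2-cell of the Grothendieck construction. -/
def assocC (f : a ⟶ b) (g : b ⟶ c) (h : c ⟶ d) {t : 𝓕.fib d} (p : y ⟶ 𝓕.ob f x)
    (q : x ⟶ 𝓕.ob g z) (r : z ⟶ 𝓕.ob h t) :
    𝓕.tob (f ≫ g ≫ h) ((p ≫ 𝓕.mp f ((q ≫ 𝓕.mp g r) ≫ 𝓕.ch g h t)) ≫ 𝓕.ch f (g ≫ h) t) ⟶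
      𝓕.tob ((f ≫ g) ≫ h)
        ((((p ≫ 𝓕.mp f q) ≫ 𝓕.ch f g z) ≫ 𝓕.mp (f ≫ g) r) ≫ 𝓕.ch (f ≫ g) h t) :=
  ver ((𝓕.mpCompAt f (q ≫ 𝓕.mp g r) (𝓕.ch g h t) p).hom ▷ 𝓕.ch f (g ≫ h) t) ≫
    ver ((𝓕.mpCompAt f q (𝓕.mp g r) p).hom ▷ 𝓕.mp f (𝓕.ch g h t) ▷ 𝓕.ch f (g ≫ h) t) ≫
    omegaC f g h ((p ≫ 𝓕.mp f q) ≫ 𝓕.mp f (𝓕.mp g r)) ≫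
    ver ((𝓕.chNatAt f g r (p ≫ 𝓕.mp f q)).hom ▷ 𝓕.ch (f ≫ g) h t)

/-- The unit constraint `f ∘ 1 ⟶ f` as a 2-cell of the Grothendieck construction. -/
def unitRC (f : a ⟶ b) (p : y ⟶ 𝓕.ob f x) :
    𝓕.tob (𝟙 a ≫ f) ((𝓕.cu a y ≫ 𝓕.mp (𝟙 a) p) ≫ 𝓕.ch (𝟙 a) f x) ⟶ 𝓕.tob f p :=
  ver ((𝓕.cuNat a p).inv ▷ 𝓕.ch (𝟙 a) f x) ≫ deltaC f p

theorem cell_hcompFib {f g : a ⟶ b} {f' g' : b ⟶ c} (α : f ⟶ g) (α' : f' ⟶ g')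
    {p : y ⟶ 𝓕.ob f x} {q : y ⟶ 𝓕.ob g x} {p' : x ⟶ 𝓕.ob f' z} {q' : x ⟶ 𝓕.ob g' z}
    (φ : p ≫ 𝓕.st α x ⟶ q) (φ' : p' ≫ 𝓕.st α' z ⟶ q') :
    cell (hc α α') (𝓕.hcompFib α α' φ φ') = hC α α' φ φ' := by
  rw [hC, chiC, cell_comp_ver]
  congr 1
  simp only [hcompFib, hFib, actAt, chiAt, stNatAt, mpCompAt, Iso.trans_hom, Iso.trans_inv,
    whiskerLeftIso_hom, whiskerLeftIso_inv, Iso.symm_hom, Iso.symm_inv, whiskerRightIso_hom]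
  bicategory

theorem cell_assocFib (f : a ⟶ b) (g : b ⟶ c) (h : c ⟶ d) {t : 𝓕.fib d} (p : y ⟶ 𝓕.ob f x)
    (q : x ⟶ 𝓕.ob g z) (r : z ⟶ 𝓕.ob h t) :
    cell (α_ f g h).inv (𝓕.assocFib f g h p q r) = assocC f g h p q r := by
  simp only [assocC, omegaC, cell_comp_ver, ver_comp_cell]
  congr 1
  simp only [assocFib, omegaAt, chNatAt, mpCompAt, Iso.trans_hom, Iso.trans_inv,
    whiskerLeftIso_hom, whiskerLeftIso_inv, Iso.symm_hom, Iso.symm_inv, whiskerRightIso_hom]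
  bicategory

theorem cell_unitLFib (f : a ⟶ b) (p : y ⟶ 𝓕.ob f x) :
    cell (ρ_ f).hom (𝓕.unitLFib f p) = gammaC f p := by
  rw [gammaC]
  congr 1
  simp only [unitLFib, gammaAt, Iso.trans_hom, whiskerLeftIso_hom, whiskerRightIso_hom]
  bicategory

theorem cell_unitRFib (f : a ⟶ b) (p : y ⟶ 𝓕.ob f x) :
    cell (λ_ f).hom (𝓕.unitRFib f p) = unitRC f p := by
  rw [unitRC, deltaC, ver_comp_cell]
  congr 1
  simp only [unitRFib, deltaAt, Iso.trans_hom, whiskerLeftIso_hom, whiskerRightIso_hom]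
  bicategory

theorem vcompFib_eq {f g h : a ⟶ b} (α : f ⟶ g) (β : g ⟶ h) {p : y ⟶ 𝓕.ob f x}
    {q : y ⟶ 𝓕.ob g x} {r : y ⟶ 𝓕.ob h x}
    (φ : p ≫ 𝓕.st α x ⟶ q) (ψ : q ≫ 𝓕.st β x ⟶ r) :
    𝓕.vcompFib α β φ ψ = vFib α β φ ψ := by
  simp only [vcompFib, vFib, xiAt, Iso.trans_inv, whiskerLeftIso_inv]
  bicategory

theorem idFib_eq (f : a ⟶ b) (p : y ⟶ 𝓕.ob f x) : 𝓕.idFib f p = (𝓕.xiIdAt f p).inv := by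
  simp [idFib, xiIdAt]

/-- The fibre part of the first factor moves past the `χ` of the second; `hFib_comp` then leaves
exactly the left-hand side of (C3). -/
theorem hC_comp (M : HasModifications 𝓕) (T : TotAxioms 𝓕) {f g h : a ⟶ b} {f' g' h' : b ⟶ c} (α : f ⟶ g)
    (β : g ⟶ h) (α' : f' ⟶ g') (β' : g' ⟶ h')
    {p : y ⟶ 𝓕.ob f x} {q : y ⟶ 𝓕.ob g x} {r : y ⟶ 𝓕.ob h x}
    {p' : x ⟶ 𝓕.ob f' z} {q' : x ⟶ 𝓕.ob g' z} {r' : x ⟶ 𝓕.ob h' z}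
    (φ : p ≫ 𝓕.st α x ⟶ q) (φ' : p' ≫ 𝓕.st α' z ⟶ q') (ψ : q ≫ 𝓕.st β x ⟶ r)
    (ψ' : q' ≫ 𝓕.st β' z ⟶ r') :
    hC α α' φ φ' ≫ hC β β' ψ ψ' = hC (α ≫ β) (α' ≫ β') (vFib α β φ ψ) (vFib α' β' φ' ψ') := by
  rw [hC, hC, hC, Category.assoc, reassoc_of% ver_comp_chiC, ver_comp_ver, ← comp_whiskerRight,
    hFib_comp M, ← T.chi₂_comp]
  simp only [ver_comp_ver, Category.assoc, comp_whiskerRight]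

/-- Axiom (C4). Since the unit `ξ` is a modification, the naturality cell of the transformation of
an identity 2-cell disappears. -/
theorem hC_id (M : HasModifications 𝓕) (T : TotAxioms 𝓕) (f : a ⟶ b) (g : b ⟶ c) (p : y ⟶ 𝓕.ob f x)
    (q : x ⟶ 𝓕.ob g z) :
    hC (𝟙 f) (𝟙 g) (𝓕.xiIdAt f p).inv (𝓕.xiIdAt g q).inv = 𝟙 _ := by
  rw [hC, ← T.chi₂_id, ver_comp_ver]
  congr 2
  rw [← comp_whiskerRight]
  congr 1
  have e := M.xiIdAt_stNatAt f q p
  rw [← Iso.eq_inv_comp] at e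
  rw [hFib, e, Category.assoc, hom_inv_whiskerRight, Category.comp_id, xiIdAt_inv_nat, actAt_xiIdAt]

end HC

end Tot

end Data

end LaxBidiag

/-! ### Images of the structure cells under homomorphisms, and naturality of the unit constraints.
-/

namespace LaxBidiag

namespace Data

variable {B : Type u} [Bicategory.{w, v} B] {𝓕 : Data.{w, v, u, w₁, v₁, u₁} B}

variable {a b c d e : B}

theorem map₂_associator_inv (f : a ⟶ b) {x x' x'' x₃ : 𝓕.fib b} (p : x ⟶ x') (q : x' ⟶ x'')
    (r : x'' ⟶ x₃) : (𝓕.pull f).map₂ (α_ p q r).inv =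
      (𝓕.mpComp f p (q ≫ r)).hom ≫ 𝓕.mp f p ◁ (𝓕.mpComp f q r).hom ≫
        (α_ (𝓕.mp f p) (𝓕.mp f q) (𝓕.mp f r)).inv ≫ (𝓕.mpComp f p q).inv ▷ 𝓕.mp f r ≫
        (𝓕.mpComp f (p ≫ q) r).inv := by
  rw [← cancel_epi ((𝓕.pull f).map₂ (α_ p q r).hom), ← PrelaxFunctor.map₂_comp]
  simp [Pseudofunctor.map₂_associator]

section ActAt

variable {y : 𝓕.fib a} {x : 𝓕.fib b}

/-- Compares the image under `f^*` of a whiskered `χ` with the whiskering of `f^*χ`. They agree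
after distributing `f^*` over all composites, by the axioms of a homomorphism. `actAt_omegaAt` and
`actAt_deltaAt` do the same for `ω` and `δ`. -/
theorem actAt_chiAt (f : a ⟶ b) {g g' : b ⟶ c} {h h' : c ⟶ d} (β : g ⟶ g') (ζ : h ⟶ h')
    {z : 𝓕.fib d} (p : y ⟶ 𝓕.ob f x) (t : x ⟶ 𝓕.ob g (𝓕.ob h z)) :
    actAt f p (𝓕.chiAt β ζ t).hom ≫
        (𝓕.mpCompAt f ((t ≫ 𝓕.mp g (𝓕.st ζ z)) ≫ 𝓕.st β (𝓕.ob h' z)) (𝓕.ch g' h' z) p).hom ≫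
        (𝓕.mpCompAt f (t ≫ 𝓕.mp g (𝓕.st ζ z)) (𝓕.st β (𝓕.ob h' z)) p).hom ▷ 𝓕.mp f _ ≫
        (𝓕.mpCompAt f t (𝓕.mp g (𝓕.st ζ z)) p).hom ▷ 𝓕.mp f _ ▷ 𝓕.mp f _ =
      (𝓕.mpCompAt f t (𝓕.ch g h z) p).hom ▷ 𝓕.mp f _ ≫ (𝓕.mpChiAt f β ζ (p ≫ 𝓕.mp f t)).hom := by
  simp only [actAt, mpCompAt, mpChiAt, chiAt, Iso.trans_hom, Iso.trans_inv, whiskerLeftIso_hom,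
    whiskerLeftIso_inv, Iso.symm_hom, Iso.symm_inv, whiskerRightIso_hom, PrelaxFunctor.map₂_comp,
    Functor.mapIso_hom, PrelaxFunctor.mapFunctor_map, Bicategory.whiskerLeft_comp,
    Pseudofunctor.map₂_whisker_left, Pseudofunctor.map₂_associator,
    Pseudofunctor.map₂_whisker_right, map₂_associator_inv]
  simp only [← Bicategory.whiskerLeft_comp, ← Bicategory.whiskerLeft_comp_assoc, Category.assoc]
  simp
  bicategory

theorem actAt_omegaAt (f : a ⟶ b) (g : b ⟶ c) (h : c ⟶ d) (k : d ⟶ e) {z : 𝓕.fib e}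
    (p : y ⟶ 𝓕.ob f x) (t : x ⟶ 𝓕.ob g (𝓕.ob h (𝓕.ob k z))) :
    actAt f p (𝓕.omegaAt g h k t).hom ≫
        (𝓕.mpCompAt f (t ≫ 𝓕.ch g h (𝓕.ob k z)) (𝓕.ch (g ≫ h) k z) p).hom ≫
        (𝓕.mpCompAt f t (𝓕.ch g h (𝓕.ob k z)) p).hom ▷ 𝓕.mp f (𝓕.ch (g ≫ h) k z) =
      (𝓕.mpCompAt f (t ≫ 𝓕.mp g (𝓕.ch h k z)) (𝓕.ch g (h ≫ k) z) p).hom ▷ 𝓕.mp f _ ≫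
        (𝓕.mpCompAt f t (𝓕.mp g (𝓕.ch h k z)) p).hom ▷ 𝓕.mp f _ ▷ 𝓕.mp f _ ≫
        (𝓕.mpOmegaAt f g h k (p ≫ 𝓕.mp f t)).hom := by
  simp only [actAt, mpCompAt, mpOmegaAt, omegaAt, Iso.trans_hom, Iso.trans_inv, whiskerLeftIso_hom,
    whiskerLeftIso_inv, Iso.symm_hom, Iso.symm_inv, whiskerRightIso_hom, PrelaxFunctor.map₂_comp,
    Functor.mapIso_hom, PrelaxFunctor.mapFunctor_map, Bicategory.whiskerLeft_comp,
    Pseudofunctor.map₂_whisker_left, Pseudofunctor.map₂_associator,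
    Pseudofunctor.map₂_whisker_right, map₂_associator_inv]
  simp only [← Bicategory.whiskerLeft_comp, ← Bicategory.whiskerLeft_comp_assoc, Category.assoc]
  simp
  bicategory

theorem actAt_deltaAt (f : a ⟶ b) (g : b ⟶ c) {z : 𝓕.fib c}
    (p : y ⟶ 𝓕.ob f x) (t : x ⟶ 𝓕.ob g z) :
    actAt f p (𝓕.deltaAt g t).hom =
      (𝓕.mpCompAt f (t ≫ 𝓕.cu b _) (𝓕.ch (𝟙 b) g z) p).hom ▷ 𝓕.mp f _ ≫
        (𝓕.mpCompAt f t (𝓕.cu b _) p).hom ▷ 𝓕.mp f _ ▷ 𝓕.mp f _ ≫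
        (𝓕.mpDeltaAt f g (p ≫ 𝓕.mp f t)).hom := by
  simp only [actAt, mpCompAt, mpDeltaAt, deltaAt, mpIdAt, Iso.trans_hom, Iso.trans_inv,
    whiskerLeftIso_hom,
    whiskerLeftIso_inv, Iso.symm_hom, Iso.symm_inv, whiskerRightIso_hom, PrelaxFunctor.map₂_comp,
    Functor.mapIso_hom, PrelaxFunctor.mapFunctor_map, Bicategory.whiskerLeft_comp,
    Pseudofunctor.map₂_whisker_left, Pseudofunctor.map₂_associator,
    Pseudofunctor.map₂_whisker_right, map₂_associator_inv, Pseudofunctor.map₂_right_unitor]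
  simp only [← Bicategory.whiskerLeft_comp, ← Bicategory.whiskerLeft_comp_assoc, Category.assoc]
  simp
  bicategory

/-- The action on a 1-cell of the image under `f^* g^*` of a 2-cell with target a composite. -/
def actAt₂ (f : a ⟶ b) (g : b ⟶ c) {z z' z'' : 𝓕.fib c} (p : y ⟶ 𝓕.ob f (𝓕.ob g z))
    {q : z ⟶ z'} {m : z' ⟶ z''} {r : z ⟶ z''} (φ : q ≫ m ⟶ r) :
    (p ≫ 𝓕.mp f (𝓕.mp g q)) ≫ 𝓕.mp f (𝓕.mp g m) ⟶ p ≫ 𝓕.mp f (𝓕.mp g r) :=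
  (mpMpCompAt f g q m p).inv ≫ p ◁ 𝓕.mp₂ f (𝓕.mp₂ g φ)

theorem chNatAt_actAt₂ (f : a ⟶ b) (g : b ⟶ c) {z z' z'' : 𝓕.fib c}
    (p : y ⟶ 𝓕.ob f (𝓕.ob g z)) {q : z ⟶ z'} {m : z' ⟶ z''} {r : z ⟶ z''} (φ : q ≫ m ⟶ r) :
    (𝓕.chNatAt f g m (p ≫ 𝓕.mp f (𝓕.mp g q))).hom ≫
        (𝓕.chNatAt f g q p).hom ▷ 𝓕.mp (f ≫ g) m ≫ actAt (f ≫ g) (p ≫ 𝓕.ch f g z) φ =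
      actAt₂ f g p φ ▷ 𝓕.ch f g z'' ≫ (𝓕.chNatAt f g r p).hom := by
  rw [actAt, actAt₂, ← cancel_epi ((mpMpCompAt f g q m p).hom ▷ 𝓕.ch f g z''), reassoc_of% chNatAt_comp,
    Iso.hom_inv_id_assoc, ← comp_whiskerRight_assoc, Iso.hom_inv_id_assoc, chNatAt_map₂]

/-- The image under `f^*` of the part without `χ` of a horizontal composite, with `f^*` distributed
over the composites. It serves the horizontal composition of three cells. -/
theorem map₂_hFib {f : a ⟶ b} {g g' : b ⟶ c} {h h' : c ⟶ d} (β : g ⟶ g') (ζ : h ⟶ h')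
    {z : 𝓕.fib c} {t : 𝓕.fib d} (p : y ⟶ 𝓕.ob f x)
    {q : x ⟶ 𝓕.ob g z} {q' : x ⟶ 𝓕.ob g' z} {r : z ⟶ 𝓕.ob h t} {r' : z ⟶ 𝓕.ob h' t}
    (φ : q ≫ 𝓕.st β z ⟶ q') (ψ : r ≫ 𝓕.st ζ t ⟶ r') :
    p ◁ 𝓕.mp₂ f (hFib β ζ φ ψ) ≫ (𝓕.mpCompAt f q' (𝓕.mp g' r') p).hom =
      (𝓕.mpCompAt f ((q ≫ 𝓕.mp g r) ≫ 𝓕.mp g (𝓕.st ζ t)) (𝓕.st β (𝓕.ob h' t)) p).hom ≫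
        (𝓕.mpCompAt f (q ≫ 𝓕.mp g r) (𝓕.mp g (𝓕.st ζ t)) p).hom ▷ 𝓕.mp f _ ≫
        (𝓕.mpCompAt f q (𝓕.mp g r) p).hom ▷ 𝓕.mp f _ ▷ 𝓕.mp f _ ≫
        actAt₂ f g (p ≫ 𝓕.mp f q) ψ ▷ 𝓕.mp f _ ≫ (mpStNatAt f β r' (p ≫ 𝓕.mp f q)).hom ≫
        actAt f p φ ▷ 𝓕.mp f (𝓕.mp g' r') := by
  simp only [hFib, actAt, actAt₂, mpMpCompAt, mpStNatAt, mpCompAt, stNatAt, Iso.trans_hom,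
    Iso.trans_inv, whiskerLeftIso_hom,
    whiskerLeftIso_inv, Iso.symm_hom, Iso.symm_inv, whiskerRightIso_hom, PrelaxFunctor.map₂_comp,
    Functor.mapIso_hom, Functor.mapIso_inv, PrelaxFunctor.mapFunctor_map,
    Bicategory.whiskerLeft_comp, comp_whiskerRight,
    Pseudofunctor.map₂_whisker_left, Pseudofunctor.map₂_associator,
    Pseudofunctor.map₂_whisker_right, map₂_associator_inv, Pseudofunctor.map₂_right_unitor]
  simp only [← Bicategory.whiskerLeft_comp, ← Bicategory.whiskerLeft_comp_assoc, Category.assoc]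
  simp
  bicategory

end ActAt

namespace Tot

section HC

variable {y : 𝓕.fib a} {x : 𝓕.fib b} {z : 𝓕.fib c} [HasXi 𝓕]

theorem chiLC_eq (f : a ⟶ b) {g k : b ⟶ c} (β : g ⟶ k) (s : y ⟶ 𝓕.ob f (𝓕.ob g z)) :
    chiLC f β s = chiC (𝟙 f) β s ≫ ver ((𝓕.xiIdAt f _).inv ▷ 𝓕.ch f k z) := by
  rw [chiLC, chiC, cell_comp_ver]
  refine cell_eq_cell (by simp [hc]) ?_
  simp only [chiLAt, chiL, chiAt, xiIdAt, Iso.trans_hom, Iso.trans_inv,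
    whiskerLeftIso_hom, whiskerLeftIso_inv, Iso.symm_hom, Iso.symm_inv, whiskerRightIso_hom]
  bicategory

theorem chiRC_eq {f h : a ⟶ b} (α : f ⟶ h) (g : b ⟶ c) (s : y ⟶ 𝓕.ob f (𝓕.ob g z)) :
    chiRC α g s = chiC α (𝟙 g) s ≫ ver ((𝓕.mpXiIdAt f g s).inv ▷ 𝓕.st α _ ▷ 𝓕.ch h g z) := by
  rw [chiRC, chiC, cell_comp_ver]
  refine cell_eq_cell (by simp [hc]) ?_
  simp only [chiRAt, chiR, chiAt, mpXiIdAt, mpIdAt, Iso.trans_hom, Iso.trans_inv,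
    Functor.mapIso_hom, Functor.mapIso_inv, PrelaxFunctor.mapFunctor_map,
    whiskerLeftIso_hom, whiskerLeftIso_inv, Iso.symm_hom, Iso.symm_inv, whiskerRightIso_hom]
  bicategory

/-- With an identity on the left, the modification axiom of the unit `ξ` removes the naturality
cell, and the remaining unit cell turns `χ_{β,1_f}` into `χ_{β,f}`. In `hC_id_right` the unit cell
appears under `f^*` and is absorbed into `χ_{g,α}` directly. -/
theorem hC_id_left (M : HasModifications 𝓕) (f : a ⟶ b) {g k : b ⟶ c} (β : g ⟶ k)
    (p : y ⟶ 𝓕.ob f x) {q : x ⟶ 𝓕.ob g z} {r : x ⟶ 𝓕.ob k z} (φ : q ≫ 𝓕.st β z ⟶ r) :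
    hC (𝟙 f) β (𝓕.xiIdAt f p).inv φ =
      chiLC f β (p ≫ 𝓕.mp f q) ≫ ver (actAt f p φ ▷ 𝓕.ch f k z) := by
  have e := M.xiIdAt_stNatAt f r p
  rw [← Iso.eq_inv_comp] at e
  rw [hC, chiLC_eq, Category.assoc, ver_comp_ver, ← comp_whiskerRight, hFib, e, Category.assoc,
    hom_inv_whiskerRight, Category.comp_id, xiIdAt_inv_nat]

theorem hC_id_right {f h : a ⟶ b} (α : f ⟶ h) (g : b ⟶ c)
    {p : y ⟶ 𝓕.ob f x} {q : y ⟶ 𝓕.ob h x} (φ : p ≫ 𝓕.st α x ⟶ q) (r : x ⟶ 𝓕.ob g z) :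
    hC α (𝟙 g) φ (𝓕.xiIdAt g r).inv = chiRC α g (p ≫ 𝓕.mp f r) ≫
      ver (((𝓕.stNatAt α r p).hom ≫ φ ▷ 𝓕.mp h r) ▷ 𝓕.ch h g z) := by
  rw [hC, chiRC_eq, Category.assoc, ver_comp_ver, ← comp_whiskerRight, hFib, actAt_xiIdAt]

/-- `cell_eq_lam_comp` splits the 2-cell into the lift of `α`, treated by the half of (C7) on `γ`,
and a cell of the fibre, for which the interchange law suffices. -/
theorem gamma_natural (T : TotAxioms 𝓕) {f g : a ⟶ b} (α : f ⟶ g)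
    {p : y ⟶ 𝓕.ob f x} {q : y ⟶ 𝓕.ob g x} (φ : p ≫ 𝓕.st α x ⟶ q) :
    hC α (𝟙 (𝟙 b)) φ (𝓕.xiIdAt (𝟙 b) (𝓕.cu b x)).inv ≫ gammaC g q = gammaC f p ≫ cell α φ := by
  rw [hC_id_right, cell_eq_lam_comp, reassoc_of% (T.gamma_nat α p), ← ver_comp_gammaC]
  simp

/-- Naturality of the unit `χ` in the 2-cell `φ`, and its compatibility with the composite that is
the source of `φ`. This is the additional ingredient for `δ`, whose unit constraint contains a
naturality cell. -/
theorem actAt_cuNat {f g : a ⟶ b} (α : f ⟶ g)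
    {p : y ⟶ 𝓕.ob f x} {q : y ⟶ 𝓕.ob g x} (φ : p ≫ 𝓕.st α x ⟶ q) :
    actAt (𝟙 a) (𝓕.cu a y) φ ≫ (𝓕.cuNat a q).inv =
      (𝓕.cuNat a p).inv ▷ 𝓕.mp (𝟙 a) (𝓕.st α x) ≫ (𝓕.cuNatAt (𝓕.st α x) p).inv ≫
        φ ▷ 𝓕.cu a _ := by
  have h : (𝓕.cuNat a (p ≫ 𝓕.st α x)).hom ≫ 𝓕.cu a y ◁ (𝓕.mpComp (𝟙 a) p (𝓕.st α x)).hom =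
      𝟙 _ ▷ 𝓕.cu a _ ≫ (α_ _ _ _).hom ≫ p ◁ (𝓕.cuNat a (𝓕.st α x)).hom ≫ (α_ _ _ _).inv ≫
        (𝓕.cuNat a p).hom ▷ 𝓕.mp (𝟙 a) (𝓕.st α x) ≫ (α_ _ _ _).hom :=
    (𝓕.chiId a).naturality_comp p (𝓕.st α x)
  have h₂ : φ ▷ 𝓕.cu a _ ≫ (𝓕.cuNat a q).hom =
      (𝓕.cuNat a (p ≫ 𝓕.st α x)).hom ≫ 𝓕.cu a y ◁ 𝓕.mp₂ (𝟙 a) φ :=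
    (𝓕.chiId a).naturality_naturality φ
  rw [Iso.comp_inv_eq, Category.assoc, Category.assoc, h₂,
    ← cancel_epi (𝓕.mpCompAt (𝟙 a) p (𝓕.st α x) (𝓕.cu a y)).hom, mpCompAt_hom_actAt,
    ← cancel_epi (𝓕.cuNat a (p ≫ 𝓕.st α x)).hom, mpCompAt, Iso.trans_hom, whiskerLeftIso_hom,
    Category.assoc, reassoc_of% h]
  simp [cuNatAt]

theorem delta_natural (M : HasModifications 𝓕) (T : TotAxioms 𝓕) {f g : a ⟶ b} (α : f ⟶ g)
    {p : y ⟶ 𝓕.ob f x} {q : y ⟶ 𝓕.ob g x} (φ : p ≫ 𝓕.st α x ⟶ q) :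
    hC (𝟙 (𝟙 a)) α (𝓕.xiIdAt (𝟙 a) (𝓕.cu a y)).inv φ ≫ unitRC g q = unitRC f p ≫ cell α φ := by
  rw [hC_id_left M, cell_eq_lam_comp, unitRC, unitRC, Category.assoc, Category.assoc,
    reassoc_of% (T.delta_nat α p), ← ver_comp_deltaC, reassoc_of% ver_comp_chiLC, ver_comp_ver_assoc,
    ver_comp_ver_assoc, ver_comp_ver_assoc, ← comp_whiskerRight, ← comp_whiskerRight,
    ← comp_whiskerRight, Category.assoc, actAt_cuNat]

end HC

end Tot

end Data

end LaxBidiag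

/-! ### Naturality of the associativity constraint. -/

namespace LaxBidiag

namespace Data

variable {B : Type u} [Bicategory.{w, v} B] {𝓕 : Data.{w, v, u, w₁, v₁, u₁} B}

variable {a b c d e : B}

section HcFib

variable {y : 𝓕.fib a} {x : 𝓕.fib b} {z : 𝓕.fib c}

/-- The horizontal composite of two cells over `B`, left-bracketed. -/
def hcFib {f g : a ⟶ b} {f' g' : b ⟶ c} (α : f ⟶ g) (α' : f' ⟶ g')
    {p : y ⟶ 𝓕.ob f x} {q : y ⟶ 𝓕.ob g x} {p' : x ⟶ 𝓕.ob f' z} {q' : x ⟶ 𝓕.ob g' z}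
    (φ : p ≫ 𝓕.st α x ⟶ q) (φ' : p' ≫ 𝓕.st α' z ⟶ q') :
    ((p ≫ 𝓕.mp f p') ≫ 𝓕.ch f f' z) ≫ 𝓕.st (hc α α') z ⟶ (q ≫ 𝓕.mp g q') ≫ 𝓕.ch g g' z :=
  (𝓕.chiAt α α' (p ≫ 𝓕.mp f p')).hom ≫ hFib α α' φ φ' ▷ 𝓕.ch g g' z

/-- The auxiliary composite in the naturality of the associativity constraint. -/
def hhFib {f f' : a ⟶ b} {g g' : b ⟶ c} {h h' : c ⟶ d} (α : f ⟶ f') (β : g ⟶ g') (ζ : h ⟶ h')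
    {t : 𝓕.fib d} {p : y ⟶ 𝓕.ob f x} {p' : y ⟶ 𝓕.ob f' x} {q : x ⟶ 𝓕.ob g z}
    {q' : x ⟶ 𝓕.ob g' z} {r : z ⟶ 𝓕.ob h t} {r' : z ⟶ 𝓕.ob h' t}
    (φ : p ≫ 𝓕.st α x ⟶ p') (ψ : q ≫ 𝓕.st β z ⟶ q') (θ : r ≫ 𝓕.st ζ t ⟶ r') :
    ((((p ≫ 𝓕.mp f q) ≫ 𝓕.mp f (𝓕.mp g r)) ≫ 𝓕.mp f (𝓕.mp g (𝓕.st ζ t))) ≫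
        𝓕.mp f (𝓕.st β _)) ≫ 𝓕.st α _ ⟶ (p' ≫ 𝓕.mp f' q') ≫ 𝓕.mp f' (𝓕.mp g' r') :=
  actAt₂ f g (p ≫ 𝓕.mp f q) θ ▷ 𝓕.mp f _ ▷ 𝓕.st α _ ≫
    (mpStNatAt f β r' (p ≫ 𝓕.mp f q)).hom ▷ 𝓕.st α _ ≫
    (𝓕.stNatAt α (𝓕.mp g' r') ((p ≫ 𝓕.mp f q) ≫ 𝓕.mp f (𝓕.st β z))).hom ≫
    hFib α β φ ψ ▷ 𝓕.mp f' (𝓕.mp g' r')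

/-- `hhFib` is the part of a triple horizontal composite without `χ` and `ω`. In the bracketing with
`f, g` composed first, the naturality cells of `χ` at `r` and at `ζ^*` slide through the composite.
They meet `χ_{β,α}`, and its modification axiom at `r'` lets them pass. -/
theorem hhFib_right (M : HasModifications 𝓕) {f f' : a ⟶ b} {g g' : b ⟶ c} {h h' : c ⟶ d}
    (α : f ⟶ f') (β : g ⟶ g') (ζ : h ⟶ h')
    {t : 𝓕.fib d} {p : y ⟶ 𝓕.ob f x} {p' : y ⟶ 𝓕.ob f' x} {q : x ⟶ 𝓕.ob g z}
    {q' : x ⟶ 𝓕.ob g' z} {r : z ⟶ 𝓕.ob h t} {r' : z ⟶ 𝓕.ob h' t}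
    (φ : p ≫ 𝓕.st α x ⟶ p') (ψ : q ≫ 𝓕.st β z ⟶ q') (θ : r ≫ 𝓕.st ζ t ⟶ r') :
    (𝓕.chNatAt f g (𝓕.st ζ t) _).hom ▷ 𝓕.st (hc α β) _ ≫
        (𝓕.chNatAt f g r (p ≫ 𝓕.mp f q)).hom ▷ 𝓕.mp (f ≫ g) _ ▷ 𝓕.st (hc α β) _ ≫
        hFib (hc α β) ζ (hcFib α β φ ψ) θ =
      (𝓕.chiAt α β _).hom ≫ hhFib α β ζ φ ψ θ ▷ 𝓕.ch f' g' _ ≫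
        (𝓕.chNatAt f' g' r' (p' ≫ 𝓕.mp f' q')).hom := by
  have e₁ := congrArg (· ▷ 𝓕.st (hc α β) _) (chNatAt_actAt₂ f g (p ≫ 𝓕.mp f q) θ)
  have e₂ := M.chiAt_chNatAt α β r' (p ≫ 𝓕.mp f q)
  have e₃ := chiAt_nat α β (actAt₂ f g (p ≫ 𝓕.mp f q) θ)
  have e₄ := chNatAt_nat f' g' r' (hFib α β φ ψ)
  simp only [comp_whiskerRight, Category.assoc] at e₁
  simp only [hFib, hcFib, comp_whiskerRight, Category.assoc] at e₄ ⊢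
  rw [reassoc_of% e₁, ← reassoc_of% e₂, reassoc_of% e₃]
  simp only [hhFib, hFib, comp_whiskerRight, Category.assoc, e₄]

theorem map₂_hFib_stNatAt {f f' : a ⟶ b} {g g' : b ⟶ c} {h h' : c ⟶ d}
    (α : f ⟶ f') (β : g ⟶ g') (ζ : h ⟶ h')
    {t : 𝓕.fib d} {p : y ⟶ 𝓕.ob f x} {p' : y ⟶ 𝓕.ob f' x} {q : x ⟶ 𝓕.ob g z}
    {q' : x ⟶ 𝓕.ob g' z} {r : z ⟶ 𝓕.ob h t} {r' : z ⟶ 𝓕.ob h' t}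
    (φ : p ≫ 𝓕.st α x ⟶ p') (ψ : q ≫ 𝓕.st β z ⟶ q') (θ : r ≫ 𝓕.st ζ t ⟶ r') :
    (p ◁ 𝓕.mp₂ f (hFib β ζ ψ θ)) ▷ 𝓕.st α _ ≫ (𝓕.stNatAt α (q' ≫ 𝓕.mp g' r') p).hom ≫
        φ ▷ 𝓕.mp f' (q' ≫ 𝓕.mp g' r') ≫ (𝓕.mpCompAt f' q' (𝓕.mp g' r') p').hom =
      (𝓕.mpCompAt f ((q ≫ 𝓕.mp g r) ≫ 𝓕.mp g (𝓕.st ζ t)) (𝓕.st β _) p).hom ▷ 𝓕.st α _ ≫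
        (𝓕.mpCompAt f (q ≫ 𝓕.mp g r) (𝓕.mp g (𝓕.st ζ t)) p).hom ▷ 𝓕.mp f _ ▷ 𝓕.st α _ ≫
        (𝓕.mpCompAt f q (𝓕.mp g r) p).hom ▷ 𝓕.mp f _ ▷ 𝓕.mp f _ ▷ 𝓕.st α _ ≫
        hhFib α β ζ φ ψ θ := by
  have e₁ := mpCompAt_nat f' q' (𝓕.mp g' r') φ
  have e₂ := stNatAt_comp α q' (𝓕.mp g' r') p
  have e₃ := congrArg (· ▷ 𝓕.st α _) (map₂_hFib β ζ p ψ θ)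
  have e₄ := stNatAt_nat α (𝓕.mp g' r') (actAt f p ψ)
  simp only [comp_whiskerRight, Category.assoc] at e₃
  rw [e₁, ← reassoc_of% e₂, reassoc_of% e₃, reassoc_of% e₄]
  simp only [hhFib, hFib, comp_whiskerRight, Category.assoc]

theorem mpChiAt_nat (f : a ⟶ b) {g g' : b ⟶ c} {h h' : c ⟶ d} (β : g ⟶ g') (ζ : h ⟶ h')
    {t : 𝓕.fib d} {s s' : y ⟶ 𝓕.ob f (𝓕.ob g (𝓕.ob h t))} (σ : s ⟶ s') :
    (𝓕.mpChiAt f β ζ s).hom ≫ σ ▷ 𝓕.mp f _ ▷ 𝓕.mp f _ ▷ 𝓕.mp f _ =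
      σ ▷ 𝓕.mp f _ ▷ 𝓕.mp f _ ≫ (𝓕.mpChiAt f β ζ s').hom := by
  refine coh_congr (whisker_exchange σ ((𝓕.mpComp f (𝓕.ch g h t) (𝓕.st (hc β ζ) t)).inv ≫
    𝓕.mp₂ f (𝓕.chi₂ β ζ t).hom ≫
    (𝓕.mpComp f (𝓕.mp g (𝓕.st ζ t) ≫ 𝓕.st β (𝓕.ob h' t)) (𝓕.ch g' h' t)).hom ≫
    (𝓕.mpComp f (𝓕.mp g (𝓕.st ζ t)) (𝓕.st β (𝓕.ob h' t))).hom ▷ _)) ?_ ?_ <;>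
  (try simp only [mpChiAt, mpCompAt, Iso.trans_hom, Iso.trans_inv, whiskerLeftIso_hom,
    whiskerLeftIso_inv, Iso.symm_hom, Iso.symm_inv, whiskerRightIso_hom, Functor.mapIso_hom,
    PrelaxFunctor.mapFunctor_map]) <;>
  bicategory

/-- The other bracketing. Here the inner composite lies under `f^*`, so constraints of `f^*` and
`f'^*` have to be moved through; no modification axiom is used. The cells `f^*χ_{ζ,β}` and the
naturality of `α^*` at `χ` that split off are those of (C5). -/
theorem hhFib_left {f f' : a ⟶ b} {g g' : b ⟶ c} {h h' : c ⟶ d}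
    (α : f ⟶ f') (β : g ⟶ g') (ζ : h ⟶ h')
    {t : 𝓕.fib d} {p : y ⟶ 𝓕.ob f x} {p' : y ⟶ 𝓕.ob f' x} {q : x ⟶ 𝓕.ob g z}
    {q' : x ⟶ 𝓕.ob g' z} {r : z ⟶ 𝓕.ob h t} {r' : z ⟶ 𝓕.ob h' t}
    (φ : p ≫ 𝓕.st α x ⟶ p') (ψ : q ≫ 𝓕.st β z ⟶ q') (θ : r ≫ 𝓕.st ζ t ⟶ r') :
    hFib α (hc β ζ) φ (hcFib β ζ ψ θ) ≫
        (𝓕.mpCompAt f' (q' ≫ 𝓕.mp g' r') (𝓕.ch g' h' t) p').hom ≫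
        (𝓕.mpCompAt f' q' (𝓕.mp g' r') p').hom ▷ 𝓕.mp f' (𝓕.ch g' h' t) =
      (𝓕.mpCompAt f (q ≫ 𝓕.mp g r) (𝓕.ch g h t) p).hom ▷ 𝓕.mp f _ ▷ 𝓕.st α _ ≫
        (𝓕.mpCompAt f q (𝓕.mp g r) p).hom ▷ 𝓕.mp f (𝓕.ch g h t) ▷ 𝓕.mp f _ ▷ 𝓕.st α _ ≫
        (𝓕.mpChiAt f β ζ _).hom ▷ 𝓕.st α _ ≫ (𝓕.stNatAt α (𝓕.ch g' h' t) _).hom ≫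
        hhFib α β ζ φ ψ θ ▷ 𝓕.mp f' (𝓕.ch g' h' t) := by
  have e₁ := mpCompAt_nat f' (q' ≫ 𝓕.mp g' r') (𝓕.ch g' h' t) φ
  have e₂ := stNatAt_comp α (q' ≫ 𝓕.mp g' r') (𝓕.ch g' h' t) p
  have e₃ := congrArg (· ▷ 𝓕.st α _)
    (mpCompAt_map₂_left f (hFib β ζ ψ θ) (𝓕.ch g' h' t) p)
  have e₄ := stNatAt_nat α (𝓕.ch g' h' t) (p ◁ 𝓕.mp₂ f (hFib β ζ ψ θ))
  have e₅ := congrArg (· ▷ 𝓕.mp f' (𝓕.ch g' h' t)) (map₂_hFib_stNatAt α β ζ φ ψ θ)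
  have e₆ := congrArg (· ▷ 𝓕.st α _) (actAt_chiAt f β ζ p (q ≫ 𝓕.mp g r))
  have e₇ := congrArg (· ▷ 𝓕.st α _) (mpChiAt_nat f β ζ (𝓕.mpCompAt f q (𝓕.mp g r) p).hom)
  simp only [comp_whiskerRight, Category.assoc] at e₃ e₅ e₆ e₇
  rw [hFib, hcFib, actAt_comp]
  simp only [comp_whiskerRight, Category.assoc]
  rw [reassoc_of% e₁, ← reassoc_of% e₂, reassoc_of% e₃, reassoc_of% e₄, e₅,
    ← reassoc_of% stNatAt_nat, ← reassoc_of% stNatAt_nat, ← reassoc_of% stNatAt_nat, reassoc_of% e₆, reassoc_of% e₇]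


end HcFib

namespace Tot

section HC

variable {y : 𝓕.fib a} {x : 𝓕.fib b} {z : 𝓕.fib c} [HasXi 𝓕]

/-- By `hhFib_left` and `hhFib_right` both sides end in the same cells `hhFib` and naturality of `χ`
at `r'`. What precedes them is (C5), whiskered with the triple composite of `p`, `q`, `r`. -/
theorem assoc_natural (M : HasModifications 𝓕) (T : TotAxioms 𝓕) {f f' : a ⟶ b} {g g' : b ⟶ c} {h h' : c ⟶ d}
    (α : f ⟶ f') (β : g ⟶ g') (ζ : h ⟶ h')
    {t : 𝓕.fib d} {p : y ⟶ 𝓕.ob f x} {p' : y ⟶ 𝓕.ob f' x} {q : x ⟶ 𝓕.ob g z}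
    {q' : x ⟶ 𝓕.ob g' z} {r : z ⟶ 𝓕.ob h t} {r' : z ⟶ 𝓕.ob h' t}
    (φ : p ≫ 𝓕.st α x ⟶ p') (ψ : q ≫ 𝓕.st β z ⟶ q') (θ : r ≫ 𝓕.st ζ t ⟶ r') :
    hC α (hc β ζ) φ (hcFib β ζ ψ θ) ≫ assocC f' g' h' p' q' r' =
      assocC f g h p q r ≫ hC (hc α β) ζ (hcFib α β φ ψ) θ := by
  have e₁ := hhFib_right M α β ζ φ ψ θ
  have e₂ := congrArg (fun m => ver (m ▷ 𝓕.ch f' (g' ≫ h') t)) (hhFib_left α β ζ φ ψ θ)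
  rw [← whiskerRightIso_hom, ← Iso.eq_inv_comp, whiskerRightIso_inv] at e₁
  replace e₁ := congrArg (fun m => ver (m ▷ 𝓕.ch (f' ≫ g') h' t)) e₁
  simp only [comp_whiskerRight, ← ver_comp_ver, Category.assoc] at e₁ e₂
  rw [hC, hC, assocC, assocC]
  simp only [Category.assoc]
  rw [reassoc_of% e₂, reassoc_of% ver_comp_omegaC, ← reassoc_of% ver_comp_chiC, ← reassoc_of% ver_comp_chiC,
    reassoc_of% (T.omega_nat α β ζ ((p ≫ 𝓕.mp f q) ≫ 𝓕.mp f (𝓕.mp g r))), ← e₁,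
    reassoc_of% ver_comp_chiC]

end HC

end Tot

end Data

end LaxBidiag

/-! ### The pentagon and triangle equations. -/

namespace LaxBidiag

namespace Data

variable {B : Type u} [Bicategory.{w, v} B] {𝓕 : Data.{w, v, u, w₁, v₁, u₁} B}

variable {a b c d e : B}

section AssocAt

variable {y : 𝓕.fib a} {x : 𝓕.fib b} {z : 𝓕.fib c}

/-- The associativity constraint, left-bracketed. -/
def assocAt (f : a ⟶ b) (g : b ⟶ c) (h : c ⟶ d) {t : 𝓕.fib d} (p : y ⟶ 𝓕.ob f x)
    (q : x ⟶ 𝓕.ob g z) (r : z ⟶ 𝓕.ob h t) :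
    ((p ≫ 𝓕.mp f ((q ≫ 𝓕.mp g r) ≫ 𝓕.ch g h t)) ≫ 𝓕.ch f (g ≫ h) t) ≫ 𝓕.st (α_ f g h).inv t ⟶
      (((p ≫ 𝓕.mp f q) ≫ 𝓕.ch f g z) ≫ 𝓕.mp (f ≫ g) r) ≫ 𝓕.ch (f ≫ g) h t :=
  (𝓕.mpCompAt f (q ≫ 𝓕.mp g r) (𝓕.ch g h t) p).hom ▷ 𝓕.ch f (g ≫ h) t ▷ 𝓕.st (α_ f g h).inv t ≫
    (𝓕.mpCompAt f q (𝓕.mp g r) p).hom ▷ 𝓕.mp f (𝓕.ch g h t) ▷ 𝓕.ch f (g ≫ h) t ▷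
      𝓕.st (α_ f g h).inv t ≫
    (𝓕.omegaAt f g h ((p ≫ 𝓕.mp f q) ≫ 𝓕.mp f (𝓕.mp g r))).hom ≫
    (𝓕.chNatAt f g r (p ≫ 𝓕.mp f q)).hom ▷ 𝓕.ch (f ≫ g) h t

theorem mpCompAt_inv_nat (f : a ⟶ b) {x x' x'' : 𝓕.fib b} (p : x ⟶ x') (q : x' ⟶ x'')
    {s s' : y ⟶ 𝓕.ob f x} (σ : s ⟶ s') :
    (𝓕.mpCompAt f p q s).inv ≫ σ ▷ 𝓕.mp f (p ≫ q) =
      σ ▷ 𝓕.mp f p ▷ 𝓕.mp f q ≫ (𝓕.mpCompAt f p q s').inv := by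
  rw [Iso.inv_comp_eq, ← reassoc_of% mpCompAt_nat, Iso.hom_inv_id, Category.comp_id]

theorem mpOmegaAt_nat (f : a ⟶ b) (g : b ⟶ c) (h : c ⟶ d) (k : d ⟶ e) {l : 𝓕.fib e}
    {s s' : y ⟶ 𝓕.ob f (𝓕.ob g (𝓕.ob h (𝓕.ob k l)))} (σ : s ⟶ s') :
    (𝓕.mpOmegaAt f g h k s).hom ≫ σ ▷ 𝓕.mp f _ ▷ 𝓕.mp f _ =
      σ ▷ 𝓕.mp f _ ▷ 𝓕.mp f _ ▷ 𝓕.mp f _ ≫ (𝓕.mpOmegaAt f g h k s').hom := by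
  have e := whisker_exchange σ ((𝓕.pull f).map₂Iso (𝓕.omega g h k l)).hom
  simp only [mpOmegaAt, Iso.trans_hom, Iso.symm_hom, whiskerRightIso_hom, whiskerLeftIso_hom,
    Category.assoc]
  rw [← mpCompAt_nat, reassoc_of% e, reassoc_of% mpCompAt_inv_nat]
  simp only [← comp_whiskerRight_assoc, mpCompAt_inv_nat]

theorem mpChNatAt_nat (f : a ⟶ b) (g : b ⟶ c) (h : c ⟶ d) {t t' : 𝓕.fib d} (r : t ⟶ t')
    {s s' : y ⟶ 𝓕.ob f (𝓕.ob g (𝓕.ob h t))} (σ : s ⟶ s') :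
    (mpChNatAt f g h r s).hom ≫ σ ▷ 𝓕.mp f _ ▷ 𝓕.mp f _ =
      σ ▷ 𝓕.mp f _ ▷ 𝓕.mp f _ ≫ (mpChNatAt f g h r s').hom := by
  have e := whisker_exchange σ ((𝓕.pull f).map₂Iso (𝓕.chNat g h r)).hom
  simp only [mpChNatAt, Iso.trans_hom, Iso.symm_hom, whiskerLeftIso_hom, Category.assoc]
  rw [← mpCompAt_nat, reassoc_of% e, reassoc_of% mpCompAt_inv_nat]

theorem whiskerLeft_map₂_chNatAt (f : a ⟶ b) (g : b ⟶ c) (h : c ⟶ d) {t t' : 𝓕.fib d}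
    (p : y ⟶ 𝓕.ob f x) (q : x ⟶ 𝓕.ob g (𝓕.ob h t)) (r : t ⟶ t') :
    p ◁ 𝓕.mp₂ f (𝓕.chNatAt g h r q).hom ≫
        (𝓕.mpCompAt f (q ≫ 𝓕.ch g h t) (𝓕.mp (g ≫ h) r) p).hom ≫
        (𝓕.mpCompAt f q (𝓕.ch g h t) p).hom ▷ 𝓕.mp f _ =
      (𝓕.mpCompAt f (q ≫ 𝓕.mp g (𝓕.mp h r)) (𝓕.ch g h t') p).hom ≫
        (𝓕.mpCompAt f q (𝓕.mp g (𝓕.mp h r)) p).hom ▷ 𝓕.mp f _ ≫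
        (mpChNatAt f g h r (p ≫ 𝓕.mp f q)).hom := by
  simp only [mpCompAt, mpChNatAt, chNatAt, Iso.trans_hom, Iso.symm_hom, whiskerLeftIso_hom,
    whiskerLeftIso_inv, PrelaxFunctor.map₂_comp,
    Functor.mapIso_hom, PrelaxFunctor.mapFunctor_map, Bicategory.whiskerLeft_comp,
    Pseudofunctor.map₂_whisker_left, Pseudofunctor.map₂_associator,
    Pseudofunctor.map₂_whisker_right, map₂_associator_inv]
  simp only [← Bicategory.whiskerLeft_comp, ← Bicategory.whiskerLeft_comp_assoc, Category.assoc]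
  simp

theorem whiskerLeft_map₂_mpCompAt (f : a ⟶ b) (g : b ⟶ c) {w w' w'' : 𝓕.fib c}
    (p : y ⟶ 𝓕.ob f x) (q : x ⟶ 𝓕.ob g w) (r : w ⟶ w') (s : w' ⟶ w'') :
    p ◁ 𝓕.mp₂ f (𝓕.mpCompAt g r s q).hom ≫
        (𝓕.mpCompAt f (q ≫ 𝓕.mp g r) (𝓕.mp g s) p).hom ≫
        (𝓕.mpCompAt f q (𝓕.mp g r) p).hom ▷ 𝓕.mp f _ =
      (𝓕.mpCompAt f q (𝓕.mp g (r ≫ s)) p).hom ≫ (mpMpCompAt f g r s (p ≫ 𝓕.mp f q)).hom := by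
  simp only [mpCompAt, mpMpCompAt, Iso.trans_hom, Iso.symm_hom, whiskerLeftIso_hom,
    whiskerLeftIso_inv, PrelaxFunctor.map₂_comp,
    Functor.mapIso_hom, PrelaxFunctor.mapFunctor_map, Bicategory.whiskerLeft_comp,
    Pseudofunctor.map₂_whisker_left, Pseudofunctor.map₂_associator,
    Pseudofunctor.map₂_whisker_right, map₂_associator_inv]
  simp only [← Bicategory.whiskerLeft_comp, ← Bicategory.whiskerLeft_comp_assoc, Category.assoc]
  simp

/-- The image under `f^*` of an associativity constraint, needed because the pentagon contains one
composed with an identity. After `f^*` is distributed over all composites, `f^*ω` and `f^*` of the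
naturality cell of `χ` remain. -/
theorem actAt_assocAt (f : a ⟶ b) (g : b ⟶ c) (h : c ⟶ d) (k : d ⟶ e) {t : 𝓕.fib d}
    {l : 𝓕.fib e} (p : y ⟶ 𝓕.ob f x) (q : x ⟶ 𝓕.ob g z) (r : z ⟶ 𝓕.ob h t) (s : t ⟶ 𝓕.ob k l) :
    actAt f p (assocAt g h k q r s) ≫
        (𝓕.mpCompAt f (((q ≫ 𝓕.mp g r) ≫ 𝓕.ch g h t) ≫ 𝓕.mp (g ≫ h) s)
          (𝓕.ch (g ≫ h) k l) p).hom ≫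
        (𝓕.mpCompAt f ((q ≫ 𝓕.mp g r) ≫ 𝓕.ch g h t) (𝓕.mp (g ≫ h) s) p).hom ▷ 𝓕.mp f _ ≫
        (𝓕.mpCompAt f (q ≫ 𝓕.mp g r) (𝓕.ch g h t) p).hom ▷ 𝓕.mp f _ ▷ 𝓕.mp f _ ≫
        (𝓕.mpCompAt f q (𝓕.mp g r) p).hom ▷ 𝓕.mp f _ ▷ 𝓕.mp f _ ▷ 𝓕.mp f _ =
      (𝓕.mpCompAt f (q ≫ 𝓕.mp g ((r ≫ 𝓕.mp h s) ≫ 𝓕.ch h k l)) (𝓕.ch g (h ≫ k) l) p).hom ▷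
          𝓕.mp f _ ≫
        (𝓕.mpCompAt f q (𝓕.mp g ((r ≫ 𝓕.mp h s) ≫ 𝓕.ch h k l)) p).hom ▷ 𝓕.mp f _ ▷ 𝓕.mp f _ ≫
        (mpMpCompAt f g (r ≫ 𝓕.mp h s) (𝓕.ch h k l) (p ≫ 𝓕.mp f q)).hom ▷ 𝓕.mp f _ ▷ 𝓕.mp f _ ≫
        (mpMpCompAt f g r (𝓕.mp h s) (p ≫ 𝓕.mp f q)).hom ▷ 𝓕.mp f _ ▷ 𝓕.mp f _ ▷ 𝓕.mp f _ ≫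
        (𝓕.mpOmegaAt f g h k _).hom ≫
        (mpChNatAt f g h s ((p ≫ 𝓕.mp f q) ≫ 𝓕.mp f (𝓕.mp g r))).hom ▷ 𝓕.mp f _ := by
  have e₁ := congrArg (· ▷ 𝓕.mp f (𝓕.ch (g ≫ h) k l))
    (whiskerLeft_map₂_chNatAt f g h p (q ≫ 𝓕.mp g r) s)
  have e₂ := actAt_omegaAt f g h k p ((q ≫ 𝓕.mp g r) ≫ 𝓕.mp g (𝓕.mp h s))
  have e₃ := congrArg (· ▷ 𝓕.mp f (𝓕.ch (g ≫ h) k l))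
    (mpChNatAt_nat f g h s (𝓕.mpCompAt f q (𝓕.mp g r) p).hom)
  have e₄ := congrArg (· ▷ 𝓕.mp f (𝓕.st (α_ g h k).inv l))
    (mpCompAt_map₂_left f (𝓕.mpCompAt g (r ≫ 𝓕.mp h s) (𝓕.ch h k l) q).hom
      (𝓕.ch g (h ≫ k) l) p)
  have e₅ := congrArg (· ▷ 𝓕.mp f (𝓕.st (α_ g h k).inv l))
    (mpCompAt_map₂_left f ((𝓕.mpCompAt g r (𝓕.mp h s) q).hom ▷ 𝓕.mp g (𝓕.ch h k l))
      (𝓕.ch g (h ≫ k) l) p)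
  have e₆ := congrArg (· ▷ 𝓕.mp f (𝓕.ch g (h ≫ k) l) ▷ 𝓕.mp f (𝓕.st (α_ g h k).inv l))
    (mpCompAt_map₂_left f (𝓕.mpCompAt g r (𝓕.mp h s) q).hom (𝓕.mp g (𝓕.ch h k l)) p)
  have e₇ := congrArg (· ▷ 𝓕.mp f (𝓕.ch g (h ≫ k) l) ▷ 𝓕.mp f (𝓕.st (α_ g h k).inv l))
    (whiskerLeft_map₂_mpCompAt f g p q (r ≫ 𝓕.mp h s) (𝓕.ch h k l))
  have e₈ := congrArg (fun m => m ▷ 𝓕.mp f (𝓕.mp g (𝓕.ch h k l)) ▷ 𝓕.mp f (𝓕.ch g (h ≫ k) l) ▷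
    𝓕.mp f (𝓕.st (α_ g h k).inv l)) (whiskerLeft_map₂_mpCompAt f g p q r (𝓕.mp h s))
  have e₁₀ := mpOmegaAt_nat f g h k (𝓕.mpCompAt f (q ≫ 𝓕.mp g r) (𝓕.mp g (𝓕.mp h s)) p).hom
  have e₉ := mpOmegaAt_nat f g h k
    ((𝓕.mpCompAt f q (𝓕.mp g r) p).hom ▷ 𝓕.mp f (𝓕.mp g (𝓕.mp h s)))
  simp only [comp_whiskerRight, Category.assoc] at e₁ e₃ e₄ e₅ e₆ e₇ e₈
  rw [assocAt, ← map₂_actAt, ← map₂_actAt, actAt_comp]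
  simp only [Category.assoc]
  rw [reassoc_of% mpCompAt_map₂_left, reassoc_of% e₁, e₃, reassoc_of% e₂, reassoc_of% e₁₀, reassoc_of% e₉,
    reassoc_of% e₅, reassoc_of% e₄, reassoc_of% e₆, reassoc_of% e₈, reassoc_of% e₇]

/-- The unit constraint `f ∘ 1 ⟶ f`, left-bracketed. -/
def unitRAt (f : a ⟶ b) (p : y ⟶ 𝓕.ob f x) :
    ((𝓕.cu a y ≫ 𝓕.mp (𝟙 a) p) ≫ 𝓕.ch (𝟙 a) f x) ≫ 𝓕.st (λ_ f).hom x ⟶ p :=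
  (𝓕.cuNat a p).inv ▷ 𝓕.ch (𝟙 a) f x ▷ 𝓕.st (λ_ f).hom x ≫ (𝓕.deltaAt f p).hom

theorem actAt_unitRAt (f : a ⟶ b) (g : b ⟶ c) (p : y ⟶ 𝓕.ob f x) (q : x ⟶ 𝓕.ob g z) :
    actAt f p (unitRAt g q) =
      (𝓕.mpCompAt f (𝓕.cu b x ≫ 𝓕.mp (𝟙 b) q) (𝓕.ch (𝟙 b) g z) p).hom ▷ 𝓕.mp f _ ≫
        (𝓕.mpCompAt f (𝓕.cu b x) (𝓕.mp (𝟙 b) q) p).hom ▷ 𝓕.mp f _ ▷ 𝓕.mp f _ ≫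
        (mpCuNatAt f q p).inv ▷ 𝓕.mp f _ ▷ 𝓕.mp f _ ≫ (𝓕.mpDeltaAt f g (p ≫ 𝓕.mp f q)).hom := by
  rw [unitRAt, ← map₂_actAt, actAt_deltaAt, mpCuNatAt]
  have e₁ := congrArg (· ▷ 𝓕.mp f (𝓕.st (λ_ g).hom z))
    (mpCompAt_map₂_left f (𝓕.cuNat b q).inv (𝓕.ch (𝟙 b) g z) p)
  simp only [comp_whiskerRight, Category.assoc] at e₁
  simp only [Iso.trans_inv, Iso.symm_inv, whiskerLeftIso_inv, Functor.mapIso_inv,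
    PrelaxFunctor.mapFunctor_map, comp_whiskerRight, Category.assoc]
  rw [reassoc_of% e₁, hom_inv_whiskerRight_whiskerRight_assoc]

end AssocAt

namespace Tot

section HC

variable {y : 𝓕.fib a} {x : 𝓕.fib b} {z : 𝓕.fib c} [HasXi 𝓕]

theorem assocC_eq (f : a ⟶ b) (g : b ⟶ c) (h : c ⟶ d) {t : 𝓕.fib d} (p : y ⟶ 𝓕.ob f x)
    (q : x ⟶ 𝓕.ob g z) (r : z ⟶ 𝓕.ob h t) :
    assocC f g h p q r = cell (α_ f g h).inv (assocAt f g h p q r) := by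
  simp [assocC, omegaC, assocAt]

theorem unitRC_eq (f : a ⟶ b) (p : y ⟶ 𝓕.ob f x) :
    unitRC f p = cell (λ_ f).hom (unitRAt f p) := by
  simp [unitRC, unitRAt, deltaC]

/-- Axiom (C8), whiskered with the composite of `p` and `f^*q`. The modification axiom of `γ` at `q`
supplies the naturality cells of `χ` and of `(ρ_ f).hom^*`; the image under `f^*` of the naturality
of the unit `χ` occurs on both sides. -/
theorem hC_triangle (M : HasModifications 𝓕) (T : TotAxioms 𝓕) (f : a ⟶ b) (g : b ⟶ c) (p : y ⟶ 𝓕.ob f x)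
    (q : x ⟶ 𝓕.ob g z) :
    assocC f (𝟙 b) g p (𝓕.cu b x) q ≫ hC (ρ_ f).hom (𝟙 g) (𝓕.gammaAt f p).hom (𝓕.xiIdAt g q).inv =
      hC (𝟙 f) (λ_ g).hom (𝓕.xiIdAt f p).inv (unitRAt g q) := by
  have e₁ := congrArg (fun m => ver (m ▷ 𝓕.ch f g z)) (M.gammaAt_stNatAt f q p)
  have e₂ := congrArg (fun m => ver (m ▷ 𝓕.ch f g z)) (actAt_unitRAt f g p q)
  have e₃ := T.omega_triangle f g (p ≫ 𝓕.mp f q)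
  simp only [comp_whiskerRight, ← ver_comp_ver, Category.assoc] at e₁ e₂
  rw [← e₁, ← reassoc_of% ver_comp_chiRC, ← reassoc_of% ver_comp_chiRC, ← reassoc_of% ver_comp_omegaC] at e₃
  rw [hC_id_left M, hC_id_right, assocC, e₂, ← reassoc_of% ver_comp_chiLC, ← reassoc_of% ver_comp_chiLC,
    ← reassoc_of% ver_comp_chiLC, ← e₃]
  simp

/-- Axiom (C6), whiskered with the composite of `p`, `q`, `r`, `s`. The modification axiom of `ω` at
`s` moves `ω_{h,g,f}` past the last 1-cell, and compatibility of `χ` with composition distributes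
its naturality cell over the three factors of the composite of `r` and `s`. All other steps are
naturality in the whiskering 1-cell. -/
theorem hC_pentagon (M : HasModifications 𝓕) (T : TotAxioms 𝓕) (f : a ⟶ b) (g : b ⟶ c) (h : c ⟶ d) (k : d ⟶ e)
    {t : 𝓕.fib d} {l : 𝓕.fib e} (p : y ⟶ 𝓕.ob f x) (q : x ⟶ 𝓕.ob g z) (r : z ⟶ 𝓕.ob h t)
    (s : t ⟶ 𝓕.ob k l) :
    hC (𝟙 f) (α_ g h k).inv (𝓕.xiIdAt f p).inv (assocAt g h k q r s) ≫
        assocC f (g ≫ h) k p ((q ≫ 𝓕.mp g r) ≫ 𝓕.ch g h t) s ≫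
        hC (α_ f g h).inv (𝟙 k) (assocAt f g h p q r) (𝓕.xiIdAt k s).inv =
      assocC f g (h ≫ k) p q ((r ≫ 𝓕.mp h s) ≫ 𝓕.ch h k l) ≫
        assocC (f ≫ g) h k ((p ≫ 𝓕.mp f q) ≫ 𝓕.ch f g z) r s := by
  have e₁ := congrArg (fun m => ver (m ▷ 𝓕.ch f ((g ≫ h) ≫ k) l)) (actAt_assocAt f g h k p q r s)
  have e₂ := congrArg (fun m => ver (m ▷ 𝓕.ch ((f ≫ g) ≫ h) k l))
    (M.omegaAt_chNatAt f g h s ((p ≫ 𝓕.mp f q) ≫ 𝓕.mp f (𝓕.mp g r)))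
  have e₃ := T.omega_pentagon f g h k (((p ≫ 𝓕.mp f q) ≫ 𝓕.mp f (𝓕.mp g r)) ≫
    𝓕.mp f (𝓕.mp g (𝓕.mp h s)))
  have e₄ := congrArg (fun m => ver (m ▷ 𝓕.ch (f ≫ g) (h ≫ k) l))
    (chNatAt_comp f g (r ≫ 𝓕.mp h s) (𝓕.ch h k l) (p ≫ 𝓕.mp f q))
  have e₅ := congrArg (fun m => ver (m ▷ 𝓕.mp (f ≫ g) (𝓕.ch h k l) ▷ 𝓕.ch (f ≫ g) (h ≫ k) l))
    (chNatAt_comp f g r (𝓕.mp h s) (p ≫ 𝓕.mp f q))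
  have n₁ := congrArg (fun m => ver (m ▷ 𝓕.ch ((f ≫ g) ≫ h) k l)) (stNatAt_nat (α_ f g h).inv s
    ((𝓕.mpCompAt f (q ≫ 𝓕.mp g r) (𝓕.ch g h t) p).hom ▷ 𝓕.ch f (g ≫ h) t))
  have n₂ := congrArg (fun m => ver (m ▷ 𝓕.ch ((f ≫ g) ≫ h) k l)) (stNatAt_nat (α_ f g h).inv s
    ((𝓕.mpCompAt f q (𝓕.mp g r) p).hom ▷ 𝓕.mp f (𝓕.ch g h t) ▷ 𝓕.ch f (g ≫ h) t))
  have n₃ := congrArg (fun m => ver (m ▷ 𝓕.ch (f ≫ g ≫ h) k l)) (chNatAt_nat f (g ≫ h) s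
    (𝓕.mpCompAt f (q ≫ 𝓕.mp g r) (𝓕.ch g h t) p).hom)
  have n₄ := congrArg (fun m => ver (m ▷ 𝓕.ch (f ≫ g ≫ h) k l)) (chNatAt_nat f (g ≫ h) s
    ((𝓕.mpCompAt f q (𝓕.mp g r) p).hom ▷ 𝓕.mp f (𝓕.ch g h t)))
  have n₅ := congrArg (fun m => ver (m ▷ 𝓕.ch (f ≫ g) (h ≫ k) l)) (chNatAt_nat f g (𝓕.ch h k l)
    (mpMpCompAt f g r (𝓕.mp h s) (p ≫ 𝓕.mp f q)).hom)
  have n₆ := congrArg (fun m => ver (m ▷ 𝓕.ch ((f ≫ g) ≫ h) k l)) (chNatAt_nat (f ≫ g) h s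
    (𝓕.chNatAt f g r (p ≫ 𝓕.mp f q)).hom)
  simp only [comp_whiskerRight, ← ver_comp_ver, Category.assoc] at e₁ e₂ e₄ e₅ n₁ n₂ n₃ n₄ n₅ n₆
  rw [hC_id_left M, hC_id_right, assocC, assocC, assocC, assocAt.eq_def (p := p)]
  simp only [Category.assoc, comp_whiskerRight, ← ver_comp_ver]
  rw [← reassoc_of% n₁, ← reassoc_of% ver_comp_chiRC, ← reassoc_of% n₃, ← reassoc_of% ver_comp_omegaC,
    ← reassoc_of% n₂, ← reassoc_of% ver_comp_chiRC, ← reassoc_of% n₄, ← reassoc_of% ver_comp_omegaC,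
    reassoc_of% e₁]
  rw [reassoc_of% ver_comp_omegaC, reassoc_of% ver_comp_chiRC, reassoc_of% ver_comp_chiRC, ← reassoc_of% e₂]
  rw [← reassoc_of% ver_comp_chiLC, ← reassoc_of% ver_comp_chiLC, ← reassoc_of% ver_comp_chiLC,
    ← reassoc_of% ver_comp_chiLC, ← reassoc_of% e₃]
  rw [← reassoc_of% e₄, ← reassoc_of% e₅, ← reassoc_of% n₅]
  simp only [reassoc_of% ver_comp_omegaC, n₆]

end HC

end Tot

end Data

end LaxBidiag

/-! ### The Grothendieck construction is a bicategory. -/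

namespace LaxBidiag

open Data Tot

variable {B : Type u} [Bicategory.{w, v} B] {𝓕 : Data.{w, v, u, w₁, v₁, u₁} B}

namespace Data.Tot

variable {a b c d : B} {y : 𝓕.fib a} {x : 𝓕.fib b} {z : 𝓕.fib c} [HasXi 𝓕]

/-- Both cells give the same 2-cell of `Tot` over one base 2-cell, hence coincide. The
left-bracketed forms can then stand for the original definitions inside other composites. -/
theorem assocFib_eq (f : a ⟶ b) (g : b ⟶ c) (h : c ⟶ d) {t : 𝓕.fib d} (p : y ⟶ 𝓕.ob f x)
    (q : x ⟶ 𝓕.ob g z) (r : z ⟶ 𝓕.ob h t) : 𝓕.assocFib f g h p q r = assocAt f g h p q r :=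
  cell_injective ((cell_assocFib f g h p q r).trans (assocC_eq f g h p q r))

theorem unitLFib_eq (f : a ⟶ b) (p : y ⟶ 𝓕.ob f x) : 𝓕.unitLFib f p = (𝓕.gammaAt f p).hom :=
  cell_injective (cell_unitLFib f p)

theorem unitRFib_eq (f : a ⟶ b) (p : y ⟶ 𝓕.ob f x) : 𝓕.unitRFib f p = unitRAt f p :=
  cell_injective ((cell_unitRFib f p).trans (unitRC_eq f p))

theorem hC_eq {f g : a ⟶ b} {f' g' : b ⟶ c} (α : f ⟶ g) (α' : f' ⟶ g')
    {p : y ⟶ 𝓕.ob f x} {q : y ⟶ 𝓕.ob g x} {p' : x ⟶ 𝓕.ob f' z} {q' : x ⟶ 𝓕.ob g' z}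
    (φ : p ≫ 𝓕.st α x ⟶ q) (φ' : p' ≫ 𝓕.st α' z ⟶ q') :
    hC α α' φ φ' = cell (hc α α') (hcFib α α' φ φ') := by
  rw [hC, chiC, cell_comp_ver, hcFib]

theorem hcompFib_eq {f g : a ⟶ b} {f' g' : b ⟶ c} (α : f ⟶ g) (α' : f' ⟶ g')
    {p : y ⟶ 𝓕.ob f x} {q : y ⟶ 𝓕.ob g x} {p' : x ⟶ 𝓕.ob f' z} {q' : x ⟶ 𝓕.ob g' z}
    (φ : p ≫ 𝓕.st α x ⟶ q) (φ' : p' ≫ 𝓕.st α' z ⟶ q') :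
    𝓕.hcompFib α α' φ φ' = hcFib α α' φ φ' :=
  cell_injective ((cell_hcompFib α α' φ φ').trans (hC_eq α α' φ φ'))

instance isIso_assocAt (f : a ⟶ b) (g : b ⟶ c) (h : c ⟶ d) {t : 𝓕.fib d} (p : y ⟶ 𝓕.ob f x)
    (q : x ⟶ 𝓕.ob g z) (r : z ⟶ 𝓕.ob h t) : IsIso (assocAt f g h p q r) := by
  unfold assocAt
  infer_instance

instance isIso_unitRAt (f : a ⟶ b) (p : y ⟶ 𝓕.ob f x) : IsIso (unitRAt f p) := by
  unfold unitRAt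
  infer_instance

end Data.Tot

namespace Obj

/-- A 1-cell of the Grothendieck construction as an object of a category of 1-cells. -/
abbrev Hom₁.tot {X Y : Obj 𝓕} (p : Hom₁ X Y) : 𝓕.Tot X.fib Y.fib := 𝓕.tob p.base p.fib

variable [HasXi 𝓕]

/-- A 2-cell of the Grothendieck construction as a morphism of a category of 1-cells. -/
def Hom₂.tot {X Y : Obj 𝓕} {p q : Hom₁ X Y} (s : Hom₂ p q) : p.tot ⟶ q.tot :=
  cell s.base s.fib

theorem Hom₂.tot_injective {X Y : Obj 𝓕} {p q : Hom₁ X Y} {s t : Hom₂ p q}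
    (h : s.tot = t.tot) : s = t := by
  obtain ⟨α, φ⟩ := s
  obtain ⟨β, ψ⟩ := t
  obtain rfl : α = β := by
    simpa only [Hom₂.tot, cell_base] using congrArg Tot.Hom.base h
  obtain rfl : φ = ψ := cell_injective h
  rfl

/-- The 2-cell of the Grothendieck construction given by a morphism of a category of 1-cells. -/
def Hom₂.ofTot {X Y : Obj 𝓕} {p q : Hom₁ X Y} (m : p.tot ⟶ q.tot) : Hom₂ p q :=
  ⟨Tot.Hom.base m, Tot.Hom.fib m⟩

theorem Hom₂.tot_ofTot {X Y : Obj 𝓕} {p q : Hom₁ X Y} (m : p.tot ⟶ q.tot) :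
    (Hom₂.ofTot m).tot = m :=
  (cell_surj m).symm

theorem tot_id₂ {X Y : Obj 𝓕} (p : Hom₁ X Y) : (id₂ p).tot = 𝟙 p.tot := by
  change cell (𝟙 p.base) (𝓕.idFib p.base p.fib) = 𝟙 p.tot
  rw [idFib_eq, ← ver_id, ver, Category.comp_id]

theorem tot_comp₂ {X Y : Obj 𝓕} {p q r : Hom₁ X Y} (s : Hom₂ p q) (t : Hom₂ q r) :
    (comp₂ s t).tot = s.tot ≫ t.tot := by
  change cell (s.base ≫ t.base) (𝓕.vcompFib s.base t.base s.fib t.fib) = _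
  rw [vcompFib_eq, Hom₂.tot, Hom₂.tot, cell_comp]

theorem tot_hcomp₂ {X Y Z : Obj 𝓕} {p q : Hom₁ X Y} {p' q' : Hom₁ Y Z} (s : Hom₂ p q)
    (s' : Hom₂ p' q') : (hcomp₂ s s').tot = hC s.base s'.base s.fib s'.fib :=
  cell_hcompFib s.base s'.base s.fib s'.fib

theorem tot_assoc₂ {X Y Z T : Obj 𝓕} (p : Hom₁ X Y) (q : Hom₁ Y Z) (r : Hom₁ Z T) :
    (assoc₂ p q r).tot = assocC p.base q.base r.base p.fib q.fib r.fib :=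
  cell_assocFib p.base q.base r.base p.fib q.fib r.fib

theorem tot_unitL₂ {X Y : Obj 𝓕} (p : Hom₁ X Y) : (unitL₂ p).tot = gammaC p.base p.fib :=
  cell_unitLFib p.base p.fib

theorem tot_unitR₂ {X Y : Obj 𝓕} (p : Hom₁ X Y) : (unitR₂ p).tot = unitRC p.base p.fib :=
  cell_unitRFib p.base p.fib

theorem exists_inverse {X Y : Obj 𝓕} {p q : Hom₁ X Y} (s : Hom₂ p q) [IsIso s.tot] :
    ∃ i : Hom₂ q p, comp₂ s i = id₂ p ∧ comp₂ i s = id₂ q := by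
  refine ⟨Hom₂.ofTot (inv s.tot), Hom₂.tot_injective ?_, Hom₂.tot_injective ?_⟩ <;>
    simp [tot_comp₂, tot_id₂, Hom₂.tot_ofTot]

end Obj

open Obj

/-- Every axiom is an equation in a category `Tot`. The category laws there need only (C1) and (C2);
the constraints are invertible as cells with invertible base and invertible fibre component. -/
theorem IsLaxBidiagram.isBicategory (H : IsLaxBidiagram 𝓕) : IsBicategory 𝓕 := by
  have := H.hasXi
  have M := H.hasModifications
  have T := totAxioms H
  constructor
  · intro X Y p q s
    exact Hom₂.tot_injective (by rw [tot_comp₂, tot_id₂, Category.id_comp])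
  · intro X Y p q s
    exact Hom₂.tot_injective (by rw [tot_comp₂, tot_id₂, Category.comp_id])
  · intro X Y p q r t s₁ s₂ s₃
    exact Hom₂.tot_injective (by simp only [tot_comp₂, Category.assoc])
  · intro X Y Z p q
    refine Hom₂.tot_injective ?_
    rw [tot_hcomp₂, tot_id₂]
    simp only [id₂_base, id₂_fib, idFib_eq]
    exact hC_id M T p.base q.base p.fib q.fib
  · intro X Y Z p q r p' q' r' s₁ s₂ t₁ t₂
    refine Hom₂.tot_injective ?_
    rw [tot_comp₂, tot_hcomp₂, tot_hcomp₂, tot_hcomp₂]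
    simp only [comp₂_base, comp₂_fib, vcompFib_eq]
    exact (hC_comp M T s₁.base s₂.base t₁.base t₂.base s₁.fib t₁.fib s₂.fib t₂.fib).symm
  · intro X Y Z W p q r
    have : IsIso (assoc₂ p q r).tot := by
      rw [tot_assoc₂, assocC_eq]
      exact isIso_cell
    exact exists_inverse _
  · intro X Y p
    have : IsIso (unitL₂ p).tot := by
      rw [tot_unitL₂, gammaC]
      exact isIso_cell
    exact exists_inverse _
  · intro X Y p
    have : IsIso (unitR₂ p).tot := by
      rw [tot_unitR₂, unitRC_eq]
      exact isIso_cell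
    exact exists_inverse _
  · intro X Y Z W p p' q q' r r' s s' s''
    refine Hom₂.tot_injective ?_
    rw [tot_comp₂, tot_comp₂, tot_hcomp₂, tot_hcomp₂, tot_assoc₂, tot_assoc₂]
    simp only [hcomp₂_base, hcomp₂_fib, hcompFib_eq]
    exact assoc_natural M T s.base s'.base s''.base s.fib s'.fib s''.fib
  · intro X Y p q s
    refine Hom₂.tot_injective ?_
    rw [tot_comp₂, tot_comp₂, tot_hcomp₂, tot_unitL₂, tot_unitL₂]
    simp only [id₂_base, id₂_fib, idFib_eq]
    exact gamma_natural T s.base s.fib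
  · intro X Y p q s
    refine Hom₂.tot_injective ?_
    rw [tot_comp₂, tot_comp₂, tot_hcomp₂, tot_unitR₂, tot_unitR₂]
    simp only [id₂_base, id₂_fib, idFib_eq]
    exact delta_natural M T s.base s.fib
  · intro X Y Z W U p q r t
    refine Hom₂.tot_injective ?_
    simp only [tot_comp₂, tot_hcomp₂, tot_assoc₂, id₂_base, id₂_fib, idFib_eq, assoc₂_base,
      assoc₂_fib, assocFib_eq]
    exact hC_pentagon M T p.base q.base r.base t.base p.fib q.fib r.fib t.fib
  · intro X Y Z p q
    refine Hom₂.tot_injective ?_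
    simp only [tot_comp₂, tot_hcomp₂, tot_assoc₂, id₂_base, id₂_fib, idFib_eq, unitL₂_base,
      unitL₂_fib, unitR₂_base, unitR₂_fib, unitLFib_eq, unitRFib_eq]
    exact hC_triangle M T p.base q.base p.fib q.fib

end LaxBidiag

/-! ### Calculus of invertible modifications. -/

namespace LaxBidiag

section Modifications

variable {C : Type u} [Bicategory.{w, v} C] {D : Type u₁} [Bicategory.{w₁, v₁} D]
  {E : Type u₂} [Bicategory.{w₂, v₂} E]

theorem map₂_associator_inv' (P : D ⥤ᵖ E) {x y z t : D} (p : x ⟶ y) (q : y ⟶ z) (r : z ⟶ t) :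
    P.map₂ (α_ p q r).inv = (P.mapComp p (q ≫ r)).hom ≫ P.map p ◁ (P.mapComp q r).hom ≫
      (α_ (P.map p) (P.map q) (P.map r)).inv ≫ (P.mapComp p q).inv ▷ P.map r ≫
        (P.mapComp (p ≫ q) r).inv := by
  rw [← cancel_epi (P.map₂ (α_ p q r).hom), ← PrelaxFunctor.map₂_comp]
  simp [Pseudofunctor.map₂_associator]

theorem map₂_leftUnitor_inv' (P : D ⥤ᵖ E) {x y : D} (p : x ⟶ y) :
    P.map₂ (λ_ p).inv = (λ_ (P.map p)).inv ≫ (P.mapId x).inv ▷ P.map p ≫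
      (P.mapComp (𝟙 x) p).inv := by
  rw [← cancel_epi (P.map₂ (λ_ p).hom), ← PrelaxFunctor.map₂_comp]
  simp [Pseudofunctor.map₂_left_unitor]

/-- An invertible modification. -/
structure ModIso {F G : C ⥤q D} (s t : TransData F G) where
  /-- the components -/
  app (x : C) : s.app x ≅ t.app x
  isModification : IsModification s t app

namespace ModIso

variable {F G H : C ⥤q D}

/-- The identity modification. -/
@[simps]
def refl (s : TransData F G) : ModIso s s where
  app x := Iso.refl (s.app x)
  isModification := by
    intro x y u
    simp

/-- Composition of modifications. -/
@[simps]
def trans {r s t : TransData F G} (m : ModIso r s) (n : ModIso s t) : ModIso r t where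
  app x := m.app x ≪≫ n.app x
  isModification := by
    intro x y u
    have e₁ := m.isModification u
    have e₂ := n.isModification u
    simp [e₂, reassoc_of% e₁]

/-- The inverse modification. -/
@[simps]
def symm {s t : TransData F G} (m : ModIso s t) : ModIso t s where
  app x := (m.app x).symm
  isModification := by
    intro x y u
    have e := m.isModification u
    rw [← cancel_epi (F.map u ◁ (m.app y).hom)]
    simp [reassoc_of% e]

/-- Whiskering of a modification on the left. -/
@[simps]
def compLeft (s : TransData F G) {t t' : TransData G H} (m : ModIso t t') :
    ModIso (s.comp t) (s.comp t') where
  app x := whiskerLeftIso (s.app x) (m.app x)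
  isModification := by
    intro x y u
    have e := m.isModification u
    calc
      _ = 𝟙 _ ⊗≫ (F.map u ≫ s.app y) ◁ (m.app y).hom ⊗≫ ((s.nat u).hom ▷ t'.app y) ⊗≫
          s.app x ◁ (t'.nat u).hom ⊗≫ 𝟙 _ := by
        simp only [TransData.comp, Iso.trans_hom, whiskerLeftIso_hom, whiskerRightIso_hom,
          Iso.symm_hom]
        bicategory
      _ = 𝟙 _ ⊗≫ ((F.map u ≫ s.app y) ◁ (m.app y).hom ≫ ((s.nat u).hom ▷ t'.app y)) ⊗≫
          s.app x ◁ (t'.nat u).hom ⊗≫ 𝟙 _ := by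
        bicategory
      _ = 𝟙 _ ⊗≫ (s.nat u).hom ▷ t.app y ⊗≫ s.app x ◁ (G.map u ◁ (m.app y).hom ≫
          (t'.nat u).hom) ⊗≫ 𝟙 _ := by
        rw [whisker_exchange]
        bicategory
      _ = _ := by
        rw [e]
        simp only [TransData.comp, Iso.trans_hom, whiskerLeftIso_hom, whiskerRightIso_hom,
          Iso.symm_hom]
        bicategory

/-- Whiskering of a modification on the right. -/
@[simps]
def compRight {s s' : TransData F G} (m : ModIso s s') (t : TransData G H) :
    ModIso (s.comp t) (s'.comp t) where
  app x := whiskerRightIso (m.app x) (t.app x)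
  isModification := by
    intro x y u
    have e := m.isModification u
    calc
      _ = 𝟙 _ ⊗≫ (F.map u ◁ (m.app y).hom ≫ (s'.nat u).hom) ▷ t.app y ⊗≫
          s'.app x ◁ (t.nat u).hom ⊗≫ 𝟙 _ := by
        simp only [TransData.comp, Iso.trans_hom, whiskerLeftIso_hom, whiskerRightIso_hom,
          Iso.symm_hom]
        bicategory
      _ = 𝟙 _ ⊗≫ (s.nat u).hom ▷ t.app y ⊗≫ ((m.app x).hom ▷ (G.map u ≫ t.app y) ≫
          s'.app x ◁ (t.nat u).hom) ⊗≫ 𝟙 _ := by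
        rw [e]
        bicategory
      _ = _ := by
        rw [← whisker_exchange]
        simp only [TransData.comp, Iso.trans_hom, whiskerLeftIso_hom, whiskerRightIso_hom,
          Iso.symm_hom]
        bicategory

/-- The associativity constraint of composition of transformations. -/
@[simps]
def assoc {K : C ⥤q D} (r : TransData F G) (s : TransData G H) (t : TransData H K) :
    ModIso ((r.comp s).comp t) (r.comp (s.comp t)) where
  app x := α_ (r.app x) (s.app x) (t.app x)
  isModification := by
    intro x y u
    simp only [TransData.comp, Iso.trans_hom, whiskerLeftIso_hom, whiskerRightIso_hom,
      Iso.symm_hom]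
    bicategory

/-- The unit constraint of composition of transformations. -/
@[simps]
def idComp (t : TransData F G) : ModIso ((TransData.id F).comp t) t where
  app x := λ_ (t.app x)
  isModification := by
    intro x y u
    simp only [TransData.comp, TransData.id, Iso.trans_hom, whiskerLeftIso_hom,
      whiskerRightIso_hom, Iso.symm_hom]
    bicategory

/-- The unit constraint of composition of transformations. -/
@[simps]
def compId (t : TransData F G) : ModIso (t.comp (TransData.id G)) t where
  app x := ρ_ (t.app x)
  isModification := by
    intro x y u
    simp only [TransData.comp, TransData.id, Iso.trans_hom, whiskerLeftIso_hom,
      whiskerRightIso_hom, Iso.symm_hom]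
    bicategory

/-- Restriction of a modification. -/
@[simps]
def precomp {s t : TransData F G} (m : ModIso s t) (K : E ⥤q C) :
    ModIso (s.precomp K) (t.precomp K) where
  app x := m.app (K.obj x)
  isModification _ _ u := m.isModification (K.map u)

/-- The image of a modification under a homomorphism. -/
@[simps]
def postcomp {s t : TransData F G} (m : ModIso s t) (P : D ⥤ᵖ E) :
    ModIso (s.postcomp P) (t.postcomp P) where
  app x := P.map₂Iso (m.app x)
  isModification := by
    intro x y u
    have e := congrArg P.map₂ (m.isModification u)
    simp only [PrelaxFunctor.map₂_comp, Pseudofunctor.map₂_whisker_left,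
      Pseudofunctor.map₂_whisker_right, Category.assoc] at e
    change P.map (F.map u) ◁ P.map₂ (m.app y).hom ≫ (P.mapComp (F.map u) (t.app y)).inv ≫
        P.map₂ (t.nat u).hom ≫ (P.mapComp (t.app x) (G.map u)).hom =
      ((P.mapComp (F.map u) (s.app y)).inv ≫ P.map₂ (s.nat u).hom ≫
        (P.mapComp (s.app x) (G.map u)).hom) ≫ P.map₂ (m.app x).hom ▷ P.map (G.map u)
    rw [← cancel_epi (P.mapComp (F.map u) (s.app y)).hom, reassoc_of% e]
    simp

/-- A homomorphism preserves composition of transformations. -/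
@[simps]
def postcompComp (s : TransData F G) (t : TransData G H) (P : D ⥤ᵖ E) :
    ModIso ((s.comp t).postcomp P) ((s.postcomp P).comp (t.postcomp P)) where
  app x := P.mapComp (s.app x) (t.app x)
  isModification := by
    intro x y u
    change P.map (F.map u) ◁ (P.mapComp (s.app y) (t.app y)).hom ≫ (α_ _ _ _).inv ≫
        ((P.mapComp (F.map u) (s.app y)).inv ≫ P.map₂ (s.nat u).hom ≫
          (P.mapComp (s.app x) (G.map u)).hom) ▷ P.map (t.app y) ≫ (α_ _ _ _).hom ≫
        P.map (s.app x) ◁ ((P.mapComp (G.map u) (t.app y)).inv ≫ P.map₂ (t.nat u).hom ≫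
          (P.mapComp (t.app x) (H.map u)).hom) ≫ (α_ _ _ _).inv =
      ((P.mapComp (F.map u) (s.app y ≫ t.app y)).inv ≫ P.map₂ ((α_ _ _ _).inv ≫
        (s.nat u).hom ▷ t.app y ≫ (α_ _ _ _).hom ≫ s.app x ◁ (t.nat u).hom ≫ (α_ _ _ _).inv) ≫
        (P.mapComp (s.app x ≫ t.app x) (H.map u)).hom) ≫
        (P.mapComp (s.app x) (t.app x)).hom ▷ P.map (H.map u)
    simp only [PrelaxFunctor.map₂_comp, Pseudofunctor.map₂_whisker_left,
      Pseudofunctor.map₂_whisker_right, Pseudofunctor.map₂_associator,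
      map₂_associator_inv']
    simp

/-- A homomorphism preserves identity transformations. -/
@[simps]
def postcompId (F : C ⥤q D) (P : D ⥤ᵖ E) :
    ModIso ((TransData.id F).postcomp P) (TransData.id (F ⋙q P.toPrefunctor)) where
  app x := P.mapId (F.obj x)
  isModification := by
    intro x y u
    change P.map (F.map u) ◁ (P.mapId (F.obj y)).hom ≫ (ρ_ (P.map (F.map u))).hom ≫
        (λ_ (P.map (F.map u))).inv =
      ((P.mapComp (F.map u) (𝟙 (F.obj y))).inv ≫ P.map₂ ((ρ_ (F.map u)).hom ≫
        (λ_ (F.map u)).inv) ≫ (P.mapComp (𝟙 (F.obj x)) (F.map u)).hom) ≫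
        (P.mapId (F.obj x)).hom ▷ P.map (F.map u)
    simp [Pseudofunctor.map₂_right_unitor, map₂_leftUnitor_inv']

end ModIso

end Modifications

end LaxBidiag

/-! ### The cells `ξ` and the modification axioms for the change of base. -/

namespace LaxBidiag

open Data

/-- A family is a modification as soon as its components agree with those of a pasting of
modifications. This is used when the agreement holds only up to coherence. -/
theorem ModIso.isModification_of_hom {C : Type u} [Bicategory.{w, v} C] {D : Type u₁}
    [Bicategory.{w₁, v₁} D] {F G : C ⥤q D} {s t : TransData F G} (n : ModIso s t)
    {m : ∀ x, s.app x ≅ t.app x} (h : ∀ x, (m x).hom = (n.app x).hom) : IsModification s t m := by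
  obtain rfl : m = n.app := funext fun x => Iso.ext (h x)
  exact n.isModification

namespace HasModifications

variable {B : Type u} [Bicategory.{w, v} B] {𝓕 : Data.{w, v, u, w₁, v₁, u₁} B}
  (H : HasModifications 𝓕)

variable {a b c d : B}

/-- The modification `ξ`. -/
@[simps]
def xiM {f g h : a ⟶ b} (α : f ⟶ g) (β : g ⟶ h) :
    ModIso ((TransData.of (𝓕.pull₂ α)).comp (TransData.of (𝓕.pull₂ β)))
      (TransData.of (𝓕.pull₂ (α ≫ β))) := ⟨_, H.xi_mod α β⟩

/-- The unit modification `ξ`. -/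
@[simps]
def xiIdM (f : a ⟶ b) : ModIso (TransData.id (𝓕.pull f).toPrefunctor)
    (TransData.of (𝓕.pull₂ (𝟙 f))) := ⟨_, H.xiId_mod f⟩

/-- The modification `θ^* ≅ τ^*` when `θ = τ`. -/
@[simps]
def stEqM (𝓕 : Data.{w, v, u, w₁, v₁, u₁} B) {f g : a ⟶ b} {θ τ : f ⟶ g} (e : θ = τ) :
    ModIso (TransData.of (𝓕.pull₂ θ)) (TransData.of (𝓕.pull₂ τ)) where
  app := 𝓕.stEq e
  isModification := by
    subst e
    exact (ModIso.refl _).isModification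

/-- The modification `β^* ∘ α^* ≅ θ^*` when `β · α = θ`. -/
@[simps]
def xi₂M {f g h : a ⟶ b} (α : f ⟶ g) (β : g ⟶ h) {θ : f ⟶ h} (e : α ≫ β = θ) :
    ModIso ((TransData.of (𝓕.pull₂ α)).comp (TransData.of (𝓕.pull₂ β)))
      (TransData.of (𝓕.pull₂ θ)) where
  app := 𝓕.xi₂ α β e
  isModification := ((H.xiM α β).trans (stEqM 𝓕 e)).isModification

/-- The modification `γ^* ∘ β^* ∘ α^* ≅ θ^*` when `γ · β · α = θ`. -/
@[simps]
def xi₃M {f g h k : a ⟶ b} (α : f ⟶ g) (β : g ⟶ h) (γ : h ⟶ k) {θ : f ⟶ k}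
    (e : α ≫ β ≫ γ = θ) :
    ModIso ((TransData.of (𝓕.pull₂ α)).comp ((TransData.of (𝓕.pull₂ β)).comp
      (TransData.of (𝓕.pull₂ γ)))) (TransData.of (𝓕.pull₂ θ)) where
  app := 𝓕.xi₃ α β γ e
  isModification := (((H.xiM β γ).compLeft _).trans (H.xi₂M α (β ≫ γ) e)).isModification

/-- The modification `χ_{β,α}`. -/
@[simps]
def chi₂M {f h : a ⟶ b} {g k : b ⟶ c} (α : f ⟶ h) (β : g ⟶ k) :
    ModIso ((TransData.of (𝓕.chi f g)).comp (TransData.of (𝓕.pull₂ (hc α β))))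
      ((((TransData.of (𝓕.pull₂ β)).postcomp (𝓕.pull f)).comp
        ((TransData.of (𝓕.pull₂ α)).precomp (𝓕.pull k).toPrefunctor)).comp
        (TransData.of (𝓕.chi h k))) := ⟨_, H.chi₂_mod α β⟩

/-- The modification `ω`. -/
@[simps]
def omegaM (f : a ⟶ b) (g : b ⟶ c) (h : c ⟶ d) :
    ModIso ((((TransData.of (𝓕.chi g h)).postcomp (𝓕.pull f)).comp
        (TransData.of (𝓕.chi f (g ≫ h)))).comp (TransData.of (𝓕.pull₂ (α_ f g h).inv)))
      (((TransData.of (𝓕.chi f g)).precomp (𝓕.pull h).toPrefunctor).comp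
        (TransData.of (𝓕.chi (f ≫ g) h))) := ⟨_, H.omega_mod f g h⟩

/-- The modification `γ`. -/
@[simps]
def gammaM (f : a ⟶ b) :
    ModIso ((((TransData.of (𝓕.chiId b)).postcomp (𝓕.pull f)).comp
        (TransData.of (𝓕.chi f (𝟙 b)))).comp (TransData.of (𝓕.pull₂ (ρ_ f).hom)))
      (TransData.id (𝓕.pull f).toPrefunctor) := ⟨_, H.gamma_mod f⟩

/-- The modification `δ`. -/
@[simps]
def deltaM (f : a ⟶ b) :
    ModIso ((((TransData.of (𝓕.chiId a)).precomp (𝓕.pull f).toPrefunctor).comp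
        (TransData.of (𝓕.chi (𝟙 a) f))).comp (TransData.of (𝓕.pull₂ (λ_ f).hom)))
      (TransData.id (𝓕.pull f).toPrefunctor) := ⟨_, H.delta_mod f⟩

/-- The modification `χ_{β,f}`. -/
@[simps]
def chiLM (f : a ⟶ b) {g k : b ⟶ c} (β : g ⟶ k) :
    ModIso ((TransData.of (𝓕.chi f g)).comp (TransData.of (𝓕.pull₂ (f ◁ β))))
      (((TransData.of (𝓕.pull₂ β)).postcomp (𝓕.pull f)).comp (TransData.of (𝓕.chi f k))) where
  app := 𝓕.chiL f β
  isModification := (((stEqM 𝓕 (show f ◁ β = hc (𝟙 f) β by simp [hc])).compLeft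
    (TransData.of (𝓕.chi f g))).trans ((H.chi₂M (𝟙 f) β).trans (((((H.xiIdM f).precomp (𝓕.pull k).toPrefunctor).symm.compLeft
      ((TransData.of (𝓕.pull₂ β)).postcomp (𝓕.pull f))).trans (ModIso.compId _)).compRight
        (TransData.of (𝓕.chi f k))))).isModification

/-- The modification `χ_{g,α}`. -/
@[simps]
def chiRM {f h : a ⟶ b} (α : f ⟶ h) (g : b ⟶ c) :
    ModIso ((TransData.of (𝓕.chi f g)).comp (TransData.of (𝓕.pull₂ (α ▷ g))))
      (((TransData.of (𝓕.pull₂ α)).precomp (𝓕.pull g).toPrefunctor).comp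
        (TransData.of (𝓕.chi h g))) where
  app := 𝓕.chiR α g
  isModification := (((stEqM 𝓕 (show α ▷ g = hc α (𝟙 g) by simp [hc])).compLeft
    (TransData.of (𝓕.chi f g))).trans ((H.chi₂M α (𝟙 g)).trans ((((((H.xiIdM g).symm.postcomp (𝓕.pull f)).trans
      (ModIso.postcompId (𝓕.pull g).toPrefunctor (𝓕.pull f))).compRight
        ((TransData.of (𝓕.pull₂ α)).precomp (𝓕.pull g).toPrefunctor)).trans
      (ModIso.idComp _)).compRight (TransData.of (𝓕.chi h g))))).isModification

end HasModifications

end LaxBidiag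

namespace LaxBidiag

open Data

variable {A : Type u₂} [Bicategory.{w₂, v₂} A] {B : Type u} [Bicategory.{w, v} B]
  {𝓕 : Data.{w, v, u, w₁, v₁, u₁} B} (F : A ⥤ᴸ B)

section Xi

variable {a b : B}

theorem xi₂_trans_stEq {f g h : a ⟶ b} (α : f ⟶ g) (β : g ⟶ h) {θ θ' : f ⟶ h} (e : α ≫ β = θ)
    (e' : θ = θ') (x : 𝓕.fib b) : 𝓕.xi₂ α β e x ≪≫ 𝓕.stEq e' x = 𝓕.xi₂ α β (e.trans e') x := by
  subst e'
  simp

/-- (C1) with every composite replaced by a 2-cell equal to it. The bases for `𝓕F` are of the form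
`F.map₂ (α ≫ β)`, equal to a composite only by an axiom of `F`. -/
theorem xi₂_assoc [HasXi 𝓕] {f g h k : a ⟶ b} (α : f ⟶ g) (β : g ⟶ h) (ζ : h ⟶ k) {θ₁ : f ⟶ h}
    {θ₂ : g ⟶ k} {θ : f ⟶ k} (e₁ : α ≫ β = θ₁) (e₂ : β ≫ ζ = θ₂) (e₃ : θ₁ ≫ ζ = θ)
    (e₄ : α ≫ θ₂ = θ) (x : 𝓕.fib b) :
    (𝓕.xi₂ α β e₁ x).hom ▷ 𝓕.st ζ x ≫ (𝓕.xi₂ θ₁ ζ e₃ x).hom =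
      (α_ (𝓕.st α x) (𝓕.st β x) (𝓕.st ζ x)).hom ≫ 𝓕.st α x ◁ (𝓕.xi₂ β ζ e₂ x).hom ≫
        (𝓕.xi₂ α θ₂ e₄ x).hom := by
  subst e₁ e₂ e₄
  simpa [xi₂_eq] using HasXi.xi_assoc α β ζ x

theorem xi₂_id_left [HasXi 𝓕] {f g : a ⟶ b} (α : f ⟶ g) {ι : f ⟶ f} (e : 𝟙 f = ι)
    (e' : ι ≫ α = α) (x : 𝓕.fib b) :
    (𝓕.xi₀ e x).hom ▷ 𝓕.st α x ≫ (𝓕.xi₂ ι α e' x).hom = (λ_ (𝓕.st α x)).hom := by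
  subst e
  simpa [xi₀_eq] using HasXi.xi_id_left α x

theorem xi₂_id_right [HasXi 𝓕] {f g : a ⟶ b} (α : f ⟶ g) {ι : g ⟶ g} (e : 𝟙 g = ι)
    (e' : α ≫ ι = α) (x : 𝓕.fib b) :
    𝓕.st α x ◁ (𝓕.xi₀ e x).hom ≫ (𝓕.xi₂ α ι e' x).hom = (ρ_ (𝓕.st α x)).hom := by
  subst e
  simpa [xi₀_eq] using HasXi.xi_id_right α x

end Xi

variable {a b c d : A}

theorem xi₂_comp {f g h : a ⟶ b} (α : f ⟶ g) (β : g ⟶ h) {θ : f ⟶ h} (e : α ≫ β = θ)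
    (x : 𝓕.fib (F.obj b)) : (𝓕.comp F).xi₂ α β e x =
      𝓕.xi₂ (F.map₂ α) (F.map₂ β) (by rw [← e, F.map₂_comp]) x :=
  xi₂_trans_stEq (F.map₂ α) (F.map₂ β) (F.map₂_comp α β).symm (congrArg F.map₂ e) x

instance hasXi_comp [HasXi 𝓕] : HasXi (𝓕.comp F) where
  xi_assoc {_ b f g h k} α β ζ x := by
    refine (congrArg (fun m => _ ≫ Iso.hom m) (xi₂_comp (𝓕 := 𝓕) F (α ≫ β) ζ
      (Category.assoc α β ζ) x)).trans ?_
    exact xi₂_assoc (F.map₂ α) (F.map₂ β) (F.map₂ ζ) (F.map₂_comp α β).symm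
      (F.map₂_comp β ζ).symm (by simp) (F.map₂_comp α (β ≫ ζ)).symm x
  xi_id_left {_ b f g} α x := by
    refine (congrArg (fun m => _ ≫ Iso.hom m) (xi₂_comp (𝓕 := 𝓕) F (𝟙 f) α
      (Category.id_comp α) x)).trans ?_
    exact xi₂_id_left (F.map₂ α) (F.map₂_id f).symm (by simp) x
  xi_id_right {_ b f g} α x := by
    refine (congrArg (fun m => _ ≫ Iso.hom m) (xi₂_comp (𝓕 := 𝓕) F α (𝟙 g)
      (Category.comp_id α) x)).trans ?_
    exact xi₂_id_right (F.map₂ α) (F.map₂_id g).symm (by simp) x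

/-- Replacing the middle of a composite of transformations. -/
def ModIso.middle {C : Type u} [Bicategory.{w, v} C] {D : Type u₁} [Bicategory.{w₁, v₁} D]
    {F G H K L M : C ⥤q D} {c : TransData G K} {θ : TransData K L} {t : TransData G H}
    {u : TransData H L} (s : TransData F G) (m : ModIso (c.comp θ) (t.comp u))
    (v : TransData L M) : ModIso ((s.comp c).comp (θ.comp v)) ((s.comp t).comp (u.comp v)) :=
  (ModIso.assoc _ _ _).trans ((((ModIso.assoc _ _ _).symm.trans ((m.compRight v).trans
    (ModIso.assoc _ _ _))).compLeft s).trans (ModIso.assoc _ _ _).symm)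

namespace HasModifications

/-- The defining pasting of `χ^{𝓕F}` is literally a composite of modifications, so no coherence
argument is needed. -/
theorem chi₂_mod_comp (H : HasModifications 𝓕) {f h : a ⟶ b} {g k : b ⟶ c} (α : f ⟶ h) (β : g ⟶ k) :
    IsModification ((TransData.of ((𝓕.comp F).chi f g)).comp
        (TransData.of ((𝓕.comp F).pull₂ (hc α β))))
      ((((TransData.of ((𝓕.comp F).pull₂ β)).postcomp ((𝓕.comp F).pull f)).comp
        ((TransData.of ((𝓕.comp F).pull₂ α)).precomp ((𝓕.comp F).pull k).toPrefunctor)).comp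
        (TransData.of ((𝓕.comp F).chi h k))) ((𝓕.comp F).chi₂ α β) :=
  (ModIso.trans (ModIso.assoc (TransData.of (𝓕.chi (F.map f) (F.map g)))
      (TransData.of (𝓕.pull₂ (F.mapComp f g))) (TransData.of (𝓕.pull₂ (F.map₂ (hc α β)))))
    ((((H.xi₂M (F.mapComp f g) (F.map₂ (hc α β)) rfl).trans
      (H.xi₂M (hc (F.map₂ α) (F.map₂ β)) (F.mapComp h k) (by simp [hc])).symm).compLeft _).trans
    ((ModIso.assoc _ _ _).symm.trans (((H.chi₂M (F.map₂ α) (F.map₂ β)).compRight _).trans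
      (ModIso.assoc _ _ _))))).isModification

theorem xi_mod_comp (H : HasModifications 𝓕) {f g h : a ⟶ b} (α : f ⟶ g) (β : g ⟶ h) :
    IsModification ((TransData.of ((𝓕.comp F).pull₂ α)).comp
      (TransData.of ((𝓕.comp F).pull₂ β))) (TransData.of ((𝓕.comp F).pull₂ (α ≫ β)))
      ((𝓕.comp F).xi α β) :=
  (H.xi₂M (F.map₂ α) (F.map₂ β) (F.map₂_comp α β).symm).isModification

theorem xiId_mod_comp (H : HasModifications 𝓕) (f : a ⟶ b) :
    IsModification (TransData.id ((𝓕.comp F).pull f).toPrefunctor)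
      (TransData.of ((𝓕.comp F).pull₂ (𝟙 f))) ((𝓕.comp F).xiId f) :=
  ((H.xiIdM (F.map f)).trans (stEqM 𝓕 (F.map₂_id f).symm)).isModification

/-- `ω^{𝓕F}` is defined with coherence cells filled in. The same pasting is built here from
modifications with explicit associators, and the components are compared. -/
theorem omega_mod_comp (H : HasModifications 𝓕) (f : a ⟶ b) (g : b ⟶ c) (h : c ⟶ d) :
    IsModification (((((TransData.of (𝓕.chi (F.map g) (F.map h))).comp
        (TransData.of (𝓕.pull₂ (F.mapComp g h)))).postcomp (𝓕.pull (F.map f))).comp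
        ((TransData.of (𝓕.chi (F.map f) (F.map (g ≫ h)))).comp
          (TransData.of (𝓕.pull₂ (F.mapComp f (g ≫ h)))))).comp
          (TransData.of (𝓕.pull₂ (F.map₂ (α_ f g h).inv))))
      (((TransData.of (𝓕.chi (F.map f) (F.map g))).precomp (𝓕.pull (F.map h)).toPrefunctor |>.comp
        ((TransData.of (𝓕.pull₂ (F.mapComp f g))).precomp (𝓕.pull (F.map h)).toPrefunctor)).comp
        ((TransData.of (𝓕.chi (F.map (f ≫ g)) (F.map h))).comp
          (TransData.of (𝓕.pull₂ (F.mapComp (f ≫ g) h))))) (𝓕.compOmega F f g h) := by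
  refine ModIso.isModification_of_hom
    ((((ModIso.postcompComp (TransData.of (𝓕.chi (F.map g) (F.map h)))
      (TransData.of (𝓕.pull₂ (F.mapComp g h))) (𝓕.pull (F.map f))).compRight _).compRight _).trans
    (((ModIso.assoc _ _ _).trans ((ModIso.assoc _ _ _).compLeft _)).trans
    (((H.chiLM (F.map f) (F.mapComp g h)).symm.middle _ _).trans
    (((H.xi₃M (F.map f ◁ F.mapComp g h) (F.mapComp f (g ≫ h)) (F.map₂ (α_ f g h).inv)
        rfl).trans (H.xi₃M (α_ (F.map f) (F.map g) (F.map h)).inv (F.mapComp f g ▷ F.map h)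
          (F.mapComp (f ≫ g) h) (by simp [LaxFunctor.mapComp_assoc_left])).symm).compLeft _ |>.trans
    ((ModIso.assoc _ _ _).symm.trans (((H.omegaM (F.map f) (F.map g) (F.map h)).compRight
      _).trans
    ((H.chiRM (F.mapComp f g) (F.map h)).middle _ _)))))))
    fun x => ?_
  -- The component of the composite modification written out; it differs from `compOmega` only by
  -- coherence cells.
  change (𝓕.compOmega F f g h x).hom = (𝓕.mpComp _ _ _).hom ▷ _ ▷ _ ≫ ((α_ _ _ _).hom ≫ _ ◁ (α_ _ _ _).hom) ≫
    ((α_ _ _ _).hom ≫ _ ◁ ((α_ _ _ _).inv ≫ (𝓕.chiL (F.map f) (F.mapComp g h) x).inv ▷ _ ≫ (α_ _ _ _).hom) ≫ (α_ _ _ _).inv) ≫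
    _ ◁ ((𝓕.xi₃ _ _ _ _ x).hom ≫ (𝓕.xi₃ _ _ _ _ x).inv) ≫ (α_ _ _ _).inv ≫
      (𝓕.omega (F.map f) (F.map g) (F.map h) x).hom ▷ _ ≫ ((α_ _ _ _).hom ≫
      _ ◁ ((α_ _ _ _).inv ≫ (𝓕.chiR (F.mapComp f g) (F.map h) x).hom ▷ _ ≫ (α_ _ _ _).hom) ≫
        (α_ _ _ _).inv)
  simp only [compOmega, bicategoricalIsoComp, Iso.trans_hom, whiskerLeftIso_hom, whiskerRightIso_hom,
    Iso.symm_hom, Iso.refl_hom, Iso.symm_inv]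
  bicategory

theorem gamma_mod_comp (H : HasModifications 𝓕) (f : a ⟶ b) :
    IsModification (((((TransData.of (𝓕.chiId (F.obj b))).comp
        (TransData.of (𝓕.pull₂ (F.mapId b)))).postcomp (𝓕.pull (F.map f))).comp
        ((TransData.of (𝓕.chi (F.map f) (F.map (𝟙 b)))).comp
          (TransData.of (𝓕.pull₂ (F.mapComp f (𝟙 b)))))).comp
          (TransData.of (𝓕.pull₂ (F.map₂ (ρ_ f).hom))))
      (TransData.id (𝓕.pull (F.map f)).toPrefunctor) (𝓕.compGamma F f) := by
  refine ModIso.isModification_of_hom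
    ((((ModIso.postcompComp (TransData.of (𝓕.chiId (F.obj b)))
      (TransData.of (𝓕.pull₂ (F.mapId b))) (𝓕.pull (F.map f))).compRight _).compRight _).trans
    (((ModIso.assoc _ _ _).trans ((ModIso.assoc _ _ _).compLeft _)).trans
    (((H.chiLM (F.map f) (F.mapId b)).symm.middle _ _).trans
    ((H.xi₃M (F.map f ◁ F.mapId b) (F.mapComp f (𝟙 b)) (F.map₂ (ρ_ f).hom)
        (F.map₂_rightUnitor_hom f).symm).compLeft _ |>.trans (H.gammaM (F.map f))))))
    fun x => ?_
  change (𝓕.compGamma F f x).hom = (𝓕.mpComp _ _ _).hom ▷ _ ▷ _ ≫ ((α_ _ _ _).hom ≫ _ ◁ (α_ _ _ _).hom) ≫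
    ((α_ _ _ _).hom ≫ _ ◁ ((α_ _ _ _).inv ≫ (𝓕.chiL (F.map f) (F.mapId b) x).inv ▷ _ ≫ (α_ _ _ _).hom) ≫ (α_ _ _ _).inv) ≫
    _ ◁ (𝓕.xi₃ _ _ _ _ x).hom ≫ (𝓕.gamma (F.map f) x).hom
  simp only [compGamma, bicategoricalIsoComp, Iso.trans_hom, whiskerLeftIso_hom, whiskerRightIso_hom,
    Iso.symm_hom, Iso.refl_hom, Iso.symm_inv]
  bicategory

theorem delta_mod_comp (H : HasModifications 𝓕) (f : a ⟶ b) :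
    IsModification (((((TransData.of (𝓕.chiId (F.obj a))).precomp
        (𝓕.pull (F.map f)).toPrefunctor).comp
        ((TransData.of (𝓕.pull₂ (F.mapId a))).precomp (𝓕.pull (F.map f)).toPrefunctor)).comp
        ((TransData.of (𝓕.chi (F.map (𝟙 a)) (F.map f))).comp
          (TransData.of (𝓕.pull₂ (F.mapComp (𝟙 a) f))))).comp
          (TransData.of (𝓕.pull₂ (F.map₂ (λ_ f).hom))))
      (TransData.id (𝓕.pull (F.map f)).toPrefunctor) (𝓕.compDelta F f) := by
  refine ModIso.isModification_of_hom
    (((ModIso.assoc _ _ _).trans ((ModIso.assoc _ _ _).compLeft _)).trans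
    (((H.chiRM (F.mapId a) (F.map f)).symm.middle _ _).trans
    ((H.xi₃M (F.mapId a ▷ F.map f) (F.mapComp (𝟙 a) f) (F.map₂ (λ_ f).hom)
        (F.map₂_leftUnitor_hom f).symm).compLeft _ |>.trans (H.deltaM (F.map f)))))
    fun x => ?_
  change (𝓕.compDelta F f x).hom = ((α_ _ _ _).hom ≫ _ ◁ (α_ _ _ _).hom) ≫
    ((α_ _ _ _).hom ≫ _ ◁ ((α_ _ _ _).inv ≫ (𝓕.chiR (F.mapId a) (F.map f) x).inv ▷ _ ≫ (α_ _ _ _).hom) ≫ (α_ _ _ _).inv) ≫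
    _ ◁ (𝓕.xi₃ _ _ _ _ x).hom ≫ (𝓕.delta (F.map f) x).hom
  simp only [compDelta, bicategoricalIsoComp, Iso.trans_hom, whiskerLeftIso_hom, whiskerRightIso_hom,
    Iso.symm_hom, Iso.refl_hom, Iso.symm_inv]
  bicategory

end HasModifications

theorem HasModifications.comp (H : HasModifications 𝓕) (F : A ⥤ᴸ B) :
    HasModifications (𝓕.comp F) where
  xi_mod := H.xi_mod_comp F
  xiId_mod := H.xiId_mod_comp F
  chi₂_mod := H.chi₂_mod_comp F
  omega_mod := H.omega_mod_comp F
  gamma_mod := H.gamma_mod_comp F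
  delta_mod := H.delta_mod_comp F


end LaxBidiag

--CUT
namespace LaxBidiag

open Data Tot

variable {B : Type u} [Bicategory.{w, v} B] {𝓕 : Data.{w, v, u, w₁, v₁, u₁} B}

variable {a b c d e : B}

namespace Data

section Nat

variable {y : 𝓕.fib a}

instance isIso_actAt {x x' x'' : 𝓕.fib b} (f : a ⟶ b) (p : y ⟶ 𝓕.ob f x) {q : x ⟶ x'}
    {m : x' ⟶ x''} {r : x ⟶ x''} (φ : q ≫ m ⟶ r) [IsIso φ] : IsIso (actAt f p φ) := by
  unfold actAt
  infer_instance

instance isIso_hFib {x : 𝓕.fib b} {z : 𝓕.fib c} {f g : a ⟶ b} {f' g' : b ⟶ c} (α : f ⟶ g)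
    (α' : f' ⟶ g') {p : y ⟶ 𝓕.ob f x} {q : y ⟶ 𝓕.ob g x} {p' : x ⟶ 𝓕.ob f' z}
    {q' : x ⟶ 𝓕.ob g' z} (φ : p ≫ 𝓕.st α x ⟶ q) (φ' : p' ≫ 𝓕.st α' z ⟶ q') [IsIso φ]
    [IsIso φ'] : IsIso (hFib α α' φ φ') := by
  unfold hFib
  infer_instance

theorem mpXiAt_nat (f : a ⟶ b) {g h k : b ⟶ c} (β : g ⟶ h) (β' : h ⟶ k) {x : 𝓕.fib c}
    {s s' : y ⟶ 𝓕.ob f (𝓕.ob g x)} (σ : s ⟶ s') :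
    σ ▷ 𝓕.mp f (𝓕.st β x) ▷ 𝓕.mp f (𝓕.st β' x) ≫ (𝓕.mpXiAt f β β' s').hom =
      (𝓕.mpXiAt f β β' s).hom ≫ σ ▷ 𝓕.mp f (𝓕.st (β ≫ β') x) := by
  have e := whisker_exchange σ ((𝓕.pull f).map₂Iso (𝓕.xi β β' x)).hom
  simp only [mpXiAt, Iso.trans_hom, Iso.symm_hom, whiskerLeftIso_hom, Category.assoc]
  rw [e, reassoc_of% mpCompAt_inv_nat]

theorem mpXiIdAt_inv_nat (f : a ⟶ b) (g : b ⟶ c) {x : 𝓕.fib c}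
    {s s' : y ⟶ 𝓕.ob f (𝓕.ob g x)} (σ : s ⟶ s') :
    σ ▷ 𝓕.mp f (𝓕.st (𝟙 g) x) ≫ (𝓕.mpXiIdAt f g s').inv = (𝓕.mpXiIdAt f g s).inv ≫ σ := by
  simp only [mpXiIdAt, Iso.trans_inv, Iso.symm_inv, whiskerLeftIso_inv, Category.assoc]
  rw [← whisker_exchange_assoc, mpIdAt_nat]

theorem mpDeltaAt_nat (f : a ⟶ b) (g : b ⟶ c) {x : 𝓕.fib c}
    {s s' : y ⟶ 𝓕.ob f (𝓕.ob g x)} (σ : s ⟶ s') :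
    σ ▷ 𝓕.mp f _ ▷ 𝓕.mp f _ ▷ 𝓕.mp f _ ≫ (𝓕.mpDeltaAt f g s').hom =
      (𝓕.mpDeltaAt f g s).hom ≫ σ := by
  have e := whisker_exchange σ ((𝓕.pull f).map₂Iso (𝓕.delta g x)).hom
  simp only [mpDeltaAt, Iso.trans_hom, Iso.symm_hom, whiskerRightIso_hom, whiskerLeftIso_hom,
    Category.assoc]
  rw [← mpIdAt_nat, reassoc_of% e, reassoc_of% mpCompAt_inv_nat]
  simp only [← comp_whiskerRight_assoc, mpCompAt_inv_nat]

theorem stNatAt_inv_nat {f g : a ⟶ b} (α : f ⟶ g) {x x' : 𝓕.fib b} (p : x ⟶ x')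
    {s s' : y ⟶ 𝓕.ob f x} (σ : s ⟶ s') :
    σ ▷ 𝓕.st α x ▷ 𝓕.mp g p ≫ (𝓕.stNatAt α p s').inv =
      (𝓕.stNatAt α p s).inv ≫ σ ▷ 𝓕.mp f p ▷ 𝓕.st α x' := by
  rw [Iso.comp_inv_eq, Category.assoc, stNatAt_nat, Iso.inv_hom_id_assoc]

theorem chNatAt_inv_nat (f : a ⟶ b) (g : b ⟶ c) {x x' : 𝓕.fib c} (p : x ⟶ x')
    {s s' : y ⟶ 𝓕.ob f (𝓕.ob g x)} (σ : s ⟶ s') :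
    σ ▷ 𝓕.ch f g x ▷ 𝓕.mp (f ≫ g) p ≫ (𝓕.chNatAt f g p s').inv =
      (𝓕.chNatAt f g p s).inv ≫ σ ▷ 𝓕.mp f (𝓕.mp g p) ▷ 𝓕.ch f g x' := by
  rw [Iso.comp_inv_eq, Category.assoc, chNatAt_nat, Iso.inv_hom_id_assoc]

end Nat

end Data

namespace Data.Tot

variable [HasXi 𝓕] {y : 𝓕.fib a} {x : 𝓕.fib b}

theorem ver_congr {w : 𝓕.fib a} {f : a ⟶ b} {P Q Q' R : y ⟶ w} {m : w ⟶ 𝓕.ob f x} {i : P ⟶ Q} {j : Q ⟶ R} {i' : P ⟶ Q'} {j' : Q' ⟶ R}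
    (h : i ≫ j = i' ≫ j') :
    ver (i ▷ m) ≫ ver (j ▷ m) = ver (i' ▷ m) ≫ ver (j' ▷ m) := by
  rw [ver_comp_ver, ver_comp_ver, whiskerRight_comp_congr h]

end Data.Tot

namespace IsBicategory

variable [HasXi 𝓕] (I : IsBicategory 𝓕) {y : 𝓕.fib a} {x : 𝓕.fib b} {z : 𝓕.fib c}

/-- This lemma and the following ones restate the bicategory axioms in `Tot`, at arbitrary cells.
They reverse the translations in `IsLaxBidiagram.isBicategory`. -/
theorem hC_comp (I : IsBicategory 𝓕) {f g h : a ⟶ b} {f' g' h' : b ⟶ c} (α : f ⟶ g)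
    (β : g ⟶ h) (α' : f' ⟶ g') (β' : g' ⟶ h')
    {p : y ⟶ 𝓕.ob f x} {q : y ⟶ 𝓕.ob g x} {r : y ⟶ 𝓕.ob h x}
    {p' : x ⟶ 𝓕.ob f' z} {q' : x ⟶ 𝓕.ob g' z} {r' : x ⟶ 𝓕.ob h' z}
    (φ : p ≫ 𝓕.st α x ⟶ q) (φ' : p' ≫ 𝓕.st α' z ⟶ q') (ψ : q ≫ 𝓕.st β x ⟶ r)
    (ψ' : q' ≫ 𝓕.st β' z ⟶ r') :
    hC α α' φ φ' ≫ hC β β' ψ ψ' = hC (α ≫ β) (α' ≫ β') (vFib α β φ ψ) (vFib α' β' φ' ψ') := by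
  have h := congrArg Obj.Hom₂.tot (I.hcomp_comp
    (X := ⟨a, y⟩) (Y := ⟨b, x⟩) (Z := ⟨c, z⟩) (p := ⟨f, p⟩) (q := ⟨g, q⟩) (r := ⟨h, r⟩)
    (p' := ⟨f', p'⟩) (q' := ⟨g', q'⟩) (r' := ⟨h', r'⟩) ⟨α, φ⟩ ⟨β, ψ⟩ ⟨α', φ'⟩ ⟨β', ψ'⟩)
  rw [Obj.tot_comp₂, Obj.tot_hcomp₂, Obj.tot_hcomp₂, Obj.tot_hcomp₂] at h
  simp only [Obj.comp₂_base, Obj.comp₂_fib, vcompFib_eq] at h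
  exact h.symm

theorem hC_id (I : IsBicategory 𝓕) (f : a ⟶ b) (g : b ⟶ c) (p : y ⟶ 𝓕.ob f x)
    (q : x ⟶ 𝓕.ob g z) :
    hC (𝟙 f) (𝟙 g) (𝓕.xiIdAt f p).inv (𝓕.xiIdAt g q).inv = 𝟙 _ := by
  have h := congrArg Obj.Hom₂.tot (I.hcomp_id
    (X := ⟨a, y⟩) (Y := ⟨b, x⟩) (Z := ⟨c, z⟩) ⟨f, p⟩ ⟨g, q⟩)
  rw [Obj.tot_hcomp₂, Obj.tot_id₂] at h
  simp only [Obj.id₂_base, Obj.id₂_fib, idFib_eq] at h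
  exact h

theorem assoc_natural (I : IsBicategory 𝓕) {f f' : a ⟶ b} {g g' : b ⟶ c} {h h' : c ⟶ d}
    (α : f ⟶ f') (β : g ⟶ g') (ζ : h ⟶ h')
    {t : 𝓕.fib d} {p : y ⟶ 𝓕.ob f x} {p' : y ⟶ 𝓕.ob f' x} {q : x ⟶ 𝓕.ob g z}
    {q' : x ⟶ 𝓕.ob g' z} {r : z ⟶ 𝓕.ob h t} {r' : z ⟶ 𝓕.ob h' t}
    (φ : p ≫ 𝓕.st α x ⟶ p') (ψ : q ≫ 𝓕.st β z ⟶ q') (θ : r ≫ 𝓕.st ζ t ⟶ r') :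
    hC α (hc β ζ) φ (hcFib β ζ ψ θ) ≫ assocC f' g' h' p' q' r' =
      assocC f g h p q r ≫ hC (hc α β) ζ (hcFib α β φ ψ) θ := by
  have h := congrArg Obj.Hom₂.tot (I.assoc_nat
    (X := ⟨a, y⟩) (Y := ⟨b, x⟩) (Z := ⟨c, z⟩) (T := ⟨d, t⟩) (p := ⟨f, p⟩) (p' := ⟨f', p'⟩)
    (q := ⟨g, q⟩) (q' := ⟨g', q'⟩) (r := ⟨h, r⟩) (r' := ⟨h', r'⟩) ⟨α, φ⟩ ⟨β, ψ⟩ ⟨ζ, θ⟩)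
  rw [Obj.tot_comp₂, Obj.tot_comp₂, Obj.tot_hcomp₂, Obj.tot_hcomp₂, Obj.tot_assoc₂,
    Obj.tot_assoc₂] at h
  simp only [Obj.hcomp₂_base, Obj.hcomp₂_fib, hcompFib_eq] at h
  exact h

theorem gamma_natural (I : IsBicategory 𝓕) {f g : a ⟶ b} (α : f ⟶ g)
    {p : y ⟶ 𝓕.ob f x} {q : y ⟶ 𝓕.ob g x} (φ : p ≫ 𝓕.st α x ⟶ q) :
    hC α (𝟙 (𝟙 b)) φ (𝓕.xiIdAt (𝟙 b) (𝓕.cu b x)).inv ≫ gammaC g q = gammaC f p ≫ cell α φ := by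
  have h := congrArg Obj.Hom₂.tot (I.unitL_nat
    (X := ⟨a, y⟩) (Y := ⟨b, x⟩) (p := ⟨f, p⟩) (q := ⟨g, q⟩) ⟨α, φ⟩)
  rw [Obj.tot_comp₂, Obj.tot_comp₂, Obj.tot_hcomp₂, Obj.tot_unitL₂, Obj.tot_unitL₂] at h
  simp only [Obj.id₂_base, Obj.id₂_fib, idFib_eq] at h
  exact h

theorem delta_natural (I : IsBicategory 𝓕) {f g : a ⟶ b} (α : f ⟶ g)
    {p : y ⟶ 𝓕.ob f x} {q : y ⟶ 𝓕.ob g x} (φ : p ≫ 𝓕.st α x ⟶ q) :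
    hC (𝟙 (𝟙 a)) α (𝓕.xiIdAt (𝟙 a) (𝓕.cu a y)).inv φ ≫ unitRC g q = unitRC f p ≫ cell α φ := by
  have h := congrArg Obj.Hom₂.tot (I.unitR_nat
    (X := ⟨a, y⟩) (Y := ⟨b, x⟩) (p := ⟨f, p⟩) (q := ⟨g, q⟩) ⟨α, φ⟩)
  rw [Obj.tot_comp₂, Obj.tot_comp₂, Obj.tot_hcomp₂, Obj.tot_unitR₂, Obj.tot_unitR₂] at h
  simp only [Obj.id₂_base, Obj.id₂_fib, idFib_eq] at h
  exact h

theorem hC_triangle (I : IsBicategory 𝓕) (f : a ⟶ b) (g : b ⟶ c) (p : y ⟶ 𝓕.ob f x)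
    (q : x ⟶ 𝓕.ob g z) :
    assocC f (𝟙 b) g p (𝓕.cu b x) q ≫ hC (ρ_ f).hom (𝟙 g) (𝓕.gammaAt f p).hom (𝓕.xiIdAt g q).inv =
      hC (𝟙 f) (λ_ g).hom (𝓕.xiIdAt f p).inv (unitRAt g q) := by
  have h := congrArg Obj.Hom₂.tot (I.triangle
    (X := ⟨a, y⟩) (Y := ⟨b, x⟩) (Z := ⟨c, z⟩) ⟨f, p⟩ ⟨g, q⟩)
  simp only [Obj.tot_comp₂, Obj.tot_hcomp₂, Obj.tot_assoc₂, Obj.id₂_base, Obj.id₂_fib, idFib_eq,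
    Obj.unitL₂_base, Obj.unitL₂_fib, Obj.unitR₂_base, Obj.unitR₂_fib, unitLFib_eq,
    unitRFib_eq] at h
  exact h

theorem hC_pentagon (I : IsBicategory 𝓕) (f : a ⟶ b) (g : b ⟶ c) (h : c ⟶ d) (k : d ⟶ e)
    {t : 𝓕.fib d} {l : 𝓕.fib e} (p : y ⟶ 𝓕.ob f x) (q : x ⟶ 𝓕.ob g z) (r : z ⟶ 𝓕.ob h t)
    (s : t ⟶ 𝓕.ob k l) :
    hC (𝟙 f) (α_ g h k).inv (𝓕.xiIdAt f p).inv (assocAt g h k q r s) ≫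
        assocC f (g ≫ h) k p ((q ≫ 𝓕.mp g r) ≫ 𝓕.ch g h t) s ≫
        hC (α_ f g h).inv (𝟙 k) (assocAt f g h p q r) (𝓕.xiIdAt k s).inv =
      assocC f g (h ≫ k) p q ((r ≫ 𝓕.mp h s) ≫ 𝓕.ch h k l) ≫
        assocC (f ≫ g) h k ((p ≫ 𝓕.mp f q) ≫ 𝓕.ch f g z) r s := by
  have h := congrArg Obj.Hom₂.tot (I.pentagon
    (X := ⟨a, y⟩) (Y := ⟨b, x⟩) (Z := ⟨c, z⟩) (T := ⟨d, t⟩) (U := ⟨e, l⟩) ⟨f, p⟩ ⟨g, q⟩ ⟨h, r⟩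
    ⟨k, s⟩)
  simp only [Obj.tot_comp₂, Obj.tot_hcomp₂, Obj.tot_assoc₂, Obj.id₂_base, Obj.id₂_fib, idFib_eq,
    Obj.assoc₂_base, Obj.assoc₂_fib, assocFib_eq] at h
  exact h

end IsBicategory

end LaxBidiag

namespace LaxBidiag
open Data Tot
variable {B : Type u} [Bicategory.{w, v} B] {𝓕 : Data.{w, v, u, w₁, v₁, u₁} B}
variable {a b c d e : B}
namespace Data

instance isIso_actAt₂ {y : 𝓕.fib a} (f : a ⟶ b) (g : b ⟶ c) {z z' z'' : 𝓕.fib c}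
    (p : y ⟶ 𝓕.ob f (𝓕.ob g z)) {q : z ⟶ z'} {m : z' ⟶ z''} {r : z ⟶ z''} (φ : q ≫ m ⟶ r)
    [IsIso φ] : IsIso (actAt₂ f g p φ) := by
  unfold actAt₂
  infer_instance

instance isIso_hhFib {y : 𝓕.fib a} {x : 𝓕.fib b} {z : 𝓕.fib c} {f f' : a ⟶ b} {g g' : b ⟶ c}
    {h h' : c ⟶ d} (α : f ⟶ f') (β : g ⟶ g') (ζ : h ⟶ h')
    {t : 𝓕.fib d} {p : y ⟶ 𝓕.ob f x} {p' : y ⟶ 𝓕.ob f' x} {q : x ⟶ 𝓕.ob g z}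
    {q' : x ⟶ 𝓕.ob g' z} {r : z ⟶ 𝓕.ob h t} {r' : z ⟶ 𝓕.ob h' t}
    (φ : p ≫ 𝓕.st α x ⟶ p') (ψ : q ≫ 𝓕.st β z ⟶ q') (θ : r ≫ 𝓕.st ζ t ⟶ r')
    [IsIso φ] [IsIso ψ] [IsIso θ] : IsIso (hhFib α β ζ φ ψ θ) := by
  unfold hhFib
  infer_instance

end Data

namespace IsBicategory

variable [HasXi 𝓕] {y : 𝓕.fib a}

theorem gamma_nat (I : IsBicategory 𝓕) {f g : a ⟶ b} (α : f ⟶ g) {x : 𝓕.fib b} (s : y ⟶ 𝓕.ob f x) :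
    gammaC f s ≫ cell α (𝟙 (s ≫ 𝓕.st α x)) =
      chiRC α (𝟙 b) (s ≫ 𝓕.mp f (𝓕.cu b x)) ≫
        ver ((𝓕.stNatAt α (𝓕.cu b x) s).hom ▷ 𝓕.ch g (𝟙 b) x) ≫ gammaC g (s ≫ 𝓕.st α x) := by
  rw [← I.gamma_natural, hC_id_right]
  simp

/-- Naturality of the unit constraint at the lift of `α`. Both sides begin with the invertible
naturality cell of the unit `χ` at `s`, which cancels. -/
theorem delta_nat (I : IsBicategory 𝓕) (M : HasModifications 𝓕) {f g : a ⟶ b} (α : f ⟶ g)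
    {x : 𝓕.fib b} (s : y ⟶ 𝓕.ob f x) :
    deltaC f s ≫ cell α (𝟙 (s ≫ 𝓕.st α x)) =
      chiLC (𝟙 a) α (s ≫ 𝓕.cu a _) ≫
        ver ((𝓕.cuNatAt (𝓕.st α x) s).inv ▷ 𝓕.ch (𝟙 a) g x) ≫ deltaC g (s ≫ 𝓕.st α x) := by
  have h := I.delta_natural α (𝟙 (s ≫ 𝓕.st α x))
  have e := congrArg (fun m => ver (m ▷ 𝓕.ch (𝟙 a) g x)) (actAt_cuNat α (𝟙 (s ≫ 𝓕.st α x)))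
  simp only [comp_whiskerRight, ← ver_comp_ver, id_whiskerRight, Category.comp_id] at e
  rw [hC_id_left M, unitRC, unitRC, Category.assoc, Category.assoc, reassoc_of% e,
    ← reassoc_of% ver_comp_chiLC, cancel_epi] at h
  exact h.symm

/-- The device for all the two-variable axioms: regard `s` as a 1-cell over `f` with target `g^*x`
and compose it with the identity of `g^*x`, regarded as a 1-cell over `g`. The composite involves
`s` followed by `f^* 1`, which is then identified with `s`. -/
theorem chi₂_id (I : IsBicategory 𝓕) (M : HasModifications 𝓕) (f : a ⟶ b) (g : b ⟶ c) {x : 𝓕.fib c}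
    (s : y ⟶ 𝓕.ob f (𝓕.ob g x)) :
    chiC (𝟙 f) (𝟙 g) s ≫ ver ((𝓕.xiIdAt f _).inv ▷ 𝓕.ch f g x) ≫
        ver ((𝓕.mpXiIdAt f g s).inv ▷ 𝓕.ch f g x) =
      𝟙 (𝓕.tob (f ≫ g) (s ≫ 𝓕.ch f g x)) := by
  have h := I.hC_id f g s (𝟙 _)
  rw [Tot.hC_id_left M, actAt_xiIdAt, chiLC_eq, Category.assoc] at h
  rw [← cancel_epi (ver ((𝓕.mpIdAt f s).hom ▷ 𝓕.ch f g x)), reassoc_of% ver_comp_chiC,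
    reassoc_of% ver_congr (xiIdAt_inv_nat _ _), ver_congr (mpXiIdAt_inv_nat _ _ _), reassoc_of% h,
    Category.comp_id]

/-- The functoriality of horizontal composition at identity fibre components, with `s` completed by
an identity 1-cell. -/
theorem chi₂_comp (I : IsBicategory 𝓕) (M : HasModifications 𝓕) {f f' f'' : a ⟶ b}
    {g g' g'' : b ⟶ c} (α : f ⟶ f') (α' : f' ⟶ f'') (β : g ⟶ g') (β' : g' ⟶ g'') {x : 𝓕.fib c}
    (s : y ⟶ 𝓕.ob f (𝓕.ob g x)) :
    chiC α β s ≫ chiC α' β' _ ≫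
        ver ((𝓕.stNatAt α (𝓕.st β' x) (s ≫ 𝓕.mp f (𝓕.st β x))).inv ▷ 𝓕.st α' _ ▷ 𝓕.ch f'' g'' x) ≫
        ver ((𝓕.mpXiAt f β β' s).hom ▷ 𝓕.st α _ ▷ 𝓕.st α' _ ▷ 𝓕.ch f'' g'' x) ≫
        ver ((𝓕.xiAt α α' _).hom ▷ 𝓕.ch f'' g'' x) =
      chiC (α ≫ α') (β ≫ β') s := by
  have h := I.hC_comp α α' β β' (𝟙 (s ≫ 𝓕.st α _)) (𝟙 (𝟙 _ ≫ 𝓕.st β x)) (𝟙 _) (𝟙 _)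
  rw [hC, hC, hC, Category.assoc, reassoc_of% ver_comp_chiC, ver_comp_ver, ← comp_whiskerRight,
    hFib_comp M] at h
  simp only [comp_whiskerRight, ← ver_comp_ver] at h
  simp only [← Category.assoc] at h
  -- The `hFib` of identity 2-cells is the same on both sides and invertible; removing it leaves
  -- (C3) for `s` followed by `f^* 1`.
  rw [cancel_mono] at h
  simp only [Category.assoc] at h
  rw [← cancel_epi (ver ((𝓕.mpIdAt f s).hom ▷ 𝓕.ch f g x)), ver_comp_chiC, ← h,
    reassoc_of% ver_comp_chiC, reassoc_of% ver_comp_chiC,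
    reassoc_of% ver_congr (whiskerRight_comp_congr (stNatAt_inv_nat α _ _) _),
    reassoc_of% ver_congr (whiskerRight_comp_congr (whiskerRight_comp_congr
      (mpXiAt_nat f β β' _) _) _), ver_congr (xiAt_nat α α' _)]
  simp only [Category.assoc]

/-- The proof of `assoc_natural` run backwards, with identity 1-cells as second and third factors
and identities as fibre components. `hhFib` and the naturality cells around it are invertible and
cancel, leaving (C5). -/
theorem omega_nat (I : IsBicategory 𝓕) (M : HasModifications 𝓕) {f f' : a ⟶ b} {g g' : b ⟶ c}
    {h h' : c ⟶ d} (α : f ⟶ f') (β : g ⟶ g') (ζ : h ⟶ h') {x : 𝓕.fib d}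
    (s : y ⟶ 𝓕.ob f (𝓕.ob g (𝓕.ob h x))) :
    chiC α (hc β ζ) (s ≫ 𝓕.mp f (𝓕.ch g h x)) ≫
        ver ((𝓕.mpChiAt f β ζ s).hom ▷ 𝓕.st α _ ▷ 𝓕.ch f' (g' ≫ h') x) ≫
        ver ((𝓕.stNatAt α (𝓕.ch g' h' x) _).hom ▷ 𝓕.ch f' (g' ≫ h') x) ≫ omegaC f' g' h' _ =
      omegaC f g h s ≫ chiC (hc α β) ζ (s ≫ 𝓕.ch f g _) ≫
        ver ((𝓕.chNatAt f g (𝓕.st ζ x) s).inv ▷ 𝓕.st (hc α β) _ ▷ 𝓕.ch (f' ≫ g') h' x) ≫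
        ver ((𝓕.chiAt α β (s ≫ 𝓕.mp f (𝓕.mp g (𝓕.st ζ x)))).hom ▷ 𝓕.ch (f' ≫ g') h' x) := by
  have hn := I.assoc_natural α β ζ (𝟙 (s ≫ 𝓕.st α _)) (𝟙 (𝟙 _ ≫ 𝓕.st β _)) (𝟙 (𝟙 _ ≫ 𝓕.st ζ x))
  have e₁ := hhFib_right M α β ζ (𝟙 (s ≫ 𝓕.st α _)) (𝟙 (𝟙 _ ≫ 𝓕.st β _)) (𝟙 (𝟙 _ ≫ 𝓕.st ζ x))
  have e₂ := congrArg (fun m => ver (m ▷ 𝓕.ch f' (g' ≫ h') x)) (hhFib_left α β ζ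
    (𝟙 (s ≫ 𝓕.st α _)) (𝟙 (𝟙 _ ≫ 𝓕.st β _)) (𝟙 (𝟙 _ ≫ 𝓕.st ζ x)))
  rw [← whiskerRightIso_hom, ← Iso.eq_inv_comp, whiskerRightIso_inv] at e₁
  replace e₁ := congrArg (fun m => ver (m ▷ 𝓕.ch (f' ≫ g') h' x)) e₁
  simp only [comp_whiskerRight, ← ver_comp_ver, Category.assoc] at e₁ e₂
  rw [hC, hC, assocC, assocC] at hn
  simp only [Category.assoc] at hn
  rw [reassoc_of% e₂, reassoc_of% ver_comp_omegaC, ← reassoc_of% ver_comp_chiC,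
    ← reassoc_of% ver_comp_chiC, cancel_epi, cancel_epi, reassoc_of% ver_comp_chiC, e₁] at hn
  simp only [← Category.assoc] at hn
  rw [cancel_mono, cancel_mono] at hn
  simp only [Category.assoc] at hn
  -- Removes the identity 1-cells inserted above. Every cell in the equation is natural in `s`, so
  -- the equation passes along `σ`.
  let σ : (s ≫ 𝓕.mp f (𝟙 _)) ≫ 𝓕.mp f (𝓕.mp g (𝟙 _)) ≅ s :=
    whiskerLeftIso _ ((𝓕.pull f).map₂Iso (𝓕.mpId g _)) ≪≫ 𝓕.mpIdAt f _ ≪≫ 𝓕.mpIdAt f s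
  rw [← cancel_epi (ver (σ.hom ▷ _ ▷ _)), reassoc_of% ver_comp_chiC,
    ← reassoc_of% ver_congr (whiskerRight_comp_congr (mpChiAt_nat f β ζ _) _),
    reassoc_of% ver_congr (stNatAt_nat α _ _), ver_comp_omegaC, reassoc_of% hn,
    reassoc_of% ver_comp_omegaC, reassoc_of% ver_comp_chiC,
    reassoc_of% ver_congr (whiskerRight_comp_congr (chNatAt_inv_nat f g _ _) _),
    ver_congr (chiAt_nat α β _)]

/-- The triangle equation with an identity as second 1-cell; the naturality cells at that identity
occur on both sides and cancel. -/
theorem omega_triangle (I : IsBicategory 𝓕) (M : HasModifications 𝓕) (f : a ⟶ b) (g : b ⟶ c)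
    {x : 𝓕.fib c} (s : y ⟶ 𝓕.ob f (𝓕.ob g x)) :
    omegaC f (𝟙 b) g (s ≫ 𝓕.mp f (𝓕.cu b (𝓕.ob g x))) ≫ chiRC (ρ_ f).hom g _ ≫
        ver ((𝓕.gammaAt f s).hom ▷ 𝓕.ch f g x) =
      chiLC f (λ_ g).hom
          ((s ≫ 𝓕.mp f (𝓕.cu b (𝓕.ob g x))) ≫ 𝓕.mp f (𝓕.ch (𝟙 b) g x)) ≫
        ver ((𝓕.mpDeltaAt f g s).hom ▷ 𝓕.ch f g x) := by
  have hn := I.hC_triangle f g s (𝟙 (𝓕.ob g x))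
  have e₁ := M.gammaAt_stNatAt f (𝟙 (𝓕.ob g x)) s
  have e₂ := congrArg (fun m => ver (m ▷ 𝓕.ch f g x)) (actAt_unitRAt f g s (𝟙 (𝓕.ob g x)))
  rw [← whiskerRightIso_hom, ← whiskerRightIso_hom, ← Iso.eq_inv_comp, whiskerRightIso_inv,
    whiskerRightIso_inv] at e₁
  replace e₁ := congrArg (fun m => ver (m ▷ 𝓕.ch f g x)) e₁
  simp only [comp_whiskerRight, ← ver_comp_ver] at e₁ e₂
  rw [hC_id_left M, hC_id_right, assocC, e₂, ← reassoc_of% ver_comp_chiLC, ← reassoc_of% ver_comp_chiLC,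
    ← reassoc_of% ver_comp_chiLC, Category.assoc, Category.assoc, Category.assoc, cancel_epi,
    cancel_epi, reassoc_of% ver_comp_chiRC, comp_whiskerRight, ← ver_comp_ver, e₁,
    ← reassoc_of% ver_comp_chiRC, ← reassoc_of% ver_comp_omegaC, cancel_epi] at hn
  rw [← cancel_epi (ver ((𝓕.mpIdAt f s).hom ▷ 𝓕.mp f _ ▷ 𝓕.mp f _ ▷ 𝓕.ch f _ x)),
    reassoc_of% ver_comp_omegaC, reassoc_of% ver_comp_chiRC, ver_congr (gammaAt_nat f _),
    reassoc_of% hn, reassoc_of% ver_comp_chiLC, ver_congr (mpDeltaAt_nat f g _)]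

/-- The proof of `hC_pentagon` run backwards: everything around (C6) is invertible and cancels. What
remains is (C6) whiskered with a 1-cell `u` that is a fourfold composite. -/
theorem omega_pentagon_comp (I : IsBicategory 𝓕) (M : HasModifications 𝓕) (f : a ⟶ b) (g : b ⟶ c) (h : c ⟶ d)
    (k : d ⟶ e) {x : 𝓕.fib b} {z : 𝓕.fib c} {t : 𝓕.fib d} {l : 𝓕.fib e} (p : y ⟶ 𝓕.ob f x)
    (q : x ⟶ 𝓕.ob g z) (r : z ⟶ 𝓕.ob h t) (s : t ⟶ 𝓕.ob k l)
    {u : y ⟶ 𝓕.ob f (𝓕.ob g (𝓕.ob h (𝓕.ob k l)))}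
    (hu : ((p ≫ 𝓕.mp f q) ≫ 𝓕.mp f (𝓕.mp g r)) ≫ 𝓕.mp f (𝓕.mp g (𝓕.mp h s)) = u) :
    omegaC f g (h ≫ k) (u ≫ 𝓕.mp f (𝓕.mp g (𝓕.ch h k l))) ≫
        ver ((𝓕.chNatAt f g (𝓕.ch h k l) u).hom ▷ 𝓕.ch (f ≫ g) (h ≫ k) l) ≫
        omegaC (f ≫ g) h k (u ≫ 𝓕.ch f g _) =
      chiLC f (α_ g h k).inv
          ((u ≫ 𝓕.mp f (𝓕.mp g (𝓕.ch h k l))) ≫ 𝓕.mp f (𝓕.ch g (h ≫ k) l)) ≫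
        ver ((𝓕.mpOmegaAt f g h k u).hom ▷ 𝓕.ch f ((g ≫ h) ≫ k) l) ≫
        omegaC f (g ≫ h) k (u ≫ 𝓕.mp f (𝓕.ch g h (𝓕.ob k l))) ≫
        chiRC (α_ f g h).inv k _ ≫ ver ((𝓕.omegaAt f g h u).hom ▷ 𝓕.ch ((f ≫ g) ≫ h) k l) := by
  subst hu
  have hn := I.hC_pentagon f g h k p q r s
  have e₁ := congrArg (fun m => ver (m ▷ 𝓕.ch f ((g ≫ h) ≫ k) l)) (actAt_assocAt f g h k p q r s)
  have e₂ := congrArg (fun m => ver (m ▷ 𝓕.ch ((f ≫ g) ≫ h) k l))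
    (M.omegaAt_chNatAt f g h s ((p ≫ 𝓕.mp f q) ≫ 𝓕.mp f (𝓕.mp g r)))
  have e₄ := congrArg (fun m => ver (m ▷ 𝓕.ch (f ≫ g) (h ≫ k) l))
    (chNatAt_comp f g (r ≫ 𝓕.mp h s) (𝓕.ch h k l) (p ≫ 𝓕.mp f q))
  have e₅ := congrArg (fun m => ver (m ▷ 𝓕.mp (f ≫ g) (𝓕.ch h k l) ▷ 𝓕.ch (f ≫ g) (h ≫ k) l))
    (chNatAt_comp f g r (𝓕.mp h s) (p ≫ 𝓕.mp f q))
  have n₁ := congrArg (fun m => ver (m ▷ 𝓕.ch ((f ≫ g) ≫ h) k l)) (stNatAt_nat (α_ f g h).inv s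
    ((𝓕.mpCompAt f (q ≫ 𝓕.mp g r) (𝓕.ch g h t) p).hom ▷ 𝓕.ch f (g ≫ h) t))
  have n₂ := congrArg (fun m => ver (m ▷ 𝓕.ch ((f ≫ g) ≫ h) k l)) (stNatAt_nat (α_ f g h).inv s
    ((𝓕.mpCompAt f q (𝓕.mp g r) p).hom ▷ 𝓕.mp f (𝓕.ch g h t) ▷ 𝓕.ch f (g ≫ h) t))
  have n₃ := congrArg (fun m => ver (m ▷ 𝓕.ch (f ≫ g ≫ h) k l)) (chNatAt_nat f (g ≫ h) s
    (𝓕.mpCompAt f (q ≫ 𝓕.mp g r) (𝓕.ch g h t) p).hom)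
  have n₄ := congrArg (fun m => ver (m ▷ 𝓕.ch (f ≫ g ≫ h) k l)) (chNatAt_nat f (g ≫ h) s
    ((𝓕.mpCompAt f q (𝓕.mp g r) p).hom ▷ 𝓕.mp f (𝓕.ch g h t)))
  have n₅ := congrArg (fun m => ver (m ▷ 𝓕.ch (f ≫ g) (h ≫ k) l)) (chNatAt_nat f g (𝓕.ch h k l)
    (mpMpCompAt f g r (𝓕.mp h s) (p ≫ 𝓕.mp f q)).hom)
  have n₆ := congrArg (fun m => ver (m ▷ 𝓕.ch ((f ≫ g) ≫ h) k l)) (chNatAt_nat (f ≫ g) h s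
    (𝓕.chNatAt f g r (p ≫ 𝓕.mp f q)).hom)
  simp only [comp_whiskerRight, ← ver_comp_ver, Category.assoc] at e₁ e₂ e₄ e₅ n₁ n₂ n₃ n₄ n₅ n₆
  rw [hC_id_left M, hC_id_right, assocC, assocC, assocC, assocAt.eq_def (p := p)] at hn
  simp only [Category.assoc, comp_whiskerRight, ← ver_comp_ver] at hn
  rw [← reassoc_of% n₁, ← reassoc_of% ver_comp_chiRC, ← reassoc_of% n₃, ← reassoc_of% ver_comp_omegaC,
    ← reassoc_of% n₂, ← reassoc_of% ver_comp_chiRC, ← reassoc_of% n₄, ← reassoc_of% ver_comp_omegaC,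
    reassoc_of% e₁] at hn
  rw [reassoc_of% ver_comp_omegaC, reassoc_of% ver_comp_chiRC, reassoc_of% ver_comp_chiRC, ← reassoc_of% e₂] at hn
  rw [← reassoc_of% ver_comp_chiLC, ← reassoc_of% ver_comp_chiLC, ← reassoc_of% ver_comp_chiLC,
    ← reassoc_of% ver_comp_chiLC] at hn
  rw [← reassoc_of% e₄, ← reassoc_of% e₅, ← reassoc_of% n₅, ← reassoc_of% ver_comp_omegaC,
    ← reassoc_of% ver_comp_omegaC, cancel_epi, cancel_epi, cancel_epi, cancel_epi] at hn
  simp only [reassoc_of% ver_comp_omegaC, n₆] at hn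
  simp only [← Category.assoc] at hn
  rw [cancel_mono, cancel_mono, cancel_mono] at hn
  simp only [Category.assoc] at hn
  exact hn.symm

/-- `omega_pentagon_comp` with three identity 1-cells, carried along the isomorphism that removes
them. -/
theorem omega_pentagon (I : IsBicategory 𝓕) (M : HasModifications 𝓕) (f : a ⟶ b) (g : b ⟶ c)
    (h : c ⟶ d) (k : d ⟶ e) {x : 𝓕.fib e} (s : y ⟶ 𝓕.ob f (𝓕.ob g (𝓕.ob h (𝓕.ob k x)))) :
    omegaC f g (h ≫ k) (s ≫ 𝓕.mp f (𝓕.mp g (𝓕.ch h k x))) ≫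
        ver ((𝓕.chNatAt f g (𝓕.ch h k x) s).hom ▷ 𝓕.ch (f ≫ g) (h ≫ k) x) ≫
        omegaC (f ≫ g) h k (s ≫ 𝓕.ch f g _) =
      chiLC f (α_ g h k).inv
          ((s ≫ 𝓕.mp f (𝓕.mp g (𝓕.ch h k x))) ≫ 𝓕.mp f (𝓕.ch g (h ≫ k) x)) ≫
        ver ((𝓕.mpOmegaAt f g h k s).hom ▷ 𝓕.ch f ((g ≫ h) ≫ k) x) ≫
        omegaC f (g ≫ h) k (s ≫ 𝓕.mp f (𝓕.ch g h (𝓕.ob k x))) ≫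
        chiRC (α_ f g h).inv k _ ≫ ver ((𝓕.omegaAt f g h s).hom ▷ 𝓕.ch ((f ≫ g) ≫ h) k x) := by
  have hn := I.omega_pentagon_comp M f g h k s (𝟙 (𝓕.ob g (𝓕.ob h (𝓕.ob k x))))
    (𝟙 (𝓕.ob h (𝓕.ob k x))) (𝟙 (𝓕.ob k x)) rfl
  let σ : ((s ≫ 𝓕.mp f (𝟙 _)) ≫ 𝓕.mp f (𝓕.mp g (𝟙 _))) ≫ 𝓕.mp f (𝓕.mp g (𝓕.mp h (𝟙 _))) ≅ s :=
    whiskerLeftIso _ ((𝓕.pull f).map₂Iso ((𝓕.pull g).map₂Iso (𝓕.mpId h _) ≪≫ 𝓕.mpId g _)) ≪≫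
      𝓕.mpIdAt f _ ≪≫ whiskerLeftIso _ ((𝓕.pull f).map₂Iso (𝓕.mpId g _)) ≪≫
      𝓕.mpIdAt f _ ≪≫ 𝓕.mpIdAt f s
  rw [← cancel_epi (ver (σ.hom ▷ _ ▷ _ ▷ _)), reassoc_of% ver_comp_omegaC,
    reassoc_of% ver_congr (chNatAt_nat f g _ _), ver_comp_omegaC, reassoc_of% hn,
    reassoc_of% ver_comp_chiLC, ← reassoc_of% ver_congr (mpOmegaAt_nat f g h k _),
    reassoc_of% ver_comp_omegaC, reassoc_of% ver_comp_chiRC, ver_congr (omegaAt_nat f g h _)]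

theorem totAxioms (I : IsBicategory 𝓕) (M : HasModifications 𝓕) : TotAxioms 𝓕 where
  chi₂_comp α α' β β' _ _ s := I.chi₂_comp M α α' β β' s
  chi₂_id f g _ _ s := I.chi₂_id M f g s
  omega_nat α β ζ _ _ s := I.omega_nat M α β ζ s
  omega_pentagon f g h k _ _ s := I.omega_pentagon M f g h k s
  delta_nat α _ _ s := I.delta_nat M α s
  gamma_nat α _ _ s := I.gamma_nat α s
  omega_triangle f g _ _ s := I.omega_triangle M f g s

end IsBicategory

end LaxBidiag

/-! ### Comparison of the structure cells of `𝓕F` with those of `𝓕`. -/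

namespace LaxBidiag

open Data Tot

variable {A : Type u₂} [Bicategory.{w₂, v₂} A] {B : Type u} [Bicategory.{w, v} B]
  {𝓕 : Data.{w, v, u, w₁, v₁, u₁} B} (F : A ⥤ᴸ B)

namespace Data

theorem stEq_inv {B : Type u} [Bicategory.{w, v} B] {𝓕 : Data.{w, v, u, w₁, v₁, u₁} B} {a b : B}
    {f g : a ⟶ b} {θ τ : f ⟶ g} (e : θ = τ) (x : 𝓕.fib b) :
    (𝓕.stEq e x).inv = (𝓕.stEq e.symm x).hom := by
  subst e
  rfl

variable {a b c d : A}

section CompAt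

/-- The action of the component of `χ` for the composite of `𝓕` with `F` on a 1-cell. -/
def compChiAt {f h : a ⟶ b} {g k : b ⟶ c} (α : f ⟶ h) (β : g ⟶ k) {y : 𝓕.fib (F.obj a)}
    {x : 𝓕.fib (F.obj c)} (s : y ⟶ 𝓕.ob (F.map f) (𝓕.ob (F.map g) x)) :
    (s ≫ 𝓕.ch (F.map f) (F.map g) x ≫ 𝓕.st (F.mapComp f g) x) ≫ 𝓕.st (F.map₂ (hc α β)) x ≅
      ((s ≫ 𝓕.mp (F.map f) (𝓕.st (F.map₂ β) x)) ≫ 𝓕.st (F.map₂ α) (𝓕.ob (F.map k) x)) ≫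
        𝓕.ch (F.map h) (F.map k) x ≫ 𝓕.st (F.mapComp h k) x :=
  α_ _ _ _ ≪≫ whiskerLeftIso s (α_ (𝓕.ch (F.map f) (F.map g) x) (𝓕.st (F.mapComp f g) x)
      (𝓕.st (F.map₂ (hc α β)) x) ≪≫
      whiskerLeftIso (𝓕.ch (F.map f) (F.map g) x)
        (𝓕.xi₂ (F.mapComp f g) (F.map₂ (hc α β)) rfl x ≪≫
          (𝓕.xi₂ (hc (F.map₂ α) (F.map₂ β)) (F.mapComp h k) (by simp [hc]) x).symm) ≪≫
      (α_ (𝓕.ch (F.map f) (F.map g) x) (𝓕.st (hc (F.map₂ α) (F.map₂ β)) x)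
        (𝓕.st (F.mapComp h k) x)).symm ≪≫
      whiskerRightIso (𝓕.chi₂ (F.map₂ α) (F.map₂ β) x) (𝓕.st (F.mapComp h k) x) ≪≫
      α_ (𝓕.mp (F.map f) (𝓕.st (F.map₂ β) x) ≫ 𝓕.st (F.map₂ α) (𝓕.ob (F.map k) x))
        (𝓕.ch (F.map h) (F.map k) x) (𝓕.st (F.mapComp h k) x)) ≪≫ (α_ _ _ _).symm ≪≫
    whiskerRightIso (α_ _ _ _).symm _

def compOmegaAt (f : a ⟶ b) (g : b ⟶ c) (h : c ⟶ d) {y : 𝓕.fib (F.obj a)}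
    {x : 𝓕.fib (F.obj d)} (s : y ⟶ 𝓕.ob (F.map f) (𝓕.ob (F.map g) (𝓕.ob (F.map h) x))) :
    ((s ≫ 𝓕.mp (F.map f) (𝓕.ch (F.map g) (F.map h) x ≫ 𝓕.st (F.mapComp g h) x)) ≫
        𝓕.ch (F.map f) (F.map (g ≫ h)) x ≫ 𝓕.st (F.mapComp f (g ≫ h)) x) ≫
        𝓕.st (F.map₂ (α_ f g h).inv) x ≅
      (s ≫ 𝓕.ch (F.map f) (F.map g) (𝓕.ob (F.map h) x) ≫
        𝓕.st (F.mapComp f g) (𝓕.ob (F.map h) x)) ≫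
        𝓕.ch (F.map (f ≫ g)) (F.map h) x ≫ 𝓕.st (F.mapComp (f ≫ g) h) x :=
  whiskerRightIso (α_ _ _ _) _ ≪≫ α_ _ _ _ ≪≫ whiskerLeftIso s (𝓕.compOmega F f g h x) ≪≫
    (α_ _ _ _).symm

def compGammaAt (f : a ⟶ b) {y : 𝓕.fib (F.obj a)} {x : 𝓕.fib (F.obj b)}
    (s : y ⟶ 𝓕.ob (F.map f) x) :
    ((s ≫ 𝓕.mp (F.map f) (𝓕.cu (F.obj b) x ≫ 𝓕.st (F.mapId b) x)) ≫
        𝓕.ch (F.map f) (F.map (𝟙 b)) x ≫ 𝓕.st (F.mapComp f (𝟙 b)) x) ≫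
        𝓕.st (F.map₂ (ρ_ f).hom) x ≅ s :=
  whiskerRightIso (α_ _ _ _) _ ≪≫ α_ _ _ _ ≪≫ whiskerLeftIso s (𝓕.compGamma F f x) ≪≫ ρ_ s

def compDeltaAt (f : a ⟶ b) {y : 𝓕.fib (F.obj a)} {x : 𝓕.fib (F.obj b)}
    (s : y ⟶ 𝓕.ob (F.map f) x) :
    ((s ≫ 𝓕.cu (F.obj a) (𝓕.ob (F.map f) x) ≫ 𝓕.st (F.mapId a) (𝓕.ob (F.map f) x)) ≫
        𝓕.ch (F.map (𝟙 a)) (F.map f) x ≫ 𝓕.st (F.mapComp (𝟙 a) f) x) ≫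
        𝓕.st (F.map₂ (λ_ f).hom) x ≅ s :=
  whiskerRightIso (α_ _ _ _) _ ≪≫ α_ _ _ _ ≪≫ whiskerLeftIso s (𝓕.compDelta F f x) ≪≫ ρ_ s

end CompAt

end Data

namespace Data.Tot

variable {a b c d : A} [HasXi 𝓕]

/-- The constraint of the change of base. -/
def jC (f : a ⟶ b) (g : b ⟶ c) {y : 𝓕.fib (F.obj a)} {x : 𝓕.fib (F.obj c)}
    (s : y ⟶ 𝓕.ob (F.map f) (𝓕.ob (F.map g) x)) :
    𝓕.tob (F.map f ≫ F.map g) (s ≫ 𝓕.ch (F.map f) (F.map g) x) ⟶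
      𝓕.tob (F.map (f ≫ g)) (s ≫ 𝓕.ch (F.map f) (F.map g) x ≫ 𝓕.st (F.mapComp f g) x) :=
  cell (F.mapComp f g) (α_ s (𝓕.ch (F.map f) (F.map g) x) (𝓕.st (F.mapComp f g) x)).hom

/-- The definition of `χ^{𝓕F}` read in `Tot`: its `ξ` for the naturality of `F.mapComp` is absorbed
into the composition, so only a commuting square is left. -/
theorem jC_comp_chiC {f h : a ⟶ b} {g k : b ⟶ c} (α : f ⟶ h) (β : g ⟶ k) {y : 𝓕.fib (F.obj a)}
    {x : 𝓕.fib (F.obj c)} (s : y ⟶ 𝓕.ob (F.map f) (𝓕.ob (F.map g) x)) :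
    jC F f g s ≫ cell (F.map₂ (hc α β)) (compChiAt F α β s).hom =
      chiC (F.map₂ α) (F.map₂ β) s ≫ jC F h k _ := by
  rw [jC, jC, chiC, cell_comp, cell_comp]
  refine cell_eq_cell (by simp [hc]) ?_
  rw [Iso.inv_comp_eq]
  simp only [compChiAt, xi₂_eq, stEq_refl, Iso.trans_refl, xiAt, chiAt, Iso.trans_hom,
    whiskerLeftIso_hom, Iso.trans_inv, whiskerLeftIso_inv, Iso.symm_hom, whiskerRightIso_hom,
    Iso.symm_inv, stEq_inv]
  bicategory

/-- The definition of `ω^{𝓕F}` with the inverse of `χ_{F.mapComp g h, f}` moved to the other side.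
The `ξ` in it, which stands for the associativity axiom of `F`, becomes the equality of the bases.
-/
theorem jC_comp_omegaC (f : a ⟶ b) (g : b ⟶ c) (h : c ⟶ d) {y : 𝓕.fib (F.obj a)}
    {x : 𝓕.fib (F.obj d)} (s : y ⟶ 𝓕.ob (F.map f) (𝓕.ob (F.map g) (𝓕.ob (F.map h) x))) :
    chiLC (F.map f) (F.mapComp g h) (s ≫ 𝓕.mp (F.map f) (𝓕.ch (F.map g) (F.map h) x)) ≫
        ver ((𝓕.mpCompAt (F.map f) (𝓕.ch (F.map g) (F.map h) x) (𝓕.st (F.mapComp g h) x) s).inv ▷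
          𝓕.ch (F.map f) (F.map (g ≫ h)) x) ≫
        jC F f (g ≫ h) (s ≫ 𝓕.mp (F.map f) (𝓕.ch (F.map g) (F.map h) x ≫ 𝓕.st (F.mapComp g h) x)) ≫
        cell (F.map₂ (α_ f g h).inv) (compOmegaAt F f g h s).hom =
      omegaC (F.map f) (F.map g) (F.map h) s ≫
        chiRC (F.mapComp f g) (F.map h) (s ≫ 𝓕.ch (F.map f) (F.map g) _) ≫
        ver ((α_ s (𝓕.ch (F.map f) (F.map g) _) (𝓕.st (F.mapComp f g) _)).hom ▷
          𝓕.ch (F.map (f ≫ g)) (F.map h) x) ≫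
        jC F (f ≫ g) h (s ≫ 𝓕.ch (F.map f) (F.map g) _ ≫ 𝓕.st (F.mapComp f g) _) := by
  simp only [jC, chiLC, chiRC, omegaC, cell_comp_ver_assoc, ver_comp_cell, ver_comp_cell_assoc, cell_comp₃]
  refine cell_eq_cell (by simp [LaxFunctor.mapComp_assoc_left]) ?_
  rw [Iso.inv_comp_eq, Iso.inv_comp_eq]
  -- The invertible cells before `compOmegaAt` are collected into one isomorphism, which can then be
  -- moved across the equation.
  trans (whiskerRightIso (whiskerRightIso (𝓕.chiLAt (F.map f) (F.mapComp g h)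
    (s ≫ 𝓕.mp (F.map f) (𝓕.ch (F.map g) (F.map h) x)) ≪≫ whiskerRightIso
      (𝓕.mpCompAt (F.map f) (𝓕.ch (F.map g) (F.map h) x) (𝓕.st (F.mapComp g h) x) s).symm
      (𝓕.ch (F.map f) (F.map (g ≫ h)) x)) (𝓕.st (F.mapComp f (g ≫ h)) x))
      (𝓕.st (F.map₂ (α_ f g h).inv) x)).hom ≫ (α_ (s ≫ 𝓕.mp (F.map f) (𝓕.ch (F.map g) (F.map h) x ≫ 𝓕.st (F.mapComp g h) x))
      (𝓕.ch (F.map f) (F.map (g ≫ h)) x) (𝓕.st (F.mapComp f (g ≫ h)) x)).hom ▷ 𝓕.st (F.map₂ (α_ f g h).inv) x ≫ (compOmegaAt F f g h s).hom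
  · simp only [Iso.trans_hom, Iso.symm_hom, whiskerRightIso_hom, comp_whiskerRight, Category.assoc]
  rw [← Iso.eq_inv_comp]
  simp only [compOmegaAt, compOmega, bicategoricalIsoComp, xi₃_eq, stEq_refl, Iso.trans_refl, xiAt, omegaAt, chiLAt,
    chiRAt, mpCompAt, Iso.trans_hom, whiskerRightIso_inv, Iso.symm_symm_eq,
    whiskerLeftIso_hom, Iso.trans_inv, whiskerLeftIso_inv, Iso.symm_hom, whiskerRightIso_hom,
    Iso.symm_inv, stEq_inv, Iso.refl_hom]
  bicategory

theorem jC_comp_gammaC (f : a ⟶ b) {y : 𝓕.fib (F.obj a)} {x : 𝓕.fib (F.obj b)}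
    (s : y ⟶ 𝓕.ob (F.map f) x) :
    chiLC (F.map f) (F.mapId b) (s ≫ 𝓕.mp (F.map f) (𝓕.cu (F.obj b) x)) ≫
        ver ((𝓕.mpCompAt (F.map f) (𝓕.cu (F.obj b) x) (𝓕.st (F.mapId b) x) s).inv ▷
          𝓕.ch (F.map f) (F.map (𝟙 b)) x) ≫
        jC F f (𝟙 b) (s ≫ 𝓕.mp (F.map f) (𝓕.cu (F.obj b) x ≫ 𝓕.st (F.mapId b) x)) ≫
        cell (F.map₂ (ρ_ f).hom) (compGammaAt F f s).hom =
      gammaC (F.map f) s := by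
  simp only [jC, chiLC, gammaC, cell_comp_ver_assoc, ver_comp_cell, ver_comp_cell_assoc, cell_comp₃]
  refine cell_eq_cell (F.map₂_rightUnitor_hom f).symm ?_
  rw [Iso.inv_comp_eq, Iso.inv_comp_eq]
  trans (whiskerRightIso (whiskerRightIso (𝓕.chiLAt (F.map f) (F.mapId b)
    (s ≫ 𝓕.mp (F.map f) (𝓕.cu (F.obj b) x)) ≪≫ whiskerRightIso
      (𝓕.mpCompAt (F.map f) (𝓕.cu (F.obj b) x) (𝓕.st (F.mapId b) x) s).symm
      (𝓕.ch (F.map f) (F.map (𝟙 b)) x)) (𝓕.st (F.mapComp f (𝟙 b)) x))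
      (𝓕.st (F.map₂ (ρ_ f).hom) x)).hom ≫ (α_ (s ≫ 𝓕.mp (F.map f) (𝓕.cu (F.obj b) x ≫ 𝓕.st (F.mapId b) x))
      (𝓕.ch (F.map f) (F.map (𝟙 b)) x) (𝓕.st (F.mapComp f (𝟙 b)) x)).hom ▷ 𝓕.st (F.map₂ (ρ_ f).hom) x ≫ (compGammaAt F f s).hom
  · simp only [Iso.trans_hom, Iso.symm_hom, whiskerRightIso_hom, comp_whiskerRight, Category.assoc]
  rw [← Iso.eq_inv_comp]
  simp only [compGammaAt, compGamma, bicategoricalIsoComp, xi₃_eq, stEq_refl, Iso.trans_refl, xiAt, gammaAt, chiLAt,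
    chiRAt, mpCompAt, Iso.trans_hom, whiskerRightIso_inv, Iso.symm_symm_eq,
    whiskerLeftIso_hom, Iso.trans_inv, whiskerLeftIso_inv, Iso.symm_hom, whiskerRightIso_hom,
    Iso.symm_inv, stEq_inv, Iso.refl_hom]
  bicategory

theorem jC_comp_deltaC (f : a ⟶ b) {y : 𝓕.fib (F.obj a)} {x : 𝓕.fib (F.obj b)}
    (s : y ⟶ 𝓕.ob (F.map f) x) :
    chiRC (F.mapId a) (F.map f) (s ≫ 𝓕.cu (F.obj a) _) ≫
        ver ((α_ s (𝓕.cu (F.obj a) _) (𝓕.st (F.mapId a) _)).hom ▷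
          𝓕.ch (F.map (𝟙 a)) (F.map f) x) ≫
        jC F (𝟙 a) f (s ≫ 𝓕.cu (F.obj a) _ ≫ 𝓕.st (F.mapId a) _) ≫
        cell (F.map₂ (λ_ f).hom) (compDeltaAt F f s).hom =
      deltaC (F.map f) s := by
  simp only [jC, chiRC, deltaC, cell_comp_ver_assoc, ver_comp_cell, ver_comp_cell_assoc, cell_comp₃]
  refine cell_eq_cell (F.map₂_leftUnitor_hom f).symm ?_
  rw [Iso.inv_comp_eq, Iso.inv_comp_eq]
  trans (whiskerRightIso (whiskerRightIso (𝓕.chiRAt (F.mapId a) (F.map f)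
    (s ≫ 𝓕.cu (F.obj a) (𝓕.ob (F.map f) x)) ≪≫ whiskerRightIso
      (α_ s (𝓕.cu (F.obj a) (𝓕.ob (F.map f) x)) (𝓕.st (F.mapId a) (𝓕.ob (F.map f) x)))
      (𝓕.ch (F.map (𝟙 a)) (F.map f) x)) (𝓕.st (F.mapComp (𝟙 a) f) x))
      (𝓕.st (F.map₂ (λ_ f).hom) x)).hom ≫ (α_ (s ≫ 𝓕.cu (F.obj a) (𝓕.ob (F.map f) x) ≫ 𝓕.st (F.mapId a) (𝓕.ob (F.map f) x))
      (𝓕.ch (F.map (𝟙 a)) (F.map f) x) (𝓕.st (F.mapComp (𝟙 a) f) x)).hom ▷ 𝓕.st (F.map₂ (λ_ f).hom) x ≫ (compDeltaAt F f s).hom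
  · simp only [Iso.trans_hom, Iso.symm_hom, whiskerRightIso_hom, comp_whiskerRight, Category.assoc]
  rw [← Iso.eq_inv_comp]
  simp only [compDeltaAt, compDelta, bicategoricalIsoComp, xi₃_eq, stEq_refl, Iso.trans_refl, xiAt, deltaAt, chiLAt,
    chiRAt, mpCompAt, Iso.trans_hom, whiskerRightIso_inv, Iso.symm_symm_eq,
    whiskerLeftIso_hom, Iso.trans_inv, whiskerLeftIso_inv, Iso.symm_hom, whiskerRightIso_hom,
    Iso.symm_inv, stEq_inv, Iso.refl_hom]
  bicategory

end Data.Tot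

end LaxBidiag

/-! ### The constraints of the change of base as 2-cells over `B`. -/

namespace LaxBidiag

open Data Tot

variable {A : Type u₂} [Bicategory.{w₂, v₂} A] {B : Type u} [Bicategory.{w, v} B]
  {𝓕 : Data.{w, v, u, w₁, v₁, u₁} B} (F : A ⥤ᴸ B)

variable {a b c d : A}

namespace Data

/-- The action of the naturality 2-cell of `χ` for the composite of `𝓕` with `F` on a 1-cell. -/
def compChNatAt (f : a ⟶ b) (g : b ⟶ c) {y : 𝓕.fib (F.obj a)} {x x' : 𝓕.fib (F.obj c)}
    (p : x ⟶ x') (s : y ⟶ 𝓕.ob (F.map f) (𝓕.ob (F.map g) x)) :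
    (s ≫ 𝓕.mp (F.map f) (𝓕.mp (F.map g) p)) ≫ 𝓕.ch (F.map f) (F.map g) x' ≫
        𝓕.st (F.mapComp f g) x' ≅
      (s ≫ 𝓕.ch (F.map f) (F.map g) x ≫ 𝓕.st (F.mapComp f g) x) ≫ 𝓕.mp (F.map (f ≫ g)) p :=
  α_ _ _ _ ≪≫ whiskerLeftIso s (((α_ _ (𝓕.ch (F.map f) (F.map g) x') _).symm ≪≫
    whiskerRightIso (𝓕.chNat (F.map f) (F.map g) p) _ ≪≫ α_ _ (𝓕.mp (F.map f ≫ F.map g) p) _ ≪≫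
    whiskerLeftIso _ (𝓕.stNat (F.mapComp f g) p) ≪≫ (α_ _ _ (𝓕.mp (F.map (f ≫ g)) p)).symm)) ≪≫
    (α_ _ _ _).symm

theorem compChNatAt_hom (f : a ⟶ b) (g : b ⟶ c) {y : 𝓕.fib (F.obj a)} {x x' : 𝓕.fib (F.obj c)}
    (p : x ⟶ x') (s : y ⟶ 𝓕.ob (F.map f) (𝓕.ob (F.map g) x)) :
    (α_ (s ≫ 𝓕.mp (F.map f) (𝓕.mp (F.map g) p)) (𝓕.ch (F.map f) (F.map g) x')
        (𝓕.st (F.mapComp f g) x')).hom ≫ (compChNatAt F f g p s).hom =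
      (𝓕.chNatAt (F.map f) (F.map g) p s).hom ▷ 𝓕.st (F.mapComp f g) x' ≫
        (𝓕.stNatAt (F.mapComp f g) p (s ≫ 𝓕.ch (F.map f) (F.map g) x)).hom ≫
        (α_ s (𝓕.ch (F.map f) (F.map g) x) (𝓕.st (F.mapComp f g) x)).hom ▷
          𝓕.mp (F.map (f ≫ g)) p := by
  simp only [compChNatAt, chNatAt, stNatAt, Iso.trans_hom, whiskerLeftIso_hom, Iso.symm_hom,
    whiskerRightIso_hom]
  bicategory

/-- The naturality 2-cell of the unit `χ` for the composite of `𝓕` with `F`. -/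
def compCuNat (a : A) {x x' : 𝓕.fib (F.obj a)} (p : x ⟶ x') :
    p ≫ 𝓕.cu (F.obj a) x' ≫ 𝓕.st (F.mapId a) x' ≅
      (𝓕.cu (F.obj a) x ≫ 𝓕.st (F.mapId a) x) ≫ 𝓕.mp (F.map (𝟙 a)) p :=
  (α_ _ _ _).symm ≪≫ whiskerRightIso (𝓕.cuNat (F.obj a) p) _ ≪≫
    α_ (𝓕.cu (F.obj a) x) (𝓕.mp (𝟙 (F.obj a)) p) _ ≪≫
    whiskerLeftIso _ (𝓕.stNat (F.mapId a) p) ≪≫ (α_ _ _ (𝓕.mp (F.map (𝟙 a)) p)).symm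

theorem compCuNat_inv (a : A) {x x' : 𝓕.fib (F.obj a)} (p : x ⟶ x') :
    (𝓕.stNatAt (F.mapId a) p (𝓕.cu (F.obj a) x)).hom ≫ (compCuNat F a p).inv =
      (𝓕.cuNat (F.obj a) p).inv ▷ 𝓕.st (F.mapId a) x' ≫ (α_ _ _ _).hom := by
  rw [Iso.comp_inv_eq]
  have e : (𝓕.cuNat (F.obj a) p).inv ▷ 𝓕.st (F.mapId a) x' ≫
      (𝓕.cuNat (F.obj a) p).hom ▷ 𝓕.st (F.mapId a) x' = 𝟙 _ := by
    rw [← comp_whiskerRight]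
    simp
  simp only [compCuNat, stNatAt, Iso.trans_hom, whiskerLeftIso_hom, Iso.symm_hom,
    whiskerRightIso_hom, Category.assoc, Iso.hom_inv_id_assoc]
  rw [reassoc_of% e]

end Data

namespace Data.Tot

variable [HasXi 𝓕] {y : 𝓕.fib (F.obj a)} {x : 𝓕.fib (F.obj b)} {z : 𝓕.fib (F.obj c)}

theorem ver_comp_jC (f : a ⟶ b) (g : b ⟶ c) {s s' : y ⟶ 𝓕.ob (F.map f) (𝓕.ob (F.map g) z)}
    (σ : s ⟶ s') :
    ver (σ ▷ 𝓕.ch (F.map f) (F.map g) z) ≫ jC F f g s' =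
      jC F f g s ≫ ver (σ ▷ (𝓕.ch (F.map f) (F.map g) z ≫ 𝓕.st (F.mapComp f g) z)) := by
  rw [jC, jC, ver_comp_cell, cell_comp_ver, associator_naturality_left]

/-- Naturality of the constraint of `F̄` at a composite: `jC_comp_chiC`, followed by the part of the
horizontal composite without `χ`, which the change of base leaves as it is. -/
theorem jC_comp_hcFib {f h : a ⟶ b} {g k : b ⟶ c} (α : f ⟶ h) (β : g ⟶ k)
    {p : y ⟶ 𝓕.ob (F.map f) x} {q : y ⟶ 𝓕.ob (F.map h) x} {p' : x ⟶ 𝓕.ob (F.map g) z}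
    {q' : x ⟶ 𝓕.ob (F.map k) z} (φ : p ≫ 𝓕.st (F.map₂ α) x ⟶ q)
    (φ' : p' ≫ 𝓕.st (F.map₂ β) z ⟶ q') :
    jC F f g (p ≫ 𝓕.mp (F.map f) p') ≫ cell (F.map₂ (hc α β))
        ((compChiAt F α β (p ≫ 𝓕.mp (F.map f) p')).hom ≫
          hFib (F.map₂ α) (F.map₂ β) φ φ' ▷ (𝓕.ch (F.map h) (F.map k) z ≫ 𝓕.st (F.mapComp h k) z)) =
      hC (F.map₂ α) (F.map₂ β) φ φ' ≫ jC F h k (q ≫ 𝓕.mp (F.map h) q') := by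
  rw [← cell_comp_ver, reassoc_of% jC_comp_chiC, ← ver_comp_jC, hC, Category.assoc]

/-- The associativity 2-cell for the composite of `𝓕` with `F`. -/
def compAssocAt (f : a ⟶ b) (g : b ⟶ c) (h : c ⟶ d) {t : 𝓕.fib (F.obj d)}
    (p : y ⟶ 𝓕.ob (F.map f) x) (q : x ⟶ 𝓕.ob (F.map g) z) (r : z ⟶ 𝓕.ob (F.map h) t) :
    ((p ≫ 𝓕.mp (F.map f) ((q ≫ 𝓕.mp (F.map g) r) ≫ 𝓕.ch (F.map g) (F.map h) t ≫
        𝓕.st (F.mapComp g h) t)) ≫ 𝓕.ch (F.map f) (F.map (g ≫ h)) t ≫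
        𝓕.st (F.mapComp f (g ≫ h)) t) ≫ 𝓕.st (F.map₂ (α_ f g h).inv) t ⟶
      (((p ≫ 𝓕.mp (F.map f) q) ≫ 𝓕.ch (F.map f) (F.map g) z ≫ 𝓕.st (F.mapComp f g) z) ≫
        𝓕.mp (F.map (f ≫ g)) r) ≫ 𝓕.ch (F.map (f ≫ g)) (F.map h) t ≫
        𝓕.st (F.mapComp (f ≫ g) h) t :=
  (𝓕.mpCompAt (F.map f) (q ≫ 𝓕.mp (F.map g) r)
      (𝓕.ch (F.map g) (F.map h) t ≫ 𝓕.st (F.mapComp g h) t) p).hom ▷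
        (𝓕.ch (F.map f) (F.map (g ≫ h)) t ≫ 𝓕.st (F.mapComp f (g ≫ h)) t) ▷
        𝓕.st (F.map₂ (α_ f g h).inv) t ≫
    (𝓕.mpCompAt (F.map f) q (𝓕.mp (F.map g) r) p).hom ▷
        𝓕.mp (F.map f) (𝓕.ch (F.map g) (F.map h) t ≫ 𝓕.st (F.mapComp g h) t) ▷
        (𝓕.ch (F.map f) (F.map (g ≫ h)) t ≫ 𝓕.st (F.mapComp f (g ≫ h)) t) ▷
        𝓕.st (F.map₂ (α_ f g h).inv) t ≫
    (compOmegaAt F f g h ((p ≫ 𝓕.mp (F.map f) q) ≫ 𝓕.mp (F.map f) (𝓕.mp (F.map g) r))).hom ≫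
    (compChNatAt F f g r (p ≫ 𝓕.mp (F.map f) q)).hom ▷
      (𝓕.ch (F.map (f ≫ g)) (F.map h) t ≫ 𝓕.st (F.mapComp (f ≫ g) h) t)

theorem actAt_associator_hom {B : Type u} [Bicategory.{w, v} B] {𝓕 : Data.{w, v, u, w₁, v₁, u₁} B}
    {a b : B} (f : a ⟶ b) {y : 𝓕.fib a} {x x' x'' x₃ : 𝓕.fib b} (p : y ⟶ 𝓕.ob f x) (q : x ⟶ x')
    (m : x' ⟶ x'') (n : x'' ⟶ x₃) :
    actAt f p (α_ q m n).hom ≫ (𝓕.mpCompAt f q (m ≫ n) p).hom =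
      (𝓕.mpCompAt f q m p).hom ▷ 𝓕.mp f n ≫ (𝓕.mpCompAt f m n (p ≫ 𝓕.mp f q)).inv := by
  rw [actAt, Iso.eq_comp_inv, Category.assoc, Category.assoc, ← mpCompAt_assoc, Iso.inv_hom_id_assoc]

/-- The associativity axiom of `F̄`, in `Tot`. The core is `jC_comp_omegaC`. In addition, the
naturality cell of `χ^{𝓕F}` is that of `χ` pasted with that of the transformation of `F.mapComp`,
and the latter appears in the horizontal composite with an identity. -/
theorem jC_comp_assoc (M : HasModifications 𝓕) (f : a ⟶ b) (g : b ⟶ c) (h : c ⟶ d)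
    {t : 𝓕.fib (F.obj d)}
    (p : y ⟶ 𝓕.ob (F.map f) x) (q : x ⟶ 𝓕.ob (F.map g) z) (r : z ⟶ 𝓕.ob (F.map h) t) :
    hC (𝟙 (F.map f)) (F.mapComp g h) (𝓕.xiIdAt (F.map f) p).inv
          (α_ (q ≫ 𝓕.mp (F.map g) r) (𝓕.ch (F.map g) (F.map h) t) (𝓕.st (F.mapComp g h) t)).hom ≫
        jC F f (g ≫ h) (p ≫ 𝓕.mp (F.map f) ((q ≫ 𝓕.mp (F.map g) r) ≫
          𝓕.ch (F.map g) (F.map h) t ≫ 𝓕.st (F.mapComp g h) t)) ≫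
        cell (F.map₂ (α_ f g h).inv) (compAssocAt F f g h p q r) =
      assocC (F.map f) (F.map g) (F.map h) p q r ≫
        hC (F.mapComp f g) (𝟙 (F.map h)) (α_ (p ≫ 𝓕.mp (F.map f) q) (𝓕.ch (F.map f) (F.map g) z)
          (𝓕.st (F.mapComp f g) z)).hom (𝓕.xiIdAt (F.map h) r).inv ≫
        jC F (f ≫ g) h (((p ≫ 𝓕.mp (F.map f) q) ≫ 𝓕.ch (F.map f) (F.map g) z ≫
          𝓕.st (F.mapComp f g) z) ≫ 𝓕.mp (F.map (f ≫ g)) r) := by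
  have e := actAt_associator_hom (F.map f) p (q ≫ 𝓕.mp (F.map g) r) (𝓕.ch (F.map g) (F.map h) t)
    (𝓕.st (F.mapComp g h) t)
  have e' := mpCompAt_inv_nat (F.map f) (𝓕.ch (F.map g) (F.map h) t) (𝓕.st (F.mapComp g h) t)
    (𝓕.mpCompAt (F.map f) q (𝓕.mp (F.map g) r) p).hom
  have o := jC_comp_omegaC F f g h ((p ≫ 𝓕.mp (F.map f) q) ≫ 𝓕.mp (F.map f) (𝓕.mp (F.map g) r))
  have n := compChNatAt_hom F f g r (p ≫ 𝓕.mp (F.map f) q)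
  rw [compAssocAt, ← ver_comp_cell, ← ver_comp_cell, ← cell_comp_ver, hC_id_left M, hC_id_right,
    assocC]
  simp only [Category.assoc]
  rw [← reassoc_of% ver_comp_jC, ← reassoc_of% ver_comp_jC,
    reassoc_of% ver_congr e, reassoc_of% ver_congr e', ← reassoc_of% ver_comp_chiLC,
    ← reassoc_of% ver_comp_chiLC, reassoc_of% o, ← ver_comp_jC, reassoc_of% ver_congr n,
    reassoc_of% ver_comp_chiRC]

theorem jC_comp_gamma (M : HasModifications 𝓕) (f : a ⟶ b) (p : y ⟶ 𝓕.ob (F.map f) x) :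
    hC (𝟙 (F.map f)) (F.mapId b) (𝓕.xiIdAt (F.map f) p).inv
          (𝟙 (𝓕.cu (F.obj b) x ≫ 𝓕.st (F.mapId b) x)) ≫
        jC F f (𝟙 b) (p ≫ 𝓕.mp (F.map f) (𝓕.cu (F.obj b) x ≫ 𝓕.st (F.mapId b) x)) ≫
        cell (F.map₂ (ρ_ f).hom) (compGammaAt F f p).hom =
      gammaC (F.map f) p := by
  have e : actAt (F.map f) p (𝟙 (𝓕.cu (F.obj b) x ≫ 𝓕.st (F.mapId b) x)) =
      (𝓕.mpCompAt (F.map f) (𝓕.cu (F.obj b) x) (𝓕.st (F.mapId b) x) p).inv := by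
    simp [actAt]
  rw [hC_id_left M, e, Category.assoc, jC_comp_gammaC]

/-- The unit axiom for `δ`. As in the associativity axiom, the naturality cell of the unit `χ^{𝓕F}`
is a pasting, whose second part comes from the horizontal composite with the identity of `p`. -/
theorem jC_comp_delta (f : a ⟶ b) (p : y ⟶ 𝓕.ob (F.map f) x) :
    hC (F.mapId a) (𝟙 (F.map f)) (𝟙 (𝓕.cu (F.obj a) y ≫ 𝓕.st (F.mapId a) y))
          (𝓕.xiIdAt (F.map f) p).inv ≫
        jC F (𝟙 a) f ((𝓕.cu (F.obj a) y ≫ 𝓕.st (F.mapId a) y) ≫ 𝓕.mp (F.map (𝟙 a)) p) ≫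
        cell (F.map₂ (λ_ f).hom) ((compCuNat F a p).inv ▷
          (𝓕.ch (F.map (𝟙 a)) (F.map f) x ≫ 𝓕.st (F.mapComp (𝟙 a) f) x) ▷
          𝓕.st (F.map₂ (λ_ f).hom) x ≫ (compDeltaAt F f p).hom) =
      unitRC (F.map f) p := by
  have e := compCuNat_inv F a p
  have o := jC_comp_deltaC F f p
  rw [hC_id_right, id_whiskerRight, Category.comp_id, ← ver_comp_cell, Category.assoc,
    ← reassoc_of% ver_comp_jC, reassoc_of% ver_congr e, ← reassoc_of% ver_comp_chiRC, o, unitRC]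

end Data.Tot

end LaxBidiag

/-! ### `F̄` respects the compositions and constraints. -/

namespace LaxBidiag

open Data Tot

variable {A : Type u₂} [Bicategory.{w₂, v₂} A] {B : Type u} [Bicategory.{w, v} B]
  {𝓕 : Data.{w, v, u, w₁, v₁, u₁} B} (F : A ⥤ᴸ B)

namespace Data.Tot

variable {a b : B} [HasXi 𝓕] {y : 𝓕.fib a} {x : 𝓕.fib b}

/-- Vertical composition over a base 2-cell equal to the composite. With `γ = F.map₂ (α ≫ β)` this
is vertical composition for `𝓕F`, whose `ξ` contains that transport. -/
theorem cell_comp_eq {f g h : a ⟶ b} {α : f ⟶ g} {β : g ⟶ h} {γ : f ⟶ h} (e : γ = α ≫ β)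
    {s : y ⟶ 𝓕.ob f x} {t : y ⟶ 𝓕.ob g x} {r : y ⟶ 𝓕.ob h x} (φ : s ≫ 𝓕.st α x ⟶ t)
    (ψ : t ≫ 𝓕.st β x ⟶ r) :
    cell α φ ≫ cell β ψ = cell γ ((s ◁ (𝓕.xi₂ α β e.symm x).inv ≫ (α_ _ _ _).inv) ≫
      φ ▷ 𝓕.st β x ≫ ψ) := by
  subst e
  rw [cell_comp]
  simp [xi₂_eq, xiAt]

theorem cell_id_eq {f : a ⟶ b} {γ : f ⟶ f} (e : γ = 𝟙 f) (s : y ⟶ 𝓕.ob f x) :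
    cell (𝟙 f) (s ◁ (𝓕.xiId f x).inv ≫ (ρ_ s).hom) =
      cell γ (s ◁ (𝓕.xi₀ e.symm x).inv ≫ (ρ_ s).hom) := by
  subst e
  simp [xi₀_eq]

end Data.Tot

namespace Obj

/-! ### The change of base on objects and cells -/

/-- The change of base on objects. -/
abbrev push (X : Obj (𝓕.comp F)) : Obj 𝓕 := { base := F.obj X.base, fib := X.fib }

/-- The change of base on 1-cells. -/
abbrev Hom₁.push {X Y : Obj (𝓕.comp F)} (p : Hom₁ X Y) : Hom₁ (X.push F) (Y.push F) :=
  { base := F.map p.base, fib := p.fib }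

/-- The change of base on 2-cells. -/
abbrev Hom₂.push {X Y : Obj (𝓕.comp F)} {p q : Hom₁ X Y} (s : Hom₂ p q) :
    Hom₂ (p.push F) (q.push F) :=
  { base := F.map₂ s.base, fib := s.fib }

/-- The constraint of the change of base at a composite. -/
abbrev pushComp {X Y Z : Obj (𝓕.comp F)} (p : Hom₁ X Y) (q : Hom₁ Y Z) :
    Hom₂ (comp₁ (p.push F) (q.push F)) ((comp₁ p q).push F) :=
  { base := F.mapComp p.base q.base
    fib := 𝓕.baseChangeComp F p.base q.base p.fib q.fib }

/-- The constraint of the change of base at an identity. -/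
abbrev pushId (X : Obj (𝓕.comp F)) : Hom₂ (id₁ (X.push F)) ((id₁ X).push F) :=
  { base := F.mapId X.base, fib := 𝓕.baseChangeId F X.base X.fib }

/-- `F̄` is the identity on fibre components, but `F` need not be faithful on 2-cells, so equality
of the bases in `A` is a separate hypothesis. -/
theorem Hom₂.push_injective {X Y : Obj (𝓕.comp F)} {p q : Hom₁ X Y} {s t : Hom₂ p q}
    (e : s.base = t.base) (h : s.push F = t.push F) : s = t := by
  obtain ⟨α, φ⟩ := s
  obtain ⟨β, ψ⟩ := t
  obtain rfl : α = β := e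
  injection h with _ h
  obtain rfl : φ = ψ := h
  rfl

variable [HasXi 𝓕]

theorem push_comp₂ {X Y : Obj (𝓕.comp F)} {p q r : Hom₁ X Y} (s : Hom₂ p q) (t : Hom₂ q r) :
    (comp₂ s t).push F = comp₂ (s.push F) (t.push F) := by
  -- The fibre component in `∫ 𝓕F` is brought to left-bracketed form inside the pair; the bases
  -- agree by definition.
  have h := congrArg (Hom₂.mk (p := p.push F) (q := r.push F) (F.map₂ (s.base ≫ t.base)))
    (vcompFib_eq (𝓕 := 𝓕.comp F) s.base t.base s.fib t.fib)
  refine Hom₂.tot_injective ?_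
  rw [tot_comp₂]
  refine (congrArg Hom₂.tot h).trans ?_
  exact (cell_comp_eq (F.map₂_comp s.base t.base) s.fib t.fib).symm

theorem push_id₂ {X Y : Obj (𝓕.comp F)} (p : Hom₁ X Y) : (id₂ p).push F = id₂ (p.push F) := by
  refine Hom₂.tot_injective ?_
  exact (cell_id_eq (F.map₂_id p.base) p.fib).symm

theorem pushComp_comp_push {X Y Z : Obj (𝓕.comp F)} {p q : Hom₁ X Y} {p' q' : Hom₁ Y Z}
    (s : Hom₂ p q) (s' : Hom₂ p' q') :
    comp₂ (pushComp F p p') ((hcomp₂ s s').push F) =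
      comp₂ (hcomp₂ (s.push F) (s'.push F)) (pushComp F q q') := by
  have h := congrArg (Hom₂.mk (p := (comp₁ p p').push F) (q := (comp₁ q q').push F)
    (F.map₂ (hc s.base s'.base)))
      (hcompFib_eq (𝓕 := 𝓕.comp F) s.base s'.base s.fib s'.fib)
  refine Hom₂.tot_injective ?_
  rw [tot_comp₂, tot_comp₂, tot_hcomp₂]
  refine (congrArg (fun s => Hom₂.tot (pushComp F p p') ≫ Hom₂.tot s) h).trans ?_
  exact jC_comp_hcFib F s.base s'.base s.fib s'.fib

theorem pushComp_comp_assoc₂ (M : HasModifications 𝓕) {X Y Z T : Obj (𝓕.comp F)} (p : Hom₁ X Y)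
    (q : Hom₁ Y Z) (r : Hom₁ Z T) :
    comp₂ (hcomp₂ (id₂ (p.push F)) (pushComp F q r))
        (comp₂ (pushComp F p (comp₁ q r)) ((assoc₂ p q r).push F)) =
      comp₂ (assoc₂ (p.push F) (q.push F) (r.push F))
        (comp₂ (hcomp₂ (pushComp F p q) (id₂ (r.push F))) (pushComp F (comp₁ p q) r)) := by
  have h := congrArg (Hom₂.mk (p := (comp₁ p (comp₁ q r)).push F)
    (q := (comp₁ (comp₁ p q) r).push F) (F.map₂ (α_ p.base q.base r.base).inv))
      (assocFib_eq (𝓕 := 𝓕.comp F) p.base q.base r.base p.fib q.fib r.fib)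
  refine Hom₂.tot_injective ?_
  rw [tot_comp₂, tot_comp₂, tot_comp₂, tot_comp₂, tot_hcomp₂, tot_hcomp₂, tot_assoc₂]
  simp only [id₂_base, id₂_fib, idFib_eq]
  refine (congrArg (fun s => hC _ _ _ _ ≫ Hom₂.tot (pushComp F p (comp₁ q r)) ≫ Hom₂.tot s)
    h).trans ?_
  exact jC_comp_assoc F M p.base q.base r.base p.fib q.fib r.fib

theorem pushId_comp_unitL₂ (M : HasModifications 𝓕) {X Y : Obj (𝓕.comp F)} (p : Hom₁ X Y) :
    comp₂ (hcomp₂ (id₂ (p.push F)) (pushId F Y))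
        (comp₂ (pushComp F p (id₁ Y)) ((unitL₂ p).push F)) = unitL₂ (p.push F) := by
  have h := congrArg (Hom₂.mk (p := (comp₁ p (id₁ Y)).push F) (q := p.push F)
    (F.map₂ (ρ_ p.base).hom)) (unitLFib_eq (𝓕 := 𝓕.comp F) p.base p.fib)
  refine Hom₂.tot_injective ?_
  rw [tot_comp₂, tot_comp₂, tot_hcomp₂, tot_unitL₂]
  simp only [id₂_base, id₂_fib, idFib_eq]
  refine (congrArg (fun s => hC _ _ _ _ ≫ Hom₂.tot (pushComp F p (id₁ Y)) ≫ Hom₂.tot s)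
    h).trans ?_
  exact jC_comp_gamma F M p.base p.fib

theorem pushId_comp_unitR₂ {X Y : Obj (𝓕.comp F)} (p : Hom₁ X Y) :
    comp₂ (hcomp₂ (pushId F X) (id₂ (p.push F)))
        (comp₂ (pushComp F (id₁ X) p) ((unitR₂ p).push F)) = unitR₂ (p.push F) := by
  have h := congrArg (Hom₂.mk (p := (comp₁ (id₁ X) p).push F) (q := p.push F)
    (F.map₂ (λ_ p.base).hom)) (unitRFib_eq (𝓕 := 𝓕.comp F) p.base p.fib)
  refine Hom₂.tot_injective ?_
  rw [tot_comp₂, tot_comp₂, tot_hcomp₂, tot_unitR₂]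
  simp only [id₂_base, id₂_fib, idFib_eq]
  refine (congrArg (fun s => hC _ _ _ _ ≫ Hom₂.tot (pushComp F (id₁ X) p) ≫ Hom₂.tot s)
    h).trans ?_
  exact jC_comp_delta F p.base p.fib

end Obj

end LaxBidiag

/-! ### Reflection of the bicategory axioms along the change of base. -/

namespace LaxBidiag

open Data Tot

section Hc

variable {A : Type u₂} [Bicategory.{w₂, v₂} A] {a b c d e : A}

theorem hc_id (f : a ⟶ b) (g : b ⟶ c) : hc (𝟙 f) (𝟙 g) = 𝟙 (f ≫ g) := by simp [hc]

theorem hc_comp {f g h : a ⟶ b} {f' g' h' : b ⟶ c} (α : f ⟶ g) (β : g ⟶ h) (α' : f' ⟶ g')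
    (β' : g' ⟶ h') : hc (α ≫ β) (α' ≫ β') = hc α α' ≫ hc β β' := by
  simp [hc, whisker_exchange_assoc]

theorem hc_assoc {f f' : a ⟶ b} {g g' : b ⟶ c} {h h' : c ⟶ d} (α : f ⟶ f')
    (β : g ⟶ g') (γ : h ⟶ h') :
    hc α (hc β γ) ≫ (α_ f' g' h').inv = (α_ f g h).inv ≫ hc (hc α β) γ := by simp [hc]

theorem hc_rightUnitor {f g : a ⟶ b} (α : f ⟶ g) :
    hc α (𝟙 (𝟙 b)) ≫ (ρ_ g).hom = (ρ_ f).hom ≫ α := by simp [hc]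

theorem hc_leftUnitor {f g : a ⟶ b} (α : f ⟶ g) :
    hc (𝟙 (𝟙 a)) α ≫ (λ_ g).hom = (λ_ f).hom ≫ α := by simp [hc]

theorem hc_pentagon (f : a ⟶ b) (g : b ⟶ c) (h : c ⟶ d) (k : d ⟶ e) :
    hc (𝟙 f) (α_ g h k).inv ≫ (α_ f (g ≫ h) k).inv ≫ hc (α_ f g h).inv (𝟙 k) =
      (α_ f g (h ≫ k)).inv ≫ (α_ (f ≫ g) h k).inv := by simp [hc]

theorem hc_triangle (f : a ⟶ b) (g : b ⟶ c) :
    (α_ f (𝟙 b) g).inv ≫ hc (ρ_ f).hom (𝟙 g) = hc (𝟙 f) (λ_ g).hom := by simp [hc]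

end Hc

namespace Data.Tot

variable {B : Type u} [Bicategory.{w, v} B] {𝓕 : Data.{w, v, u, w₁, v₁, u₁} B} {a b c : B}
  {y : 𝓕.fib a} {x : 𝓕.fib b} {z : 𝓕.fib c}

theorem isIso_hcFib {f g : a ⟶ b} {f' g' : b ⟶ c} (α : f ⟶ g) (α' : f' ⟶ g')
    {p : y ⟶ 𝓕.ob f x} {q : y ⟶ 𝓕.ob g x} {p' : x ⟶ 𝓕.ob f' z} {q' : x ⟶ 𝓕.ob g' z}
    (φ : p ≫ 𝓕.st α x ⟶ q) (φ' : p' ≫ 𝓕.st α' z ⟶ q') [IsIso φ] [IsIso φ'] :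
    IsIso (hcFib α α' φ φ') := by
  unfold hcFib
  infer_instance

theorem isIso_vFib {f g h : a ⟶ b} (α : f ⟶ g) (β : g ⟶ h) {p : y ⟶ 𝓕.ob f x}
    {q : y ⟶ 𝓕.ob g x} {r : y ⟶ 𝓕.ob h x} (φ : p ≫ 𝓕.st α x ⟶ q) (ψ : q ≫ 𝓕.st β x ⟶ r)
    [IsIso φ] [IsIso ψ] : IsIso (vFib α β φ ψ) := by
  unfold vFib
  infer_instance

end Data.Tot

namespace Obj

section Cells

variable {B : Type u} [Bicategory.{w, v} B] {𝓕 : Data.{w, v, u, w₁, v₁, u₁} B} [HasXi 𝓕]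
  [I : IsBicategory 𝓕] {X Y Z T U : Obj 𝓕}

/-- Horizontal composition of 2-cells as morphisms of the hom-categories. -/
def hmap {p q : Hom₁ X Y} {p' q' : Hom₁ Y Z} (s : p ⟶ q) (t : p' ⟶ q') :
    comp₁ p p' ⟶ comp₁ q q' := hcomp₂ s t

/-- The associativity constraint as a morphism of a hom-category. -/
def amap (p : Hom₁ X Y) (q : Hom₁ Y Z) (r : Hom₁ Z T) :
    comp₁ p (comp₁ q r) ⟶ comp₁ (comp₁ p q) r := assoc₂ p q r

/-- The constraint `1 ∘ f ⟶ f` as a morphism of a hom-category. -/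
def lmap (p : Hom₁ X Y) : comp₁ p (id₁ Y) ⟶ p := unitL₂ p

/-- The constraint `f ∘ 1 ⟶ f` as a morphism of a hom-category. -/
def rmap (p : Hom₁ X Y) : comp₁ (id₁ X) p ⟶ p := unitR₂ p

@[simp]
theorem hmap_comp_hmap {p q r : Hom₁ X Y} {p' q' r' : Hom₁ Y Z} (s₁ : p ⟶ q) (s₂ : q ⟶ r)
    (t₁ : p' ⟶ q') (t₂ : q' ⟶ r') : hmap s₁ t₁ ≫ hmap s₂ t₂ = hmap (s₁ ≫ s₂) (t₁ ≫ t₂) :=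
  (I.hcomp_comp s₁ s₂ t₁ t₂).symm

@[simp]
theorem hmap_comp_hmap_assoc {p q r : Hom₁ X Y} {p' q' r' : Hom₁ Y Z} (s₁ : p ⟶ q) (s₂ : q ⟶ r)
    (t₁ : p' ⟶ q') (t₂ : q' ⟶ r') {l : Hom₁ X Z} (m : comp₁ r r' ⟶ l) :
    hmap s₁ t₁ ≫ hmap s₂ t₂ ≫ m = hmap (s₁ ≫ s₂) (t₁ ≫ t₂) ≫ m := by
  rw [← hmap_comp_hmap, Category.assoc]

@[simp]
theorem hmap_id (p : Hom₁ X Y) (q : Hom₁ Y Z) : hmap (𝟙 p) (𝟙 q) = 𝟙 (comp₁ p q) :=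
  I.hcomp_id p q

theorem amap_nat {p p' : Hom₁ X Y} {q q' : Hom₁ Y Z} {r r' : Hom₁ Z T}
    (s : p ⟶ p') (s' : q ⟶ q') (s'' : r ⟶ r') :
    hmap s (hmap s' s'') ≫ amap p' q' r' = amap p q r ≫ hmap (hmap s s') s'' :=
  I.assoc_nat s s' s''

theorem lmap_nat {p q : Hom₁ X Y} (s : p ⟶ q) : hmap s (𝟙 (id₁ Y)) ≫ lmap q = lmap p ≫ s :=
  I.unitL_nat s

theorem rmap_nat {p q : Hom₁ X Y} (s : p ⟶ q) : hmap (𝟙 (id₁ X)) s ≫ rmap q = rmap p ≫ s :=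
  I.unitR_nat s

theorem amap_pentagon (p : Hom₁ X Y) (q : Hom₁ Y Z) (r : Hom₁ Z T) (t : Hom₁ T U) :
    hmap (𝟙 p) (amap q r t) ≫ amap p (comp₁ q r) t ≫ hmap (amap p q r) (𝟙 t) =
      amap p q (comp₁ r t) ≫ amap (comp₁ p q) r t :=
  I.pentagon p q r t

theorem amap_triangle (p : Hom₁ X Y) (q : Hom₁ Y Z) :
    amap p (id₁ Y) q ≫ hmap (lmap p) (𝟙 q) = hmap (𝟙 p) (rmap q) :=
  I.triangle p q

theorem isIso_hcomp₂_fib {p q : Hom₁ X Y} {p' q' : Hom₁ Y Z} (s : Hom₂ p q) (t : Hom₂ p' q')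
    (_ : IsIso s.fib) (_ : IsIso t.fib) : IsIso (hcomp₂ s t).fib := by
  rw [hcomp₂_fib, hcompFib_eq]
  exact isIso_hcFib _ _ _ _

theorem isIso_comp₂_fib {p q r : Hom₁ X Y} (s : Hom₂ p q) (t : Hom₂ q r)
    (_ : IsIso s.fib) (_ : IsIso t.fib) : IsIso (comp₂ s t).fib := by
  rw [comp₂_fib, vcompFib_eq]
  exact isIso_vFib _ _ _ _

theorem isIso_id₂_fib (p : Hom₁ X Y) : IsIso (id₂ p).fib :=
  inferInstanceAs (IsIso (p.fib ◁ (𝓕.xiId p.base Y.fib).inv ≫ (ρ_ p.fib).hom))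

/-- A 2-cell of the Grothendieck construction with invertible component over its base. -/
class IsOpcartesian {p q : Hom₁ X Y} (s : p ⟶ q) : Prop where
  isIso : IsIso (Hom₂.fib s)

/-- The base of `s` may be non-invertible, so `s` need not be an epimorphism; cancellation holds
only between 2-cells already known to have the same base. -/
theorem cancel_opcartesian {p q r : Hom₁ X Y} (s : p ⟶ q) [h : IsOpcartesian s] {m n : q ⟶ r}
    (e : Hom₂.base m = Hom₂.base n) (h : s ≫ m = s ≫ n) : m = n := by
  have := IsOpcartesian.isIso (s := s)
  refine Hom₂.tot_injective (cell_cancel (α := Hom₂.base s) (φ := Hom₂.fib s) ?_ ?_)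
  · simpa only [Hom₂.tot, cell_base] using e
  · exact (tot_comp₂ s m).symm.trans ((congrArg Hom₂.tot h).trans (tot_comp₂ s n))

instance isOpcartesian_hmap {p q : Hom₁ X Y} {p' q' : Hom₁ Y Z} (s : p ⟶ q) (t : p' ⟶ q')
    [IsOpcartesian s] [IsOpcartesian t] : IsOpcartesian (hmap s t) where
  isIso := isIso_hcomp₂_fib s t IsOpcartesian.isIso IsOpcartesian.isIso

instance isOpcartesian_comp {p q r : Hom₁ X Y} (s : p ⟶ q) (t : q ⟶ r)
    [IsOpcartesian s] [IsOpcartesian t] : IsOpcartesian (s ≫ t) where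
  isIso := isIso_comp₂_fib s t IsOpcartesian.isIso IsOpcartesian.isIso

instance isOpcartesian_id (p : Hom₁ X Y) : IsOpcartesian (𝟙 p) where
  isIso := isIso_id₂_fib p

end Cells

section Push

variable {A : Type u₂} [Bicategory.{w₂, v₂} A] {B : Type u} [Bicategory.{w, v} B]
  {𝓕 : Data.{w, v, u, w₁, v₁, u₁} B} (F : A ⥤ᴸ B) [HasXi 𝓕] [I : IsBicategory 𝓕]
  {X Y Z T U : Obj (𝓕.comp F)}

/-- The change of base on 2-cells. -/
def pmap {p q : Hom₁ X Y} (s : Hom₂ p q) : p.push F ⟶ q.push F := s.push F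

/-- The constraint of the change of base at a composite. -/
def jmap (p : Hom₁ X Y) (q : Hom₁ Y Z) : comp₁ (p.push F) (q.push F) ⟶ (comp₁ p q).push F :=
  pushComp F p q

/-- The constraint of the change of base at an identity. -/
def umap (X : Obj (𝓕.comp F)) : id₁ (X.push F) ⟶ (id₁ X).push F := pushId F X

instance isOpcartesian_jmap (p : Hom₁ X Y) (q : Hom₁ Y Z) : IsOpcartesian (jmap F p q) where
  isIso := inferInstanceAs (IsIso (α_ ((p.push F).fib ≫ 𝓕.mp (F.map p.base) (q.push F).fib)
    (𝓕.ch (F.map p.base) (F.map q.base) (Z.push F).fib) _).hom)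

instance isOpcartesian_umap (X : Obj (𝓕.comp F)) : IsOpcartesian (umap F X) where
  isIso := inferInstanceAs (IsIso (𝟙 (𝓕.cu (F.obj X.base) (X.push F).fib ≫ 𝓕.st (F.mapId X.base) _)))

theorem pmap_comp₂ {p q r : Hom₁ X Y} (s : Hom₂ p q) (t : Hom₂ q r) :
    pmap F (comp₂ s t) = pmap F s ≫ pmap F t :=
  push_comp₂ F s t

theorem pmap_id₂ (p : Hom₁ X Y) : pmap F (id₂ p) = 𝟙 (p.push F) :=
  push_id₂ F p

theorem jmap_pmap {p q : Hom₁ X Y} {p' q' : Hom₁ Y Z} (s : Hom₂ p q) (s' : Hom₂ p' q') :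
    jmap F p p' ≫ pmap F (hcomp₂ s s') = hmap (pmap F s) (pmap F s') ≫ jmap F q q' :=
  pushComp_comp_push F s s'

theorem jmap_amap (M : HasModifications 𝓕) (p : Hom₁ X Y) (q : Hom₁ Y Z) (r : Hom₁ Z T) :
    hmap (𝟙 (p.push F)) (jmap F q r) ≫ jmap F p (comp₁ q r) ≫ pmap F (assoc₂ p q r) =
      amap (p.push F) (q.push F) (r.push F) ≫ hmap (jmap F p q) (𝟙 (r.push F)) ≫
        jmap F (comp₁ p q) r :=
  pushComp_comp_assoc₂ F M p q r

theorem jmap_lmap (M : HasModifications 𝓕) (p : Hom₁ X Y) :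
    hmap (𝟙 (p.push F)) (umap F Y) ≫ jmap F p (id₁ Y) ≫ pmap F (unitL₂ p) = lmap (p.push F) :=
  pushId_comp_unitL₂ F M p

theorem jmap_rmap (p : Hom₁ X Y) :
    hmap (umap F X) (𝟙 (p.push F)) ≫ jmap F (id₁ X) p ≫ pmap F (unitR₂ p) = rmap (p.push F) :=
  pushId_comp_unitR₂ F p

/-- The reflection principle. Compatibilities of `F̄` with horizontal composition hold only after
its constraints, which are not invertible but are opcartesian, so they can be cancelled once the
bases agree in `A`. -/
theorem eq_of_pmap {r : Hom₁ (X.push F) (Y.push F)} {p q : Hom₁ X Y} {s t : Hom₂ p q}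
    (m : r ⟶ p.push F) [IsOpcartesian m] (e : s.base = t.base) (h : m ≫ pmap F s = m ≫ pmap F t) :
    s = t :=
  Hom₂.push_injective F e (cancel_opcartesian m (congrArg (fun α => F.map₂ α) e) h)

end Push

end Obj

section Comp

open Obj

variable {A : Type u₂} [Bicategory.{w₂, v₂} A] {B : Type u} [Bicategory.{w, v} B]
  {𝓕 : Data.{w, v, u, w₁, v₁, u₁} B}

/-- The category laws and the invertibility of the constraints hold in `Tot` for `𝓕F`, which needs
only the axioms on `ξ`. Every other axiom is reflected by `eq_of_pmap`: on bases it is the axiom of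
`A`, and on images it is that of `∫ 𝓕`, once constraints of `F̄` have been moved through. -/
theorem IsBicategory.comp [HasXi 𝓕] (I : IsBicategory 𝓕) (M : HasModifications 𝓕) (F : A ⥤ᴸ B) :
    IsBicategory (𝓕.comp F) := by
  constructor
  · intro X Y p q s
    exact Hom₂.tot_injective (by rw [tot_comp₂, tot_id₂, Category.id_comp])
  · intro X Y p q s
    exact Hom₂.tot_injective (by rw [tot_comp₂, tot_id₂, Category.comp_id])
  · intro X Y p q r t s₁ s₂ s₃
    exact Hom₂.tot_injective (by simp only [tot_comp₂, Category.assoc])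
  · intro X Y Z p q
    refine eq_of_pmap F (jmap F p q) (hc_id _ _) ?_
    simp only [jmap_pmap, pmap_id₂, hmap_id, Category.id_comp, Category.comp_id]
  · intro X Y Z p q r p' q' r' s₁ s₂ t₁ t₂
    refine eq_of_pmap F (jmap F p p') (hc_comp _ _ _ _) ?_
    simp only [pmap_comp₂, jmap_pmap, reassoc_of% jmap_pmap, hmap_comp_hmap_assoc]
  · intro X Y Z W p q r
    have : IsIso (assoc₂ p q r).tot := by
      rw [tot_assoc₂, assocC_eq]
      exact isIso_cell
    exact exists_inverse _
  · intro X Y p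
    have : IsIso (unitL₂ p).tot := by
      rw [tot_unitL₂, gammaC]
      exact isIso_cell
    exact exists_inverse _
  · intro X Y p
    have : IsIso (unitR₂ p).tot := by
      rw [tot_unitR₂, unitRC_eq]
      exact isIso_cell
    exact exists_inverse _
  · intro X Y Z W p p' q q' r r' s s' s''
    -- The constraint of `F̄` at a triple composite, opcartesian as a composite of opcartesian
    -- cells.
    refine eq_of_pmap F (hmap (𝟙 _) (jmap F q r) ≫ jmap F p (comp₁ q r)) (hc_assoc _ _ _) ?_
    have e := jmap_amap F M p q r
    have e' := jmap_amap F M p' q' r'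
    simp only [pmap_comp₂, Category.assoc, reassoc_of% (jmap_pmap F s (hcomp₂ s' s''))]
    rw [reassoc_of% e, jmap_pmap, hmap_comp_hmap_assoc, hmap_comp_hmap_assoc, jmap_pmap, jmap_pmap, 
      Category.id_comp, Category.id_comp, ← Category.comp_id (pmap F s), ← hmap_comp_hmap_assoc, e',
      reassoc_of% amap_nat, hmap_comp_hmap_assoc, Category.comp_id, Category.comp_id]
  · intro X Y p q s
    refine eq_of_pmap F (hmap (𝟙 _) (umap F Y) ≫ jmap F p (id₁ Y)) (hc_rightUnitor _) ?_
    have e := jmap_lmap F M p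
    have e' := jmap_lmap F M q
    simp only [pmap_comp₂, Category.assoc, reassoc_of% (jmap_pmap F s (id₂ (id₁ Y)))]
    rw [reassoc_of% e, ← lmap_nat, ← e', hmap_comp_hmap_assoc, hmap_comp_hmap_assoc, pmap_id₂]
    simp only [Category.id_comp, Category.comp_id]
  · intro X Y p q s
    refine eq_of_pmap F (hmap (umap F X) (𝟙 _) ≫ jmap F (id₁ X) p) (hc_leftUnitor _) ?_
    have e := jmap_rmap F p
    have e' := jmap_rmap F q
    simp only [pmap_comp₂, Category.assoc, reassoc_of% (jmap_pmap F (id₂ (id₁ X)) s)]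
    rw [reassoc_of% e, ← rmap_nat, ← e', hmap_comp_hmap_assoc, hmap_comp_hmap_assoc, pmap_id₂]
    simp only [Category.id_comp, Category.comp_id]
  · intro X Y Z W U p q r t
    refine eq_of_pmap F (hmap (𝟙 _) (hmap (𝟙 _) (jmap F r t)) ≫ hmap (𝟙 _) (jmap F q (comp₁ r t)) ≫
      jmap F p (comp₁ q (comp₁ r t))) (hc_pentagon _ _ _ _) ?_
    have e₁ := jmap_amap F M p q (comp₁ r t)
    have e₂ := jmap_amap F M (comp₁ p q) r t
    have e₃ := jmap_amap F M q r t
    have e₄ := jmap_amap F M p (comp₁ q r) t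
    have e₅ := jmap_amap F M p q r
    have e₆ := amap_nat (𝟙 (p.push F)) (jmap F q r) (𝟙 (t.push F))
    have e₇ := amap_nat (𝟙 (p.push F)) (𝟙 (q.push F)) (jmap F r t)
    have e₈ := amap_nat (jmap F p q) (𝟙 (r.push F)) (𝟙 (t.push F))
    have e₉ := amap_pentagon (p.push F) (q.push F) (r.push F) (t.push F)
    -- Interchange of two constraints of `F̄` at disjoint places. `y` and `z` below are the
    -- associativity axiom of `F̄` composed with an identity 2-cell.
    have x : hmap (hmap (𝟙 (p.push F)) (𝟙 (q.push F))) (jmap F r t) ≫ hmap (jmap F p q) (𝟙 _) =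
        hmap (jmap F p q) (hmap (𝟙 (r.push F)) (𝟙 (t.push F))) ≫ hmap (𝟙 _) (jmap F r t) := by
      simp
    have y : hmap (𝟙 (p.push F)) (hmap (𝟙 _) (jmap F r t)) ≫ hmap (𝟙 _) (jmap F q (comp₁ r t)) ≫
        hmap (𝟙 _) (pmap F (assoc₂ q r t)) = hmap (𝟙 _) (amap _ _ _) ≫
          hmap (𝟙 _) (hmap (jmap F q r) (𝟙 _)) ≫ hmap (𝟙 _) (jmap F (comp₁ q r) t) := by
      simp [e₃]
    have z : hmap (hmap (𝟙 (p.push F)) (jmap F q r)) (𝟙 (t.push F)) ≫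
        hmap (jmap F p (comp₁ q r)) (𝟙 _) ≫ hmap (pmap F (assoc₂ p q r)) (𝟙 _) =
          hmap (amap _ _ _) (𝟙 _) ≫ hmap (hmap (jmap F p q) (𝟙 _)) (𝟙 _) ≫
            hmap (jmap F (comp₁ p q) r) (𝟙 _) := by
      simp [e₅]
    simp only [pmap_comp₂, Category.assoc]
    rw [reassoc_of% e₁, reassoc_of% e₇, reassoc_of% x, e₂, reassoc_of% e₈, ← reassoc_of% e₉,
      reassoc_of% jmap_pmap, pmap_id₂, reassoc_of% y, reassoc_of% e₄, reassoc_of% e₆, jmap_pmap,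
      pmap_id₂, reassoc_of% z]
  · intro X Y Z p q
    refine eq_of_pmap F (hmap (𝟙 _) (hmap (umap F Y) (𝟙 _)) ≫ hmap (𝟙 _) (jmap F (id₁ Y) q) ≫
      jmap F p (comp₁ (id₁ Y) q)) (hc_triangle _ _) ?_
    have e₁ := jmap_amap F M p (id₁ Y) q
    have e₂ := jmap_lmap F M p
    have e₃ := jmap_rmap F q
    have e₄ := amap_nat (𝟙 (p.push F)) (umap F Y) (𝟙 (q.push F))
    have e₅ := amap_triangle (p.push F) (q.push F)
    simp only [pmap_comp₂, Category.assoc]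
    rw [reassoc_of% e₁, jmap_pmap, jmap_pmap, reassoc_of% e₄, hmap_comp_hmap_assoc, hmap_comp_hmap_assoc,
      hmap_comp_hmap_assoc, hmap_comp_hmap_assoc, Category.assoc, e₂, pmap_id₂, pmap_id₂]
    simp only [Category.assoc, Category.id_comp, Category.comp_id, e₃, reassoc_of% e₅]

end Comp

end LaxBidiag

/-! ### `𝓕F` is a lax bidiagram and `F̄` is a lax functor. -/

namespace LaxBidiag

open Data Tot Obj

variable {A : Type u₂} [Bicategory.{w₂, v₂} A] {B : Type u} [Bicategory.{w, v} B]
  {𝓕 : Data.{w, v, u, w₁, v₁, u₁} B}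

/-- The detour through bicategories replaces the direct verification of (C3)–(C8) for `𝓕F`: from `𝓕`
to `∫ 𝓕`, by reflection to `∫ 𝓕F`, and back to `𝓕F`. -/
theorem IsLaxBidiagram.comp (H : IsLaxBidiagram 𝓕) (F : A ⥤ᴸ B) : IsLaxBidiagram (𝓕.comp F) :=
  have := H.hasXi
  have M := H.hasModifications.comp F
  ((H.isBicategory.comp H.hasModifications F).totAxioms M).isLaxBidiagram M

/-- The lax functor `∫ 𝓕 F ⟶ ∫ 𝓕` induced by `F`. -/
noncomputable def baseChangeLax [HasXi 𝓕] [I : IsBicategory 𝓕] (M : HasModifications 𝓕) (F : A ⥤ᴸ B)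
    [I' : IsBicategory (𝓕.comp F)] : Obj (𝓕.comp F) ⥤ᴸ Obj 𝓕 where
  toPrelaxFunctorStruct := (baseChange 𝓕 F).toPrelaxFunctorStruct
  map₂_id p := push_id₂ F p
  map₂_comp s t := push_comp₂ F s t
  mapId := (baseChange 𝓕 F).mapId
  mapComp := (baseChange 𝓕 F).mapComp
  mapComp_naturality_left s q := (jmap_pmap F s (id₂ q)).trans (congrArg
    (fun m => hmap (pmap F s) m ≫ jmap F _ q) (pmap_id₂ F q))
  mapComp_naturality_right p _ _ s := (jmap_pmap F (id₂ p) s).trans (congrArg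
    (fun m => hmap m (pmap F s) ≫ jmap F p _) (pmap_id₂ F p))
  map₂_associator p q r := by
    have e := jmap_amap F M p q r
    -- `jmap_amap` speaks of the chosen direction of the associativity constraint; the axiom of a
    -- lax functor uses the opposite one.
    have e' : pmap F (assoc₂ p q r) ≫ pmap F (assocIso p q r).inv = 𝟙 _ :=
      (pmap_comp₂ F _ _).symm.trans ((congrArg (pmap F) (assocIso p q r).hom_inv_id).trans
        (pmap_id₂ F _))
    change hmap (jmap F p q) (𝟙 _) ≫ jmap F _ r ≫ pmap F (assocIso p q r).inv =
      (assocIso (p.push F) (q.push F) (r.push F)).inv ≫ hmap (𝟙 _) (jmap F q r) ≫ jmap F p _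
    rw [Iso.eq_inv_comp]
    change amap _ _ _ ≫ _ = _
    rw [← reassoc_of% e, e', Category.comp_id]
  map₂_leftUnitor {X _} p := by
    have e := jmap_rmap F p
    have e' : pmap F (unitR₂ p) ≫ pmap F (unitRIso p).inv = 𝟙 _ :=
      (pmap_comp₂ F _ _).symm.trans ((congrArg (pmap F) (unitRIso p).hom_inv_id).trans
        (pmap_id₂ F _))
    change pmap F (unitRIso p).inv =
      (unitRIso (p.push F)).inv ≫ hmap (umap F X) (𝟙 _) ≫ jmap F (id₁ X) p
    rw [Iso.eq_inv_comp]
    change rmap _ ≫ _ = _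
    rw [← e, Category.assoc, Category.assoc, e', Category.comp_id]
  map₂_rightUnitor {_ Y} p := by
    have e := jmap_lmap F M p
    have e' : pmap F (unitL₂ p) ≫ pmap F (unitLIso p).inv = 𝟙 _ :=
      (pmap_comp₂ F _ _).symm.trans ((congrArg (pmap F) (unitLIso p).hom_inv_id).trans
        (pmap_id₂ F _))
    change pmap F (unitLIso p).inv =
      (unitLIso (p.push F)).inv ≫ hmap (𝟙 _) (umap F Y) ≫ jmap F p (id₁ Y)
    rw [Iso.eq_inv_comp]
    change lmap _ ≫ _ = _
    rw [← e, Category.assoc, Category.assoc, e', Category.comp_id]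

theorem of_baseChangeLax [HasXi 𝓕] [I : IsBicategory 𝓕] (M : HasModifications 𝓕) (F : A ⥤ᴸ B)
    [I' : IsBicategory (𝓕.comp F)] : LaxData.of (baseChangeLax M F) = baseChange 𝓕 F := rfl

end LaxBidiag

/-! ### Lax functors into the Grothendieck construction as base data with fibre components. -/

namespace LaxBidiag

open Data Tot Obj

universe w₃ v₃ u₃ w₄ v₄ u₄

section Hc

variable {A : Type u₂} [Bicategory.{w₂, v₂} A] {a b c : A}

theorem hc_id_right {f g : a ⟶ b} (α : f ⟶ g) (h : b ⟶ c) : hc α (𝟙 h) = α ▷ h := by simp [hc]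

theorem hc_id_left (f : a ⟶ b) {g h : b ⟶ c} (α : g ⟶ h) : hc (𝟙 f) α = f ◁ α := by simp [hc]

end Hc

namespace LaxData

section Comp

variable {C : Type u₃} [Bicategory.{w₃, v₃} C] {D : Type u₂} [Bicategory.{w₂, v₂} D]
  {E : Type u} [Bicategory.{w, v} E]

/-- Composition of the data of lax functors. -/
def comp (L : LaxData C D) (G : LaxData D E) : LaxData C E where
  obj c := G.obj (L.obj c)
  map f := G.map (L.map f)
  map₂ η := G.map₂ (L.map₂ η)
  mapId c := G.mapId (L.obj c) ≫ G.map₂ (L.mapId c)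
  mapComp f g := G.mapComp (L.map f) (L.map g) ≫ G.map₂ (L.mapComp f g)

theorem of_comp (L : C ⥤ᴸ D) (G : D ⥤ᴸ E) : of (L.comp G) = (of L).comp (of G) := rfl

/-- The axioms of a lax functor. -/
structure IsLax (L : LaxData C D) : Prop where
  map₂_id {a b : C} (f : a ⟶ b) : L.map₂ (𝟙 f) = 𝟙 (L.map f)
  map₂_comp {a b : C} {f g h : a ⟶ b} (η : f ⟶ g) (θ : g ⟶ h) :
    L.map₂ (η ≫ θ) = L.map₂ η ≫ L.map₂ θ
  mapComp_naturality_left {a b c : C} {f f' : a ⟶ b} (η : f ⟶ f') (g : b ⟶ c) :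
    L.mapComp f g ≫ L.map₂ (η ▷ g) = L.map₂ η ▷ L.map g ≫ L.mapComp f' g
  mapComp_naturality_right {a b c : C} (f : a ⟶ b) {g g' : b ⟶ c} (η : g ⟶ g') :
    L.mapComp f g ≫ L.map₂ (f ◁ η) = L.map f ◁ L.map₂ η ≫ L.mapComp f g'
  map₂_associator {a b c d : C} (f : a ⟶ b) (g : b ⟶ c) (h : c ⟶ d) :
    L.mapComp f g ▷ L.map h ≫ L.mapComp (f ≫ g) h ≫ L.map₂ (α_ f g h).hom =
      (α_ (L.map f) (L.map g) (L.map h)).hom ≫ L.map f ◁ L.mapComp g h ≫ L.mapComp f (g ≫ h)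
  map₂_leftUnitor {a b : C} (f : a ⟶ b) :
    L.map₂ (λ_ f).inv = (λ_ (L.map f)).inv ≫ L.mapId a ▷ L.map f ≫ L.mapComp (𝟙 a) f
  map₂_rightUnitor {a b : C} (f : a ⟶ b) :
    L.map₂ (ρ_ f).inv = (ρ_ (L.map f)).inv ≫ L.map f ◁ L.mapId b ≫ L.mapComp f (𝟙 b)

theorem isLax_of (L : C ⥤ᴸ D) : (of L).IsLax where
  map₂_id := L.map₂_id
  map₂_comp := L.map₂_comp
  mapComp_naturality_left := L.mapComp_naturality_left
  mapComp_naturality_right := L.mapComp_naturality_right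
  map₂_associator := L.map₂_associator
  map₂_leftUnitor := L.map₂_leftUnitor
  map₂_rightUnitor := L.map₂_rightUnitor

/-- The lax functor with given data. -/
def IsLax.lax {L : LaxData C D} (h : L.IsLax) : C ⥤ᴸ D where
  toPrelaxFunctorStruct := L.toPrelaxFunctorStruct
  mapId := L.mapId
  mapComp := L.mapComp
  map₂_id := h.map₂_id
  map₂_comp := h.map₂_comp
  mapComp_naturality_left := h.mapComp_naturality_left
  mapComp_naturality_right := h.mapComp_naturality_right
  map₂_associator := h.map₂_associator
  map₂_leftUnitor := h.map₂_leftUnitor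
  map₂_rightUnitor := h.map₂_rightUnitor

theorem of_injective {F G : C ⥤ᴸ D} (h : of F = of G) : F = G := by
  -- The data are generalised to variables, so that their equality can be substituted; the axioms
  -- are then proofs of the same propositions.
  have e : ∀ {L L' : LaxData C D} (h : L.IsLax) (h' : L'.IsLax), L = L' → h.lax = h'.lax := by
    rintro L _ _ _ rfl
    rfl
  exact e (isLax_of F) (isLax_of G) h

end Comp

section Displayed

variable {B : Type u} [Bicategory.{w, v} B] (𝓕 : Data.{w, v, u, w₁, v₁, u₁} B)
  {C : Type u₃} [Bicategory.{w₃, v₃} C]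

/-- The components in the fibres of the data of a lax functor to the Grothendieck construction. -/
structure Displayed (G : LaxData C B) where
  /-- on objects -/
  fib (c : C) : 𝓕.fib (G.obj c)
  /-- on 1-cells -/
  one {c d : C} (f : c ⟶ d) : fib c ⟶ 𝓕.ob (G.map f) (fib d)
  /-- on 2-cells -/
  two {c d : C} {f g : c ⟶ d} (η : f ⟶ g) : one f ≫ 𝓕.st (G.map₂ η) (fib d) ⟶ one g
  /-- the unit constraint -/
  unit (c : C) : 𝓕.cu (G.obj c) (fib c) ≫ 𝓕.st (G.mapId c) (fib c) ⟶ one (𝟙 c)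
  /-- the composition constraint -/
  mul {c d e : C} (f : c ⟶ d) (g : d ⟶ e) :
    𝓕.compFib (G.map f) (G.map g) (one f) (one g) ≫ 𝓕.st (G.mapComp f g) (fib e) ⟶ one (f ≫ g)

variable {𝓕}

theorem Displayed.ext_constraints {G : LaxData C B} {fib : ∀ c, 𝓕.fib (G.obj c)}
    {one : ∀ {c d : C} (f : c ⟶ d), fib c ⟶ 𝓕.ob (G.map f) (fib d)}
    {two : ∀ {c d : C} {f g : c ⟶ d} (η : f ⟶ g), one f ≫ 𝓕.st (G.map₂ η) (fib d) ⟶ one g}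
    {u u' : ∀ c, 𝓕.cu (G.obj c) (fib c) ≫ 𝓕.st (G.mapId c) (fib c) ⟶ one (𝟙 c)}
    {m m' : ∀ {c d e : C} (f : c ⟶ d) (g : d ⟶ e), 𝓕.compFib (G.map f) (G.map g) (one f) (one g) ≫
      𝓕.st (G.mapComp f g) (fib e) ⟶ one (f ≫ g)}
    (h : ∀ c, u c = u' c) (h' : ∀ {c d e : C} (f : c ⟶ d) (g : d ⟶ e), m f g = m' f g) :
    Displayed.mk fib one two u m = Displayed.mk fib one two u' m' := by
  obtain rfl : u = u' := funext h
  obtain rfl : @m = @m' := by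
    funext c d e f g
    exact h' f g
  rfl

variable [I : IsBicategory 𝓕]

/-- The projection to the base of the data of a lax functor to the Grothendieck construction. -/
def base (L : LaxData C (Obj 𝓕)) : LaxData C B where
  obj c := (L.obj c).base
  map f := Hom₁.base (L.map f)
  map₂ η := Hom₂.base (L.map₂ η)
  mapId c := Hom₂.base (L.mapId c)
  mapComp f g := Hom₂.base (L.mapComp f g)

/-- The components in the fibres. -/
def displayed (L : LaxData C (Obj 𝓕)) : Displayed 𝓕 L.base where
  fib c := (L.obj c).fib
  one f := Hom₁.fib (L.map f)
  two η := Hom₂.fib (L.map₂ η)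
  unit c := Hom₂.fib (L.mapId c)
  mul f g := Hom₂.fib (L.mapComp f g)

/-- The data of a lax functor to the Grothendieck construction with given components. -/
noncomputable def total (G : LaxData C B) (D : Displayed 𝓕 G) : LaxData C (Obj 𝓕) where
  obj c := { base := G.obj c, fib := D.fib c }
  map f := Hom₁.mk (G.map f) (D.one f)
  map₂ η := Hom₂.mk (G.map₂ η) (D.two η)
  mapId c := Hom₂.mk (G.mapId c) (D.unit c)
  mapComp f g := Hom₂.mk (G.mapComp f g) (D.mul f g)

/-- Equality of totals yields only a heterogeneous equality of fibre components in general; over one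
and the same base `G` it is an equality. -/
theorem total_injective {G : LaxData C B} {D D' : Displayed 𝓕 G} (h : total G D = total G D') :
    D = D' := by
  have e : ∀ {L L' : LaxData C (Obj 𝓕)}, L = L' → L.displayed ≍ L'.displayed := by
    rintro L _ rfl
    rfl
  exact eq_of_heq (e h)

theorem of_comp_proj (H : C ⥤ᴸ Obj 𝓕) : of (H.comp (proj 𝓕)) = (of H).base := by
  have h₁ : (of (H.comp (proj 𝓕))).mapId = (of H).base.mapId :=
    funext fun c => Category.id_comp (Hom₂.base (H.mapId c))
  have h₂ : @LaxData.mapComp _ _ _ _ (of (H.comp (proj 𝓕))) =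
      @LaxData.mapComp _ _ _ _ (of H).base := by
    funext a b c f g
    exact Category.id_comp (Hom₂.base (H.mapComp f g))
  exact congrArg₂ (LaxData.mk (of H).base.toPrelaxFunctorStruct) h₁ h₂

end Displayed

section Push

variable {A : Type u₂} [Bicategory.{w₂, v₂} A] {B : Type u} [Bicategory.{w, v} B]
  {𝓕 : Data.{w, v, u, w₁, v₁, u₁} B} {C : Type u₃} [Bicategory.{w₃, v₃} C] [HasXi 𝓕]

/-- Pasting with the invertible `ξ` and `φ ▷ β^*` can be undone. This is the unique solvability
behind the pullback: it recovers a constraint of the lift from the constraint of its composite with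
`F̄`. -/
theorem vcompFib_bijective {a b : B} {y : 𝓕.fib a} {x : 𝓕.fib b} {f g h : a ⟶ b} (α : f ⟶ g)
    (β : g ⟶ h) {p : y ⟶ 𝓕.ob f x} {q : y ⟶ 𝓕.ob g x} {r : y ⟶ 𝓕.ob h x}
    (φ : p ≫ 𝓕.st α x ⟶ q) [IsIso φ] :
    Function.Bijective fun ψ : q ≫ 𝓕.st β x ⟶ r => 𝓕.vcompFib α β φ ψ := by
  simp only [vcompFib_eq, vFib]
  constructor
  · intro ψ ψ' h
    exact (cancel_epi (φ ▷ 𝓕.st β x)).1 ((cancel_epi (𝓕.xiAt α β p).inv).1 h)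
  · intro θ
    refine ⟨inv (φ ▷ 𝓕.st β x) ≫ (𝓕.xiAt α β p).hom ≫ θ, ?_⟩
    simp

variable [I : IsBicategory 𝓕] (F : A ⥤ᴸ B) [I' : IsBicategory (𝓕.comp F)]

/-- The change of base on the components in the fibres. -/
noncomputable def Displayed.push {G : LaxData C A} (D : Displayed (𝓕.comp F) G) :
    Displayed 𝓕 (G.comp (of F)) :=
  ((total G D).comp (baseChange 𝓕 F)).displayed

theorem push_unit_bijective (G : LaxData C A) (c : C) (x : 𝓕.fib (F.obj (G.obj c)))
    (r : x ⟶ 𝓕.ob (F.map (G.map (𝟙 c))) x) :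
    Function.Bijective fun ψ : (𝓕.cu (F.obj (G.obj c)) x ≫ 𝓕.st (F.mapId (G.obj c)) x) ≫
        𝓕.st (F.map₂ (G.mapId c)) x ⟶ r =>
      𝓕.vcompFib (F.mapId (G.obj c)) (F.map₂ (G.mapId c)) (𝟙 _) ψ :=
  vcompFib_bijective _ _ _

theorem push_mul_bijective (G : LaxData C A) {c d e : C} (f : c ⟶ d) (g : d ⟶ e)
    {x : 𝓕.fib (F.obj (G.obj c))} {y : 𝓕.fib (F.obj (G.obj d))} {z : 𝓕.fib (F.obj (G.obj e))}
    (p : x ⟶ 𝓕.ob (F.map (G.map f)) y) (q : y ⟶ 𝓕.ob (F.map (G.map g)) z)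
    (r : x ⟶ 𝓕.ob (F.map (G.map (f ≫ g))) z) :
    Function.Bijective fun ψ : ((p ≫ 𝓕.mp (F.map (G.map f)) q) ≫
        𝓕.ch (F.map (G.map f)) (F.map (G.map g)) z ≫ 𝓕.st (F.mapComp (G.map f) (G.map g)) z) ≫
          𝓕.st (F.map₂ (G.mapComp f g)) z ⟶ r =>
      𝓕.vcompFib (F.mapComp (G.map f) (G.map g)) (F.map₂ (G.mapComp f g))
        (α_ (p ≫ 𝓕.mp (F.map (G.map f)) q) (𝓕.ch (F.map (G.map f)) (F.map (G.map g)) z) _).hom ψ :=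
  vcompFib_bijective _ _ _

/-- Over a fixed base in `A`, the components on objects, 1-cells and 2-cells are unchanged, and the
two constraints are changed by bijections. -/
theorem Displayed.push_injective {G : LaxData C A} {D D' : Displayed (𝓕.comp F) G}
    (h : D.push F = D'.push F) : D = D' := by
  obtain ⟨fib, one, two, unit, mul⟩ := D
  obtain ⟨fib', one', two', unit', mul'⟩ := D'
  injection h with h₁ h₂ h₃ h₄ h₅
  obtain rfl : fib = fib' := h₁
  obtain rfl : @one = @one' := eq_of_heq h₂
  obtain rfl : @two = @two' := eq_of_heq h₃
  obtain rfl : unit = unit' := funext fun c =>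
    (push_unit_bijective F G c (fib c) (one (𝟙 c))).1 (congrFun (eq_of_heq h₄) c)
  obtain rfl : @mul = @mul' := by
    funext c d e f g
    exact (push_mul_bijective F G f g (one f) (one g) (one (f ≫ g))).1
      (congrFun (congrFun (congrFun (congrFun (congrFun (eq_of_heq h₅) c) d) e) f) g)
  rfl

theorem Displayed.push_surjective {G : LaxData C A} (D : Displayed 𝓕 (G.comp (of F))) :
    ∃ D' : Displayed (𝓕.comp F) G, D'.push F = D := by
  choose unit h₁ using fun c =>
    (push_unit_bijective F G c (D.fib c) (D.one (𝟙 c))).2 (D.unit c)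
  choose mul h₂ using fun c d e (f : c ⟶ d) (g : d ⟶ e) =>
    (push_mul_bijective F G f g (D.one f) (D.one g) (D.one (f ≫ g))).2 (D.mul f g)
  let D' : Displayed (𝓕.comp F) G := ⟨D.fib, D.one, D.two, unit, fun f g => mul _ _ _ f g⟩
  exact ⟨D', Displayed.ext_constraints (u := (D'.push F).unit) (u' := D.unit)
    (m := (D'.push F).mul) (m' := D.mul) h₁ fun f g => h₂ _ _ _ f g⟩

/-- Any data are the total of their base and fibre components. Once the bases in `A` have been
identified, the fibre components are compared over one base. -/
theorem ext_baseChange {L L' : LaxData C (Obj (𝓕.comp F))} (h : L.base = L'.base)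
    (h' : L.comp (baseChange 𝓕 F) = L'.comp (baseChange 𝓕 F)) : L = L' := by
  have e : ∀ {G G' : LaxData C A} (D : Displayed (𝓕.comp F) G) (D' : Displayed (𝓕.comp F) G'),
      G = G' → (total G D).comp (baseChange 𝓕 F) = (total G' D').comp (baseChange 𝓕 F) →
        total G D = total G' D' := by
    rintro G _ D D' rfl h
    exact congrArg (total G) (Displayed.push_injective F
      (total_injective (G := G.comp (of F)) (D := D.push F) (D' := D'.push F) h))
  exact e L.displayed L'.displayed h h'

theorem exists_comp_baseChange {H : LaxData C (Obj 𝓕)} {K : LaxData C A}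
    (h : H.base = K.comp (of F)) :
    ∃ L : LaxData C (Obj (𝓕.comp F)), L.base = K ∧ L.comp (baseChange 𝓕 F) = H := by
  have e : ∀ {G : LaxData C B} (D : Displayed 𝓕 G), G = K.comp (of F) →
      ∃ L : LaxData C (Obj (𝓕.comp F)), L.base = K ∧ L.comp (baseChange 𝓕 F) = total G D := by
    rintro _ D rfl
    obtain ⟨D', rfl⟩ := D.push_surjective F
    exact ⟨total K D', rfl, rfl⟩
  exact e H.displayed h

section Reflect

variable {X Y Z T : Obj (𝓕.comp F)} {p p' : Hom₁ X Y} {q q' : Hom₁ Y Z} {r : Hom₁ Z T}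

/-- This and the next three lemmas reflect single axioms of a lax functor. They are stated for
arbitrary 2-cells, with the hypothesis in the shape that the axiom takes for a composite with `F̄`:
a constraint of `F̄` followed by the image of a constraint. -/
theorem nat_of_pmap {k k' : Hom₁ X Z} (s : Hom₂ p p') (t : Hom₂ q q') (m : Hom₂ (comp₁ p q) k)
    (m' : Hom₂ (comp₁ p' q') k') (n : Hom₂ k k')
    (e : m.base ≫ n.base = hc s.base t.base ≫ m'.base)
    (h : (jmap F p q ≫ pmap F m) ≫ pmap F n =
      hmap (pmap F s) (pmap F t) ≫ jmap F p' q' ≫ pmap F m') :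
    comp₂ m n = comp₂ (hcomp₂ s t) m' := by
  refine eq_of_pmap F (jmap F p q) e ?_
  rw [pmap_comp₂, pmap_comp₂, reassoc_of% jmap_pmap, ← h, Category.assoc]

theorem assoc_of_pmap (M : HasModifications 𝓕) {u : Hom₁ X Z} {k k' : Hom₁ X T} {v : Hom₁ Y T}
    (m₁ : Hom₂ (comp₁ p q) u) (m₂ : Hom₂ (comp₁ u r) k) (m₃ : Hom₂ (comp₁ q r) v)
    (m₄ : Hom₂ (comp₁ p v) k') (n : Hom₂ k k')
    (e : m₁.base ▷ r.base ≫ m₂.base ≫ n.base =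
      (α_ p.base q.base r.base).hom ≫ p.base ◁ m₃.base ≫ m₄.base)
    (h : hmap (jmap F p q ≫ pmap F m₁) (𝟙 _) ≫ (jmap F u r ≫ pmap F m₂) ≫ pmap F n =
      (assocIso (p.push F) (q.push F) (r.push F)).inv ≫ hmap (𝟙 _) (jmap F q r ≫ pmap F m₃) ≫
        jmap F p v ≫ pmap F m₄) :
    comp₂ (hcomp₂ m₁ (id₂ r)) (comp₂ m₂ n) =
      comp₂ (assocIso p q r).inv (comp₂ (hcomp₂ (id₂ p) m₃) m₄) := by
  have e' : hmap (jmap F p q) (𝟙 (r.push F)) ≫ jmap F _ r ≫ pmap F (assocIso p q r).inv =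
      (assocIso (p.push F) (q.push F) (r.push F)).inv ≫ hmap (𝟙 _) (jmap F q r) ≫ jmap F p _ :=
    (baseChangeLax M F).map₂_associator p q r
  refine eq_of_pmap F (hmap (jmap F p q) (𝟙 _) ≫ jmap F _ r) ?_ ?_
  · change hc m₁.base (𝟙 r.base) ≫ m₂.base ≫ n.base =
      Hom₂.base (assocIso p q r).inv ≫ hc (𝟙 p.base) m₃.base ≫ m₄.base
    simp only [hc, assocIso_inv_base, Bicategory.whiskerLeft_id, Bicategory.id_whiskerRight,
      Category.id_comp, Category.comp_id]
    exact e
  · simp only [pmap_comp₂, Category.assoc, reassoc_of% jmap_pmap, reassoc_of% e', pmap_id₂,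
      hmap_comp_hmap_assoc, Category.comp_id]
    rw [← h, Category.assoc]

theorem leftUnitor_of_pmap (M : HasModifications 𝓕) {i : Hom₁ X X} {k : Hom₁ X Y}
    (j : Hom₂ (id₁ X) i) (m : Hom₂ (comp₁ i p) k) (n : Hom₂ p k)
    (e : n.base = (λ_ p.base).inv ≫ j.base ▷ p.base ≫ m.base)
    (h : pmap F n = (unitRIso (p.push F)).inv ≫ hmap (umap F X ≫ pmap F j) (𝟙 _) ≫
      jmap F i p ≫ pmap F m) :
    n = comp₂ (unitRIso p).inv (comp₂ (hcomp₂ j (id₂ p)) m) := by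
  have e' : pmap F (unitRIso p).inv =
      (unitRIso (p.push F)).inv ≫ hmap (umap F X) (𝟙 _) ≫ jmap F (id₁ X) p :=
    (baseChangeLax M F).map₂_leftUnitor p
  refine eq_of_pmap F (𝟙 _) ?_ (congrArg (𝟙 _ ≫ ·) ?_)
  · change n.base = Hom₂.base (unitRIso p).inv ≫ hc j.base (𝟙 p.base) ≫ m.base
    simp only [hc, unitRIso_inv_base, Bicategory.whiskerLeft_id, Category.comp_id]
    exact e
  · rw [h, pmap_comp₂, pmap_comp₂, e']
    simp only [Category.assoc, reassoc_of% jmap_pmap, pmap_id₂, hmap_comp_hmap_assoc,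
      Category.comp_id]

theorem rightUnitor_of_pmap (M : HasModifications 𝓕) {i : Hom₁ Y Y} {k : Hom₁ X Y}
    (j : Hom₂ (id₁ Y) i) (m : Hom₂ (comp₁ p i) k) (n : Hom₂ p k)
    (e : n.base = (ρ_ p.base).inv ≫ p.base ◁ j.base ≫ m.base)
    (h : pmap F n = (unitLIso (p.push F)).inv ≫ hmap (𝟙 _) (umap F Y ≫ pmap F j) ≫
      jmap F p i ≫ pmap F m) :
    n = comp₂ (unitLIso p).inv (comp₂ (hcomp₂ (id₂ p) j) m) := by
  have e' : pmap F (unitLIso p).inv =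
      (unitLIso (p.push F)).inv ≫ hmap (𝟙 _) (umap F Y) ≫ jmap F p (id₁ Y) :=
    (baseChangeLax M F).map₂_rightUnitor p
  refine eq_of_pmap F (𝟙 _) ?_ (congrArg (𝟙 _ ≫ ·) ?_)
  · change n.base = Hom₂.base (unitLIso p).inv ≫ hc (𝟙 p.base) j.base ≫ m.base
    simp only [hc, unitLIso_inv_base, Bicategory.id_whiskerRight, Category.id_comp]
    exact e
  · rw [h, pmap_comp₂, pmap_comp₂, e']
    simp only [Category.assoc, reassoc_of% jmap_pmap, pmap_id₂, hmap_comp_hmap_assoc,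
      Category.comp_id]

end Reflect

/-- Each axiom is an equation of 2-cells of `∫ 𝓕F`. Its base is the axiom for `L.base`; its image,
after constraints of `F̄`, is the axiom for the composite. Hence `eq_of_pmap` applies, while the two
axioms on vertical structure need no cancellation. -/
theorem IsLax.of_baseChange (M : HasModifications 𝓕) {L : LaxData C (Obj (𝓕.comp F))}
    (h : L.base.IsLax) (h' : (L.comp (baseChange 𝓕 F)).IsLax) : L.IsLax where
  map₂_id f := Hom₂.push_injective F (h.map₂_id f)
    ((h'.map₂_id f).trans (pmap_id₂ F (L.map f)).symm)
  map₂_comp η θ := Hom₂.push_injective F (h.map₂_comp η θ)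
    ((h'.map₂_comp η θ).trans (pmap_comp₂ F (L.map₂ η) (L.map₂ θ)).symm)
  mapComp_naturality_left {_ _ _ _ f'} η g :=
    nat_of_pmap F (L.map₂ η) (id₂ (L.map g)) (L.mapComp _ g) (L.mapComp f' g) (L.map₂ (η ▷ g))
      ((h.mapComp_naturality_left η g).trans (congrArg (· ≫ Hom₂.base (L.mapComp f' g))
        (hc_id_right (Hom₂.base (L.map₂ η)) (Hom₁.base (L.map g))).symm))
      ((h'.mapComp_naturality_left η g).trans (congrArg
        (fun t => hmap (pmap F (L.map₂ η)) t ≫ jmap F _ _ ≫ pmap F (L.mapComp f' g))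
        (pmap_id₂ F (L.map g)).symm))
  mapComp_naturality_right {_ _ _} f {_ g'} η :=
    nat_of_pmap F (id₂ (L.map f)) (L.map₂ η) (L.mapComp f _) (L.mapComp f g') (L.map₂ (f ◁ η))
      ((h.mapComp_naturality_right f η).trans (congrArg (· ≫ Hom₂.base (L.mapComp f g'))
        (hc_id_left (Hom₁.base (L.map f)) (Hom₂.base (L.map₂ η))).symm))
      ((h'.mapComp_naturality_right f η).trans (congrArg
        (fun t => hmap t (pmap F (L.map₂ η)) ≫ jmap F _ _ ≫ pmap F (L.mapComp f g'))
        (pmap_id₂ F (L.map f)).symm))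
  map₂_associator f g k :=
    assoc_of_pmap F M (L.mapComp f g) (L.mapComp (f ≫ g) k) (L.mapComp g k) (L.mapComp f (g ≫ k))
      (L.map₂ (α_ f g k).hom) (h.map₂_associator f g k) (h'.map₂_associator f g k)
  map₂_leftUnitor {a _} f :=
    leftUnitor_of_pmap F M (L.mapId a) (L.mapComp (𝟙 a) f) (L.map₂ (λ_ f).inv)
      (h.map₂_leftUnitor f) (h'.map₂_leftUnitor f)
  map₂_rightUnitor {_ b} f :=
    rightUnitor_of_pmap F M (L.mapId b) (L.mapComp f (𝟙 b)) (L.map₂ (ρ_ f).inv)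
      (h.map₂_rightUnitor f) (h'.map₂_rightUnitor f)

end Push

end LaxData

end LaxBidiag

/-! ### The pullback property. -/

namespace LaxBidiag

open LaxData Limits

universe w₃ v₃ u₃

section Pullback

variable {A : Type u₂} [Bicategory.{w₂, v₂} A] {B : Type u} [Bicategory.{w, v} B]
  {𝓕 : Data.{w, v, u, w₁, v₁, u₁} B} {C : Type u₃} [Bicategory.{w₃, v₃} C] [HasXi 𝓕]
  [I : IsBicategory 𝓕] (F : A ⥤ᴸ B) [I' : IsBicategory (𝓕.comp F)] (M : HasModifications 𝓕)

/-- The projections have identity constraints, so the constraints of both composites are those of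
`F`, up to `F` applied to an identity. -/
theorem baseChangeLax_comp_proj :
    (baseChangeLax M F).comp (proj 𝓕) = (proj (𝓕.comp F)).comp F := by
  refine of_injective ((of_comp_proj _).trans ?_)
  have h₁ : (baseChange 𝓕 F).base.mapId = (of ((proj (𝓕.comp F)).comp F)).mapId := by
    funext X
    exact ((congrArg (F.mapId X.base ≫ ·) (F.map₂_id _)).trans (Category.comp_id _)).symm
  have h₂ : @LaxData.mapComp _ _ _ _ (baseChange 𝓕 F).base =
      @LaxData.mapComp _ _ _ _ (of ((proj (𝓕.comp F)).comp F)) := by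
    funext X Y Z p q
    exact ((congrArg (F.mapComp (Obj.Hom₁.base p) (Obj.Hom₁.base q) ≫ ·) (F.map₂_id _)).trans
      (Category.comp_id _)).symm
  exact congrArg₂ (LaxData.mk (baseChange 𝓕 F).base.toPrelaxFunctorStruct) h₁ h₂

/-- The lift is first found as data; its axioms are then reflected from those of `K` on bases and of
`H` on images. -/
theorem exists_lift_baseChange (H : C ⥤ᴸ Obj 𝓕) (K : C ⥤ᴸ A)
    (h : H.comp (proj 𝓕) = K.comp F) :
    ∃ L : C ⥤ᴸ Obj (𝓕.comp F),
      L.comp (baseChangeLax M F) = H ∧ L.comp (proj (𝓕.comp F)) = K := by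
  obtain ⟨L, e, e'⟩ := exists_comp_baseChange F (H := of H) (K := of K)
    ((of_comp_proj H).symm.trans ((congrArg of h).trans (of_comp K F)))
  have l : L.IsLax := .of_baseChange F M (e ▸ isLax_of K) (e' ▸ isLax_of H)
  exact ⟨l.lax, of_injective e', of_injective ((of_comp_proj _).trans e)⟩

theorem lift_baseChange_unique (L L' : C ⥤ᴸ Obj (𝓕.comp F))
    (h : L.comp (baseChangeLax M F) = L'.comp (baseChangeLax M F))
    (h' : L.comp (proj (𝓕.comp F)) = L'.comp (proj (𝓕.comp F))) : L = L' :=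
  of_injective (ext_baseChange F
    ((of_comp_proj L).symm.trans ((congrArg of h').trans (of_comp_proj L'))) (congrArg of h))

end Pullback

/-- The fibres lie in the same universes as `B`, so that both Grothendieck constructions are objects
of the same category of bicategories. -/
theorem isPullback_baseChange {A B : Type u} [Bicategory.{w, v} A] [Bicategory.{w, v} B]
    {𝓕 : Data.{w, v, u, w, v, u} B} [HasXi 𝓕] [I : IsBicategory 𝓕] (F : A ⥤ᴸ B)
    [I' : IsBicategory (𝓕.comp F)] (M : HasModifications 𝓕) :
    IsPullback (LaxBicat.ofLax (baseChangeLax M F)) (LaxBicat.ofLax (proj (𝓕.comp F)))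
      (LaxBicat.ofLax (proj 𝓕)) (LaxBicat.ofLax F) := by
  choose lift h₁ h₂ using fun s : PullbackCone (LaxBicat.ofLax (proj 𝓕)) (LaxBicat.ofLax F) =>
    exists_lift_baseChange (C := s.pt.carrier) F M s.fst s.snd s.condition
  refine ⟨⟨baseChangeLax_comp_proj F M⟩, ⟨PullbackCone.IsLimit.mk _ lift h₁ h₂ ?_⟩⟩
  intro s m e e'
  exact lift_baseChange_unique F M m (lift s) (e.trans (h₁ s).symm) (e'.trans (h₂ s).symm)

end LaxBidiag

theorem mainTheorem10 {A B : Type u} [Bicategory.{w, v} A] [Bicategory.{w, v} B]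
    (𝓕 : LaxBidiag.LaxBidiagram.{w, v, u, w, v, u} B) (F : A ⥤ᴸ B) :
    LaxBidiag.IsLaxBidiagram (𝓕.toData.comp F) ∧
    ∃ (_ : LaxBidiag.IsBicategory (𝓕.toData.comp F)) (_ : LaxBidiag.IsBicategory 𝓕.toData)
      (Fbar : LaxBidiag.Obj (𝓕.toData.comp F) ⥤ᴸ LaxBidiag.Obj 𝓕.toData),
      LaxBidiag.LaxData.of Fbar = LaxBidiag.baseChange 𝓕.toData F ∧
      IsPullback (LaxBidiag.LaxBicat.ofLax Fbar)
        (LaxBidiag.LaxBicat.ofLax (LaxBidiag.proj (𝓕.toData.comp F)))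
        (LaxBidiag.LaxBicat.ofLax (LaxBidiag.proj 𝓕.toData))
        (LaxBidiag.LaxBicat.ofLax F) := by
  have H := 𝓕.isLax
  have := H.hasXi
  have M := H.hasModifications
  have I := H.isBicategory
  have I' := I.comp M F
  exact ⟨H.comp F, I', I, LaxBidiag.baseChangeLax M F, LaxBidiag.of_baseChangeLax M F,
    LaxBidiag.isPullback_baseChange F M⟩
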